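/- Let $\bar S$ be a connected compact oriented surface of genus $g$ with $k\ge 1$ boundary components, let $R\subset\partial\bar S$ be a finite set with $r$ elements, and let $S=\bar S\smallsetminus R$; assume $4g-4+2k+r>0$ and put $c=-\chi(\bar S)=2g-2+k$. A \emph{framed $\mathrm{Sp}(2n,\mathbf R)$-local system} on $S$ is a pair $(\mathcal F,\sigma)$ of a flat $\mathrm{Sp}(2n,\mathbf R)$-bundle on $S$ and a flat section $\sigma$ over $\partial S$ of the associated bundle of Lagrangian subspaces of $\mathbf R^{2n}$. It is \emph{maximal} if $S$ has an ideal triangulation (one vertex on each component of $\partial S$) such that for each triangle the three Lagrangians given by $\sigma$ at its vertices, taken in the positive cyclic order, have Maslov index $n$. Let $\mathcal M^f(S,\mathrm{Sp}(2n,\mathbf R))$ be the space of isomorphism classes of maximal framed local systems, with the quotient topology and with the smooth functions of a quotient (those whose pull-back to the space of maximal framed local systems is smooth); for $n=1$ it is $\mathcal M^f(S,\mathrm{SL}(2,\mathbf R))$. "Isomorphic" below means homeomorphic by a map that identifies the smooth functions, where quotients of vector spaces also carry the quotient smooth structure. Inside $\mathcal M^f=\mathcal M^f(S,\mathrm{Sp}(4,\mathbf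 R))$ let $\mathcal M^f(\mathrm{SL}_2\times\mathrm{SL}_2)$ be the set of direct sums of two maximal framed $\mathrm{SL}(2,\mathbf R)$-local systems (via $\mathbf R^4=\mathrm{Span}(e_1,f_1)\oplus\mathrm{Span}(e_2,f_2)$), $\mathcal M^f(\mathrm{SL}_2\otimes\mathrm{SO}(2))$ the set of tensor products of a maximal framed $\mathrm{SL}(2,\mathbf R)$-local system with an $\mathrm{SO}(2)$-local system (via $\mathbf R^4=\mathbf R^2\otimes\mathbf R^2$, the framing being $\ell\otimes\mathbf R^2$), and $\mathcal M^f(\mathrm{SL}_2)$ the subset of the latter where the $\mathrm{SO}(2)$-local system is trivial. Then $\mathcal M^f(\mathrm{SL}_2\otimes\mathrm{SO}(2))$ is connected, and for every $x\in\mathcal M^f$: 1. If $x\notin\mathcal M^f(\mathrm{SL}_2\times\mathrm{SL}_2)\cup\mathcal M^f(\mathrm{SL}_2\otimes\mathrm{SO}(2))$, then $x$ is a smooth point, i.e. a neighborhood of $x$ is isomorphic to an open subset of some $\mathbf R^d$. 2. If $x\in\mathcal M^f(\mathrm{SL}_2\times\mathrm{SL}_2)\smallsetminus\mathcal M^f(\mathrm{SL}_2\otimes\mathrm{SO}(2))$,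 then a neighborhood of $x$ is isomorphic to a neighborhood of $0$ in $\mathbf R^{6c+2r}\times(\mathbf R^{4c+r}/\{\pm\mathrm{Id}\})$. 3. If $x\in\mathcal M^f(\mathrm{SL}_2\otimes\mathrm{SO}(2))\smallsetminus\mathcal M^f(\mathrm{SL}_2)$, then a neighborhood of $x$ is isomorphic to a neighborhood of $0$ in $\mathbf R^{4c+r+1}\times(\mathbf C^{3c+r}/\mathrm U(1))$, where $\mathrm U(1)$ acts by scalar multiplication. 4. If $x\in\mathcal M^f(\mathrm{SL}_2)$, then a neighborhood of $x$ is isomorphic to a neighborhood of $0$ in $\mathbf R^{3c+r}\times\bigl(\mathbf R^{c+1}\times(\mathbf C^{3c+r}/\mathrm U(1))\bigr)/\sigma$, where the involution $\sigma$ is $-\mathrm{Id}$ on $\mathbf R^{c+1}$ and is induced by the complex conjugation on $\mathbf C^{3c+r}/\mathrm U(1)$. In each of 2--4 the isomorphism sends $x$ to the class of $0$. If moreover $3c+r\ge 2$ (that is, $S$ is neither a disk with $r\in\{3,4\}$ nor an annulus with $r=1$), then: * $x$ is a smooth point if and only if $x\notin\mathcal M^f(\mathrm{SL}_2\times\mathrm{SL}_2)\cup\mathcal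 M^f(\mathrm{SL}_2\otimes\mathrm{SO}(2))$; * $x$ is an orbifold point with isotropy group $\mathbf Z/2\mathbf Z$ if and only if $x\in\mathcal M^f(\mathrm{SL}_2\times\mathrm{SL}_2)\smallsetminus\mathcal M^f(\mathrm{SL}_2\otimes\mathrm{SO}(2))$; * $x$ is singular and not an orbifold point if and only if $x\in\mathcal M^f(\mathrm{SL}_2\otimes\mathrm{SO}(2))$. Here $x$ is an orbifold point with isotropy group $G$ if a neighborhood of $x$ is isomorphic to a neighborhood of $0$ in $\mathbf R^d/\Gamma$ ($x$ corresponding to $0$), for some $d$ and some finite subgroup $\Gamma\cong G$ of $\mathrm{GL}(d,\mathbf R)$; it is an orbifold point if this holds for some finite group $G$. -/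

import Mathlib

/-!
# Framed maximal symplectic local systems on an ideally triangulated surface

Contents: differential spaces presented as quotients of subsets of normed spaces; smooth points
and orbifold points; symplectic linear algebra and the Maslov index; surfaces glued from ideal
triangles; framed local systems, flips and maximality; the moduli space and its subspaces.
-/

open scoped ContDiff Topology

universe u

noncomputable section

/-! ## Quotient spaces with a smooth structure -/

/-- A subset `E` of a real normed space `W` (embedded by `ι`) with an equivalence relation. It
presents the quotient space `E / s`, with the quotient topology and with the sheaf of those real
functions whose pull-back to `E` is locally the restriction of a `C^∞` function on `W`. -/
structure SmoothQuotient where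
  {E : Type u}
  {W : Type u}
  [normed : NormedAddCommGroup W]
  [space : NormedSpace ℝ W]
  ι : E → W
  s : Setoid E

namespace SmoothQuotient

attribute [instance] SmoothQuotient.normed SmoothQuotient.space

/-- The points of the quotient space. -/
def Pt (X : SmoothQuotient) : Type _ := Quotient X.s

/-- The class of an element of `E`. -/
def cls (X : SmoothQuotient) (e : X.E) : X.Pt := Quotient.mk X.s e

/-- The quotient topology of the topology that `E` inherits from `W`. -/
instance (X : SmoothQuotient) : TopologicalSpace X.Pt :=
  TopologicalSpace.coinduced X.cls (TopologicalSpace.induced X.ι inferInstance)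

/-- `f` is smooth near `x`: around every point of `E` above `x`, the pull-back of `f` is the
restriction of a smooth function on the ambient space. -/
def SmoothAt (X : SmoothQuotient) (f : X.Pt → ℝ) (x : X.Pt) : Prop :=
  ∀ e : X.E, X.cls e = x → ∃ Φ : X.W → ℝ, ContDiff ℝ ∞ Φ ∧
    ∀ᶠ e' in Filter.comap X.ι (𝓝 (X.ι e)), f (X.cls e') = Φ (X.ι e')

/-- A neighborhood of `x` in `X` is isomorphic to a neighborhood of `y` in `Y`, the isomorphism
sending `x` to `y`: it is a homeomorphism of open neighborhoods which identifies the smooth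
functions. -/
def LocallyIso (X Y : SmoothQuotient) (x : X.Pt) (y : Y.Pt) : Prop :=
  ∃ φ : OpenPartialHomeomorph X.Pt Y.Pt, x ∈ φ.source ∧ φ x = y ∧
    ∀ z ∈ φ.source, ∀ f : Y.Pt → ℝ, Y.SmoothAt f (φ z) ↔ X.SmoothAt (f ∘ φ) z

/-- The quotient of a normed space by an equivalence relation. -/
def ofSetoid {V : Type*} [NormedAddCommGroup V] [NormedSpace ℝ V] (s : Setoid V) :
    SmoothQuotient where
  E := V
  W := V
  ι := id
  s := s

/-- The smooth space `ℝ^d`. -/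
def euclidean (d : ℕ) : SmoothQuotient :=
  ofSetoid (⊥ : Setoid (Fin d → ℝ))

/-- The quotient `ℝ^d / Γ` by a group of linear automorphisms. -/
def linearQuotient (d : ℕ) (Γ : Subgroup ((Fin d → ℝ) ≃ₗ[ℝ] (Fin d → ℝ))) : SmoothQuotient :=
  ofSetoid (MulAction.orbitRel Γ (Fin d → ℝ))

/-- `x` has a neighborhood isomorphic to an open subset of some `ℝ^d`. -/
def IsSmoothPoint (X : SmoothQuotient) (x : X.Pt) : Prop :=
  ∃ d : ℕ, LocallyIso X (euclidean d) x ((euclidean d).cls (0 : Fin d → ℝ))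

/-- `x` is an orbifold point with isotropy group (isomorphic to) `G`: it has a neighborhood
isomorphic to a neighborhood of `0` in `ℝ^d / Γ`, with `Γ ≅ G` a finite group acting linearly and
faithfully. -/
def IsOrbifoldPointWithGroup (G : Type*) [Group G] (X : SmoothQuotient) (x : X.Pt) : Prop :=
  ∃ (d : ℕ) (Γ : Subgroup ((Fin d → ℝ) ≃ₗ[ℝ] (Fin d → ℝ))), Finite Γ ∧ Nonempty (Γ ≃* G) ∧
    LocallyIso X (linearQuotient d Γ) x ((linearQuotient d Γ).cls (0 : Fin d → ℝ))

/-- `x` is an orbifold point, for some finite isotropy group (the trivial one being allowed). -/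
def IsOrbifoldPoint (X : SmoothQuotient) (x : X.Pt) : Prop :=
  ∃ (d : ℕ) (Γ : Subgroup ((Fin d → ℝ) ≃ₗ[ℝ] (Fin d → ℝ))), Finite Γ ∧
    LocallyIso X (linearQuotient d Γ) x ((linearQuotient d Γ).cls (0 : Fin d → ℝ))

/-- `x` is a singular point, and not an orbifold point. -/
def IsNonOrbifoldSingularPoint (X : SmoothQuotient) (x : X.Pt) : Prop :=
  ¬ X.IsSmoothPoint x ∧ ¬ X.IsOrbifoldPoint x

/-! ### The three local models -/

/-- `ℝ^a × (ℝ^b / {± Id})`. -/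
def modelSign (a b : ℕ) : SmoothQuotient :=
  ofSetoid (V := (Fin a → ℝ) × (Fin b → ℝ))
    { r := fun p q => q.1 = p.1 ∧ (q.2 = p.2 ∨ q.2 = -p.2)
      iseqv :=
        { refl := fun p => ⟨rfl, Or.inl rfl⟩
          symm := by
            rintro ⟨x, y⟩ ⟨x', y'⟩ ⟨h, h' | h'⟩ <;> simp_all
          trans := by
            rintro ⟨x, y⟩ ⟨x', y'⟩ ⟨x'', y''⟩ ⟨h, h' | h'⟩ ⟨k, k' | k'⟩ <;> simp_all } }

/-- The equivalence relation on `ℂ^k` whose quotient is `ℂ^k / U(1)` (diagonal action). -/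
def circleRel (k : ℕ) : Setoid (Fin k → ℂ) := MulAction.orbitRel Circle (Fin k → ℂ)

/-- Complex conjugation on `ℂ^k`. -/
def conjVec {k : ℕ} (z : Fin k → ℂ) : Fin k → ℂ := fun i => (starRingEnd ℂ) (z i)

theorem conjVec_conjVec {k : ℕ} (z : Fin k → ℂ) : conjVec (conjVec z) = z := by
  funext i; simp [conjVec]

/-- Complex conjugation descends to `ℂ^k / U(1)`. -/
theorem circleRel_conj {k : ℕ} {z w : Fin k → ℂ} (h : circleRel k z w) :
    circleRel k (conjVec z) (conjVec w) := by
  obtain ⟨c, hc⟩ := h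
  refine ⟨c⁻¹, ?_⟩
  funext i
  have := congrFun hc i
  simp only [Pi.smul_apply, Circle.smul_def, smul_eq_mul, conjVec] at this ⊢
  rw [← this, Circle.coe_inv_eq_conj, map_mul]

/-- `ℝ^a × (ℂ^k / U(1))`. -/
def modelCircle (a k : ℕ) : SmoothQuotient :=
  ofSetoid (V := (Fin a → ℝ) × (Fin k → ℂ))
    { r := fun p q => q.1 = p.1 ∧ circleRel k p.2 q.2
      iseqv :=
        { refl := fun p => ⟨rfl, (circleRel k).refl p.2⟩
          symm := fun h => ⟨h.1.symm, (circleRel k).symm h.2⟩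
          trans := fun h h' => ⟨h'.1.trans h.1, (circleRel k).trans h.2 h'.2⟩ } }

/-- `ℝ^a × (ℝ^m × (ℂ^k / U(1))) / σ`, where the involution `σ` is `-Id` on `ℝ^m` and is induced
by the complex conjugation on `ℂ^k / U(1)`. -/
def modelCircleInvolution (a m k : ℕ) : SmoothQuotient :=
  ofSetoid (V := (Fin a → ℝ) × (Fin m → ℝ) × (Fin k → ℂ))
    { r := fun p q => q.1 = p.1 ∧
        ((q.2.1 = p.2.1 ∧ circleRel k p.2.2 q.2.2) ∨
          (q.2.1 = -p.2.1 ∧ circleRel k (conjVec p.2.2) q.2.2))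
      iseqv :=
        { refl := fun p => ⟨rfl, Or.inl ⟨rfl, (circleRel k).refl _⟩⟩
          symm := by
            rintro ⟨x, y, z⟩ ⟨x', y', z'⟩ ⟨h, ⟨h1, h2⟩ | ⟨h1, h2⟩⟩
            · exact ⟨h.symm, Or.inl ⟨h1.symm, (circleRel k).symm h2⟩⟩
            · refine ⟨h.symm, Or.inr ⟨?_, ?_⟩⟩
              · simp_all
              · have := circleRel_conj h2
                rw [conjVec_conjVec] at this
                exact (circleRel k).symm this
          trans := by
            rintro ⟨x, y, z⟩ ⟨x', y', z'⟩ ⟨x'', y'', z''⟩ ⟨h, ⟨h1, h2⟩ | ⟨h1, h2⟩⟩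
              ⟨k0, ⟨k1, k2⟩ | ⟨k1, k2⟩⟩
            · exact ⟨k0.trans h, Or.inl ⟨k1.trans h1, (circleRel k).trans h2 k2⟩⟩
            · refine ⟨k0.trans h, Or.inr ⟨by simp_all, ?_⟩⟩
              exact (circleRel k).trans (circleRel_conj h2) k2
            · refine ⟨k0.trans h, Or.inr ⟨by simp_all, ?_⟩⟩
              exact (circleRel k).trans h2 k2
            · refine ⟨k0.trans h, Or.inl ⟨by simp_all, ?_⟩⟩
              have := circleRel_conj h2
              rw [conjVec_conjVec] at this
              exact (circleRel k).trans this k2 } }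

end SmoothQuotient

/-! ## Symplectic linear algebra -/

/-- `ℝ^{2n}` with coordinates `(x, y)` in the symplectic basis `(e, f)`, `e = inl`, `f = inr`. -/
abbrev SympVec (n : ℕ) : Type := EuclideanSpace ℝ (Fin n ⊕ Fin n)

/-- `Sp(2n, ℝ)`. -/
abbrev Sp (n : ℕ) : Submonoid (Matrix (Fin n ⊕ Fin n) (Fin n ⊕ Fin n) ℝ) :=
  Matrix.symplecticGroup (Fin n) ℝ

/-- The standard symplectic form, `ω(e_i, f_j) = δ_{ij}`. -/
def omega (n : ℕ) : SympVec n →ₗ[ℝ] SympVec n →ₗ[ℝ] ℝ :=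
  LinearMap.mk₂ ℝ
    (fun x y => ∑ i : Fin n, (x (Sum.inl i) * y (Sum.inr i) - x (Sum.inr i) * y (Sum.inl i)))
    (by intro x x' y; simp only [PiLp.add_apply, ← Finset.sum_add_distrib]; congr 1; ext; ring)
    (by intro c x y; simp only [PiLp.smul_apply, smul_eq_mul, Finset.mul_sum]; congr 1; ext; ring)
    (by intro x y y'; simp only [PiLp.add_apply, ← Finset.sum_add_distrib]; congr 1; ext; ring)
    (by intro c x y; simp only [PiLp.smul_apply, smul_eq_mul, Finset.mul_sum]; congr 1; ext; ring)

/-- The Lagrangian Grassmannian of `ℝ^{2n}` (for `n = 1`: the projective line). -/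
def Lag (n : ℕ) : Type :=
  {L : Submodule ℝ (SympVec n) // Module.finrank ℝ L = n ∧ ∀ u ∈ L, ∀ v ∈ L, omega n u v = 0}

/-- A matrix as a continuous linear endomorphism of `ℝ^{2n}`. -/
def matOp {n : ℕ} (g : Matrix (Fin n ⊕ Fin n) (Fin n ⊕ Fin n) ℝ) : SympVec n →L[ℝ] SympVec n :=
  Matrix.toEuclideanCLM (𝕜 := ℝ) g

/-- `L' = g · L`. -/
def MovesTo {n : ℕ} (g : Sp n) (L L' : Lag n) : Prop :=
  L.1.map (matOp g.1 : SympVec n →ₗ[ℝ] SympVec n) = L'.1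

/-- The quadratic form `(v, w, x) ↦ ω(v, w) + ω(w, x) + ω(x, v)` on `L₁ ⊕ M ⊕ L₂`. -/
def maslovForm {n : ℕ} (L₁ M L₂ : Lag n) : QuadraticForm ℝ (L₁.1 × M.1 × L₂.1) :=
  let p₁ : L₁.1 × M.1 × L₂.1 →ₗ[ℝ] SympVec n := L₁.1.subtype ∘ₗ LinearMap.fst ℝ _ _
  let p₂ : L₁.1 × M.1 × L₂.1 →ₗ[ℝ] SympVec n :=
    M.1.subtype ∘ₗ LinearMap.fst ℝ _ _ ∘ₗ LinearMap.snd ℝ _ _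
  let p₃ : L₁.1 × M.1 × L₂.1 →ₗ[ℝ] SympVec n :=
    L₂.1.subtype ∘ₗ LinearMap.snd ℝ _ _ ∘ₗ LinearMap.snd ℝ _ _
  LinearMap.BilinMap.toQuadraticMap
    ((omega n).compl₁₂ p₁ p₂ + (omega n).compl₁₂ p₂ p₃ + (omega n).compl₁₂ p₃ p₁)

/-- The Maslov index of a triple of Lagrangians. -/
def maslovIndex {n : ℕ} (L₁ M L₂ : Lag n) : ℤ :=
  (sigPos (maslovForm L₁ M L₂) : ℤ) - sigNeg (maslovForm L₁ M L₂)

theorem movesTo_one {n : ℕ} (L : Lag n) : MovesTo 1 L L := by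
  have h : (matOp (1 : Sp n).1 : SympVec n →L[ℝ] SympVec n) = 1 := by simp [matOp]
  unfold MovesTo
  rw [h]
  exact Submodule.map_id _

theorem movesTo_mul {n : ℕ} {g h : Sp n} {L L' L'' : Lag n} (H : MovesTo g L L')
    (H' : MovesTo h L' L'') : MovesTo (h * g) L L'' := by
  unfold MovesTo at *
  rw [← H', ← H, ← Submodule.map_comp]
  congr 1
  simp [matOp, ContinuousLinearMap.mul_def]

theorem movesTo_inv {n : ℕ} {g : Sp n} {L L' : Lag n} (H : MovesTo g L L') :
    MovesTo g⁻¹ L' L := by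
  have h : matOp (g⁻¹).1 * matOp g.1 = (1 : SympVec n →L[ℝ] SympVec n) := by
    have h1 : (g⁻¹).1 * g.1 = 1 := congrArg Subtype.val (inv_mul_cancel g)
    simp only [matOp, ← map_mul, h1, map_one]
  unfold MovesTo at *
  rw [← H, ← Submodule.map_comp]
  have h2 : ((matOp (g⁻¹).1 : SympVec n →ₗ[ℝ] SympVec n)) ∘ₗ
      (matOp g.1 : SympVec n →ₗ[ℝ] SympVec n) = LinearMap.id := by
    ext1 v
    exact congrArg (fun T : SympVec n →L[ℝ] SympVec n => T v) h
  rw [h2, Submodule.map_id]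

/-! ## Surfaces -/

/-- An oriented connected surface `S = S̄ ∖ R` with an ideal triangulation, as a gluing of
oriented triangles. `F` is the finite nonempty set of triangles. The vertices of a triangle `t` are
the pairs `(t, i)`, `i ∈ ℤ/3`, in the positive cyclic order; `(t, i)` also denotes the oriented
side of `t` from its vertex `i` to its vertex `i + 1`. The involution `glue` pairs the internal
sides: `d` is glued to `glue d` with reversed orientation. Its fixed points are the external sides,
one for each point of `R`. The corners are truncated: the components of `∂S` correspond to the
vertices of the triangulation, the compact components to the vertices whose corners close up
cyclically. -/
structure IdealSurface (F : Type*) [Fintype F] where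
  nonempty : Nonempty F
  glue : F × ZMod 3 → F × ZMod 3
  glue_glue : ∀ d, glue (glue d) = d
  connected : ∀ t t' : F,
    Relation.ReflTransGen (fun a b : F => ∃ i j : ZMod 3, glue (a, i) = (b, j)) t t'

/-- The next side (or vertex) of the same triangle. -/
def nextSide {F : Type*} (d : F × ZMod 3) : F × ZMod 3 := (d.1, d.2 + 1)

namespace IdealSurface

variable {F : Type*} [Fintype F]

/-- The cardinality `r` of `R`, i.e. the number of external edges. -/
def numMarked (S : IdealSurface F) : ℕ := Nat.card {d // S.glue d = d}

/-- The number of internal edges. -/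
def numInternal (S : IdealSurface F) : ℕ :=
  Set.ncard {e : Set (F × ZMod 3) | ∃ d, S.glue d ≠ d ∧ e = {d, S.glue d}}

/-- The Euler characteristic of `S̄`, which retracts by deformation onto the graph dual to the
triangulation, with one vertex for each triangle and one edge for each internal edge. -/
def eulerChar (S : IdealSurface F) : ℤ := (Fintype.card F : ℤ) - S.numInternal

/-- The numbers `|χ(S̄)|`, read as `-χ(S̄)` (it is `-1` when `S̄` is a disk). -/
def absEulerChar (S : IdealSurface F) : ℤ := - S.eulerChar

/-- A local system with group `G`: it is trivialized over each triangle, and `u d` is the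
locally constant change of trivialization from the triangle of the side `d` to the one of
`glue d` (with the convention `u d = 1` if `d` is external). -/
def IsLocalSystem (S : IdealSurface F) {G : Type*} [Monoid G] (u : F × ZMod 3 → G) : Prop :=
  ∀ d, (S.glue d ≠ d → u (S.glue d) * u d = 1) ∧ (S.glue d = d → u d = 1)

/-- A framed `Sp(2n, ℝ)`-local system: a local system and a flat section over `∂S` of the
associated bundle of Lagrangians, i.e. a Lagrangian at each corner of each triangle, compatible with
the changes of trivializations. (The end vertex of the side `d` is glued to the starting vertex of
`glue d`; the corresponding compatibility is the one stated here for `glue d`.) -/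
structure FramedLocalSystem (S : IdealSurface F) (n : ℕ) where
  trans : F × ZMod 3 → Sp n
  isLocalSystem : S.IsLocalSystem trans
  lag : F × ZMod 3 → Lag n
  flat : ∀ d, S.glue d ≠ d → MovesTo (trans d) (lag d) (lag (nextSide (S.glue d)))

/-- Isomorphism of framed local systems: changes of trivialization over the triangles. -/
def FramedLocalSystem.Iso {S : IdealSurface F} {n : ℕ} (x y : S.FramedLocalSystem n) : Prop :=
  ∃ h : F → Sp n, (∀ d, y.trans d = h (S.glue d).1 * x.trans d * (h d.1)⁻¹) ∧
    ∀ c, MovesTo (h c.1) (x.lag c) (y.lag c)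

theorem FramedLocalSystem.iso_equivalence (S : IdealSurface F) (n : ℕ) :
    Equivalence (FramedLocalSystem.Iso (S := S) (n := n)) where
  refl x := ⟨fun _ => 1, fun d => by simp, fun c => movesTo_one _⟩
  symm := by
    rintro x y ⟨h, h1, h2⟩
    refine ⟨fun t => (h t)⁻¹, fun d => ?_, fun c => movesTo_inv (h2 c)⟩
    rw [h1]; group
  trans := by
    rintro x y z ⟨h, h1, h2⟩ ⟨k, k1, k2⟩
    refine ⟨fun t => k t * h t, fun d => ?_, fun c => movesTo_mul (h2 c) (k2 c)⟩
    rw [k1, h1]; group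

/-- The Maslov index of the triangle `t`. -/
def FramedLocalSystem.maslov {S : IdealSurface F} {n : ℕ} (x : S.FramedLocalSystem n) (t : F) :
    ℤ :=
  maslovIndex (x.lag (t, 0)) (x.lag (t, 1)) (x.lag (t, 2))

/-- A triangulated surface together with a framed local system on it. -/
abbrev Framed (F : Type*) [Fintype F] (n : ℕ) : Type _ :=
  Σ S : IdealSurface F, S.FramedLocalSystem n

/-- `b` is the same framed local system as `a`, on the triangulation obtained from the one of `a`
by a flip. The flipped edge is the diagonal `d = AB`, glued to `d' = BA`, of the quadrilateral
`ADBC` made of two distinct triangles `ABC` and `BAD`, over which the trivializations agree. The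
new triangles are `DCA` and `CDB` (their first sides being the new diagonal, again called `d`
and `d'`), and `π` maps each old side to the same side in the new triangulation:
`BC`, `CA`, `AD`, `DB` are the sides following `d`, resp. `d'`. -/
def IsFlip {n : ℕ} (a b : Framed F n) : Prop :=
  ∃ (d d' : F × ZMod 3) (π : Equiv.Perm (F × ZMod 3)),
    a.1.glue d = d' ∧ d.1 ≠ d'.1 ∧
    π d = d ∧ π d' = d' ∧
    π (nextSide d) = nextSide (nextSide d') ∧
    π (nextSide (nextSide d)) = nextSide d ∧
    π (nextSide d') = nextSide (nextSide d) ∧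
    π (nextSide (nextSide d')) = nextSide d' ∧
    (∀ e, e.1 ≠ d.1 → e.1 ≠ d'.1 → π e = e) ∧
    (∀ e, b.1.glue (π e) = π (a.1.glue e)) ∧
    a.2.trans d = 1 ∧
    (∀ e, b.2.trans (π e) = a.2.trans e) ∧
    (∀ e, e ≠ d → e ≠ d' → b.2.lag (π e) = a.2.lag e)

/-- `b` is obtained from `a` by an isomorphism of framed local systems over the same
triangulation. -/
def IsIso {n : ℕ} (a b : Framed F n) : Prop :=
  ∃ (S : IdealSurface F) (x y : S.FramedLocalSystem n), x.Iso y ∧ a = ⟨S, x⟩ ∧ b = ⟨S, y⟩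

/-- A framed local system is maximal if there is an ideal triangulation of the surface all of whose
triangles have Maslov index `n`. The ideal triangulations of the surface are those obtained from the
given one by a finite sequence of flips. -/
def FramedLocalSystem.IsMaximal {S : IdealSurface F} {n : ℕ} (x : S.FramedLocalSystem n) : Prop :=
  ∃ b : Framed F n, Relation.ReflTransGen (fun a a' => IsIso a a' ∨ IsFlip a a') ⟨S, x⟩ b ∧
    ∀ t : F, b.2.maslov t = n

/-! ## The moduli space of maximal framed local systems -/

/-- The space `M^f(S, Sp(2n, ℝ))` of isomorphism classes of maximal framed local systems. A framed
local system is recorded by its changes of trivialization and by the orthogonal projections onto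
its Lagrangians. -/
def Mf (S : IdealSurface F) (n : ℕ) : SmoothQuotient where
  E := {x : S.FramedLocalSystem n // x.IsMaximal}
  W := (F × ZMod 3 → SympVec n →L[ℝ] SympVec n) × (F × ZMod 3 → SympVec n →L[ℝ] SympVec n)
  ι := fun x => (fun d => matOp (x.1.trans d).1, fun c => (x.1.lag c).1.starProjection)
  s :=
    { r := fun x y => x.1.Iso y.1
      iseqv :=
        { refl := fun x => (FramedLocalSystem.iso_equivalence S n).refl x.1
          symm := fun h => (FramedLocalSystem.iso_equivalence S n).symm h
          trans := fun h h' => (FramedLocalSystem.iso_equivalence S n).trans h h' } }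

/-- The image of `(g₁, g₂)` under `SL(2, ℝ) × SL(2, ℝ) → Sp(4, ℝ)`, the two factors acting on
`Span(e₁, f₁)` and on `Span(e₂, f₂)`; here `SL(2, ℝ) = Sp(2, ℝ)`. -/
def blockSum (g₁ g₂ : Matrix (Fin 1 ⊕ Fin 1) (Fin 1 ⊕ Fin 1) ℝ) :
    Matrix (Fin 2 ⊕ Fin 2) (Fin 2 ⊕ Fin 2) ℝ :=
  Matrix.fromBlocks
    (Matrix.diagonal ![g₁ (Sum.inl 0) (Sum.inl 0), g₂ (Sum.inl 0) (Sum.inl 0)])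
    (Matrix.diagonal ![g₁ (Sum.inl 0) (Sum.inr 0), g₂ (Sum.inl 0) (Sum.inr 0)])
    (Matrix.diagonal ![g₁ (Sum.inr 0) (Sum.inl 0), g₂ (Sum.inr 0) (Sum.inl 0)])
    (Matrix.diagonal ![g₁ (Sum.inr 0) (Sum.inr 0), g₂ (Sum.inr 0) (Sum.inr 0)])

/-- The image of `(g, u)` under `SL(2, ℝ) × O(2) → Sp(4, ℝ)`: the blocks are the multiples of
`u` by the entries of `g`. -/
def tensor (g : Matrix (Fin 1 ⊕ Fin 1) (Fin 1 ⊕ Fin 1) ℝ) (u : Matrix (Fin 2) (Fin 2) ℝ) :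
    Matrix (Fin 2 ⊕ Fin 2) (Fin 2 ⊕ Fin 2) ℝ :=
  Matrix.fromBlocks
    (g (Sum.inl 0) (Sum.inl 0) • u) (g (Sum.inl 0) (Sum.inr 0) • u)
    (g (Sum.inr 0) (Sum.inl 0) • u) (g (Sum.inr 0) (Sum.inr 0) • u)

/-- The component of a vector of `ℝ⁴` in `Span(e_i, f_i) = ℝ²`. -/
def planePart (i : Fin 2) (v : SympVec 2) : SympVec 1 :=
  WithLp.toLp 2 (Sum.elim (fun _ => v (Sum.inl i)) (fun _ => v (Sum.inr i)))

/-- `L = ℓ₁ ⊕ ℓ₂`. For `ℓ₁ = ℓ₂ = Span(x e + y f)` this is the Lagrangian spanned by the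
`x e_i + y f_i`. -/
def IsDirectSum (ℓ₁ ℓ₂ : Lag 1) (L : Lag 2) : Prop :=
  ∀ v : SympVec 2, v ∈ L.1 ↔ planePart 0 v ∈ ℓ₁.1 ∧ planePart 1 v ∈ ℓ₂.1

/-- `M^f(S, SL(2, ℝ) × SL(2, ℝ))`: the image of pairs of maximal framed `SL(2, ℝ)`-local
systems. -/
def MfProduct (S : IdealSurface F) : Set (S.Mf 2).Pt :=
  {p | ∃ (x : (S.Mf 2).E) (y₁ y₂ : (S.Mf 1).E), (S.Mf 2).cls x = p ∧
    (∀ d, (x.1.trans d).1 = blockSum (y₁.1.trans d).1 (y₂.1.trans d).1) ∧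
    ∀ c, IsDirectSum (y₁.1.lag c) (y₂.1.lag c) (x.1.lag c)}

/-- `M^f(S, SL(2, ℝ) ⊗ SO(2))`: the image of the pairs of a maximal framed `SL(2, ℝ)`-local system
and an `SO(2)`-local system. -/
def MfTensorSO (S : IdealSurface F) : Set (S.Mf 2).Pt :=
  {p | ∃ (x : (S.Mf 2).E) (y : (S.Mf 1).E)
      (u : F × ZMod 3 → Matrix.specialOrthogonalGroup (Fin 2) ℝ), (S.Mf 2).cls x = p ∧
    S.IsLocalSystem u ∧ (∀ d, (x.1.trans d).1 = tensor (y.1.trans d).1 (u d).1) ∧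
    ∀ c, IsDirectSum (y.1.lag c) (y.1.lag c) (x.1.lag c)}

/-- `M^f(S, SL(2, ℝ))`, embedded diagonally. -/
def MfDiagonal (S : IdealSurface F) : Set (S.Mf 2).Pt :=
  {p | ∃ (x : (S.Mf 2).E) (y : (S.Mf 1).E), (S.Mf 2).cls x = p ∧
    (∀ d, (x.1.trans d).1 = tensor (y.1.trans d).1 1) ∧
    ∀ c, IsDirectSum (y.1.lag c) (y.1.lag c) (x.1.lag c)}

end IdealSurface

end

/-! ## Local isomorphisms of smooth quotients -/

noncomputable section

namespace SmoothQuotient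

/-! Reduction to matrices. A triangle has Maslov index `n` exactly when its three Lagrangians form a
positive triple (`Lag.maslovIndex_eq_iff`), and positivity of the two triangles after a flip implies
positivity of the two before it (`Lag.IsPositive.flip`). So maximality is positivity of every
triangle of the given triangulation (`FramedLocalSystem.isMaximal_iff`). For `n = 1` and `n = 2`
every positive triple is the image of the standard one, whose stabilizer is O(n). In adapted frames,
a maximal system is a family of invertible matrices `B` on the internal sides, with `-Bᵀ` on the
opposite side, up to `B ↦ o' B oᵀ` with one orthogonal matrix per triangle
(`EdgeData.system_iso_iff`).

The slice. For `n = 2`, read `B` as the real linear map `z ↦ h z + k z̄` of the complex line. Polar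
decomposition along a spanning tree of the dual graph makes `h` real and `‖k‖ < h` on the tree
edges. Only one element of O(2), common to all triangles, is then left: a rotation by `c` fixes each
`h` and multiplies each `k` by `c²`, and a reflection also conjugates all of them. With `m` internal
edges, `b` of them outside the tree, the free parameters are `p` (real parts of the `h`), `q`
(imaginary parts off the tree) and `z` (the `k`). The moduli space is the quotient of an open
saturated subset of `ℝ^m × ℝ^b × ℂ^m` by the relation defining `modelCircleInvolution m b m`
(`Skeleton.point_iso_iff`); explicit smooth local sections make this an isomorphism of smooth
structures (`Skeleton.locallyIso_point`). Counting sides gives `m = 3c + r` and `b = c + 1`.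

The loci. Tensor products are the points `z = 0`, the diagonal is `q = 0`, `z = 0`, and the direct
sums are the points equivalent to one with `q = 0` and `z` real. The local models come from the
relation at such points: where `q ≠ 0` and `z = 0` the involution is inactive and the circle
remains; where `z ≠ 0` the condition that one coordinate be positive uses up the circle and leaves
at most a sign. The tensor locus is the continuous image of a vector space, in logarithmic
coordinates, hence connected.

The converses. Isomorphisms respect smooth functions, so leading Taylor terms of invariant functions
can be compared at the origin. For a sign quotient, a reversed direction together with a nonnegative
quadratic invariant excludes smoothness (`not_locallyIso_euclidean`). For the circle quotients with
at least two complex coordinates, suppose there is an isomorphism with a finite quotient `ℝ^d / Γ`.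
Blowing it up gives a correspondence of tangent cones (`exists_tangentCorrespondence`) under which
the invariants `‖∑ vᵢ zᵢ‖²` become quadratic forms. The complex line through each vector of an
infinite family then corresponds to a real line, on which `Γ` acts by a sign character
(`TangentCorrespondence.eq_or_eq_neg`). Two members of the family have the same character; the
product of the associated linear forms is therefore invariant and would be a quadratic form on the
circle side, which a rotation of one of the two vectors contradicts (`TangentCorrespondence.false`).
-/

theorem isOpen_iff_forall (X : SmoothQuotient) {U : Set X.Pt} :
    IsOpen U ↔ ∀ e, X.cls e ∈ U → ∃ O : Set X.W, IsOpen O ∧ X.ι e ∈ O ∧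
      ∀ e', X.ι e' ∈ O → X.cls e' ∈ U := by
  have key : IsOpen U ↔ ∃ O : Set X.W, IsOpen O ∧ X.ι ⁻¹' O = X.cls ⁻¹' U := by
    rw [isOpen_coinduced, isOpen_induced_iff]
  rw [key]
  constructor
  · rintro ⟨O, hO, h⟩ e he
    exact ⟨O, hO, (Set.ext_iff.1 h e).2 he, fun e' he' => (Set.ext_iff.1 h e').1 he'⟩
  · intro h
    choose! O hO he hO' using h
    refine ⟨⋃ e ∈ X.cls ⁻¹' U, O e, isOpen_biUnion fun e he => hO e he, ?_⟩
    ext e'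
    simp only [Set.mem_preimage, Set.mem_iUnion]
    exact ⟨fun ⟨e, h1, h2⟩ => hO' e h1 e' h2, fun h => ⟨e', h, he e' h⟩⟩

theorem eventually_comap_nhds_iff (X : SmoothQuotient) {e : X.E} {p : X.E → Prop} :
    (∀ᶠ e' in Filter.comap X.ι (𝓝 (X.ι e)), p e') ↔
      ∃ O : Set X.W, IsOpen O ∧ X.ι e ∈ O ∧ ∀ e', X.ι e' ∈ O → p e' := by
  rw [((nhds_basis_opens (X.ι e)).comap X.ι).eventually_iff]
  constructor
  · rintro ⟨O, ⟨h1, h2⟩, h3⟩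
    exact ⟨O, h2, h1, fun e' he' => h3 he'⟩
  · rintro ⟨O, h2, h1, h3⟩
    exact ⟨O, ⟨h1, h2⟩, fun e' he' => h3 e' he'⟩

theorem exists_cls_eq (X : SmoothQuotient) (x : X.Pt) : ∃ e, X.cls e = x := Quotient.exists_rep x

theorem cls_eq_iff (X : SmoothQuotient) {e e' : X.E} : X.cls e = X.cls e' ↔ X.s e e' :=
  ⟨fun h => Quotient.exact h, fun h => Quotient.sound h⟩

/-- A neighborhood of `x` in the quotient pulls back to a neighborhood of every representative of
`x`, so smoothness depends only on the germ. -/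
theorem SmoothAt.congr {X : SmoothQuotient} {f g : X.Pt → ℝ} {x : X.Pt} (hf : X.SmoothAt f x)
    (h : f =ᶠ[𝓝 x] g) : X.SmoothAt g x := by
  intro e he
  obtain ⟨Φ, hΦ, hev⟩ := hf e he
  refine ⟨Φ, hΦ, ?_⟩
  obtain ⟨U, hU, hUo, hxU⟩ := eventually_nhds_iff.1 h
  obtain ⟨O, hO, heO, hO'⟩ := (X.isOpen_iff_forall.1 hUo) e (he ▸ hxU)
  have : ∀ᶠ e' in Filter.comap X.ι (𝓝 (X.ι e)), X.cls e' ∈ U :=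
    X.eventually_comap_nhds_iff.2 ⟨O, hO, heO, hO'⟩
  filter_upwards [hev, this] with e' h1 h2
  rw [← hU _ h2, h1]

/-- The definition of a local isomorphism tests functions on the target only. Testing functions on
the source is equivalent, since `f` and `f ∘ φ.symm ∘ φ` have the same germ; this gives the symmetry
of `LocallyIso`. -/
theorem smoothAt_comp_symm_iff {X Y : SmoothQuotient} (φ : OpenPartialHomeomorph X.Pt Y.Pt)
    (hφ : ∀ z ∈ φ.source, ∀ f : Y.Pt → ℝ, Y.SmoothAt f (φ z) ↔ X.SmoothAt (f ∘ φ) z) :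
    ∀ z ∈ φ.symm.source, ∀ f : X.Pt → ℝ,
      X.SmoothAt f (φ.symm z) ↔ Y.SmoothAt (f ∘ φ.symm) z := by
  intro z hz f
  have hz' : φ.symm z ∈ φ.source := φ.map_target hz
  have key := hφ _ hz' (f ∘ φ.symm)
  rw [φ.right_inv hz] at key
  rw [key]
  have hev : f =ᶠ[𝓝 (φ.symm z)] ((f ∘ φ.symm) ∘ φ) := by
    filter_upwards [φ.open_source.mem_nhds hz'] with w hw
    simp [φ.left_inv hw]
  exact ⟨fun h => h.congr hev, fun h => h.congr hev.symm⟩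

theorem LocallyIso.symm {X Y : SmoothQuotient} {x : X.Pt} {y : Y.Pt} (h : LocallyIso X Y x y) :
    LocallyIso Y X y x := by
  obtain ⟨φ, hx, hxy, hφ⟩ := h
  refine ⟨φ.symm, ?_, ?_, smoothAt_comp_symm_iff φ hφ⟩
  · rw [← hxy]; exact φ.map_source hx
  · rw [← hxy]; exact φ.left_inv hx

theorem LocallyIso.trans {X Y Z : SmoothQuotient} {x : X.Pt} {y : Y.Pt} {z : Z.Pt}
    (h : LocallyIso X Y x y) (h' : LocallyIso Y Z y z) : LocallyIso X Z x z := by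
  obtain ⟨φ, hx, hxy, hφ⟩ := h
  obtain ⟨ψ, hy, hyz, hψ⟩ := h'
  refine ⟨φ.trans ψ, ?_, ?_, ?_⟩
  · simp [hx, hxy, hy]
  · simp [hxy, hyz]
  · intro w hw f
    rw [OpenPartialHomeomorph.trans_source] at hw
    have h1 := hψ (φ w) hw.2 f
    have h2 := hφ w hw.1 (f ∘ ψ)
    rw [OpenPartialHomeomorph.coe_trans, Function.comp_apply, h1, h2]
    rfl

/-- A map of quotient spaces which near `x` lifts to smooth maps of the ambient spaces. -/
def SmoothMapAt {X Y : SmoothQuotient} (ψ : X.Pt → Y.Pt) (x : X.Pt) : Prop :=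
  ∀ e, X.cls e = x → ∃ O : Set X.W, IsOpen O ∧ X.ι e ∈ O ∧ ∃ G : X.W → Y.W,
    ContDiffOn ℝ ∞ G O ∧ ∀ e₁, X.ι e₁ ∈ O → ∃ e₂, Y.ι e₂ = G (X.ι e₁) ∧ Y.cls e₂ = ψ (X.cls e₁)

/-- A function smooth on a neighborhood agrees near the point with a globally smooth one. -/
theorem exists_contDiff_eventuallyEq {W : Type*} [NormedAddCommGroup W] [NormedSpace ℝ W]
    [FiniteDimensional ℝ W] {f : W → ℝ} {O : Set W} (hO : IsOpen O) {w : W} (hw : w ∈ O)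
    (hf : ContDiffOn ℝ ∞ f O) : ∃ g : W → ℝ, ContDiff ℝ ∞ g ∧ g =ᶠ[𝓝 w] f := by
  obtain ⟨ε, hε, hεO⟩ := Metric.isOpen_iff.1 hO w hw
  -- The outer radius is smaller than `ε`, so the closed support of the bump lies in `O`; outside it
  -- the product vanishes, however `f` behaves there.
  let b : ContDiffBump w := ⟨ε / 3, ε / 2, by positivity, by linarith⟩
  refine ⟨fun y => b y * f y, ?_, ?_⟩
  · rw [contDiff_iff_contDiffAt]
    intro y
    by_cases hy : y ∈ O
    · exact b.contDiff.contDiffAt.mul (hf.contDiffAt (hO.mem_nhds hy))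
    · have hy' : y ∉ tsupport b := by
        rw [b.tsupport_eq]
        intro h
        exact hy (hεO (lt_of_le_of_lt (Metric.mem_closedBall.1 h) (show ε / 2 < ε by linarith)))
      have : (fun y => b y * f y) =ᶠ[𝓝 y] fun _ => 0 := by
        filter_upwards [(isClosed_tsupport b).isOpen_compl.mem_nhds hy'] with z hz
        rw [image_eq_zero_of_notMem_tsupport hz, zero_mul]
      exact contDiffAt_const.congr_of_eventuallyEq this
  · filter_upwards [b.eventuallyEq_one] with y hy
    rw [hy]; simp

/-- `SmoothAt` asks for a function smooth on the whole ambient space, whereas the lift is smooth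
only on an open set. The cutoff bridges the two and is where finite dimension enters. -/
theorem SmoothMapAt.smoothAt_comp {X Y : SmoothQuotient} [FiniteDimensional ℝ X.W]
    {ψ : X.Pt → Y.Pt} {x : X.Pt} (h : SmoothMapAt ψ x) {f : Y.Pt → ℝ} (hf : Y.SmoothAt f (ψ x)) :
    X.SmoothAt (f ∘ ψ) x := by
  intro e he
  obtain ⟨O, hO, heO, G, hG, hlift⟩ := h e he
  obtain ⟨e₀, he₀, he₀'⟩ := hlift e heO
  obtain ⟨Φ, hΦ, hev⟩ := hf e₀ (by rw [he₀', he])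
  obtain ⟨O', hO', heO', hO''⟩ := Y.eventually_comap_nhds_iff.1 hev
  have hopen : IsOpen (O ∩ G ⁻¹' O') := hG.continuousOn.isOpen_inter_preimage hO hO'
  have hmem : X.ι e ∈ O ∩ G ⁻¹' O' := ⟨heO, by rw [Set.mem_preimage, ← he₀]; exact heO'⟩
  obtain ⟨g, hg, hgeq⟩ := exists_contDiff_eventuallyEq (f := Φ ∘ G) hO heO
    (hΦ.comp_contDiffOn hG)
  refine ⟨g, hg, ?_⟩
  have h1 : ∀ᶠ e' in Filter.comap X.ι (𝓝 (X.ι e)), g (X.ι e') = (Φ ∘ G) (X.ι e') :=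
    Filter.Eventually.comap hgeq _
  have h2 : ∀ᶠ e' in Filter.comap X.ι (𝓝 (X.ι e)), X.ι e' ∈ O ∩ G ⁻¹' O' :=
    Filter.Eventually.comap (hopen.mem_nhds hmem) _
  filter_upwards [h1, h2] with e' h3 h4
  obtain ⟨e'', h5, h6⟩ := hlift e' h4.1
  rw [h3, Function.comp_apply, ← h6, hO'' e'' (by rw [h5]; exact h4.2), h5]
  rfl

theorem SmoothMapAt.isOpen_inter_preimage {X Y : SmoothQuotient} {ψ : X.Pt → Y.Pt} {N : Set X.Pt}
    (hN : IsOpen N) (h : ∀ x ∈ N, SmoothMapAt ψ x) {U : Set Y.Pt} (hU : IsOpen U) :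
    IsOpen (N ∩ ψ ⁻¹' U) := by
  rw [X.isOpen_iff_forall]
  rintro e ⟨he, he'⟩
  obtain ⟨O₁, hO₁, heO₁, hO₁'⟩ := X.isOpen_iff_forall.1 hN e he
  obtain ⟨O, hO, heO, G, hG, hlift⟩ := h _ he e rfl
  obtain ⟨e₀, he₀, he₀'⟩ := hlift e heO
  obtain ⟨O', hO', heO', hO''⟩ := Y.isOpen_iff_forall.1 hU e₀ (by rw [he₀']; exact he')
  refine ⟨O₁ ∩ (O ∩ G ⁻¹' O'), hO₁.inter (hG.continuousOn.isOpen_inter_preimage hO hO'),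
    ⟨heO₁, heO, by rw [Set.mem_preimage, ← he₀]; exact heO'⟩, ?_⟩
  rintro e' ⟨h1, h2, h3⟩
  obtain ⟨e'', h5, h6⟩ := hlift e' h2
  refine ⟨hO₁' e' h1, ?_⟩
  rw [Set.mem_preimage, ← h6]
  exact hO'' e'' (by rw [h5]; exact h3)

theorem SmoothMapAt.continuousOn {X Y : SmoothQuotient} {ψ : X.Pt → Y.Pt} {N : Set X.Pt}
    (hN : IsOpen N) (h : ∀ x ∈ N, SmoothMapAt ψ x) : ContinuousOn ψ N := by
  rw [continuousOn_open_iff hN]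
  exact fun U hU => SmoothMapAt.isOpen_inter_preimage hN h hU

/-- Mutually inverse bijections of open sets with smooth lifts give local isomorphisms. -/
theorem locallyIso_of_smoothMapAt {X Y : SmoothQuotient} [FiniteDimensional ℝ X.W]
    [FiniteDimensional ℝ Y.W] {ψ : X.Pt → Y.Pt} {χ : Y.Pt → X.Pt} {N : Set X.Pt} {M : Set Y.Pt}
    (hN : IsOpen N) (hM : IsOpen M) (hNM : Set.MapsTo ψ N M) (hMN : Set.MapsTo χ M N)
    (hl : Set.LeftInvOn χ ψ N) (hr : Set.LeftInvOn ψ χ M) (hψ : ∀ x ∈ N, SmoothMapAt ψ x)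
    (hχ : ∀ y ∈ M, SmoothMapAt χ y) {x : X.Pt} (hx : x ∈ N) : LocallyIso X Y x (ψ x) := by
  let φ : OpenPartialHomeomorph X.Pt Y.Pt :=
    { toFun := ψ
      invFun := χ
      source := N
      target := M
      map_source' := hNM
      map_target' := hMN
      left_inv' := hl
      right_inv' := hr
      open_source := hN
      open_target := hM
      continuousOn_toFun := SmoothMapAt.continuousOn hN hψ
      continuousOn_invFun := SmoothMapAt.continuousOn hM hχ }
  refine ⟨φ, hx, rfl, ?_⟩
  intro z hz f
  refine ⟨fun h => (hψ z hz).smoothAt_comp h, fun h => ?_⟩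
  have h1 : Y.SmoothAt ((f ∘ ψ) ∘ χ) (ψ z) := by
    refine (hχ (ψ z) (hNM hz)).smoothAt_comp ?_
    rw [hl hz]; exact h
  refine h1.congr ?_
  filter_upwards [hM.mem_nhds (hNM hz)] with w hw
  simp [hr hw]

/-- A slice: an open saturated set `N` of a vector space with an equivalence relation and a smooth
map `g` from `N` to `X`, inducing an injection of quotients, with local smooth inverses up to
equivalence. -/
theorem locallyIso_of_slice {X : SmoothQuotient} [FiniteDimensional ℝ X.W] {V : Type*}
    [NormedAddCommGroup V] [NormedSpace ℝ V] [FiniteDimensional ℝ V] (s : Setoid V) {N : Set V}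
    (hN : IsOpen N) (hsat : ∀ v v', s v v' → v ∈ N → v' ∈ N) (g : V → X.E)
    (hrel : ∀ v ∈ N, ∀ v' ∈ N, s v v' ↔ X.s (g v) (g v'))
    (hg : ContDiffOn ℝ ∞ (fun v => X.ι (g v)) N)
    (hsec : ∀ v ∈ N, ∀ e, X.s e (g v) → ∃ O : Set X.W, IsOpen O ∧ X.ι e ∈ O ∧ ∃ H : X.W → V,
      ContDiffOn ℝ ∞ H O ∧ ∀ e', X.ι e' ∈ O → H (X.ι e') ∈ N ∧ X.s (g (H (X.ι e'))) e')
    {v : V} (hv : v ∈ N) : LocallyIso X (ofSetoid s) (X.cls (g v)) ((ofSetoid s).cls v) := by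
  classical
  have hout : ∀ v : V, s (Quotient.out (Quotient.mk s v)) v := fun v => Quotient.mk_out v
  let ψ : (ofSetoid s).Pt → X.Pt := fun p => X.cls (g (Quotient.out p))
  have hψ : ∀ v ∈ N, ψ ((ofSetoid s).cls v) = X.cls (g v) := by
    intro v hv
    -- Saturation keeps the representative picked by `Quotient.out` inside `N`, where `hrel`
    -- applies.
    refine X.cls_eq_iff.2 ((hrel _ (hsat _ _ (s.symm (hout v)) hv) _ hv).1 (hout v))
  let N' : Set (ofSetoid s).Pt := (ofSetoid s).cls '' N
  have hcls : ∀ v, (ofSetoid s).cls v ∈ N' ↔ v ∈ N := by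
    intro v
    refine ⟨?_, fun h => ⟨v, h, rfl⟩⟩
    rintro ⟨v', hv', h⟩
    exact hsat _ _ ((ofSetoid s).cls_eq_iff.1 h) hv'
  let M : Set X.Pt := (fun v => X.cls (g v)) '' N
  -- The value outside the image of `N` is irrelevant; `v` only provides some point.
  let χ : X.Pt → (ofSetoid s).Pt := fun p =>
    if h : ∃ v ∈ N, X.cls (g v) = p then (ofSetoid s).cls h.choose else (ofSetoid s).cls v
  have hχ : ∀ v ∈ N, χ (X.cls (g v)) = (ofSetoid s).cls v := by
    intro v hv
    have h : ∃ v' ∈ N, X.cls (g v') = X.cls (g v) := ⟨v, hv, rfl⟩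
    have : χ (X.cls (g v)) = (ofSetoid s).cls h.choose := dif_pos h
    rw [this]
    exact (ofSetoid s).cls_eq_iff.2
      ((hrel _ h.choose_spec.1 _ hv).2 (X.cls_eq_iff.1 h.choose_spec.2))
  have hN' : IsOpen N' := by
    rw [isOpen_iff_forall]
    intro e he
    exact ⟨N, hN, (hcls e).1 he, fun e' he' => (hcls e').2 he'⟩
  have hM : IsOpen M := by
    rw [isOpen_iff_forall]
    rintro e ⟨v, hv, h⟩
    obtain ⟨O, hO, heO, H, hH, hHO⟩ := hsec v hv e (X.s.symm (X.cls_eq_iff.1 h))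
    exact ⟨O, hO, heO, fun e' he' => ⟨H (X.ι e'), (hHO e' he').1, X.cls_eq_iff.2 (hHO e' he').2⟩⟩
  have : FiniteDimensional ℝ (ofSetoid s).W := inferInstanceAs (FiniteDimensional ℝ V)
  have key := locallyIso_of_smoothMapAt (X := X) (Y := ofSetoid s) (ψ := χ) (χ := ψ) (N := M)
    (M := N') hM hN' ?_ ?_ ?_ ?_ ?_ ?_ (x := X.cls (g v)) ⟨v, hv, rfl⟩
  · rwa [hχ v hv] at key
  · rintro _ ⟨v, hv, rfl⟩
    simp only [hχ v hv]
    exact ⟨v, hv, rfl⟩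
  · rintro _ ⟨v, hv, rfl⟩
    rw [hψ v hv]
    exact ⟨v, hv, rfl⟩
  · rintro _ ⟨v, hv, rfl⟩
    simp only [hχ v hv, hψ v hv]
  · rintro _ ⟨v, hv, rfl⟩
    rw [hψ v hv, hχ v hv]
  · rintro _ ⟨v, hv, rfl⟩ e he
    obtain ⟨O, hO, heO, H, hH, hHO⟩ := hsec v hv e (X.cls_eq_iff.1 he)
    refine ⟨O, hO, heO, H, hH, fun e' he' => ⟨H (X.ι e'), rfl, ?_⟩⟩
    rw [← X.cls_eq_iff.2 (hHO e' he').2, hχ _ (hHO e' he').1]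
  · rintro _ ⟨v, hv, rfl⟩ e he
    have heN : e ∈ N := (hcls e).1 (by rw [he]; exact ⟨v, hv, rfl⟩)
    exact ⟨N, hN, heN, fun v => X.ι (g v), hg, fun e' he' => ⟨g e', rfl, (hψ e' he').symm⟩⟩

/-- `locallyIso_of_slice` between quotients of vector spaces. -/
theorem locallyIso_ofSetoid_of_slice {U V : Type*} [NormedAddCommGroup U] [NormedSpace ℝ U]
    [FiniteDimensional ℝ U] [NormedAddCommGroup V] [NormedSpace ℝ V] [FiniteDimensional ℝ V]
    (t : Setoid U) (s : Setoid V) {N : Set V} (hN : IsOpen N)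
    (hsat : ∀ v v', s v v' → v ∈ N → v' ∈ N) (g : V → U)
    (hrel : ∀ v ∈ N, ∀ v' ∈ N, s v v' ↔ t (g v) (g v')) (hg : ContDiffOn ℝ ∞ g N)
    (hsec : ∀ v ∈ N, ∀ u, t u (g v) → ∃ O : Set U, IsOpen O ∧ u ∈ O ∧ ∃ H : U → V,
      ContDiffOn ℝ ∞ H O ∧ ∀ u' ∈ O, H u' ∈ N ∧ t (g (H u')) u')
    {v : V} (hv : v ∈ N) {u : U} (hu : g v = u) :
    LocallyIso (ofSetoid t) (ofSetoid s) ((ofSetoid t).cls u) ((ofSetoid s).cls v) := by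
  have : FiniteDimensional ℝ (ofSetoid t).W := inferInstanceAs (FiniteDimensional ℝ U)
  subst hu
  exact locallyIso_of_slice (X := ofSetoid t) s hN hsat g hrel hg hsec hv

end SmoothQuotient

end

/-! ## The local models at points other than the origin -/

noncomputable section

namespace SmoothQuotient

/-- The equivalence relation of `modelSign`. -/
def signRel (a b : ℕ) : Setoid ((Fin a → ℝ) × (Fin b → ℝ)) := (modelSign a b).s

/-- The equivalence relation of `modelCircle`. -/
def circleProdRel (a k : ℕ) : Setoid ((Fin a → ℝ) × (Fin k → ℂ)) := (modelCircle a k).s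

/-- The equivalence relation of `modelCircleInvolution`. -/
def involutionRel (a m k : ℕ) : Setoid ((Fin a → ℝ) × (Fin m → ℝ) × (Fin k → ℂ)) :=
  (modelCircleInvolution a m k).s

theorem signRel_iff {a b : ℕ} {p q : (Fin a → ℝ) × (Fin b → ℝ)} :
    signRel a b p q ↔ q.1 = p.1 ∧ (q.2 = p.2 ∨ q.2 = -p.2) := Iff.rfl

theorem circleRel_iff {k : ℕ} {z w : Fin k → ℂ} :
    circleRel k z w ↔ ∃ c : Circle, ∀ i, w i = (c : ℂ) * z i := by
  constructor
  · rintro ⟨c, hc⟩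
    refine ⟨c⁻¹, fun i => ?_⟩
    rw [← hc]
    simp [Circle.smul_def]
  · rintro ⟨c, hc⟩
    refine ⟨c⁻¹, ?_⟩
    funext i
    simp [Circle.smul_def, hc]

theorem circleProdRel_iff {a k : ℕ} {p q : (Fin a → ℝ) × (Fin k → ℂ)} :
    circleProdRel a k p q ↔ q.1 = p.1 ∧ circleRel k p.2 q.2 := Iff.rfl

theorem involutionRel_iff {a m k : ℕ} {p q : (Fin a → ℝ) × (Fin m → ℝ) × (Fin k → ℂ)} :
    involutionRel a m k p q ↔ q.1 = p.1 ∧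
        ((q.2.1 = p.2.1 ∧ circleRel k p.2.2 q.2.2) ∨
          (q.2.1 = -p.2.1 ∧ circleRel k (conjVec p.2.2) q.2.2)) := Iff.rfl

theorem contDiff_conjVec {k : ℕ} : ContDiff ℝ ∞ (conjVec : (Fin k → ℂ) → (Fin k → ℂ)) := by
  rw [contDiff_pi]
  intro i
  exact Complex.conjCLE.contDiff.comp (contDiff_apply ℝ ℂ i)

theorem contDiff_re {n : WithTop ℕ∞} : ContDiff ℝ n Complex.re := Complex.reCLM.contDiff

theorem contDiff_im {n : WithTop ℕ∞} : ContDiff ℝ n Complex.im := Complex.imCLM.contDiff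

theorem contDiff_conj {n : WithTop ℕ∞} : ContDiff ℝ n (fun z : ℂ => (starRingEnd ℂ) z) :=
  Complex.conjCLE.contDiff

theorem contDiff_ofReal {n : WithTop ℕ∞} : ContDiff ℝ n (fun z : ℝ => (z : ℂ)) :=
  Complex.ofRealCLM.contDiff

/-- Translation along the first factor. -/
theorem locallyIso_involution_translate {a m k : ℕ} (p : Fin a → ℝ) :
    LocallyIso (modelCircleInvolution a m k) (modelCircleInvolution a m k)
      (cls _ (p, 0, 0)) (cls _ (0, 0, 0)) :=
  locallyIso_ofSetoid_of_slice (involutionRel a m k) (involutionRel a m k) (N := Set.univ)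
    isOpen_univ (fun _ _ _ _ => trivial) (fun v => v + (p, 0, 0))
    (fun v _ v' _ => by simp [involutionRel_iff]) (by fun_prop)
    (fun v _ e _ => ⟨Set.univ, isOpen_univ, trivial, fun w => w - (p, 0, 0), by fun_prop,
      fun e' _ => ⟨trivial, by simp⟩⟩)
    (v := (0, 0, 0)) trivial (by simp)

theorem locallyIso_sign_translate {a b : ℕ} (p : Fin a → ℝ) :
    LocallyIso (modelSign a b) (modelSign a b) (cls _ (p, 0)) (cls _ (0, 0)) :=
  locallyIso_ofSetoid_of_slice (signRel a b) (signRel a b) (N := Set.univ)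
    isOpen_univ (fun _ _ _ _ => trivial) (fun v => v + (p, 0))
    (fun v _ v' _ => by simp [signRel_iff]) (by fun_prop)
    (fun v _ e _ => ⟨Set.univ, isOpen_univ, trivial, fun w => w - (p, 0), by fun_prop,
      fun e' _ => ⟨trivial, by simp⟩⟩)
    (v := (0, 0)) trivial (by simp)

/-- A real coordinate space is the product of two others of complementary dimensions. -/
def piProdEquiv {ι κ : Type*} [Fintype ι] [Fintype κ] (n : ℕ)
    (h : n = Fintype.card ι + Fintype.card κ) : (Fin n → ℝ) ≃L[ℝ] (ι → ℝ) × (κ → ℝ) :=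
  ContinuousLinearEquiv.ofFinrankEq (by simp [h])

/-- The open ball of radius `‖y‖` about `y` is disjoint from its image under `-Id`; on it the sign
identifies nothing. -/
theorem add_ne_neg_add_of_norm_lt {E : Type*} [NormedAddCommGroup E] [NormedSpace ℝ E]
    {u v y : E} (hu : ‖u‖ < ‖y‖) (hv : ‖v‖ < ‖y‖) : v + y ≠ -(u + y) := by
  intro h
  have h2 : (2 : ℝ) • y = -(u + v) := by
    rw [two_smul]
    have h' : v + y + (u + y) = 0 := by rw [h, neg_add_cancel]
    rw [eq_neg_iff_add_eq_zero, ← h']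
    abel
  have h3 := norm_add_le u v
  rw [← norm_neg, ← h2, norm_smul] at h3
  norm_num at h3
  linarith

/-- A ball around `y` which contains no two opposite points is a chart of the quotient. -/
theorem isSmoothPoint_sign {a b : ℕ} (x : Fin a → ℝ) {y : Fin b → ℝ} (hy : y ≠ 0) :
    IsSmoothPoint (modelSign a b) (cls _ (x, y)) := by
  refine ⟨a + b, ?_⟩
  let e := piProdEquiv (ι := Fin a) (κ := Fin b) (a + b) (by simp)
  refine locallyIso_ofSetoid_of_slice (signRel a b) ⊥
    (N := {v | ‖(e v).2‖ < ‖y‖}) (isOpen_lt (by fun_prop) (by fun_prop))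
    (fun v v' h hv => by rwa [← show v = v' from h])
    (fun v => e v + (x, y)) (fun v hv v' hv' => ?_) (by fun_prop) (fun v hv w hw => ?_)
    (v := 0) (by simpa using hy) (by simp)
  · change v = v' ↔ _
    rw [signRel_iff]
    constructor
    · rintro rfl; simp
    · rintro ⟨h1, h2 | h2⟩
      · apply e.injective
        refine Prod.ext ?_ ?_
        · simpa using h1.symm
        · simpa using h2.symm
      · exact absurd h2 (add_ne_neg_add_of_norm_lt hv hv')
  · obtain ⟨h1, h2 | h2⟩ := signRel_iff.1 hw
    · refine ⟨{w | ‖w.2 - y‖ < ‖y‖}, isOpen_lt (by fun_prop) (by fun_prop), ?_,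
        fun w => e.symm (w - (x, y)), by fun_prop, fun w' hw' => ⟨?_, by simp⟩⟩
      · change ‖w.2 - y‖ < ‖y‖
        rw [← h2]
        simpa using hv
      · simpa using hw'
    -- Representatives on the sheet around `-y` are brought back to the chart by a change of sign.
    · refine ⟨{w | ‖-w.2 - y‖ < ‖y‖}, isOpen_lt (by fun_prop) (by fun_prop), ?_,
        fun w => e.symm ((w.1, -w.2) - (x, y)), by fun_prop,
        fun w' hw' => ⟨?_, by simp [signRel_iff]⟩⟩
      · change ‖-w.2 - y‖ < ‖y‖
        rw [← h2]
        simpa using hv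
      · simpa using hw'

/-- Near `q ≠ 0` the involution moves every point off the chart, so only the circle identifies
points there and both real factors become parameters. -/
theorem locallyIso_involution_circle {a m k n : ℕ} (hn : n = a + m) (p : Fin a → ℝ)
    {q : Fin m → ℝ} (hq : q ≠ 0) :
    LocallyIso (modelCircleInvolution a m k) (modelCircle n k) (cls _ (p, q, 0))
      (cls _ (0, 0)) := by
  let e := piProdEquiv (ι := Fin a) (κ := Fin m) n (by simp [hn])
  let g : (Fin n → ℝ) × (Fin k → ℂ) → (Fin a → ℝ) × (Fin m → ℝ) × (Fin k → ℂ) :=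
    fun v => ((e v.1).1 + p, (e v.1).2 + q, v.2)
  refine locallyIso_ofSetoid_of_slice (involutionRel a m k) (circleProdRel n k)
    (N := {v | ‖(e v.1).2‖ < ‖q‖}) (isOpen_lt (by fun_prop) (by fun_prop))
    (fun v v' h hv => by
      have h1 : v'.1 = v.1 := h.1
      simpa only [Set.mem_ofPred_eq, h1] using hv)
    g (fun v hv v' hv' => ?_) (by fun_prop) (fun v hv w hw => ?_)
    (v := (0, 0)) (by simpa using hq) (by simp [g])
  · rw [circleProdRel_iff, involutionRel_iff]
    constructor
    · rintro ⟨h1, h2⟩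
      exact ⟨by simp [g, h1], Or.inl ⟨by simp [g, h1], h2⟩⟩
    · rintro ⟨h1, ⟨h2, h3⟩ | ⟨h2, h3⟩⟩
      · refine ⟨?_, h3⟩
        apply e.injective
        exact Prod.ext (by simpa [g] using h1) (by simpa [g] using h2)
      · exact absurd h2 (add_ne_neg_add_of_norm_lt hv hv')
  · obtain ⟨h1, ⟨h2, h3⟩ | ⟨h2, h3⟩⟩ := involutionRel_iff.1 hw
    · refine ⟨{w | ‖w.2.1 - q‖ < ‖q‖}, isOpen_lt (by fun_prop) (by fun_prop), ?_,
        fun w => (e.symm (w.1 - p, w.2.1 - q), w.2.2), by fun_prop,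
        fun w' hw' => ⟨by simpa using hw', by simp [g]⟩⟩
      change ‖w.2.1 - q‖ < ‖q‖
      rw [← h2]
      simpa [g] using hv
    · refine ⟨{w | ‖-w.2.1 - q‖ < ‖q‖}, isOpen_lt (by fun_prop) (by fun_prop), ?_,
        fun w => (e.symm (w.1 - p, -w.2.1 - q), conjVec w.2.2),
        (ContDiff.prodMk (by fun_prop)
          (contDiff_conjVec.comp (contDiff_snd.comp contDiff_snd))).contDiffOn,
        fun w' hw' => ⟨by simpa using hw', ?_⟩⟩
      · change ‖-w.2.1 - q‖ < ‖q‖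
        rw [← h2]
        simpa [g] using hv
      · rw [involutionRel_iff]
        refine ⟨by simp [g], Or.inr ⟨by simp [g], ?_⟩⟩
        change circleRel k (conjVec (conjVec w'.2.2)) w'.2.2
        rw [conjVec_conjVec]

/-- The slice `z i₀ > 0` through a point with `z ≠ 0`. -/
theorem locallyIso_involution_sign {a m k n l : ℕ} (hn : n = a + k) (hl : l + 1 = m + k)
    (p : Fin a → ℝ) (q : Fin m → ℝ) (z : Fin k → ℂ) (i₀ : Fin k) (hre : 0 < (z i₀).re)
    (him : (z i₀).im = 0) :
    ∃ (x : Fin n → ℝ) (y : Fin l → ℝ), (y = 0 → q = 0 ∧ ∀ i, (z i).im = 0) ∧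
      (q = 0 → (∀ i, (z i).im = 0) → y = 0) ∧
      LocallyIso (modelCircleInvolution a m k) (modelSign n l) (cls _ (p, q, z)) (cls _ (x, y)) := by
  let e₁ := piProdEquiv (ι := Fin a) (κ := Fin k) n (by simp [hn])
  let e₂ := piProdEquiv (ι := Fin m) (κ := {i : Fin k // i ≠ i₀}) l (by
    have := i₀.pos
    simp only [Fintype.card_fin, Fintype.card_subtype_compl, Fintype.card_unique, ne_eq]
    omega)
  -- On the slice the real parts of `z` are fixed by conjugation and join the first factor; the
  -- imaginary parts change sign together with `q`. The one at `i₀` is zero on the slice, hence `l +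
  -- 1 = m + k`.
  let im : (Fin l → ℝ) → Fin k → ℝ := fun y i => if h : i ≠ i₀ then (e₂ y).2 ⟨i, h⟩ else 0
  have him_neg : ∀ y i, im (-y) i = -im y i := by
    intro y i
    by_cases h : i = i₀ <;> simp [im, h]
  have him₀ : ∀ y, im y i₀ = 0 := fun y => by simp [im]
  let g : (Fin n → ℝ) × (Fin l → ℝ) → (Fin a → ℝ) × (Fin m → ℝ) × (Fin k → ℂ) :=
    fun v => ((e₁ v.1).1, (e₂ v.2).1, fun i => ⟨(e₁ v.1).2 i, im v.2 i⟩)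
  have hinj : ∀ v v' : (Fin n → ℝ) × (Fin l → ℝ), g v = g v' → v = v' := by
    intro v v' h
    have h1 := congrArg Prod.fst h
    have h2 := congrArg (fun u => u.2.1) h
    have h3 := congrArg (fun u => u.2.2) h
    refine Prod.ext (e₁.injective (Prod.ext h1 ?_)) (e₂.injective (Prod.ext h2 ?_))
    · funext i
      exact congrArg Complex.re (congrFun h3 i)
    · funext i
      have := congrArg Complex.im (congrFun h3 i.1)
      simpa [g, im, i.2] using this
  have hconj : ∀ v : (Fin n → ℝ) × (Fin l → ℝ),
      g (v.1, -v.2) = ((g v).1, -(g v).2.1, conjVec (g v).2.2) := by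
    intro v
    refine Prod.ext rfl (Prod.ext (by simp [g]) ?_)
    funext i
    apply Complex.ext <;> simp [g, conjVec, him_neg]
  -- The rotation that makes the coordinate `i₀` equal to its modulus; it gives the smooth return to
  -- the slice wherever this coordinate is nonzero.
  let ρ : (Fin k → ℂ) → (Fin k → ℂ) := fun z i => (starRingEnd ℂ) (z i₀) * (‖z i₀‖ : ℂ)⁻¹ * z i
  let H : (Fin a → ℝ) × (Fin m → ℝ) × (Fin k → ℂ) → (Fin n → ℝ) × (Fin l → ℝ) := fun w =>
    (e₁.symm (w.1, fun i => (ρ w.2.2 i).re), e₂.symm (w.2.1, fun i => (ρ w.2.2 i.1).im))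
  have hρ₀ : ∀ z : Fin k → ℂ, z i₀ ≠ 0 → ρ z i₀ = ‖z i₀‖ := by
    intro z hz
    have hz' : (‖z i₀‖ : ℂ) ≠ 0 := by simpa using hz
    have : (starRingEnd ℂ) (z i₀) * z i₀ = (‖z i₀‖ : ℂ) ^ 2 := by
      rw [mul_comm, Complex.mul_conj, Complex.normSq_eq_norm_sq]; push_cast; ring
    simp only [ρ]
    rw [mul_right_comm, this]
    field_simp
  have hgH : ∀ w : (Fin a → ℝ) × (Fin m → ℝ) × (Fin k → ℂ), w.2.2 i₀ ≠ 0 →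
      g (H w) = (w.1, w.2.1, ρ w.2.2) := by
    intro w hw
    refine Prod.ext (by simp [g, H]) (Prod.ext (by simp [g, H]) ?_)
    funext i
    apply Complex.ext
    · simp [g, H]
    · by_cases h : i ≠ i₀
      · simp [g, H, im, h]
      · obtain rfl : i = i₀ := not_not.1 h
        simp [g, im, hρ₀ _ hw]
  have hρrel : ∀ z : Fin k → ℂ, z i₀ ≠ 0 → circleRel k (ρ z) z := by
    intro z hz
    have hz' : ‖z i₀‖ ≠ 0 := by simpa using hz
    refine (circleRel k).symm (circleRel_iff.2 ⟨⟨(starRingEnd ℂ) (z i₀) * (‖z i₀‖ : ℂ)⁻¹, ?_⟩,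
      fun i => rfl⟩)
    rw [Submonoid.unitSphere, Submonoid.mem_mk, Subsemigroup.mem_mk, mem_sphere_zero_iff_norm]
    simp [hz']
  have hρid : ∀ z : Fin k → ℂ, 0 < (z i₀).re → (z i₀).im = 0 → ρ z = z := by
    intro z h h'
    have h1 : z i₀ = ((z i₀).re : ℂ) := Complex.ext (by simp) (by simp [h'])
    have h2 : ((z i₀).re : ℂ) ≠ 0 := by exact_mod_cast h.ne'
    funext i
    simp only [ρ]
    rw [h1, Complex.conj_ofReal, Complex.norm_real, Real.norm_of_nonneg h.le, mul_inv_cancel₀ h2,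
      one_mul]
  have hz₀ : z i₀ ≠ 0 := by
    intro h
    rw [h] at hre
    simp at hre
  -- Positivity of the coordinate `i₀` at two equivalent points of the slice uses up the circle.
  have hunit : ∀ (c : Circle) (r r' : ℝ), 0 < r → 0 < r' → (r' : ℂ) = (c : ℂ) * r → (c : ℂ) = 1 := by
    intro c r r' h h' hc
    have h1 : r' = r := by
      have := congrArg norm hc
      simpa [abs_of_pos h, abs_of_pos h', Circle.norm_coe] using this
    have h2 : (r : ℂ) ≠ 0 := by exact_mod_cast h.ne'
    rw [h1] at hc
    exact mul_right_cancel₀ h2 (by rw [← hc, one_mul])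
  refine ⟨(H (p, q, z)).1, (H (p, q, z)).2, ?_, ?_, ?_⟩
  · intro h
    have h1 : (q, fun i : {i : Fin k // i ≠ i₀} => (ρ z i.1).im) = 0 :=
      e₂.symm.injective (by rw [map_zero]; exact h)
    refine ⟨congrArg Prod.fst h1, fun i => ?_⟩
    by_cases hi : i = i₀
    · rw [hi, him]
    · have := congrFun (congrArg Prod.snd h1) ⟨i, hi⟩
      rw [hρid z hre him] at this
      exact this
  · intro h h'
    change e₂.symm (q, fun i => (ρ z i.1).im) = 0
    rw [hρid z hre him, h, show (fun i : {i : Fin k // i ≠ i₀} => (z i.1).im) = 0 from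
      funext fun i => h' i.1]
    exact map_zero _
  refine locallyIso_ofSetoid_of_slice (involutionRel a m k) (signRel n l)
    (N := {v | 0 < (e₁ v.1).2 i₀}) (isOpen_lt (by fun_prop) (by fun_prop))
    (fun v v' h hv => by
      have h1 : v'.1 = v.1 := h.1
      simpa only [Set.mem_ofPred_eq, h1] using hv)
    g (fun v hv v' hv' => ?_) ?_ (fun v hv w hw => ?_)
    (v := H (p, q, z)) ?_ (by rw [hgH _ hz₀, hρid z hre him])
  · have hgi : ∀ v, (g v).2.2 i₀ = ((e₁ v.1).2 i₀ : ℂ) := by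
      intro v
      apply Complex.ext <;> simp [g, him₀]
    rw [signRel_iff, involutionRel_iff]
    constructor
    · rintro ⟨h1, h2 | h2⟩
      · rw [show v' = v from Prod.ext h1 h2]
        exact ⟨rfl, Or.inl ⟨rfl, (circleRel k).refl _⟩⟩
      · rw [show v' = (v.1, -v.2) from Prod.ext h1 h2, hconj]
        exact ⟨rfl, Or.inr ⟨rfl, (circleRel k).refl _⟩⟩
    · rintro ⟨h1, ⟨h2, h3⟩ | ⟨h2, h3⟩⟩
      · obtain ⟨c, hc⟩ := circleRel_iff.1 h3
        have hc₀ := hc i₀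
        rw [hgi, hgi] at hc₀
        have hc1 := hunit c _ _ hv hv' hc₀
        have : v' = v := hinj _ _ (Prod.ext h1 (Prod.ext h2 (funext fun i => by
          rw [hc i, hc1, one_mul])))
        rw [this]
        exact ⟨rfl, Or.inl rfl⟩
      · obtain ⟨c, hc⟩ := circleRel_iff.1 h3
        have hc₀ := hc i₀
        rw [conjVec, hgi, hgi, Complex.conj_ofReal] at hc₀
        have hc1 := hunit c _ _ hv hv' hc₀
        have : v' = (v.1, -v.2) := hinj _ _ (by
          rw [hconj]
          exact (Prod.ext h1 (Prod.ext h2 (funext fun i => by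
          rw [hc i, hc1, one_mul]))))
        rw [this]
        exact ⟨rfl, Or.inr rfl⟩
  · refine ContDiff.contDiffOn (ContDiff.prodMk (by fun_prop) (ContDiff.prodMk (by fun_prop) ?_))
    rw [contDiff_pi]
    intro i
    have h1 : ContDiff ℝ ∞ (fun v : (Fin n → ℝ) × (Fin l → ℝ) => im v.2 i) := by
      by_cases h : i ≠ i₀
      · simp only [im, h, not_false_eq_true, dite_true, ne_eq]
        fun_prop
      · simp only [im, h, dite_false]
        fun_prop
    have h2 : ContDiff ℝ ∞ (fun v : (Fin n → ℝ) × (Fin l → ℝ) => (e₁ v.1).2 i) := by fun_prop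
    exact Complex.equivRealProdCLM.symm.contDiff.comp (h2.prodMk h1)
  · have hw₀ : w.2.2 i₀ ≠ 0 := by
      have hg₀ : (g v).2.2 i₀ ≠ 0 := by
        intro h
        have := congrArg Complex.re h
        exact (ne_of_gt hv) this
      obtain ⟨h1, ⟨h2, h3⟩ | ⟨h2, h3⟩⟩ := involutionRel_iff.1 hw
      · obtain ⟨c, hc⟩ := circleRel_iff.1 h3
        intro h
        exact hg₀ (by rw [hc, h, mul_zero])
      · obtain ⟨c, hc⟩ := circleRel_iff.1 h3
        intro h
        exact hg₀ (by rw [hc, conjVec, h, map_zero, mul_zero])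
    refine ⟨{w | w.2.2 i₀ ≠ 0}, isOpen_ne_fun (by fun_prop) (by fun_prop), hw₀, H, ?_,
      fun w' hw' => ⟨?_, ?_⟩⟩
    · have hρs : ∀ i, ContDiffOn ℝ ∞ (fun w : (Fin a → ℝ) × (Fin m → ℝ) × (Fin k → ℂ) => ρ w.2.2 i)
          {w | w.2.2 i₀ ≠ 0} := by
        intro i
        have hz : ∀ i, ContDiffOn ℝ ∞
            (fun w : (Fin a → ℝ) × (Fin m → ℝ) × (Fin k → ℂ) => w.2.2 i) {w | w.2.2 i₀ ≠ 0} :=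
          fun i => by fun_prop
        refine ContDiffOn.mul (ContDiffOn.mul (contDiff_conj.comp_contDiffOn (hz i₀)) ?_) (hz i)
        refine ContDiffOn.inv (contDiff_ofReal.comp_contDiffOn ((hz i₀).norm ℝ fun w hw => hw)) ?_
        intro w hw
        simpa using hw
      refine ContDiffOn.prodMk (e₁.symm.contDiff.comp_contDiffOn (ContDiffOn.prodMk (by fun_prop) ?_))
        (e₂.symm.contDiff.comp_contDiffOn (ContDiffOn.prodMk (by fun_prop) ?_))
      · rw [contDiffOn_pi]
        exact fun i => contDiff_re.comp_contDiffOn (hρs i)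
      · rw [contDiffOn_pi]
        exact fun i => contDiff_im.comp_contDiffOn (hρs i)
    · change 0 < (e₁ (H w').1).2 i₀
      simp only [H, ContinuousLinearEquiv.apply_symm_apply, hρ₀ _ hw', Complex.ofReal_re]
      exact norm_pos_iff.2 hw'
    · rw [hgH _ hw', involutionRel_iff]
      exact ⟨rfl, Or.inl ⟨rfl, hρrel _ hw'⟩⟩
  · change 0 < (e₁ (H (p, q, z)).1).2 i₀
    simp only [H, ContinuousLinearEquiv.apply_symm_apply, hρid z hre him]
    exact hre

/-- A vector with a nonzero coordinate can be rotated to make this coordinate positive. -/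
theorem exists_circleRel_pos {k : ℕ} {z : Fin k → ℂ} {i : Fin k} (h : z i ≠ 0) :
    ∃ w, circleRel k z w ∧ 0 < (w i).re ∧ (w i).im = 0 := by
  have hz : (‖z i‖ : ℂ) ≠ 0 := by simpa using h
  have hz' : ‖z i‖ ≠ 0 := by simpa using h
  let c : ℂ := (starRingEnd ℂ) (z i) * (‖z i‖ : ℂ)⁻¹
  have hc : c ∈ Submonoid.unitSphere ℂ := by
    rw [Submonoid.unitSphere, Submonoid.mem_mk, Subsemigroup.mem_mk, mem_sphere_zero_iff_norm]
    simp [c, hz']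
  have hi : c * z i = ‖z i‖ := by
    have : (starRingEnd ℂ) (z i) * z i = (‖z i‖ : ℂ) ^ 2 := by
      rw [mul_comm, Complex.mul_conj, Complex.normSq_eq_norm_sq]; push_cast; ring
    simp only [c]
    rw [mul_right_comm, this]
    field_simp
  refine ⟨fun j => c * z j, circleRel_iff.2 ⟨⟨c, hc⟩, fun j => rfl⟩, ?_, ?_⟩
  · simpa only [hi, Complex.ofReal_re, norm_pos_iff] using h
  · simp only [hi, Complex.ofReal_im]

/-- Near a point fixed by a reflection but not by a rotation. -/
theorem locallyIso_involution_of_real {a m k n l : ℕ} (hn : n = a + k) (hl : l + 1 = m + k)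
    (p : Fin a → ℝ) {z : Fin k → ℂ} (hz : z ≠ 0) (hreal : ∀ i, (z i).im = 0) :
    LocallyIso (modelCircleInvolution a m k) (modelSign n l) (cls _ (p, 0, z))
      (cls _ (0, 0)) := by
  obtain ⟨i, hi⟩ := Function.ne_iff.1 hz
  obtain ⟨w, hw, hre, him⟩ : ∃ w, circleRel k z w ∧ 0 < (w i).re ∧ ∀ j, (w j).im = 0 := by
    have hi' : (z i).re ≠ 0 := fun h => hi (Complex.ext h (hreal i))
    -- Multiplication by `-1` is enough to make the coordinate positive, and it keeps all the
    -- coordinates real.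
    rcases hi'.lt_or_gt with h | h
    · refine ⟨-z, circleRel_iff.2 ⟨⟨-1, ?_⟩, fun j => by simp⟩, by simpa using h,
        fun j => by simp [hreal]⟩
      rw [Submonoid.unitSphere, Submonoid.mem_mk, Subsemigroup.mem_mk, mem_sphere_zero_iff_norm]
      simp
    · exact ⟨z, (circleRel k).refl z, h, hreal⟩
  obtain ⟨x, y, -, hy, hiso⟩ := locallyIso_involution_sign hn hl p 0 w i hre (him i)
  have hcls : (modelCircleInvolution a m k).cls (p, 0, z) =
      (modelCircleInvolution a m k).cls (p, 0, w) :=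
    (cls_eq_iff _).2 ⟨rfl, Or.inl ⟨rfl, hw⟩⟩
  rw [hy rfl him] at hiso
  rw [hcls]
  exact hiso.trans (locallyIso_sign_translate x)

/-- Points fixed neither by a rotation nor by a reflection are smooth. -/
theorem isSmoothPoint_involution {a m k : ℕ} {v : (Fin a → ℝ) × (Fin m → ℝ) × (Fin k → ℂ)}
    (hz : v.2.2 ≠ 0)
    (hv : ∀ v', involutionRel a m k v v' → ¬ (v'.2.1 = 0 ∧ ∀ i, (v'.2.2 i).im = 0)) :
    IsSmoothPoint (modelCircleInvolution a m k) (cls _ v) := by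
  obtain ⟨i, hi⟩ := Function.ne_iff.1 hz
  obtain ⟨w, hw, hre, him⟩ := exists_circleRel_pos hi
  have hk : 0 < k := i.pos
  obtain ⟨x, y, hy, -, hiso⟩ := locallyIso_involution_sign (n := a + k) (l := m + k - 1) rfl
    (by omega) v.1 v.2.1 w i hre him
  have hrel : involutionRel a m k v (v.1, v.2.1, w) := ⟨rfl, Or.inl ⟨rfl, hw⟩⟩
  have hcls : (modelCircleInvolution a m k).cls v =
      (modelCircleInvolution a m k).cls (v.1, v.2.1, w) := (cls_eq_iff _).2 hrel
  obtain ⟨d, hd⟩ := isSmoothPoint_sign x (y := y) fun h => hv _ hrel (hy h)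
  rw [hcls]
  exact ⟨d, hiso.trans hd⟩

end SmoothQuotient

end

/-! ## Leading terms of smooth functions -/

noncomputable section

namespace SmoothQuotient

section Taylor

variable {E : Type*} [NormedAddCommGroup E] [NormedSpace ℝ E]

/-- The term of order `k` of the Taylor expansion at the origin. -/
def lead (k : ℕ) (f : E → ℝ) (y : E) : ℝ :=
  (k.factorial : ℝ)⁻¹ * iteratedFDeriv ℝ k f 0 (fun _ => y)

/-- Taylor's formula with integral remainder along the ray through `y`: the quotient by `t ^ k` is a
parametric integral. Its joint continuity in `t` and `y`, including `t = 0`, allows limits along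
directions that vary with `t`. -/
theorem exists_continuous_factor {f : E → ℝ} (hf : ContDiff ℝ ∞ f) (k : ℕ)
    (h : ∀ j < k, ∀ y, lead j f y = 0) :
    ∃ G : ℝ × E → ℝ, Continuous G ∧ (∀ t y, f (t • y) = t ^ k * G (t, y)) ∧
      ∀ y, G (0, y) = lead k f y := by
  rcases k with _ | k
  · exact ⟨fun p => f (p.1 • p.2), hf.continuous.comp (by fun_prop), fun t y => by simp,
      fun y => by simp [lead]⟩
  let D : ℝ × E → ℝ → ℝ := fun p τ =>
    (1 - τ) ^ k * iteratedFDeriv ℝ (k + 1) f (τ • p.1 • p.2) (fun _ => p.2)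
  have hD : Continuous (Function.uncurry D) := by
    have h1 : Continuous (iteratedFDeriv ℝ (k + 1) f) :=
      hf.continuous_iteratedFDeriv (by exact_mod_cast le_top)
    have h2 : Continuous fun q : (ℝ × E) × ℝ =>
        iteratedFDeriv ℝ (k + 1) f (q.2 • q.1.1 • q.1.2) := h1.comp (by fun_prop)
    have h3 : Continuous fun q : (ℝ × E) × ℝ => (fun _ : Fin (k + 1) => q.1.2) := by fun_prop
    have h4 : Continuous fun q : (ℝ × E) × ℝ =>
        iteratedFDeriv ℝ (k + 1) f (q.2 • q.1.1 • q.1.2) (fun _ => q.1.2) := by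
      exact h2.eval h3
    exact Continuous.mul (by fun_prop) h4
  refine ⟨fun p => (k.factorial : ℝ)⁻¹ * ∫ τ in (0 : ℝ)..1, D p τ, ?_, ?_, ?_⟩
  · exact continuous_const.mul
      (intervalIntegral.continuous_parametric_intervalIntegral_of_continuous' hD 0 1)
  · intro t y
    have := map_add_eq_sum_add_integral_iteratedFDeriv (f := f) (x := 0) (y := t • y) (n := k)
      (fun τ _ => hf.contDiffAt.of_le (by exact_mod_cast le_top))
    rw [Finset.sum_eq_zero, zero_add, zero_add] at this
    · rw [this, smul_eq_mul, mul_left_comm]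
      congr 1
      rw [← intervalIntegral.integral_const_mul]
      refine intervalIntegral.integral_congr fun τ _ => ?_
      simp only [D, zero_add, smul_eq_mul]
      rw [show (fun _ : Fin (k + 1) => t • y) = fun i => (fun _ : Fin (k + 1) => t) i •
        (fun _ : Fin (k + 1) => y) i from rfl, ContinuousMultilinearMap.map_smul_univ]
      simp
      ring
    · intro j hj
      have := h j (Finset.mem_range.1 hj) (t • y)
      simpa [lead] using this
  · intro y
    simp only [D, zero_smul, smul_zero, intervalIntegral.integral_mul_const, lead]
    -- Here `k` is the predecessor of the order; this integral turns `1 / k!` into `1 / (k + 1)!`.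
    have : ∫ τ in (0 : ℝ)..1, (1 - τ) ^ k = ((k : ℝ) + 1)⁻¹ := by
      rw [intervalIntegral.integral_comp_sub_left (fun x => x ^ k) 1]
      simp
    rw [this, Nat.factorial_succ]
    push_cast
    rw [mul_inv]
    ring

/-- Once the terms below order `j` vanish, the term of order `j` is the limit of `f (t • y) / t ^
j`, which the hypothesis bounds by a multiple of `|t| ^ (k - j)`. -/
theorem lead_eq_zero_of_isBigO {f : E → ℝ} (hf : ContDiff ℝ ∞ f) {k : ℕ}
    (h : f =O[𝓝 0] fun x => ‖x‖ ^ k) : ∀ j < k, ∀ y, lead j f y = 0 := by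
  intro j
  induction j using Nat.strong_induction_on with
  | _ j ih =>
    intro hj y
    obtain ⟨G, hG, hGf, hG0⟩ := exists_continuous_factor hf j (fun i hi => ih i hi (hi.trans hj))
    obtain ⟨C, hC⟩ := h.bound
    have ht : Filter.Tendsto (fun t : ℝ => t • y) (𝓝[≠] 0) (𝓝 0) := by
      have : Filter.Tendsto (fun t : ℝ => t • y) (𝓝 0) (𝓝 ((0 : ℝ) • y)) :=
        (continuous_id.smul continuous_const).tendsto 0
      rw [zero_smul] at this
      exact this.mono_left nhdsWithin_le_nhds
    have h1 : Filter.Tendsto (fun t : ℝ => G (t, y)) (𝓝[≠] 0) (𝓝 (G (0, y))) :=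
      ((hG.comp (by fun_prop : Continuous fun t : ℝ => (t, y))).tendsto 0).mono_left
        nhdsWithin_le_nhds
    have h2 : Filter.Tendsto (fun t : ℝ => G (t, y)) (𝓝[≠] 0) (𝓝 0) := by
      have hb : ∀ᶠ t : ℝ in 𝓝[≠] 0, ‖G (t, y)‖ ≤ C * ‖y‖ ^ k * |t| ^ (k - j) := by
        filter_upwards [ht.eventually hC, self_mem_nhdsWithin] with t h3 h4
        have h4' : 0 < |t| := abs_pos.2 h4
        rw [hGf, norm_mul, norm_pow, Real.norm_eq_abs, norm_pow, norm_norm, norm_smul,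
          Real.norm_eq_abs t, mul_pow] at h3
        have h5 : |t| ^ k = |t| ^ j * |t| ^ (k - j) := by rw [← pow_add]; congr 1; omega
        rw [h5] at h3
        have h6 : 0 < |t| ^ j := by positivity
        have h7 : |t| ^ j * ‖G (t, y)‖ ≤ |t| ^ j * (C * ‖y‖ ^ k * |t| ^ (k - j)) := by
          calc _ ≤ _ := h3
            _ = _ := by ring
        exact le_of_mul_le_mul_left h7 h6
      refine squeeze_zero_norm' hb ?_
      have : Filter.Tendsto (fun t : ℝ => C * ‖y‖ ^ k * |t| ^ (k - j)) (𝓝 0)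
          (𝓝 (C * ‖y‖ ^ k * |0| ^ (k - j))) := Continuous.tendsto (by fun_prop) 0
      rw [abs_zero, zero_pow (by omega), mul_zero] at this
      exact this.mono_left nhdsWithin_le_nhds
    rw [← hG0]
    exact tendsto_nhds_unique h1 h2

/-- The blow-up limit of a smooth function which is `O(‖x‖ ^ k)`. -/
theorem tendsto_lead {f : E → ℝ} (hf : ContDiff ℝ ∞ f) {k : ℕ}
    (h : f =O[𝓝 0] fun x => ‖x‖ ^ k) {α : Type*} {l : Filter α} {t : α → ℝ} {x : α → E} {y : E}
    (ht : Filter.Tendsto t l (𝓝[≠] 0)) (hx : Filter.Tendsto (fun a => (t a)⁻¹ • x a) l (𝓝 y)) :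
    Filter.Tendsto (fun a => ((t a)⁻¹) ^ k * f (x a)) l (𝓝 (lead k f y)) := by
  obtain ⟨G, hG, hGf, hG0⟩ := exists_continuous_factor hf k (lead_eq_zero_of_isBigO hf h)
  have h1 : Filter.Tendsto (fun a => G (t a, (t a)⁻¹ • x a)) l (𝓝 (G (0, y))) :=
    (hG.tendsto (0, y)).comp ((ht.mono_right nhdsWithin_le_nhds).prodMk_nhds hx)
  rw [hG0] at h1
  refine h1.congr' ?_
  filter_upwards [ht.eventually self_mem_nhdsWithin] with a ha
  have ha' : t a ≠ 0 := ha
  have h2 := hGf (t a) ((t a)⁻¹ • x a)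
  rw [smul_smul, mul_inv_cancel₀ ha', one_smul] at h2
  rw [h2, ← mul_assoc, ← mul_pow, inv_mul_cancel₀ ha', one_pow, one_mul]

theorem isBigO_pow_one {f : E → ℝ} (hf : ContDiff ℝ ∞ f) (h0 : f 0 = 0) :
    f =O[𝓝 0] fun x => ‖x‖ ^ 1 := by
  have h1 := (hf.differentiable (by simp)).differentiableAt (x := 0)
  have h2 := h1.hasFDerivAt.isBigO_sub
  simp only [h0, sub_zero] at h2
  simpa using h2.norm_right

/-- A nonnegative smooth function vanishes to second order at its zeros. -/
theorem isBigO_pow_two_of_nonneg {f : E → ℝ} (hf : ContDiff ℝ ∞ f) (h0 : f 0 = 0)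
    (hnn : ∀ᶠ x in 𝓝 0, 0 ≤ f x) : f =O[𝓝 0] fun x => ‖x‖ ^ 2 := by
  have hmin : IsLocalMin f 0 := by
    filter_upwards [hnn] with x hx
    rwa [h0]
  -- The derivative vanishes at the minimum, hence is `O(‖x‖)`; the mean value inequality on the
  -- ball of radius `‖x‖` gives the second factor.
  have hd : fderiv ℝ f 0 = 0 := hmin.fderiv_eq_zero
  have hf' : ContDiff ℝ ∞ (fderiv ℝ f) := hf.fderiv_right (by simp)
  have h1 : (fderiv ℝ f) =O[𝓝 0] fun x => x := by
    have := (hf'.differentiable (by simp)).differentiableAt (x := 0) |>.hasFDerivAt.isBigO_sub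
    simpa [hd] using this
  obtain ⟨C, hC⟩ := h1.bound
  obtain ⟨ε, hε, hball⟩ := Metric.eventually_nhds_iff_ball.1 hC
  refine Asymptotics.IsBigO.of_bound C ?_
  filter_upwards [Metric.ball_mem_nhds (0 : E) hε] with x hx
  have hx' : ‖x‖ < ε := by simpa using hx
  have := Convex.norm_image_sub_le_of_norm_fderiv_le (𝕜 := ℝ) (f := f) (C := C * ‖x‖)
    (s := Metric.closedBall (0 : E) ‖x‖) (x := 0) (y := x)
    (fun y _ => (hf.differentiable (by simp)).differentiableAt) (fun y hy => ?_)
    (convex_closedBall _ _) (by simp) (by simp)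
  · rw [h0, sub_zero, sub_zero] at this
    calc ‖f x‖ ≤ C * ‖x‖ * ‖x‖ := this
      _ = C * ‖‖x‖ ^ 2‖ := by rw [norm_pow, norm_norm]; ring
  · have hy' : ‖y‖ ≤ ‖x‖ := by simpa using hy
    have h2 := hball y (by simpa using lt_of_le_of_lt hy' hx')
    -- The constant of the big-O bound comes without a sign; a negative one contradicts the bound at
    -- any nonzero `y` of the ball.
    have hC0 : 0 ≤ C ∨ ‖y‖ = 0 := by
      by_contra hcon
      push Not at hcon
      have : 0 < ‖y‖ := lt_of_le_of_ne (norm_nonneg _) (Ne.symm hcon.2)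
      have h3 := norm_nonneg (fderiv ℝ f y)
      nlinarith [mul_neg_of_neg_of_pos hcon.1 this]
    rcases hC0 with hC0 | hC0
    · exact h2.trans (mul_le_mul_of_nonneg_left hy' hC0)
    · have hy0 : y = 0 := norm_eq_zero.1 hC0
      rw [hy0, hd, norm_zero]
      by_contra hcon
      push Not at hcon
      have hx0 : 0 < ‖x‖ := by
        by_contra h
        have : ‖x‖ = 0 := le_antisymm (not_lt.1 h) (norm_nonneg _)
        rw [this, mul_zero] at hcon
        exact lt_irrefl _ hcon
      have h3 := hball x hx
      have h4 := norm_nonneg (fderiv ℝ f x)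
      linarith

end Taylor

/-! ## Corresponding points under a local isomorphism -/

section Correspondence

variable {U V : Type*} [NormedAddCommGroup U] [NormedSpace ℝ U] [NormedAddCommGroup V]
  [NormedSpace ℝ V]

/-- A local isomorphism at the origins, expressed by the relation between representatives and by
the transfer of smooth invariant functions in one direction. -/
structure Transfer (t : Setoid U) (s : Setoid V) (R : U → V → Prop) : Prop where
  zero : R 0 0
  congr : ∀ u u' v, t u u' → R u v → R u' v
  exact : ∀ u u' v, R u v → R u' v → t u u'
  exists_left : ∀ᶠ v in 𝓝 0, ∃ u, R u v
  lift : ∀ f : U → ℝ, ContDiff ℝ ∞ f → (∀ u u', t u u' → f u = f u') →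
    ∃ F : V → ℝ, ContDiff ℝ ∞ F ∧ ∀ᶠ v in 𝓝 0, ∀ u, R u v → F v = f u

/-- An invariant smooth function descends to the quotient, is carried across `φ`, and is smooth at
the class of the origin. Testing this on the representative `0` yields an honest smooth function on
`V` near `0`. -/
theorem transfer_of_openPartialHomeomorph {t : Setoid U} {s : Setoid V}
    (φ : OpenPartialHomeomorph (ofSetoid t).Pt (ofSetoid s).Pt)
    (h0 : (ofSetoid t).cls (0 : U) ∈ φ.source)
    (h0' : φ ((ofSetoid t).cls (0 : U)) = (ofSetoid s).cls (0 : V))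
    (hφ : ∀ z ∈ φ.source, ∀ f : (ofSetoid s).Pt → ℝ,
      (ofSetoid s).SmoothAt f (φ z) ↔ (ofSetoid t).SmoothAt (f ∘ φ) z) :
    Transfer t s fun u v => (ofSetoid t).cls u ∈ φ.source ∧
      φ ((ofSetoid t).cls u) = (ofSetoid s).cls v where
  zero := ⟨h0, h0'⟩
  congr u u' v h := by
    rw [show (ofSetoid t).cls u = (ofSetoid t).cls u' from (cls_eq_iff _).2 h]
    exact id
  exact u u' v h h' := (ofSetoid t).cls_eq_iff.1 (φ.injOn h.1 h'.1 (by rw [h.2, h'.2]))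
  exists_left := by
    have h1 : IsOpen φ.target := φ.open_target
    have h2 : (ofSetoid s).cls (0 : V) ∈ φ.target := by rw [← h0']; exact φ.map_source h0
    obtain ⟨O, hO, h0O, hO'⟩ := (ofSetoid s).isOpen_iff_forall.1 h1 (0 : V) h2
    filter_upwards [hO.mem_nhds h0O] with v hv
    obtain ⟨u, hu⟩ := (ofSetoid t).exists_cls_eq (φ.symm ((ofSetoid s).cls v))
    have hv' := hO' v hv
    exact ⟨u, by rw [hu]; exact φ.map_target hv', by rw [hu]; exact φ.right_inv hv'⟩
  lift f hf hft := by
    let fbar : (ofSetoid t).Pt → ℝ := Quotient.lift f hft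
    have hfbar : ∀ u, fbar ((ofSetoid t).cls u) = f u := fun u => rfl
    have h1 : (ofSetoid t).SmoothAt fbar ((ofSetoid t).cls (0 : U)) :=
      fun e he => ⟨f, hf, Filter.Eventually.of_forall fun u => rfl⟩
    have h2 : (ofSetoid s).SmoothAt (fbar ∘ φ.symm) (φ ((ofSetoid t).cls (0 : U))) := by
      rw [hφ _ h0]
      refine h1.congr ?_
      filter_upwards [φ.open_source.mem_nhds h0] with z hz
      simp [φ.left_inv hz]
    obtain ⟨F, hF, hev⟩ := h2 (0 : V) h0'.symm
    refine ⟨F, hF, ?_⟩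
    change ∀ᶠ v in Filter.comap id (𝓝 (0 : V)), _ at hev
    rw [Filter.comap_id] at hev
    filter_upwards [hev] with v hv u hu
    have h3 : φ.symm ((ofSetoid s).cls v) = (ofSetoid t).cls u := by
      rw [← hu.2]; exact φ.left_inv hu.1
    have h4 : fbar (φ.symm ((ofSetoid s).cls v)) = F v := hv
    rw [h3] at h4
    exact h4.symm

/-- A single relation serves in both directions, so functions lifted from either side are evaluated
at the same pairs of points. -/
theorem LocallyIso.exists_transfer {t : Setoid U} {s : Setoid V}
    (h : LocallyIso (ofSetoid t) (ofSetoid s) ((ofSetoid t).cls (0 : U))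
      ((ofSetoid s).cls (0 : V))) :
    ∃ R : U → V → Prop, Transfer t s R ∧ Transfer s t fun v u => R u v := by
  obtain ⟨φ, h0, h0', hφ⟩ := h
  refine ⟨_, transfer_of_openPartialHomeomorph φ h0 h0' hφ, ?_⟩
  have key := transfer_of_openPartialHomeomorph φ.symm
    (by rw [← h0']; exact φ.map_source h0) (by rw [← h0']; exact φ.left_inv h0)
    (smoothAt_comp_symm_iff φ hφ)
  have hR : (fun v u => (ofSetoid t).cls u ∈ φ.source ∧ φ ((ofSetoid t).cls u) =
      (ofSetoid s).cls v) = fun v u => (ofSetoid s).cls v ∈ φ.symm.source ∧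
        φ.symm ((ofSetoid s).cls v) = (ofSetoid t).cls u := by
    funext v u
    refine propext ⟨?_, ?_⟩
    · rintro ⟨h1, h2⟩
      exact ⟨by rw [← h2]; exact φ.map_source h1, by rw [← h2]; exact φ.left_inv h1⟩
    · rintro ⟨h1, h2⟩
      exact ⟨by rw [← h2]; exact φ.map_target h1, by rw [← h2]; exact φ.right_inv h1⟩
  exact hR ▸ key

end Correspondence

end SmoothQuotient

end

/-! ## Smooth points and orbifold points of the models -/

noncomputable section

namespace SmoothQuotient

section

variable {E : Type*} [NormedAddCommGroup E] [NormedSpace ℝ E]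

theorem lead_apply_zero {k : ℕ} (hk : k ≠ 0) (f : E → ℝ) : lead k f 0 = 0 := by
  rw [lead, ContinuousMultilinearMap.map_coord_zero _ (⟨0, Nat.pos_of_ne_zero hk⟩ : Fin k) rfl,
    mul_zero]

theorem lead_one_apply (f : E → ℝ) (y : E) : lead 1 f y = fderiv ℝ f 0 y := by
  simp [lead, iteratedFDeriv_one_apply]

theorem tendsto_inv_smul_smul (z : E) :
    Filter.Tendsto (fun τ : ℝ => τ⁻¹ • τ • z) (𝓝[≠] 0) (𝓝 z) := by
  refine tendsto_const_nhds.congr' ?_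
  filter_upwards [self_mem_nhdsWithin] with τ hτ
  have hτ' : τ ≠ 0 := hτ
  rw [smul_smul, inv_mul_cancel₀ hτ', one_smul]

theorem tendsto_smul_nhdsNE (z : E) :
    Filter.Tendsto (fun τ : ℝ => τ • z) (𝓝[≠] 0) (𝓝 0) := by
  have : Filter.Tendsto (fun τ : ℝ => τ • z) (𝓝 0) (𝓝 ((0 : ℝ) • z)) :=
    (continuous_id.smul continuous_const).tendsto 0
  rw [zero_smul] at this
  exact this.mono_left nhdsWithin_le_nhds

end

/-- A direction reversed by the equivalence relation, detected by a nonnegative invariant function,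
obstructs smoothness. -/
theorem not_locallyIso_euclidean {U : Type*} [NormedAddCommGroup U] [NormedSpace ℝ U]
    (t : Setoid U) {f : U → ℝ} (hf : ContDiff ℝ ∞ f) (hinv : ∀ u u', t u u' → f u = f u')
    (hnn : ∀ u, 0 ≤ f u) {z : U} {c : ℝ} (hc : c ≠ 0) (hfz : ∀ τ : ℝ, f (τ • z) = τ ^ 2 * c)
    (hz : ∀ τ : ℝ, t (τ • z) (-(τ • z))) (d : ℕ) :
    ¬ LocallyIso (ofSetoid t) (euclidean d) ((ofSetoid t).cls (0 : U))
      ((euclidean d).cls (0 : Fin d → ℝ)) := by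
  intro h
  obtain ⟨R, T₁, T₂⟩ := LocallyIso.exists_transfer (s := (⊥ : Setoid (Fin d → ℝ))) h
  obtain ⟨F, hF, hFf⟩ := T₁.lift f hf hinv
  have hF0 : F 0 = 0 := by
    rw [hFf.self_of_nhds 0 T₁.zero]
    simpa using hfz 0
  -- The lifted function inherits nonnegativity because every point near the origin has a
  -- counterpart.
  have hFO : F =O[𝓝 0] fun x => ‖x‖ ^ 2 := by
    refine isBigO_pow_two_of_nonneg hF hF0 ?_
    filter_upwards [hFf, T₁.exists_left] with v h1 h2
    obtain ⟨u, hu⟩ := h2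
    rw [h1 u hu]
    exact hnn u
  have hG := fun i : Fin d => T₂.lift (fun v => v i) (contDiff_apply ℝ ℝ i)
    (fun v v' h => by rw [show v = v' from h])
  choose G hGs hG using hG
  have hlim := tendsto_smul_nhdsNE z
  have hlim' := tendsto_smul_nhdsNE (-z)
  have hex : ∃ v : ℝ → Fin d → ℝ, ∀ᶠ τ in 𝓝[≠] (0 : ℝ), R (τ • z) (v τ) := by
    have := hlim.eventually T₂.exists_left
    classical
    refine ⟨fun τ => if h : ∃ v, R (τ • z) v then h.choose else 0, ?_⟩
    filter_upwards [this] with τ hτ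
    rw [dif_pos hτ]
    exact hτ.choose_spec
  obtain ⟨v, hv⟩ := hex
  have hGv : ∀ i, ∀ᶠ τ in 𝓝[≠] (0 : ℝ), G i (τ • z) = v τ i := by
    intro i
    filter_upwards [hlim.eventually (hG i), hv] with τ h1 h2
    exact h1 _ h2
  have hGv' : ∀ i, ∀ᶠ τ in 𝓝[≠] (0 : ℝ), G i (τ • (-z)) = v τ i := by
    intro i
    filter_upwards [hlim'.eventually (hG i), hv] with τ h1 h2
    refine h1 _ (T₁.congr _ _ _ ?_ h2)
    rw [smul_neg]
    exact hz τ
  have hG0 : ∀ i, G i 0 = 0 := fun i => (hG i).self_of_nhds 0 T₂.zero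
  have hid : Filter.Tendsto (fun τ : ℝ => τ) (𝓝[≠] 0) (𝓝[≠] 0) := Filter.tendsto_id
  -- The points `τ • z` and `-(τ • z)` correspond to the same `v τ`. Each coordinate of it, as a
  -- smooth function on `U`, thus has a linear part that is both odd and even along `z`.
  have hlead : ∀ i, lead 1 (G i) z = 0 := by
    intro i
    have h1 := tendsto_lead (hGs i) (isBigO_pow_one (hGs i) (hG0 i)) hid (tendsto_inv_smul_smul z)
    have h2 := tendsto_lead (hGs i) (isBigO_pow_one (hGs i) (hG0 i)) hid
      (tendsto_inv_smul_smul (-z))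
    have h3 : lead 1 (G i) z = lead 1 (G i) (-z) := by
      refine tendsto_nhds_unique h1 (h2.congr' ?_)
      filter_upwards [hGv i, hGv' i] with τ h4 h5
      rw [h4, h5]
    rw [lead_one_apply, lead_one_apply, map_neg] at h3
    rw [lead_one_apply]
    linarith
  have hv0 : Filter.Tendsto (fun τ : ℝ => τ⁻¹ • v τ) (𝓝[≠] 0) (𝓝 0) := by
    rw [tendsto_pi_nhds]
    intro i
    have h1 := tendsto_lead (hGs i) (isBigO_pow_one (hGs i) (hG0 i)) hid (tendsto_inv_smul_smul z)
    rw [hlead] at h1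
    refine h1.congr' ?_
    filter_upwards [hGv i] with τ h2
    simp [h2]
  have hv1 : Filter.Tendsto v (𝓝[≠] 0) (𝓝 0) := by
    rw [tendsto_pi_nhds]
    intro i
    have h1 : Filter.Tendsto (fun τ : ℝ => G i (τ • z)) (𝓝[≠] 0) (𝓝 (G i 0)) :=
      ((hGs i).continuous.tendsto 0).comp hlim
    rw [hG0] at h1
    exact h1.congr' (hGv i)
  -- Since `v τ = o(τ)` and `F` vanishes to second order, `F (v τ) = o(τ ^ 2)`; but this value is `τ
  -- ^ 2 * c`.
  have h1 := tendsto_lead hF hFO hid hv0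
  rw [lead_apply_zero two_ne_zero] at h1
  have h2 : Filter.Tendsto (fun _ : ℝ => c) (𝓝[≠] 0) (𝓝 0) := by
    refine h1.congr' ?_
    filter_upwards [hv, hv1.eventually hFf, self_mem_nhdsWithin] with τ h3 h4 h5
    have h5' : τ ≠ 0 := h5
    rw [h4 _ h3, hfz]
    field_simp
  exact hc (tendsto_nhds_unique tendsto_const_nhds h2)

theorem IsSmoothPoint.isOrbifoldPoint {X : SmoothQuotient} {x : X.Pt} (h : X.IsSmoothPoint x) :
    X.IsOrbifoldPoint x := by
  obtain ⟨d, hd⟩ := h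
  refine ⟨d, ⊥, inferInstance, hd.trans ?_⟩
  have hrel : ∀ v v' : Fin d → ℝ, MulAction.orbitRel
      (⊥ : Subgroup ((Fin d → ℝ) ≃ₗ[ℝ] (Fin d → ℝ))) (Fin d → ℝ) v v' ↔ v = v' := by
    intro v v'
    rw [MulAction.orbitRel_apply, MulAction.mem_orbit_iff]
    constructor
    · rintro ⟨⟨γ, hγ⟩, h⟩
      rw [Subgroup.mem_bot] at hγ
      subst hγ
      exact h.symm
    · rintro rfl
      exact ⟨1, one_smul _ _⟩
  exact locallyIso_ofSetoid_of_slice (⊥ : Setoid (Fin d → ℝ)) (MulAction.orbitRel _ _)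
    (N := Set.univ) isOpen_univ (fun _ _ _ _ => trivial) id (fun v _ v' _ => hrel v v')
    contDiffOn_id (fun v _ u _ => ⟨Set.univ, isOpen_univ, trivial, id, contDiffOn_id,
      fun u' _ => ⟨trivial, rfl⟩⟩) (v := 0) trivial rfl

theorem IsOrbifoldPointWithGroup.isOrbifoldPoint {G : Type*} [Group G] {X : SmoothQuotient}
    {x : X.Pt} (h : X.IsOrbifoldPointWithGroup G x) : X.IsOrbifoldPoint x := by
  obtain ⟨d, Γ, hΓ, -, hiso⟩ := h
  exact ⟨d, Γ, hΓ, hiso⟩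

theorem isOrbifoldPointWithGroup_sign (a : ℕ) {b : ℕ} (hb : 0 < b) :
    IsOrbifoldPointWithGroup (Multiplicative (ZMod 2)) (modelSign a b) (cls _ (0, 0)) := by
  let e := piProdEquiv (ι := Fin a) (κ := Fin b) (a + b) (by simp)
  let S : ((Fin a → ℝ) × (Fin b → ℝ)) ≃ₗ[ℝ] ((Fin a → ℝ) × (Fin b → ℝ)) :=
    LinearEquiv.prodCongr (LinearEquiv.refl ℝ _) (LinearEquiv.neg ℝ)
  let σ : (Fin (a + b) → ℝ) ≃ₗ[ℝ] (Fin (a + b) → ℝ) :=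
    (e.toLinearEquiv.trans S).trans e.symm.toLinearEquiv
  have hσ : ∀ v, σ v = e.symm ((e v).1, -(e v).2) := fun v => rfl
  have hσ2 : σ ^ 2 = 1 := by
    ext1 v
    rw [pow_two]
    change σ (σ v) = v
    simp [hσ]
  have hσ1 : σ ≠ 1 := by
    intro h
    -- For `b = 0` the reflection would be the identity; `0 < b` provides a coordinate that it
    -- negates.
    have h1 : σ (e.symm (0, fun _ => 1)) = e.symm (0, fun _ => 1) := by rw [h]; rfl
    rw [hσ] at h1
    have h2 := congrArg Prod.snd (e.symm.injective h1)
    have h3 := congrFun h2 ⟨0, hb⟩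
    simp at h3
    norm_num at h3
  have hord : orderOf σ = 2 := orderOf_eq_prime hσ2 hσ1
  have hfin : Finite (Subgroup.zpowers σ) :=
    Nat.finite_of_card_ne_zero (by rw [Nat.card_zpowers, hord]; norm_num)
  have hmem : ∀ γ ∈ Subgroup.zpowers σ, γ = 1 ∨ γ = σ := by
    intro γ hγ
    obtain ⟨n, rfl⟩ := Subgroup.mem_zpowers_iff.1 hγ
    rw [← zpow_mod_orderOf, hord]
    rcases Int.emod_two_eq_zero_or_one n with h | h <;> simp [h]
  refine ⟨a + b, Subgroup.zpowers σ, hfin, ⟨?_⟩, ?_⟩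
  · exact mulEquivOfPrimeCardEq (p := 2) (by rw [Nat.card_zpowers, hord]) (by simp)
  have hrel : ∀ v v' : Fin (a + b) → ℝ, MulAction.orbitRel (Subgroup.zpowers σ)
      (Fin (a + b) → ℝ) v v' ↔ signRel a b (e v) (e v') := by
    intro v v'
    rw [MulAction.orbitRel_apply, MulAction.mem_orbit_iff, signRel_iff]
    constructor
    · rintro ⟨⟨γ, hγ⟩, h⟩
      change γ v' = v at h
      rw [← h]
      rcases hmem γ hγ with rfl | rfl
      · exact ⟨rfl, Or.inl rfl⟩
      · simp [hσ]
    · rintro ⟨h1, h2 | h2⟩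
      · exact ⟨1, by rw [one_smul]; exact e.injective (Prod.ext h1 h2)⟩
      · refine ⟨⟨σ, Subgroup.mem_zpowers σ⟩, ?_⟩
        change σ v' = v
        rw [hσ, h1, h2]
        simp
  exact locallyIso_ofSetoid_of_slice (signRel a b) (MulAction.orbitRel _ _)
    (N := Set.univ) isOpen_univ (fun _ _ _ _ => trivial) e (fun v _ v' _ => hrel v v')
    e.contDiff.contDiffOn (fun v _ u _ => ⟨Set.univ, isOpen_univ, trivial, e.symm,
      e.symm.contDiff.contDiffOn, fun u' _ => ⟨trivial, by simp⟩⟩) (v := 0) trivial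
    (by rw [map_zero]; rfl)

/-- The nontrivial element `γ` is an involution: it reverses every vector `u₀ - γ u₀`, and the
squared Euclidean norm of `u - γ u` is an invariant which is positive on a nonzero such vector. -/
theorem not_isSmoothPoint_of_two {X : SmoothQuotient} {x : X.Pt}
    (h : IsOrbifoldPointWithGroup (Multiplicative (ZMod 2)) X x) : ¬ X.IsSmoothPoint x := by
  rintro ⟨n, hn⟩
  obtain ⟨d, Γ, hfin, ⟨e⟩, hiso⟩ := h
  obtain ⟨⟨γ, hγΓ⟩, hγ⟩ := e.surjective (Multiplicative.ofAdd (1 : ZMod 2))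
  have hmem : ∀ δ ∈ Γ, δ = 1 ∨ δ = γ := by
    intro δ hδ
    have h2 : ∀ y : Multiplicative (ZMod 2), y = 1 ∨ y = Multiplicative.ofAdd 1 := by decide
    rcases h2 (e ⟨δ, hδ⟩) with h | h
    · left
      exact congrArg Subtype.val (e.injective (h.trans (map_one e).symm))
    · right
      exact congrArg Subtype.val (e.injective (h.trans hγ.symm))
  have hγ1 : γ ≠ 1 := by
    rintro rfl
    have : e ⟨1, hγΓ⟩ = 1 := map_one e
    rw [hγ] at this
    exact absurd this (by decide)
  have hγ2 : ∀ u, γ (γ u) = u := by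
    intro u
    have : γ * γ = 1 := by
      rcases hmem (γ * γ) (Γ.mul_mem hγΓ hγΓ) with h | h
      · exact h
      · exact absurd (mul_eq_left.1 h) hγ1
    exact congrArg (fun T : (Fin d → ℝ) ≃ₗ[ℝ] (Fin d → ℝ) => T u) this
  obtain ⟨u₀, hu₀⟩ : ∃ u, γ u ≠ u := by
    by_contra hcon
    push Not at hcon
    exact hγ1 (LinearEquiv.ext hcon)
  have hγc : ContDiff ℝ ∞ (γ : (Fin d → ℝ) → (Fin d → ℝ)) :=
    (LinearMap.toContinuousLinearMap (γ : (Fin d → ℝ) →ₗ[ℝ] (Fin d → ℝ))).contDiff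
  have hz : u₀ - γ u₀ ≠ 0 := sub_ne_zero.2 (Ne.symm hu₀)
  refine not_locallyIso_euclidean (MulAction.orbitRel Γ (Fin d → ℝ))
    (f := fun u => ∑ i, (u i - γ u i) ^ 2) ?_ ?_ (fun u => Finset.sum_nonneg fun i _ => sq_nonneg _)
    (z := u₀ - γ u₀) (c := ∑ i, (2 * (u₀ - γ u₀) i) ^ 2) ?_ ?_ ?_ n (hiso.symm.trans hn)
  · refine ContDiff.sum fun i _ => ContDiff.pow (ContDiff.sub (contDiff_apply ℝ ℝ i) ?_) 2
    exact (contDiff_apply ℝ ℝ i).comp hγc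
  · intro u u' h
    rw [MulAction.orbitRel_apply, MulAction.mem_orbit_iff] at h
    obtain ⟨⟨δ, hδ⟩, h⟩ := h
    change δ u' = u at h
    rw [← h]
    rcases hmem δ hδ with rfl | rfl
    · rfl
    · refine Finset.sum_congr rfl fun i _ => ?_
      rw [hγ2]
      ring
  · intro h0
    rw [Finset.sum_eq_zero_iff_of_nonneg fun i _ => sq_nonneg _] at h0
    refine hz (funext fun i => ?_)
    have := h0 i (Finset.mem_univ i)
    simpa using this
  · intro τ
    rw [Finset.mul_sum]
    refine Finset.sum_congr rfl fun i _ => ?_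
    simp only [map_smul, map_sub, hγ2, Pi.smul_apply, Pi.sub_apply, smul_eq_mul]
    ring
  · intro τ
    rw [MulAction.orbitRel_apply, MulAction.mem_orbit_iff]
    refine ⟨⟨γ, hγΓ⟩, ?_⟩
    change γ (-(τ • (u₀ - γ u₀))) = _
    simp only [map_neg, map_smul, map_sub, hγ2]
    rw [← smul_neg, neg_sub]

end SmoothQuotient

end

/-! ## Blowing up a local isomorphism at the origin -/

noncomputable section

namespace SmoothQuotient

section BlowUp

variable {U V : Type*} [NormedAddCommGroup U] [NormedSpace ℝ U] [NormedAddCommGroup V]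
  [NormedSpace ℝ V]

/-- `u` and `v` are limits of rescalings of corresponding points. -/
def BlowUp (l : Filter ℝ) (R : U → V → Prop) (u : U) (v : V) : Prop :=
  ∃ (u' : ℝ → U) (v' : ℝ → V), (∀ᶠ τ in l, R (u' τ) (v' τ)) ∧
    Filter.Tendsto (fun τ => τ⁻¹ • u' τ) l (𝓝 u) ∧ Filter.Tendsto (fun τ => τ⁻¹ • v' τ) l (𝓝 v)

theorem BlowUp.flip {l : Filter ℝ} {R : U → V → Prop} {u : U} {v : V} (h : BlowUp l R u v) :
    BlowUp l (fun v u => R u v) v u := by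
  obtain ⟨u', v', h1, h2, h3⟩ := h
  exact ⟨v', u', h1, h3, h2⟩

theorem tendsto_zero_of_tendsto_inv_smul {l : Filter ℝ} (hl : l ≤ 𝓝[≠] 0) {u : ℝ → U} {u₀ : U}
    (h : Filter.Tendsto (fun τ => τ⁻¹ • u τ) l (𝓝 u₀)) : Filter.Tendsto u l (𝓝 0) := by
  have h1 : Filter.Tendsto (fun τ : ℝ => τ) l (𝓝 0) := hl.trans nhdsWithin_le_nhds
  have h2 := h1.smul h
  rw [zero_smul] at h2
  refine h2.congr' ?_
  filter_upwards [hl self_mem_nhdsWithin] with τ hτ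
  have hτ' : τ ≠ 0 := hτ
  rw [smul_smul, mul_inv_cancel₀ hτ', one_smul]

/-- A proper nonnegative invariant function bounds a point by the corresponding one. -/
theorem Transfer.exists_norm_le {t : Setoid U} {s : Setoid V} {R : U → V → Prop}
    (T : Transfer t s R) {f : U → ℝ} (hf : ContDiff ℝ ∞ f) (hinv : ∀ u u', t u u' → f u = f u')
    (h0 : f 0 = 0) (hle : ∀ u, ‖u‖ ^ 2 ≤ f u) :
    ∃ C : ℝ, 0 ≤ C ∧ ∀ᶠ v in 𝓝 0, ∀ u, R u v → ‖u‖ ≤ C * ‖v‖ := by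
  obtain ⟨F, hF, hFf⟩ := T.lift f hf hinv
  have hFO : F =O[𝓝 0] fun x => ‖x‖ ^ 2 := by
    refine isBigO_pow_two_of_nonneg hF (by rw [hFf.self_of_nhds 0 T.zero, h0]) ?_
    filter_upwards [hFf, T.exists_left] with v h1 h2
    obtain ⟨u, hu⟩ := h2
    rw [h1 u hu]
    exact (sq_nonneg _).trans (hle u)
  obtain ⟨C, hC⟩ := hFO.bound
  refine ⟨Real.sqrt |C|, Real.sqrt_nonneg _, ?_⟩
  filter_upwards [hFf, hC] with v h1 h2 u hu
  refine abs_le_of_sq_le_sq' ?_ (by positivity) |>.2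
  rw [mul_pow, Real.sq_sqrt (abs_nonneg C)]
  calc ‖u‖ ^ 2 ≤ f u := hle u
    _ = F v := (h1 u hu).symm
    _ ≤ ‖F v‖ := Real.le_norm_self _
    _ ≤ C * ‖‖v‖ ^ 2‖ := h2
    _ = C * ‖v‖ ^ 2 := by rw [norm_pow, norm_norm]
    _ ≤ |C| * ‖v‖ ^ 2 := mul_le_mul_of_nonneg_right (le_abs_self C) (by positivity)

/-- By the linear bound on norms, the rescaled counterparts of `τ • v` stay in a fixed closed ball,
which is compact; an ultrafilter selects a limit without passing to subsequences. -/
theorem Transfer.exists_blowUp [FiniteDimensional ℝ U] {t : Setoid U} {s : Setoid V}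
    {R : U → V → Prop} (T : Transfer t s R) {C : ℝ}
    (hC : ∀ᶠ v in 𝓝 0, ∀ u, R u v → ‖u‖ ≤ C * ‖v‖) {l : Ultrafilter ℝ}
    (hl : (l : Filter ℝ) ≤ 𝓝[≠] 0) (v : V) : ∃ u, BlowUp l R u v := by
  classical
  have hlim : Filter.Tendsto (fun τ : ℝ => τ • v) l (𝓝 0) := (tendsto_smul_nhdsNE v).mono_left hl
  let u' : ℝ → U := fun τ => if h : ∃ u, R u (τ • v) then h.choose else 0
  have hu' : ∀ᶠ τ in (l : Filter ℝ), R (u' τ) (τ • v) := by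
    filter_upwards [hlim.eventually T.exists_left] with τ hτ
    simp only [u']
    rw [dif_pos hτ]
    exact hτ.choose_spec
  have hb : ∀ᶠ τ in (l : Filter ℝ), τ⁻¹ • u' τ ∈ Metric.closedBall (0 : U) (C * ‖v‖) := by
    filter_upwards [hu', hlim.eventually hC, hl self_mem_nhdsWithin] with τ h1 h2 h3
    have h3' : τ ≠ 0 := h3
    have h4 := h2 _ h1
    rw [norm_smul] at h4
    rw [mem_closedBall_zero_iff, norm_smul, norm_inv]
    rw [inv_mul_le_iff₀ (norm_pos_iff.2 h3')]
    linarith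
  have : ProperSpace U := FiniteDimensional.proper ℝ U
  obtain ⟨u, -, hu⟩ := (isCompact_closedBall (0 : U) (C * ‖v‖)).ultrafilter_le_nhds
    (l.map fun τ => τ⁻¹ • u' τ) (by rw [Filter.le_principal_iff]; exact hb)
  exact ⟨u, u', fun τ => τ • v, hu', hu, (tendsto_inv_smul_smul v).mono_left hl⟩

/-- Homogeneous functions have homogeneous bounds. -/
theorem exists_abs_le_of_homogeneous [FiniteDimensional ℝ U] {f : U → ℝ} (hf : Continuous f)
    {k : ℕ} (hk : ∀ (τ : ℝ) u, f (τ • u) = τ ^ k * f u) : ∃ C, 0 ≤ C ∧ ∀ u, |f u| ≤ C * ‖u‖ ^ k := by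
  have : ProperSpace U := FiniteDimensional.proper ℝ U
  obtain ⟨C, hC⟩ := (isCompact_closedBall (0 : U) 1).exists_bound_of_continuousOn hf.continuousOn
  have hC0 : 0 ≤ C := (norm_nonneg _).trans (hC 0 (by simp))
  refine ⟨C, hC0, fun u => ?_⟩
  by_cases hu : u = 0
  · subst hu
    rcases Nat.eq_zero_or_pos k with rfl | hk0
    · simpa using hC 0 (by simp)
    · have h0 := hk 0 0
      rw [smul_zero, zero_pow hk0.ne', zero_mul] at h0
      rw [h0, norm_zero, zero_pow hk0.ne']
      simp
  · have hn : ‖u‖ ≠ 0 := by simpa using hu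
    have h1 := hC (‖u‖⁻¹ • u) (by simp [norm_smul, hn])
    rw [hk, norm_mul, norm_pow, norm_inv, norm_norm, Real.norm_eq_abs] at h1
    rw [inv_pow, inv_mul_le_iff₀ (by positivity)] at h1
    linarith

/-- Invariant homogeneous functions agree with the leading term of their transfer. -/
theorem Transfer.exists_lead_eq [FiniteDimensional ℝ U] {t : Setoid U} {s : Setoid V}
    {R : U → V → Prop} (T : Transfer t s R) {C : ℝ}
    (hC : ∀ᶠ v in 𝓝 0, ∀ u, R u v → ‖u‖ ≤ C * ‖v‖) {l : Filter ℝ} [l.NeBot] (hl : l ≤ 𝓝[≠] 0)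
    {f : U → ℝ} (hf : ContDiff ℝ ∞ f) (hinv : ∀ u u', t u u' → f u = f u') {k : ℕ}
    (hk : ∀ (τ : ℝ) u, f (τ • u) = τ ^ k * f u) :
    ∃ F : V → ℝ, ContDiff ℝ ∞ F ∧ ∀ u v, BlowUp l R u v → lead k F v = f u := by
  obtain ⟨F, hF, hFf⟩ := T.lift f hf hinv
  obtain ⟨K, hK0, hK⟩ := exists_abs_le_of_homogeneous hf.continuous hk
  refine ⟨F, hF, ?_⟩
  -- Homogeneity bounds `f u` by `‖u‖ ^ k`, and corresponding points have comparable norms; so the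
  -- Taylor terms of the lift below order `k` vanish.
  have hFO : F =O[𝓝 0] fun x => ‖x‖ ^ k := by
    refine Asymptotics.IsBigO.of_bound (K * C ^ k) ?_
    filter_upwards [hFf, T.exists_left, hC] with v h1 h2 h3
    obtain ⟨u, hu⟩ := h2
    rw [h1 u hu, Real.norm_eq_abs, norm_pow, norm_norm]
    calc |f u| ≤ K * ‖u‖ ^ k := hK u
      _ ≤ K * (C * ‖v‖) ^ k := by gcongr; exact h3 u hu
      _ = _ := by rw [mul_pow]; ring
  rintro u v ⟨u', v', h1, h2, h3⟩
  have h4 := tendsto_lead hF hFO (t := fun τ => τ) (l := l) hl h3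
  have h5 : Filter.Tendsto (fun τ => f (τ⁻¹ • u' τ)) l (𝓝 (f u)) :=
    (hf.continuous.tendsto u).comp h2
  refine tendsto_nhds_unique h4 (h5.congr' ?_)
  filter_upwards [h1, (tendsto_zero_of_tendsto_inv_smul hl h3).eventually hFf] with τ h6 h7
  rw [h7 _ h6, hk]

/-- The quadratic part of a function as a symmetric bilinear form. -/
theorem exists_bilin_lead_two (F : U → ℝ) :
    ∃ β : U →ₗ[ℝ] U →ₗ[ℝ] ℝ, (∀ x y, β x y = β y x) ∧ ∀ x, lead 2 F x = β x x := by
  let B := fderiv ℝ (fderiv ℝ F) 0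
  -- One factor `1/2` is that of Taylor's formula; the other symmetrizes, so the symmetry of second
  -- derivatives is not needed.
  let β : U →ₗ[ℝ] U →ₗ[ℝ] ℝ := LinearMap.mk₂ ℝ (fun x y => (4 : ℝ)⁻¹ * (B x y + B y x))
    (fun x x' y => by simp; ring) (fun c x y => by simp; ring) (fun x y y' => by simp; ring)
    (fun c x y => by simp; ring)
  refine ⟨β, fun x y => ?_, fun x => ?_⟩
  · simp only [β, LinearMap.mk₂_apply]
    ring
  · simp only [β, LinearMap.mk₂_apply, lead, iteratedFDeriv_two_apply, B]
    norm_num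
    ring

end BlowUp

/-- Vectors isotropic for a nonnegative form are in its radical. -/
theorem bilin_eq_zero_of_nonneg {U : Type*} [AddCommGroup U] [Module ℝ U]
    {β : U →ₗ[ℝ] U →ₗ[ℝ] ℝ} (hs : ∀ x y, β x y = β y x) (hnn : ∀ x, 0 ≤ β x x) {y : U}
    (hy : β y y = 0) (x : U) : β x y = 0 := by
  by_contra h
  -- With this `c` the form takes the value `-1` at `x + c • y`.
  obtain ⟨c, hc⟩ : ∃ c : ℝ, c * β x y = -(β x x + 1) / 2 :=
    ⟨-(β x x + 1) / 2 / β x y, div_mul_cancel₀ _ h⟩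
  have h1 := hnn (x + c • y)
  simp only [map_add, map_smul, LinearMap.add_apply, LinearMap.smul_apply, smul_eq_mul, hy,
    hs y x, mul_zero, add_zero, hc] at h1
  linarith

/-- Points with the same values of the homogeneous invariant polynomials of a finite group are in
the same orbit. -/
theorem exists_mem_orbit_of_forall_invariant {d : ℕ}
    (Γ : Subgroup ((Fin d → ℝ) ≃ₗ[ℝ] (Fin d → ℝ))) [Finite Γ] {x x' : Fin d → ℝ}
    (h : ∀ (k : ℕ) (P : (Fin d → ℝ) → ℝ), ContDiff ℝ ∞ P → (∀ γ ∈ Γ, ∀ y, P (γ y) = P y) →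
      (∀ (τ : ℝ) y, P (τ • y) = τ ^ k * P y) → P x = P x') : ∃ γ ∈ Γ, x' = γ x := by
  have := Fintype.ofFinite Γ
  by_contra hcon
  push Not at hcon
  -- If `x'` is outside the finite orbit of `x`, a linear form separates it from each point of the
  -- orbit. The power sums of this form over the group are homogeneous invariants.
  obtain ⟨lam, hlam⟩ := Module.exists_dual_forall_apply_ne_zero (K := ℝ)
    (fun γ : Γ => x' - (γ : (Fin d → ℝ) ≃ₗ[ℝ] (Fin d → ℝ)) x)
    (fun γ => sub_ne_zero.2 (hcon γ γ.2))
  let P : ℕ → (Fin d → ℝ) → ℝ := fun k y =>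
    ∑ γ : Γ, lam ((γ : (Fin d → ℝ) ≃ₗ[ℝ] (Fin d → ℝ)) y) ^ k
  have hP : ∀ k, P k x = P k x' := by
    intro k
    refine h k (P k) ?_ ?_ ?_
    · refine ContDiff.sum fun γ _ => ContDiff.pow ?_ k
      exact (LinearMap.toContinuousLinearMap
        (lam ∘ₗ ((γ : (Fin d → ℝ) ≃ₗ[ℝ] (Fin d → ℝ)) : (Fin d → ℝ) →ₗ[ℝ] (Fin d → ℝ)))).contDiff
    · intro γ hγ y
      exact Fintype.sum_equiv (Equiv.mulRight (⟨γ, hγ⟩ : Γ)) _ _ fun δ => rfl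
    · intro τ y
      simp only [P, map_smul, smul_eq_mul, mul_pow, Finset.mul_sum]
  have hpoly : ∀ g : Polynomial ℝ, ∑ γ : Γ, g.eval (lam ((γ : (Fin d → ℝ) ≃ₗ[ℝ] (Fin d → ℝ)) x)) =
      ∑ γ : Γ, g.eval (lam ((γ : (Fin d → ℝ) ≃ₗ[ℝ] (Fin d → ℝ)) x')) := by
    intro g
    simp only [Polynomial.eval_eq_sum_range]
    rw [Finset.sum_comm, Finset.sum_comm (s := Finset.univ)]
    refine Finset.sum_congr rfl fun i _ => ?_
    rw [← Finset.mul_sum, ← Finset.mul_sum]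
    congr 1
    exact hP i
  let p : Polynomial ℝ := ∏ γ : Γ,
    (Polynomial.X - Polynomial.C (lam ((γ : (Fin d → ℝ) ≃ₗ[ℝ] (Fin d → ℝ)) x)))
  -- The polynomial `p` vanishes at the values of `lam` on the orbit of `x`. Equality of the sums of
  -- squares makes it vanish at `lam x'` as well.
  have h1 := hpoly (p ^ 2)
  rw [Finset.sum_eq_zero, eq_comm, Finset.sum_eq_zero_iff_of_nonneg] at h1
  · have h2 := h1 1 (Finset.mem_univ _)
    rw [Polynomial.eval_pow, sq_eq_zero_iff, Polynomial.eval_prod, Finset.prod_eq_zero_iff] at h2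
    obtain ⟨γ, -, hγ⟩ := h2
    refine hlam γ ?_
    rw [map_sub]
    simpa using hγ
  · intro γ _
    rw [Polynomial.eval_pow]
    exact sq_nonneg _
  · intro γ _
    rw [Polynomial.eval_pow, sq_eq_zero_iff, Polynomial.eval_prod]
    exact Finset.prod_eq_zero (Finset.mem_univ γ) (by simp)

end SmoothQuotient

end

/-! ## The circle quotients are not orbifolds -/

noncomputable section

namespace SmoothQuotient

section

variable {a m k : ℕ}

/-- Complex multiples in the last factor. -/
def circleMul (c : ℂ) (w : (Fin a → ℝ) × (Fin m → ℝ) × (Fin k → ℂ)) :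
    (Fin a → ℝ) × (Fin m → ℝ) × (Fin k → ℂ) := (w.1, w.2.1, c • w.2.2)

/-- Real coefficients make the linear form commute with conjugation, so its modulus is invariant
under the involution as well as under the circle. -/
theorem normSq_linear_invariant {w w' : (Fin a → ℝ) × (Fin m → ℝ) × (Fin k → ℂ)}
    (h : involutionRel a m k w w') (v : Fin k → ℝ) :
    Complex.normSq (∑ i, v i * w'.2.2 i) = Complex.normSq (∑ i, v i * w.2.2 i) := by
  obtain ⟨-, ⟨-, h⟩ | ⟨-, h⟩⟩ := involutionRel_iff.1 h
  · obtain ⟨c, hc⟩ := circleRel_iff.1 h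
    have : ∑ i, v i * w'.2.2 i = c * ∑ i, v i * w.2.2 i := by
      rw [Finset.mul_sum]
      exact Finset.sum_congr rfl fun i _ => by rw [hc]; ring
    rw [this, map_mul, Circle.normSq_coe, one_mul]
  · obtain ⟨c, hc⟩ := circleRel_iff.1 h
    have : ∑ i, v i * w'.2.2 i = c * (starRingEnd ℂ) (∑ i, v i * w.2.2 i) := by
      rw [map_sum, Finset.mul_sum]
      refine Finset.sum_congr rfl fun i _ => ?_
      rw [hc, conjVec, map_mul, Complex.conj_ofReal]
      ring
    rw [this, map_mul, Circle.normSq_coe, one_mul, Complex.normSq_conj]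

theorem normSq_coord_invariant {w w' : (Fin a → ℝ) × (Fin m → ℝ) × (Fin k → ℂ)}
    (h : involutionRel a m k w w') (i : Fin k) :
    Complex.normSq (w'.2.2 i) = Complex.normSq (w.2.2 i) := by
  classical
  have := normSq_linear_invariant h (Pi.single i 1)
  have hs : ∀ z : Fin k → ℂ, ∑ j, ((Pi.single i (1 : ℝ) : Fin k → ℝ) j : ℂ) * z j = z i := by
    intro z
    rw [Finset.sum_eq_single i]
    · simp
    · intro j _ hj
      simp [hj]
    · simp
  rwa [hs, hs] at this

theorem sq_coord_invariant {w w' : (Fin a → ℝ) × (Fin m → ℝ) × (Fin k → ℂ)}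
    (h : involutionRel a m k w w') (i : Fin m) : w'.2.1 i ^ 2 = w.2.1 i ^ 2 := by
  obtain ⟨-, ⟨h, -⟩ | ⟨h, -⟩⟩ := involutionRel_iff.1 h <;> simp [h]

theorem contDiff_normSq : ContDiff ℝ ∞ (fun z : ℂ => Complex.normSq z) := by
  simp only [Complex.normSq_apply]
  exact (contDiff_re.mul contDiff_re).add (contDiff_im.mul contDiff_im)

/-- The correspondence of tangent cones induced by an isomorphism with a finite quotient. -/
structure TangentCorrespondence {d : ℕ} (Γ : Subgroup ((Fin d → ℝ) ≃ₗ[ℝ] (Fin d → ℝ)))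
    (B : (Fin a → ℝ) × (Fin m → ℝ) × (Fin k → ℂ) → (Fin d → ℝ) → Prop) : Prop where
  zero : B 0 0
  exists_right : ∀ w, ∃ x, B w x
  exists_left : ∀ x, ∃ w, B w x
  circle : ∀ (c : Circle) w x, B w x → B (circleMul c w) x
  group : ∀ γ ∈ Γ, ∀ w x, B w x → B w (γ x)
  orbit : ∀ w x x', B w x → B w x' → ∃ γ ∈ Γ, x' = γ x
  linear : ∀ i, ∃ A : (Fin d → ℝ) →ₗ[ℝ] ℝ, ∀ w x, B w x → A x = w.1 i
  sq : ∀ i, ∃ β : (Fin d → ℝ) →ₗ[ℝ] (Fin d → ℝ) →ₗ[ℝ] ℝ, (∀ x y, β x y = β y x) ∧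
    ∀ w x, B w x → β x x = w.2.1 i ^ 2
  normSq : ∀ v : Fin k → ℝ, ∃ β : (Fin d → ℝ) →ₗ[ℝ] (Fin d → ℝ) →ₗ[ℝ] ℝ,
    (∀ x y, β x y = β y x) ∧ ∀ w x, B w x → β x x = Complex.normSq (∑ i, v i * w.2.2 i)
  quad : ∀ P : (Fin d → ℝ) → ℝ, ContDiff ℝ ∞ P → (∀ γ ∈ Γ, ∀ y, P (γ y) = P y) →
    (∀ (τ : ℝ) y, P (τ • y) = τ ^ 2 * P y) →
    ∃ η : (Fin a → ℝ) × (Fin m → ℝ) × (Fin k → ℂ) →ₗ[ℝ]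
        (Fin a → ℝ) × (Fin m → ℝ) × (Fin k → ℂ) →ₗ[ℝ] ℝ,
      (∀ w w', η w w' = η w' w) ∧ ∀ w x, B w x → η w w = P x

/-- Asking only that `t` contain the circle relation and be contained in the full involution
relation covers both circle models. The correspondence is the blow-up along an ultrafilter at `0`;
each clause compares an invariant homogeneous function with the leading term of its lift. -/
theorem exists_tangentCorrespondence (t : Setoid ((Fin a → ℝ) × (Fin m → ℝ) × (Fin k → ℂ)))
    (hcirc : ∀ (c : Circle) w, t w (circleMul c w))
    (hinv : ∀ w w', t w w' → involutionRel a m k w w') {d : ℕ}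
    (Γ : Subgroup ((Fin d → ℝ) ≃ₗ[ℝ] (Fin d → ℝ))) [Finite Γ]
    (hiso : LocallyIso (ofSetoid t) (linearQuotient d Γ)
      ((ofSetoid t).cls (0 : (Fin a → ℝ) × (Fin m → ℝ) × (Fin k → ℂ)))
      ((linearQuotient d Γ).cls (0 : Fin d → ℝ))) :
    ∃ B : (Fin a → ℝ) × (Fin m → ℝ) × (Fin k → ℂ) → (Fin d → ℝ) → Prop,
      TangentCorrespondence Γ B := by
  have := Fintype.ofFinite Γ
  obtain ⟨R, T₁, T₂⟩ := LocallyIso.exists_transfer (s := MulAction.orbitRel Γ (Fin d → ℝ)) hiso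
  have hΓ : ∀ γ ∈ Γ, ∀ x : Fin d → ℝ, MulAction.orbitRel Γ (Fin d → ℝ) x (γ x) := by
    intro γ hγ x
    exact (MulAction.orbitRel Γ (Fin d → ℝ)).symm (⟨⟨γ, hγ⟩, rfl⟩ : γ x ∈ MulAction.orbit Γ x)
  have hΓinv : ∀ P : (Fin d → ℝ) → ℝ, (∀ γ ∈ Γ, ∀ y, P (γ y) = P y) →
      ∀ x x', MulAction.orbitRel Γ (Fin d → ℝ) x x' → P x = P x' := by
    intro P hP x x' h
    rw [MulAction.orbitRel_apply, MulAction.mem_orbit_iff] at h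
    obtain ⟨⟨γ, hγ⟩, h⟩ := h
    rw [← h]
    exact hP γ hγ x'
  -- The sum of the squares of all the coordinates is invariant and dominates the square of the
  -- norm.
  obtain ⟨C₁, -, hC₁⟩ := T₁.exists_norm_le
    (f := fun w => ∑ i, w.1 i ^ 2 + ∑ i, w.2.1 i ^ 2 + ∑ i, Complex.normSq (w.2.2 i))
    (by
      refine ContDiff.add (by fun_prop) (ContDiff.sum fun i _ => ?_)
      exact contDiff_normSq.comp (by fun_prop))
    (fun w w' h => by
      have h' := hinv _ _ h
      have h1 : w'.1 = w.1 := h'.1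
      simp only [h1, sq_coord_invariant h', normSq_coord_invariant h'])
    (by simp)
    (fun w => by
      have hA : 0 ≤ ∑ i, w.1 i ^ 2 := Finset.sum_nonneg fun i _ => sq_nonneg _
      have hB : 0 ≤ ∑ i, w.2.1 i ^ 2 := Finset.sum_nonneg fun i _ => sq_nonneg _
      have hC : 0 ≤ ∑ i, Complex.normSq (w.2.2 i) :=
        Finset.sum_nonneg fun i _ => Complex.normSq_nonneg _
      have key : ‖w‖ ≤ Real.sqrt
          (∑ i, w.1 i ^ 2 + ∑ i, w.2.1 i ^ 2 + ∑ i, Complex.normSq (w.2.2 i)) := by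
        refine max_le ?_ (max_le ?_ ?_)
        · refine (pi_norm_le_iff_of_nonneg (Real.sqrt_nonneg _)).2 fun i => ?_
          apply Real.le_sqrt_of_sq_le
          have := Finset.single_le_sum (f := fun i => w.1 i ^ 2)
            (fun i _ => sq_nonneg _) (Finset.mem_univ i)
          rw [Real.norm_eq_abs, sq_abs]
          linarith
        · refine (pi_norm_le_iff_of_nonneg (Real.sqrt_nonneg _)).2 fun i => ?_
          apply Real.le_sqrt_of_sq_le
          have := Finset.single_le_sum (f := fun i => w.2.1 i ^ 2)
            (fun i _ => sq_nonneg _) (Finset.mem_univ i)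
          rw [Real.norm_eq_abs, sq_abs]
          linarith
        · refine (pi_norm_le_iff_of_nonneg (Real.sqrt_nonneg _)).2 fun i => ?_
          apply Real.le_sqrt_of_sq_le
          have := Finset.single_le_sum (f := fun i => Complex.normSq (w.2.2 i))
            (fun i _ => Complex.normSq_nonneg _) (Finset.mem_univ i)
          rw [← Complex.normSq_eq_norm_sq]
          linarith
      have := pow_le_pow_left₀ (norm_nonneg w) key 2
      rwa [Real.sq_sqrt (by positivity)] at this)
  -- On the other side a sum of squares over the group is invariant, and its term at the identity
  -- bounds the norm.
  obtain ⟨C₂, -, hC₂⟩ := T₂.exists_norm_le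
    (f := fun x => ∑ γ : Γ, ∑ i, (γ : (Fin d → ℝ) ≃ₗ[ℝ] (Fin d → ℝ)) x i ^ 2)
    (by
      refine ContDiff.sum fun γ _ => ContDiff.sum fun i _ => ContDiff.pow ?_ 2
      exact (contDiff_apply ℝ ℝ i).comp (LinearMap.toContinuousLinearMap
        ((γ : (Fin d → ℝ) ≃ₗ[ℝ] (Fin d → ℝ)) : (Fin d → ℝ) →ₗ[ℝ] (Fin d → ℝ))).contDiff)
    (hΓinv _ fun γ hγ y =>
      Fintype.sum_equiv (Equiv.mulRight (⟨γ, hγ⟩ : Γ)) _ _ fun δ => rfl)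
    (by simp)
    (fun x => by
      have h1 := Finset.single_le_sum
        (f := fun γ : Γ => ∑ i, (γ : (Fin d → ℝ) ≃ₗ[ℝ] (Fin d → ℝ)) x i ^ 2)
        (fun γ _ => Finset.sum_nonneg fun i _ => sq_nonneg _) (Finset.mem_univ 1)
      refine le_trans ?_ h1
      have hA : 0 ≤ ∑ i, x i ^ 2 := Finset.sum_nonneg fun i _ => sq_nonneg _
      change ‖x‖ ^ 2 ≤ ∑ i, x i ^ 2
      have key : ‖x‖ ≤ Real.sqrt (∑ i, x i ^ 2) := by
        refine (pi_norm_le_iff_of_nonneg (Real.sqrt_nonneg _)).2 fun i => ?_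
        apply Real.le_sqrt_of_sq_le
        have := Finset.single_le_sum (f := fun i => x i ^ 2)
          (fun i _ => sq_nonneg _) (Finset.mem_univ i)
        rwa [Real.norm_eq_abs, sq_abs]
      have := pow_le_pow_left₀ (norm_nonneg x) key 2
      rwa [Real.sq_sqrt hA] at this)
  -- the blow-up relation
  let l : Ultrafilter ℝ := Ultrafilter.of (𝓝[≠] 0)
  have hl : (l : Filter ℝ) ≤ 𝓝[≠] 0 := Ultrafilter.of_le _
  have exR : ∀ w, ∃ x, BlowUp l R w x := fun w => by
    obtain ⟨x, hx⟩ := T₂.exists_blowUp hC₂ hl w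
    exact ⟨x, hx.flip⟩
  have exL : ∀ x, ∃ w, BlowUp l R w x := fun x => T₁.exists_blowUp hC₁ hl x
  have hblowC : ∀ (c : Circle) w x, BlowUp l R w x → BlowUp l R (circleMul c w) x := by
    rintro c w x ⟨w', x', h1, h2, h3⟩
    refine ⟨fun τ => circleMul c (w' τ), x', ?_, ?_, h3⟩
    · filter_upwards [h1] with τ h
      exact T₁.congr _ _ _ (hcirc c _) h
    · have hcont : Continuous (circleMul (a := a) (m := m) (k := k) (c : ℂ)) := by
        unfold circleMul
        fun_prop
      have := (hcont.tendsto w).comp h2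
      refine this.congr fun τ => ?_
      simp only [Function.comp_apply, circleMul, Prod.smul_fst, Prod.smul_snd, Prod.smul_mk]
      rw [smul_comm]
  have hblowΓ : ∀ γ ∈ Γ, ∀ w x, BlowUp l R w x → BlowUp l R w (γ x) := by
    rintro γ hγ w x ⟨w', x', h1, h2, h3⟩
    refine ⟨w', fun τ => γ (x' τ), ?_, h2, ?_⟩
    · filter_upwards [h1] with τ h
      exact T₂.congr _ _ _ (hΓ γ hγ _) h
    · have hcont : Continuous (γ : (Fin d → ℝ) → (Fin d → ℝ)) :=
        LinearMap.continuous_of_finiteDimensional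
          (γ : (Fin d → ℝ) →ₗ[ℝ] (Fin d → ℝ))
      refine ((hcont.tendsto x).comp h3).congr fun τ => ?_
      simp
  have linL : ∀ f : (Fin a → ℝ) × (Fin m → ℝ) × (Fin k → ℂ) → ℝ, ContDiff ℝ ∞ f →
      (∀ w w', t w w' → f w = f w') → (∀ (τ : ℝ) w, f (τ • w) = τ * f w) →
      ∃ A : (Fin d → ℝ) →ₗ[ℝ] ℝ, ∀ w x, BlowUp l R w x → A x = f w := by
    intro f hf h1 h2
    obtain ⟨F, -, hF⟩ := T₁.exists_lead_eq hC₁ hl hf h1 (k := 1) (by simpa using h2)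
    refine ⟨fderiv ℝ F 0, fun w x h => ?_⟩
    rw [← hF w x h, lead_one_apply]
    rfl
  have quadL : ∀ f : (Fin a → ℝ) × (Fin m → ℝ) × (Fin k → ℂ) → ℝ, ContDiff ℝ ∞ f →
      (∀ w w', t w w' → f w = f w') → (∀ (τ : ℝ) w, f (τ • w) = τ ^ 2 * f w) →
      ∃ β : (Fin d → ℝ) →ₗ[ℝ] (Fin d → ℝ) →ₗ[ℝ] ℝ, (∀ x y, β x y = β y x) ∧
        ∀ w x, BlowUp l R w x → β x x = f w := by
    intro f hf h1 h2
    obtain ⟨F, -, hF⟩ := T₁.exists_lead_eq hC₁ hl hf h1 (k := 2) h2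
    obtain ⟨β, hβs, hβ⟩ := exists_bilin_lead_two F
    exact ⟨β, hβs, fun w x h => by rw [← hβ, hF w x h]⟩
  have leadR : ∀ (n : ℕ) (P : (Fin d → ℝ) → ℝ), ContDiff ℝ ∞ P →
      (∀ γ ∈ Γ, ∀ y, P (γ y) = P y) → (∀ (τ : ℝ) y, P (τ • y) = τ ^ n * P y) →
      ∃ F : (Fin a → ℝ) × (Fin m → ℝ) × (Fin k → ℂ) → ℝ,
        ∀ w x, BlowUp l R w x → lead n F w = P x := by
    intro n P hP h1 h2
    obtain ⟨F, -, hF⟩ := T₂.exists_lead_eq hC₂ hl hP (hΓinv P h1) (k := n) h2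
    exact ⟨F, fun w x h => hF x w h.flip⟩
  -- A homogeneous invariant takes at both `x` and `x'` the value at `w` of one leading term, and
  -- such invariants separate the orbits of a finite group.
  have horbit : ∀ w x x', BlowUp l R w x → BlowUp l R w x' → ∃ γ ∈ Γ, x' = γ x := by
    intro w x x' h h'
    refine exists_mem_orbit_of_forall_invariant Γ fun n P hP h1 h2 => ?_
    obtain ⟨F, hF⟩ := leadR n P hP h1 h2
    rw [← hF w x h, ← hF w x' h']
  refine ⟨BlowUp l R, ⟨⟨0, 0, Filter.Eventually.of_forall fun _ => T₁.zero, by simp, by simp⟩,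
    exR, exL, hblowC, hblowΓ, horbit, fun i => ?_, fun i => ?_, fun v => ?_, fun P hP h1 h2 => ?_⟩⟩
  · exact linL (fun w => w.1 i) (by fun_prop)
      (fun w w' h => (congrFun (hinv _ _ h).1 i).symm) (fun τ w => rfl)
  · exact quadL (fun w => w.2.1 i ^ 2) (by fun_prop)
      (fun w w' h => (sq_coord_invariant (hinv _ _ h) i).symm) (fun τ w => by simp [mul_pow])
  · refine quadL (fun w => Complex.normSq (∑ i, v i * w.2.2 i))
      (contDiff_normSq.comp (by fun_prop))
      (fun w w' h => (normSq_linear_invariant (hinv _ _ h) v).symm) (fun τ w => ?_)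
    have : ∑ i, (v i : ℂ) * (τ • w).2.2 i = τ * ∑ i, v i * w.2.2 i := by
      rw [Finset.mul_sum]
      refine Finset.sum_congr rfl fun i _ => ?_
      simp only [Prod.smul_snd, Pi.smul_apply, Complex.real_smul]
      ring
    rw [this, map_mul, Complex.normSq_ofReal]
    ring
  · obtain ⟨F, hF⟩ := leadR 2 P hP h1 h2
    obtain ⟨η, hηs, hη⟩ := exists_bilin_lead_two F
    exact ⟨η, hηs, fun w x h => by rw [← hη, hF w x h]⟩

end

end SmoothQuotient

end

/-! ### Contradiction from the tangent correspondence. -/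

noncomputable section

namespace SmoothQuotient

section

variable {a m k d : ℕ} {Γ : Subgroup ((Fin d → ℝ) ≃ₗ[ℝ] (Fin d → ℝ))}
  {B : (Fin a → ℝ) × (Fin m → ℝ) × (Fin k → ℂ) → (Fin d → ℝ) → Prop}

/-- The vector with coordinates `-n` and `1` at two given places. -/
def testVec (a m : ℕ) {k : ℕ} (j₀ j₁ : Fin k) (n : ℕ) :
    (Fin a → ℝ) × (Fin m → ℝ) × (Fin k → ℂ) :=
  (0, 0, Pi.single j₀ (-(n : ℂ)) + Pi.single j₁ 1)

/-- The linear form `z j₀ + n z j₁`. -/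
def testForm {k : ℕ} (j₀ j₁ : Fin k) (n : ℕ) : Fin k → ℝ :=
  Pi.single j₀ 1 + Pi.single j₁ (n : ℝ)

theorem sum_single_mul (j : Fin k) (c : ℝ) (z : Fin k → ℂ) :
    ∑ i, ((Pi.single j c : Fin k → ℝ) i : ℂ) * z i = c * z j := by
  rw [Finset.sum_eq_single j]
  · simp
  · intro i _ hi
    simp [hi]
  · simp

theorem sum_testForm (j₀ j₁ : Fin k) (n : ℕ) (z : Fin k → ℂ) :
    ∑ i, (testForm j₀ j₁ n i : ℂ) * z i = z j₀ + n * z j₁ := by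
  simp only [testForm, Pi.add_apply, Complex.ofReal_add, add_mul, Finset.sum_add_distrib,
    sum_single_mul]
  simp

/-- Among the test vectors, the form of index `n` vanishes only on the one with the same index. -/
theorem sum_testForm_testVec {j₀ j₁ : Fin k} (h : j₀ ≠ j₁) (n n' : ℕ) :
    ∑ i, (testForm j₀ j₁ n i : ℂ) * (testVec a m j₀ j₁ n').2.2 i = n - n' := by
  rw [sum_testForm]
  simp [testVec, h, h.symm]
  ring

theorem TangentCorrespondence.bilin_nonneg (T : TangentCorrespondence Γ B)
    {β : (Fin d → ℝ) →ₗ[ℝ] (Fin d → ℝ) →ₗ[ℝ] ℝ}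
    {f : (Fin a → ℝ) × (Fin m → ℝ) × (Fin k → ℂ) → ℝ} (hf : ∀ w, 0 ≤ f w)
    (h : ∀ w x, B w x → β x x = f w) (x : Fin d → ℝ) : 0 ≤ β x x := by
  obtain ⟨w, hw⟩ := T.exists_left x
  rw [h w x hw]
  exact hf w

/-- The vectors corresponding to complex multiples of a test vector form a linear subspace. -/
theorem TangentCorrespondence.exists_of_add_smul (T : TangentCorrespondence Γ B) {j₀ j₁ : Fin k}
    (hj : j₀ ≠ j₁) {n : ℕ} {ζ ζ' : ℂ} {x x' : Fin d → ℝ}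
    (hx : B (circleMul ζ (testVec a m j₀ j₁ n)) x)
    (hx' : B (circleMul ζ' (testVec a m j₀ j₁ n)) x') (s s' : ℝ) :
    ∃ ξ : ℂ, B (circleMul ξ (testVec a m j₀ j₁ n)) (s • x + s' • x') := by
  obtain ⟨w, hw⟩ := T.exists_left (s • x + s' • x')
  -- The zeros of a nonnegative quadratic form are a linear subspace. Each invariant of modulus type
  -- vanishing on the test line therefore also vanishes at the counterpart `w` of the combination.
  have key : ∀ β : (Fin d → ℝ) →ₗ[ℝ] (Fin d → ℝ) →ₗ[ℝ] ℝ, (∀ x y, β x y = β y x) →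
      (∀ x, 0 ≤ β x x) → β x x = 0 → β x' x' = 0 → β (s • x + s' • x') (s • x + s' • x') = 0 := by
    intro β hs hnn h h'
    have h1 := bilin_eq_zero_of_nonneg hs hnn h' x
    simp [h, h', h1, hs x' x]
  have hv : ∀ v : Fin k → ℝ, ∑ i, (v i : ℂ) * (testVec a m j₀ j₁ n).2.2 i = 0 →
      ∑ i, (v i : ℂ) * w.2.2 i = 0 := by
    intro v hv
    obtain ⟨β, hs, hβ⟩ := T.normSq v
    have hzero : ∀ ξ : ℂ, ∑ i, (v i : ℂ) * (circleMul ξ (testVec a m j₀ j₁ n)).2.2 i = 0 := by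
      intro ξ
      have : ∑ i, (v i : ℂ) * (circleMul ξ (testVec a m j₀ j₁ n)).2.2 i =
          ξ * ∑ i, (v i : ℂ) * (testVec a m j₀ j₁ n).2.2 i := by
        rw [Finset.mul_sum]
        refine Finset.sum_congr rfl fun i _ => ?_
        simp only [circleMul, Pi.smul_apply, smul_eq_mul]
        ring
      rw [this, hv, mul_zero]
    have h1 := key β hs (T.bilin_nonneg (fun w => Complex.normSq_nonneg _) hβ)
      (by rw [hβ _ _ hx, hzero, map_zero]) (by rw [hβ _ _ hx', hzero, map_zero])
    rw [hβ _ _ hw] at h1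
    exact Complex.normSq_eq_zero.1 h1
  have h1 : w.1 = 0 := by
    funext i
    obtain ⟨A, hA⟩ := T.linear i
    have h2 := hA _ _ hw
    rw [map_add, map_smul, map_smul, hA _ _ hx, hA _ _ hx'] at h2
    simpa [circleMul, testVec] using h2.symm
  have h2 : w.2.1 = 0 := by
    funext i
    obtain ⟨β, hs, hβ⟩ := T.sq i
    have h3 := key β hs (T.bilin_nonneg (fun w => sq_nonneg _) hβ)
      (by rw [hβ _ _ hx]; simp [circleMul, testVec])
      (by rw [hβ _ _ hx']; simp [circleMul, testVec])
    rw [hβ _ _ hw] at h3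
    exact pow_eq_zero_iff two_ne_zero |>.1 h3
  -- The other coordinate forms and `testForm j₀ j₁ n` cut out exactly the complex line of the test
  -- vector.
  have h3 : ∀ j, j ≠ j₀ → j ≠ j₁ → w.2.2 j = 0 := by
    intro j h h'
    have := hv (Pi.single j 1) (by rw [sum_single_mul]; simp [testVec, h, h'])
    rw [sum_single_mul] at this
    simpa using this
  have h4 : w.2.2 j₀ + n * w.2.2 j₁ = 0 := by
    have := hv (testForm j₀ j₁ n) (by rw [sum_testForm_testVec hj, sub_self])
    rwa [sum_testForm] at this
  refine ⟨w.2.2 j₁, ?_⟩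
  have : circleMul (w.2.2 j₁) (testVec a m j₀ j₁ n) = w := by
    refine Prod.ext h1.symm (Prod.ext h2.symm ?_)
    funext j
    simp only [circleMul, testVec, Pi.smul_apply, Pi.add_apply, smul_eq_mul]
    by_cases hj0 : j = j₀
    · subst hj0
      simp [hj]
      linear_combination -h4
    · by_cases hj1 : j = j₁
      · subst hj1
        simp [hj0]
      · simp [hj0, hj1, h3 j hj0 hj1]
  rw [this]
  exact hw

theorem circleMul_circleMul (c c' : ℂ) (w : (Fin a → ℝ) × (Fin m → ℝ) × (Fin k → ℂ)) :
    circleMul c (circleMul c' w) = circleMul (c * c') w := by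
  simp [circleMul, mul_smul]

theorem circleMul_one (w : (Fin a → ℝ) × (Fin m → ℝ) × (Fin k → ℂ)) : circleMul 1 w = w := by
  simp [circleMul]

/-- Otherwise the normalized combinations of `x` and `x'` trace a path from `x` to `-x`. By the
linearity of the set of vectors attached to the test line, and after a rotation, each of them
corresponds to the test vector itself, hence lies in one finite orbit; a continuous path with finite
image is constant. -/
theorem TangentCorrespondence.eq_or_eq_neg [Finite Γ] (T : TangentCorrespondence Γ B)
    {j₀ j₁ : Fin k} (hj : j₀ ≠ j₁) {n : ℕ} {x x' : Fin d → ℝ} (hx : B (testVec a m j₀ j₁ n) x)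
    (hx' : B (testVec a m j₀ j₁ n) x') : x' = x ∨ x' = -x := by
  by_contra hcon
  obtain ⟨hne, hne'⟩ := not_or.1 hcon
  -- The coordinate `j₁` of the test vector is `1`, so this form measures the complex scale factor.
  obtain ⟨β, hs, hβ⟩ := T.normSq (Pi.single j₁ 1)
  have hval : ∀ ξ y, B (circleMul ξ (testVec a m j₀ j₁ n)) y → β y y = Complex.normSq ξ := by
    intro ξ y h
    rw [hβ _ _ h, sum_single_mul]
    simp [circleMul, testVec, hj.symm]
  have hx₁ : B (circleMul 1 (testVec a m j₀ j₁ n)) x := by rwa [circleMul_one]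
  have hx₁' : B (circleMul 1 (testVec a m j₀ j₁ n)) x' := by rwa [circleMul_one]
  have hβx : β x x = 1 := by rw [hval 1 x hx₁, map_one]
  have hβx' : β x' x' = 1 := by rw [hval 1 x' hx₁', map_one]
  have hx0 : x ≠ 0 := by
    rintro rfl
    simp at hβx
  let y : ℝ → Fin d → ℝ := fun θ => Real.cos θ • x + Real.sin θ • x'
  have hy0 : ∀ θ, y θ ≠ 0 := by
    intro θ h
    have hsin : Real.sin θ ≠ 0 := by
      intro h0
      have hcos : Real.cos θ ≠ 0 := by
        intro h1
        have := Real.sin_sq_add_cos_sq θ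
        rw [h0, h1] at this
        norm_num at this
      simp only [y, h0, zero_smul, add_zero, smul_eq_zero, hcos, false_or] at h
      exact hx0 h
    obtain ⟨r, hr⟩ : ∃ r : ℝ, x' = r • x := by
      refine ⟨-(Real.sin θ)⁻¹ * Real.cos θ, ?_⟩
      have h1 : Real.sin θ • x' = -(Real.cos θ • x) := by
        rw [eq_neg_iff_add_eq_zero, add_comm]
        exact h
      rw [mul_smul, neg_smul, ← smul_neg, ← h1, smul_smul, inv_mul_cancel₀ hsin, one_smul]
    rw [hr] at hβx'
    simp only [map_smul, LinearMap.smul_apply, smul_eq_mul, hβx, mul_one] at hβx'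
    rcases mul_self_eq_one_iff.1 hβx' with h1 | h1
    · exact hne (by rw [hr, h1, one_smul])
    · exact hne' (by rw [hr, h1, neg_one_smul])
  have hpos : ∀ θ, 0 < β (y θ) (y θ) := by
    intro θ
    obtain ⟨ξ, hξ⟩ := T.exists_of_add_smul hj hx₁ hx₁' (Real.cos θ) (Real.sin θ)
    rw [hval ξ (y θ) hξ]
    refine Complex.normSq_pos.2 ?_
    rintro rfl
    have h0 : circleMul 0 (testVec a m j₀ j₁ n) = 0 := by
      refine Prod.ext rfl (Prod.ext rfl ?_)
      simp [circleMul]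
    rw [h0] at hξ
    obtain ⟨γ, -, h⟩ := T.orbit 0 0 _ T.zero hξ
    rw [map_zero] at h
    exact hy0 θ h
  let ŷ : ℝ → Fin d → ℝ := fun θ => (Real.sqrt (β (y θ) (y θ)))⁻¹ • y θ
  have hŷ : ∀ θ, B (testVec a m j₀ j₁ n) (ŷ θ) := by
    intro θ
    have heq : ŷ θ = ((Real.sqrt (β (y θ) (y θ)))⁻¹ * Real.cos θ) • x +
        ((Real.sqrt (β (y θ) (y θ)))⁻¹ * Real.sin θ) • x' := by
      simp only [ŷ, y, smul_add, smul_smul]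
    obtain ⟨ξ, hξ⟩ := T.exists_of_add_smul hj hx₁ hx₁'
      ((Real.sqrt (β (y θ) (y θ)))⁻¹ * Real.cos θ) ((Real.sqrt (β (y θ) (y θ)))⁻¹ * Real.sin θ)
    rw [← heq] at hξ
    have h1 : Complex.normSq ξ = 1 := by
      rw [← hval ξ _ hξ]
      simp only [ŷ, map_smul, LinearMap.smul_apply, smul_eq_mul]
      have h2 := Real.mul_self_sqrt (hpos θ).le
      have h3 : Real.sqrt (β (y θ) (y θ)) ≠ 0 := (Real.sqrt_pos.2 (hpos θ)).ne'
      rw [← mul_assoc, ← mul_inv, h2, inv_mul_cancel₀ (hpos θ).ne']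
    have hξ1 : ξ ∈ Submonoid.unitSphere ℂ := by
      rw [Submonoid.unitSphere, Submonoid.mem_mk, Subsemigroup.mem_mk, mem_sphere_zero_iff_norm]
      rw [Complex.normSq_eq_norm_sq] at h1
      nlinarith [norm_nonneg ξ]
    -- The remaining factor has modulus one and is removed by the circle action, which does not
    -- change the corresponding vector.
    obtain ⟨c, hc⟩ : ∃ c : Circle, (c : ℂ) = ξ := ⟨⟨ξ, hξ1⟩, rfl⟩
    have h2 := T.circle c⁻¹ _ _ hξ
    rw [circleMul_circleMul, Circle.coe_inv, hc, inv_mul_cancel₀, circleMul_one] at h2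
    · exact h2
    · rintro rfl
      simp at h1
  have hcy : Continuous y := by fun_prop
  have hcβ : Continuous fun θ => β (y θ) (y θ) := by
    have : (fun θ => β (y θ) (y θ)) = fun θ => Real.cos θ * (Real.cos θ * β x x) +
        Real.cos θ * (Real.sin θ * β x x') + (Real.sin θ * (Real.cos θ * β x' x) +
        Real.sin θ * (Real.sin θ * β x' x')) := by
      funext θ
      simp only [y, map_add, map_smul, LinearMap.add_apply, LinearMap.smul_apply, smul_eq_mul]
      ring
    rw [this]
    fun_prop
  have hcont : Continuous ŷ :=
    ((Real.continuous_sqrt.comp hcβ).inv₀ fun θ => (Real.sqrt_pos.2 (hpos θ)).ne').smul hcy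
  have hfin : (Set.range ŷ).Finite := by
    refine Set.Finite.subset (Set.finite_range fun γ : Γ =>
      (γ : (Fin d → ℝ) ≃ₗ[ℝ] (Fin d → ℝ)) (ŷ 0)) ?_
    rintro _ ⟨θ, rfl⟩
    obtain ⟨γ, hγ, h⟩ := T.orbit _ _ _ (hŷ 0) (hŷ θ)
    exact ⟨⟨γ, hγ⟩, h.symm⟩
  have hsub := hfin.countable.isTotallyDisconnected _ subset_rfl
    (isPreconnected_range hcont)
  have h1 : ŷ Real.pi = ŷ 0 := hsub ⟨_, rfl⟩ ⟨_, rfl⟩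
  have hypi : y Real.pi = -x := by simp [y]
  have hy00 : y 0 = x := by simp [y]
  simp only [ŷ, hypi, hy00, map_neg, LinearMap.neg_apply, neg_neg, hβx, Real.sqrt_one, inv_one,
    one_smul] at h1
  exact hx0 (self_eq_neg.1 h1.symm)

theorem bilin_comp_eq {γ : (Fin d → ℝ) ≃ₗ[ℝ] (Fin d → ℝ)}
    {β : (Fin d → ℝ) →ₗ[ℝ] (Fin d → ℝ) →ₗ[ℝ] ℝ} (hs : ∀ x y, β x y = β y x)
    (h : ∀ x, β (γ x) (γ x) = β x x) (x y : Fin d → ℝ) : β (γ x) (γ y) = β x y := by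
  have h1 := h (x + y)
  simp only [map_add, LinearMap.add_apply, h, hs y x, hs (γ y) (γ x)] at h1
  linarith

theorem circleMul_testVec_eq_smul (j₀ j₁ : Fin k) (n : ℕ) (ζ : ℂ) :
    ∃ c : Circle, circleMul ζ (testVec a m j₀ j₁ n) =
      ‖ζ‖ • circleMul c (testVec a m j₀ j₁ n) := by
  by_cases hζ : ζ = 0
  · refine ⟨1, ?_⟩
    subst hζ
    refine Prod.ext ?_ (Prod.ext ?_ ?_) <;> simp [circleMul, testVec]
  · have hn : ‖ζ‖ ≠ 0 := by simpa using hζ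
    refine ⟨⟨(‖ζ‖ : ℂ)⁻¹ * ζ, ?_⟩, ?_⟩
    · rw [Submonoid.unitSphere, Submonoid.mem_mk, Subsemigroup.mem_mk, mem_sphere_zero_iff_norm]
      simp [hn]
    · have hn' : (‖ζ‖ : ℂ) ≠ 0 := by exact_mod_cast hn
      refine Prod.ext ?_ (Prod.ext ?_ ?_)
      · simp [circleMul, testVec]
      · simp [circleMul, testVec]
      · funext i
        simp only [circleMul, Prod.smul_snd, Pi.smul_apply, smul_eq_mul, Complex.real_smul]
        field_simp

/-- On `ℝ^d` two linear forms with the same sign character have invariant squares and an invariant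
product. These would be quadratic forms on the circle side satisfying `η₃² = η₁ η₂`, but a rotation
in the complex line of one test vector kills the mixed term of `η₃` and leaves `η₁` and `η₂`
nonzero. -/
theorem TangentCorrespondence.false [Finite Γ] (T : TangentCorrespondence Γ B) (hk : 2 ≤ k) :
    False := by
  let j₀ : Fin k := ⟨0, by omega⟩
  let j₁ : Fin k := ⟨1, by omega⟩
  have hj : j₀ ≠ j₁ := by simp [j₀, j₁]
  choose x hx using fun n : ℕ => T.exists_right (testVec a m j₀ j₁ n)
  choose β hs hβ using fun n : ℕ => T.normSq (testForm j₀ j₁ n)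
  have hβnn : ∀ n y, 0 ≤ β n y y := fun n =>
    T.bilin_nonneg (fun w => Complex.normSq_nonneg _) (hβ n)
  have hβx : ∀ n n', β n (x n') (x n') = ((n : ℝ) - n') ^ 2 := by
    intro n n'
    rw [hβ n _ _ (hx n'), sum_testForm_testVec hj, ← Complex.ofReal_natCast,
      ← Complex.ofReal_natCast, ← Complex.ofReal_sub, Complex.normSq_ofReal, pow_two]
  have hβΓ : ∀ n, ∀ γ ∈ Γ, ∀ y y', β n (γ y) (γ y') = β n y y' := by
    intro n γ hγ
    refine bilin_comp_eq (hs n) fun y => ?_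
    obtain ⟨w, hw⟩ := T.exists_left y
    rw [hβ n _ _ hw, hβ n _ _ (T.group γ hγ _ _ hw)]
  have hsign : ∀ n, ∀ γ ∈ Γ, γ (x n) = x n ∨ γ (x n) = -x n := fun n γ hγ =>
    T.eq_or_eq_neg hj (hx n) (T.group γ hγ _ _ (hx n))
  -- There are only finitely many sign patterns on the finite group, but infinitely many test
  -- vectors.
  obtain ⟨n, n', hnn, hsame⟩ := Finite.exists_ne_map_eq_of_infinite
    (fun n : ℕ => fun γ : Γ => (γ : (Fin d → ℝ) ≃ₗ[ℝ] (Fin d → ℝ)) (x n) = x n)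
  have hsame' : ∀ γ ∈ Γ, (γ (x n) = x n ↔ γ (x n') = x n') := fun γ hγ =>
    iff_of_eq (congrFun hsame ⟨γ, hγ⟩)
  have hdiff : ((n : ℝ) - n') ≠ 0 := sub_ne_zero.2 (by exact_mod_cast hnn)
  -- The vector `x n'` is isotropic for the nonnegative form `β n'`, hence in its radical, so `ℓ`
  -- vanishes on it but not on `x n`; `ℓ'` is the same with the roles exchanged.
  let ℓ : (Fin d → ℝ) →ₗ[ℝ] ℝ := β n' (x n)
  let ℓ' : (Fin d → ℝ) →ₗ[ℝ] ℝ := β n (x n')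
  have hℓx : ℓ (x n) ≠ 0 := by
    simp only [ℓ, hβx]
    exact pow_ne_zero 2 (sub_ne_zero.2 (by exact_mod_cast hnn.symm))
  have hℓ'x' : ℓ' (x n') ≠ 0 := by
    simp only [ℓ', hβx]
    exact pow_ne_zero 2 hdiff
  have hℓx' : ℓ (x n') = 0 := bilin_eq_zero_of_nonneg (hs n') (hβnn n') (by rw [hβx]; simp) _
  have hℓ'x : ℓ' (x n) = 0 := bilin_eq_zero_of_nonneg (hs n) (hβnn n) (by rw [hβx]; simp) _
  have hℓΓ : ∀ γ ∈ Γ, (∀ y, ℓ (γ y) = ℓ y ∧ ℓ' (γ y) = ℓ' y) ∨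
      (∀ y, ℓ (γ y) = -ℓ y ∧ ℓ' (γ y) = -ℓ' y) := by
    intro γ hγ
    by_cases h : γ (x n) = x n
    · left
      have h' := (hsame' γ hγ).1 h
      intro y
      constructor
      · have := hβΓ n' γ hγ (x n) y
        rwa [h] at this
      · have := hβΓ n γ hγ (x n') y
        rwa [h'] at this
    · right
      have h1 := (hsign n γ hγ).resolve_left h
      have h1' := (hsign n' γ hγ).resolve_left fun h' => h ((hsame' γ hγ).2 h')
      intro y
      constructor
      · have := hβΓ n' γ hγ (x n) y
        rw [h1, map_neg, LinearMap.neg_apply] at this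
        rw [← neg_eq_iff_eq_neg]
        exact this
      · have := hβΓ n γ hγ (x n') y
        rw [h1', map_neg, LinearMap.neg_apply] at this
        rw [← neg_eq_iff_eq_neg]
        exact this
  have hℓs : ContDiff ℝ ∞ (ℓ : (Fin d → ℝ) → ℝ) := (LinearMap.toContinuousLinearMap ℓ).contDiff
  have hℓ's : ContDiff ℝ ∞ (ℓ' : (Fin d → ℝ) → ℝ) :=
    (LinearMap.toContinuousLinearMap ℓ').contDiff
  obtain ⟨η₁, hs₁, hη₁⟩ := T.quad (fun y => ℓ y ^ 2) (hℓs.pow 2)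
    (fun γ hγ y => by rcases hℓΓ γ hγ with h | h <;> simp [h y])
    (fun τ y => by simp [mul_pow])
  obtain ⟨η₂, hs₂, hη₂⟩ := T.quad (fun y => ℓ' y ^ 2) (hℓ's.pow 2)
    (fun γ hγ y => by rcases hℓΓ γ hγ with h | h <;> simp [h y])
    (fun τ y => by simp [mul_pow])
  obtain ⟨η₃, hs₃, hη₃⟩ := T.quad (fun y => ℓ y * ℓ' y) (hℓs.mul hℓ's)
    (fun γ hγ y => by rcases hℓΓ γ hγ with h | h <;> simp [h y])
    (fun τ y => by simp; ring)
  have hnn₁ : ∀ w, 0 ≤ η₁ w w := fun w => by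
    obtain ⟨y, hy⟩ := T.exists_right w
    rw [hη₁ w y hy]; exact sq_nonneg _
  have hnn₂ : ∀ w, 0 ≤ η₂ w w := fun w => by
    obtain ⟨y, hy⟩ := T.exists_right w
    rw [hη₂ w y hy]; exact sq_nonneg _
  have hprod : ∀ w, η₃ w w ^ 2 = η₁ w w * η₂ w w := fun w => by
    obtain ⟨y, hy⟩ := T.exists_right w
    rw [hη₁ w y hy, hη₂ w y hy, hη₃ w y hy]; ring
  set w := testVec a m j₀ j₁ n with hw
  set w' := testVec a m j₀ j₁ n' with hw'
  have hmul : ∀ η : (Fin a → ℝ) × (Fin m → ℝ) × (Fin k → ℂ) →ₗ[ℝ]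
      (Fin a → ℝ) × (Fin m → ℝ) × (Fin k → ℂ) →ₗ[ℝ] ℝ, ∀ P : (Fin d → ℝ) → ℝ,
      (∀ w y, B w y → η w w = P y) → ∀ ζ : ℂ,
        η (circleMul ζ w) (circleMul ζ w) = ‖ζ‖ ^ 2 * P (x n) := by
    intro η P h ζ
    obtain ⟨c, hc⟩ := circleMul_testVec_eq_smul (a := a) (m := m) j₀ j₁ n ζ
    rw [hw, hc]
    simp only [map_smul, LinearMap.smul_apply, smul_eq_mul]
    rw [h _ _ (T.circle c _ _ (hx n))]
    ring
  -- The mixed term of `η₃` is one real linear condition on a complex scalar, so it has a nonzero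
  -- solution.
  obtain ⟨s, r, hsr, hζ⟩ : ∃ s r : ℝ,
      s * η₃ w w' + r * η₃ (circleMul Complex.I w) w' = 0 ∧ (⟨s, r⟩ : ℂ) ≠ 0 := by
    by_cases h : η₃ w w' = 0
    · exact ⟨1, 0, by rw [h]; ring, fun h0 => one_ne_zero (congrArg Complex.re h0)⟩
    · exact ⟨η₃ (circleMul Complex.I w) w', -η₃ w w', by ring,
        fun h0 => h (neg_eq_zero.1 (congrArg Complex.im h0))⟩
  have hlin : circleMul ⟨s, r⟩ w = s • w + r • circleMul Complex.I w := by
    refine Prod.ext ?_ (Prod.ext ?_ ?_)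
    · simp [circleMul, hw, testVec]
    · simp [circleMul, hw, testVec]
    · funext i
      have : (⟨s, r⟩ : ℂ) = s + r * Complex.I := by apply Complex.ext <;> simp
      simp only [circleMul, Prod.snd_add, Prod.smul_snd, Pi.add_apply, Pi.smul_apply, smul_eq_mul,
        Complex.real_smul, this]
      ring
  set ζ : ℂ := ⟨s, r⟩ with hζdef
  have hcross₃ : η₃ (circleMul ζ w) w' = 0 := by
    rw [hlin]
    simpa using hsr
  have hζ0 : ‖ζ‖ ^ 2 ≠ 0 := pow_ne_zero 2 (norm_ne_zero_iff.2 hζ)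
  have h3 : η₃ (circleMul ζ w + w') (circleMul ζ w + w') = 0 := by
    simp only [map_add, LinearMap.add_apply, hmul η₃ _ hη₃, hcross₃, hs₃ w' _]
    rw [hη₃ _ _ (hx n'), hℓx', hℓ'x]
    ring
  have hw'1 : η₁ w' w' = 0 := by rw [hη₁ _ _ (hx n'), hℓx']; ring
  have hw2 : η₂ (circleMul ζ w) (circleMul ζ w) = 0 := by rw [hmul η₂ _ hη₂, hℓ'x]; ring
  have h1 : η₁ (circleMul ζ w + w') (circleMul ζ w + w') ≠ 0 := by
    simp only [map_add, LinearMap.add_apply, hs₁ w' _, bilin_eq_zero_of_nonneg hs₁ hnn₁ hw'1,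
      hmul η₁ _ hη₁, add_zero]
    exact mul_ne_zero hζ0 (pow_ne_zero 2 hℓx)
  have h2 : η₂ (circleMul ζ w + w') (circleMul ζ w + w') ≠ 0 := by
    simp only [map_add, LinearMap.add_apply, hs₂ _ w', bilin_eq_zero_of_nonneg hs₂ hnn₂ hw2,
      zero_add, add_zero]
    rw [hη₂ _ _ (hx n')]
    exact pow_ne_zero 2 hℓ'x'
  -- At this sum `η₃` has neither diagonal nor mixed contribution, `η₁` keeps that of `w`, and `η₂`
  -- that of `w'`.
  have := hprod (circleMul ζ w + w')
  rw [h3, zero_pow two_ne_zero] at this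
  exact mul_ne_zero h1 h2 this.symm

end

theorem not_isOrbifoldPoint_of_involution {a m k : ℕ} (hk : 2 ≤ k) {X : SmoothQuotient} {x : X.Pt}
    (h : LocallyIso X (modelCircleInvolution a m k) x (cls _ (0, 0, 0))) :
    ¬ X.IsOrbifoldPoint x := by
  rintro ⟨d, Γ, hfin, hiso⟩
  obtain ⟨B, T⟩ := exists_tangentCorrespondence (involutionRel a m k)
    (fun c w => ⟨rfl, Or.inl ⟨rfl, circleRel_iff.2 ⟨c, fun i => rfl⟩⟩⟩) (fun _ _ h => h) Γ
    (h.symm.trans hiso)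
  exact T.false hk

theorem not_isOrbifoldPoint_of_circle {a k : ℕ} (hk : 2 ≤ k) {X : SmoothQuotient} {x : X.Pt}
    (h : LocallyIso X (modelCircle a k) x (cls _ (0, 0))) : ¬ X.IsOrbifoldPoint x := by
  rintro ⟨d, Γ, hfin, hiso⟩
  -- An empty middle factor puts the pure circle quotient in the form treated above; the sign on it
  -- is vacuous.
  let t : Setoid ((Fin a → ℝ) × (Fin 0 → ℝ) × (Fin k → ℂ)) :=
    (circleProdRel a k).comap fun w => (w.1, w.2.2)
  have ht : ∀ w w', t w w' ↔ circleProdRel a k (w.1, w.2.2) (w'.1, w'.2.2) := fun w w' => Iff.rfl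
  have key : LocallyIso (ofSetoid t) (modelCircle a k) 
      ((ofSetoid t).cls (0 : (Fin a → ℝ) × (Fin 0 → ℝ) × (Fin k → ℂ))) (cls _ (0, 0)) :=
    locallyIso_ofSetoid_of_slice t (circleProdRel a k) (N := Set.univ) isOpen_univ
      (fun _ _ _ _ => trivial) (fun v => (v.1, 0, v.2)) (fun v _ v' _ => Iff.rfl) (by fun_prop)
      (fun v _ u _ => ⟨Set.univ, isOpen_univ, trivial, fun u => (u.1, u.2.2), by fun_prop,
        fun u' _ => ⟨trivial, (ht _ _).2 ((circleProdRel a k).refl _)⟩⟩) (v := (0, 0)) trivial rfl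
  obtain ⟨B, T⟩ := exists_tangentCorrespondence t
    (fun c w => ⟨rfl, circleRel_iff.2 ⟨c, fun i => rfl⟩⟩)
    (fun w w' h => ⟨h.1, Or.inl ⟨Subsingleton.elim _ _, h.2⟩⟩) Γ
    ((key.trans h.symm).trans hiso)
  exact T.false hk

end SmoothQuotient

end

/-! ### Positive triples of Lagrangians and the Maslov index. -/

noncomputable section

open Module

theorem omega_apply {n : ℕ} (u v : SympVec n) :
    omega n u v =
      ∑ i : Fin n, (u (Sum.inl i) * v (Sum.inr i) - u (Sum.inr i) * v (Sum.inl i)) := rfl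

theorem omega_self {n : ℕ} (u : SympVec n) : omega n u u = 0 := by
  rw [omega_apply]
  exact Finset.sum_eq_zero fun i _ => by ring

theorem omega_neg_swap {n : ℕ} (u v : SympVec n) : omega n u v = -omega n v u := by
  rw [omega_apply, omega_apply, ← Finset.sum_neg_distrib]
  exact Finset.sum_congr rfl fun i _ => by ring

theorem eq_zero_of_omega {n : ℕ} {u : SympVec n} (h : ∀ v, omega n u v = 0) : u = 0 := by
  ext k
  rcases k with i | i
  · have := h (EuclideanSpace.single (Sum.inr i) 1)
    simpa [omega_apply, Pi.single_apply] using this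
  · have := h (EuclideanSpace.single (Sum.inl i) 1)
    simpa [omega_apply, Pi.single_apply] using this

theorem omega_nondegenerate (n : ℕ) : LinearMap.BilinForm.Nondegenerate (omega n) := by
  refine ⟨fun u h => eq_zero_of_omega h, fun u h => eq_zero_of_omega fun v => ?_⟩
  rw [omega_neg_swap, h, neg_zero]

theorem finrank_sympVec (n : ℕ) : finrank ℝ (SympVec n) = 2 * n := by
  rw [finrank_euclideanSpace, Fintype.card_sum, Fintype.card_fin, two_mul]

namespace Lag

variable {n : ℕ}

/-- A Lagrangian lies in its orthogonal, and both have dimension `n`. -/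
theorem mem_of_omega (L : Lag n) {u : SympVec n} (h : ∀ v ∈ L.1, omega n v u = 0) : u ∈ L.1 := by
  have h1 := LinearMap.BilinForm.finrank_orthogonal (omega_nondegenerate n) L.1
  rw [L.2.1, finrank_sympVec] at h1
  have h2 : L.1 = LinearMap.BilinForm.orthogonal (omega n) L.1 := by
    refine Submodule.eq_of_le_of_finrank_eq (fun u hu v hv => L.2.2 v hv u hu) ?_
    rw [h1, L.2.1]
    omega
  rw [h2]
  exact h

/-- The Lagrangian `M` is, in the decomposition `L₁ ⊕ L₂`, the graph of a positive definite form. -/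
def IsPositive (L₁ M L₂ : Lag n) : Prop :=
  Disjoint L₁.1 L₂.1 ∧
    ∀ v ∈ L₁.1, ∀ x ∈ L₂.1, v + x ∈ M.1 → v + x ≠ 0 → 0 < omega n v x

/-- For `y ∈ M` and `x ∈ L₁` with `y + x ∈ L₂`, the equality `y = -x + (y + x)` is the decomposition
of `y` used by the hypothesis. -/
theorem IsPositive.rotate {L₁ M L₂ : Lag n} (h : IsPositive L₁ M L₂) : IsPositive M L₂ L₁ := by
  have hd := Submodule.disjoint_def.1 h.1
  constructor
  · refine Submodule.disjoint_def.2 fun u hu hu' => ?_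
    by_contra h0
    have := h.2 u hu' 0 (zero_mem _) (by simpa using hu) (by simpa using h0)
    simp at this
  · intro y hy x hx hz hz0
    have hy0 : y ≠ 0 := by
      rintro rfl
      rw [zero_add] at hz hz0
      exact hz0 (hd x hx hz)
    have := h.2 (-x) (neg_mem hx) (y + x) hz (by simpa using hy) (by simpa using hy0)
    rw [map_add, map_neg, LinearMap.neg_apply, LinearMap.neg_apply, omega_self, neg_zero, add_zero,
      ← omega_neg_swap] at this
    exact this

theorem isCompl_of_disjoint {L₁ L₂ : Lag n} (h : Disjoint L₁.1 L₂.1) : IsCompl L₁.1 L₂.1 := by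
  refine ⟨h, codisjoint_iff.2 (Submodule.eq_top_of_finrank_eq ?_)⟩
  have := Submodule.finrank_sup_add_finrank_inf_eq L₁.1 L₂.1
  rw [h.eq_bot, finrank_bot, L₁.2.1, L₂.2.1] at this
  rw [finrank_sympVec]
  omega

/-- Writing `a = d + c'` along `D ⊕ C`, one has `ω(a, c) = ω(d, c' + c) + ω(c', d)`; the first term
is positive by the triangle containing `B`, the second nonnegative by the one containing `A`. -/
theorem IsPositive.flip {A B C D : Lag n} (h : IsPositive D C A) (h' : IsPositive C D B) :
    IsPositive A B C := by
  have h1 := h.rotate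
  have h2 := h'.rotate
  refine ⟨h1.rotate.1, ?_⟩
  · intro a ha c hc hb hb0
    obtain ⟨d, c', hd, hc', rfl⟩ :=
      Submodule.codisjoint_iff_exists_add_eq.1 (isCompl_of_disjoint h2.1).codisjoint a
    have e1 : 0 < omega n d (c' + c) := by
      refine h2.2 d hd _ (add_mem hc' hc) ?_ ?_ <;> rwa [← add_assoc]
    have e2 : 0 ≤ omega n c' d := by
      by_cases h0 : c' + d = 0
      · rw [eq_neg_of_add_eq_zero_left h0, map_neg, LinearMap.neg_apply, omega_self, neg_zero]
      · exact (h1.2 c' hc' d hd (by rwa [add_comm]) h0).le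
    rw [map_add, LinearMap.add_apply, C.2.2 c' hc' c hc, add_zero]
    rw [map_add, omega_neg_swap d c'] at e1
    linarith

theorem maslovForm_apply (L₁ M L₂ : Lag n) (u : L₁.1 × M.1 × L₂.1) :
    maslovForm L₁ M L₂ u = omega n u.1 u.2.1 + omega n u.2.1 u.2.2 + omega n u.2.2 u.1 := rfl

theorem maslovForm_polar (L₁ M L₂ : Lag n) (u u' : L₁.1 × M.1 × L₂.1) :
    QuadraticMap.polar (maslovForm L₁ M L₂) u u' = omega n u'.1 (u.2.1 - u.2.2) +
      omega n u'.2.1 (u.2.2 - u.1) + omega n u'.2.2 (u.1 - u.2.1) := by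
  simp only [QuadraticMap.polar, maslovForm_apply, Prod.fst_add, Prod.snd_add, Submodule.coe_add,
    map_add, LinearMap.add_apply, map_sub]
  rw [omega_neg_swap (u.1 : SympVec n) u'.2.1, omega_neg_swap (u.2.1 : SympVec n) u'.2.2,
    omega_neg_swap (u.2.2 : SympVec n) u'.1]
  ring

theorem finrank_comap_subtype {V : Type*} [AddCommGroup V] [Module ℝ V] [FiniteDimensional ℝ V]
    (p q : Submodule ℝ V) :
    finrank ℝ (p.comap q.subtype) = finrank ℝ (q ⊓ p : Submodule ℝ V) := by
  rw [← Submodule.map_comap_subtype, Submodule.finrank_map_subtype_eq]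

theorem finrank_submodule_prod {V V' : Type*} [AddCommGroup V] [Module ℝ V] [AddCommGroup V']
    [Module ℝ V'] [FiniteDimensional ℝ V] [FiniteDimensional ℝ V'] (p : Submodule ℝ V)
    (q : Submodule ℝ V') : finrank ℝ (p.prod q) = finrank ℝ p + finrank ℝ q := by
  rw [← finrank_prod]
  exact LinearEquiv.finrank_eq
    { toFun := fun u => (⟨u.1.1, u.2.1⟩, ⟨u.1.2, u.2.2⟩)
      invFun := fun u => ⟨(u.1, u.2), u.1.2, u.2.2⟩
      map_add' := fun _ _ => rfl
      map_smul' := fun _ _ => rfl }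

/-- For a radical vector, the difference of two components is orthogonal to the third Lagrangian,
hence in it. So `u₁ + u₂ - u₃` and its cyclic analogues lie in the pairwise intersections, and
together they determine `u`. -/
theorem finrank_radical_maslovForm_le (L₁ M L₂ : Lag n) :
    finrank ℝ (maslovForm L₁ M L₂).radical ≤ finrank ℝ (L₁.1 ⊓ M.1 : Submodule ℝ (SympVec n)) +
      finrank ℝ (M.1 ⊓ L₂.1 : Submodule ℝ (SympVec n)) +
      finrank ℝ (L₂.1 ⊓ L₁.1 : Submodule ℝ (SympVec n)) := by
  have key : ∀ u ∈ (maslovForm L₁ M L₂).radical, (u.2.1 - u.2.2 : SympVec n) ∈ L₁.1 ∧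
      (u.2.2 - u.1 : SympVec n) ∈ M.1 ∧ (u.1 - u.2.1 : SympVec n) ∈ L₂.1 := by
    intro u hu
    have h : ∀ u', QuadraticMap.polar (maslovForm L₁ M L₂) u u' = 0 := fun u' =>
      congrArg (fun T => T u') hu.2
    refine ⟨L₁.mem_of_omega fun v hv => ?_, M.mem_of_omega fun v hv => ?_,
      L₂.mem_of_omega fun v hv => ?_⟩
    · simpa [maslovForm_polar] using h (⟨v, hv⟩, 0, 0)
    · simpa [maslovForm_polar] using h (0, ⟨v, hv⟩, 0)
    · simpa [maslovForm_polar] using h (0, 0, ⟨v, hv⟩)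
  let p₁ : L₁.1 × M.1 × L₂.1 →ₗ[ℝ] SympVec n := L₁.1.subtype ∘ₗ LinearMap.fst ℝ _ _
  let p₂ : L₁.1 × M.1 × L₂.1 →ₗ[ℝ] SympVec n :=
    M.1.subtype ∘ₗ LinearMap.fst ℝ _ _ ∘ₗ LinearMap.snd ℝ _ _
  let p₃ : L₁.1 × M.1 × L₂.1 →ₗ[ℝ] SympVec n :=
    L₂.1.subtype ∘ₗ LinearMap.snd ℝ _ _ ∘ₗ LinearMap.snd ℝ _ _
  let R := (maslovForm L₁ M L₂).radical
  let s₁ : R →ₗ[ℝ] (L₁.1 ⊓ M.1 : Submodule ℝ (SympVec n)) :=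
    ((p₁ + p₂ - p₃).domRestrict R).codRestrict _ fun u => by
      obtain ⟨h1, h2, h3⟩ := key u u.2
      refine ⟨?_, ?_⟩
      · have := add_mem u.1.1.2 h1
        rwa [← add_sub_assoc] at this
      · change (u.1.1 : SympVec n) + u.1.2.1 - u.1.2.2 ∈ M.1
        rw [show (u.1.1 : SympVec n) + u.1.2.1 - u.1.2.2 = (u.1.2.1 : SympVec n) - (u.1.2.2 - u.1.1) by abel]
        exact sub_mem u.1.2.1.2 h2
  let s₂ : R →ₗ[ℝ] (M.1 ⊓ L₂.1 : Submodule ℝ (SympVec n)) :=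
    ((p₂ + p₃ - p₁).domRestrict R).codRestrict _ fun u => by
      obtain ⟨h1, h2, h3⟩ := key u u.2
      refine ⟨?_, ?_⟩
      · have := add_mem u.1.2.1.2 h2
        rwa [← add_sub_assoc] at this
      · change (u.1.2.1 : SympVec n) + u.1.2.2 - u.1.1 ∈ L₂.1
        rw [show (u.1.2.1 : SympVec n) + u.1.2.2 - u.1.1 = (u.1.2.2 : SympVec n) - (u.1.1 - u.1.2.1) by abel]
        exact sub_mem u.1.2.2.2 h3
  let s₃ : R →ₗ[ℝ] (L₂.1 ⊓ L₁.1 : Submodule ℝ (SympVec n)) :=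
    ((p₃ + p₁ - p₂).domRestrict R).codRestrict _ fun u => by
      obtain ⟨h1, h2, h3⟩ := key u u.2
      refine ⟨?_, ?_⟩
      · have := add_mem u.1.2.2.2 h3
        rwa [← add_sub_assoc] at this
      · change (u.1.2.2 : SympVec n) + u.1.1 - u.1.2.1 ∈ L₁.1
        rw [show (u.1.2.2 : SympVec n) + u.1.1 - u.1.2.1 = (u.1.1 : SympVec n) - (u.1.2.1 - u.1.2.2) by abel]
        exact sub_mem u.1.1.2 h1
  have hinj : Function.Injective ((s₁.prod s₂).prod s₃) := by
    rw [injective_iff_map_eq_zero]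
    intro u hu
    have hu1 := congrArg (fun w => (w.1.1 : SympVec n)) hu
    have hu2 := congrArg (fun w => (w.1.2 : SympVec n)) hu
    have hu3 := congrArg (fun w => (w.2 : SympVec n)) hu
    replace hu1 : (u.1.1 : SympVec n) + u.1.2.1 - u.1.2.2 = 0 := hu1
    replace hu2 : (u.1.2.1 : SympVec n) + u.1.2.2 - u.1.1 = 0 := hu2
    replace hu3 : (u.1.2.2 : SympVec n) + u.1.1 - u.1.2.1 = 0 := hu3
    have two : ∀ w : SympVec n, w + w = 0 → w = 0 := fun w hw => by
      rw [← two_smul ℝ, smul_eq_zero] at hw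
      simpa using hw
    have e1 : (u.1.1 : SympVec n) = 0 := two _ (by
      have := congrArg₂ (· + ·) hu1 hu3
      simp only [add_zero] at this
      rw [← this]; abel)
    have e2 : (u.1.2.1 : SympVec n) = 0 := two _ (by
      have := congrArg₂ (· + ·) hu1 hu2
      simp only [add_zero] at this
      rw [← this]; abel)
    have e3 : (u.1.2.2 : SympVec n) = 0 := two _ (by
      have := congrArg₂ (· + ·) hu2 hu3
      simp only [add_zero] at this
      rw [← this]; abel)
    ext1
    exact Prod.ext (Subtype.ext e1) (Prod.ext (Subtype.ext e2) (Subtype.ext e3))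
  have := LinearMap.finrank_le_finrank_of_injective hinj
  rwa [finrank_prod, finrank_prod] at this

theorem finrank_domain (L₁ M L₂ : Lag n) : finrank ℝ (L₁.1 × M.1 × L₂.1) = 3 * n := by
  rw [finrank_prod, finrank_prod, L₁.2.1, M.2.1, L₂.2.1]
  ring

/-- Both directions confront the signature, on a space of dimension `3n`, with subspaces on which
the form has a known sign; the radical is controlled by the pairwise intersections. -/
theorem maslovIndex_eq_iff (L₁ M L₂ : Lag n) : maslovIndex L₁ M L₂ = n ↔ IsPositive L₁ M L₂ := by
  have hsum := QuadraticForm.sigPos_add_sigNeg_add_radical (Q := maslovForm L₁ M L₂)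
  have hrad := finrank_radical_maslovForm_le L₁ M L₂
  rw [finrank_domain] at hsum
  have key : ∀ a : SympVec n, ∀ L : Lag n, ∀ b ∈ L.1, a ∈ L.1 → omega n a b = 0 :=
    fun a L b hb ha => L.2.2 a ha b hb
  unfold maslovIndex
  constructor
  · intro h
    have b1 := QuadraticForm.sigPos_add_finrank_le_of_nonpos (Q := maslovForm L₁ M L₂)
      (V := Submodule.prod ⊤ ((L₁.1.comap M.1.subtype).prod (L₁.1.comap L₂.1.subtype)))
      (fun u hu => by
        have h2 : (u.2.1 : SympVec n) ∈ L₁.1 := hu.2.1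
        have h3 : (u.2.2 : SympVec n) ∈ L₁.1 := hu.2.2
        rw [maslovForm_apply, key _ L₁ _ h2 u.1.2, key _ L₁ _ h3 h2,
          key _ L₁ _ u.1.2 h3]; simp)
    have b2 := QuadraticForm.sigPos_add_finrank_le_of_nonpos (Q := maslovForm L₁ M L₂)
      (V := Submodule.prod (M.1.comap L₁.1.subtype) (Submodule.prod ⊤ (M.1.comap L₂.1.subtype)))
      (fun u hu => by
        have h1 : (u.1 : SympVec n) ∈ M.1 := hu.1
        have h3 : (u.2.2 : SympVec n) ∈ M.1 := hu.2.2
        rw [maslovForm_apply, key _ M _ u.2.1.2 h1, key _ M _ h3 u.2.1.2,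
          key _ M _ h1 h3]; simp)
    have b3 := QuadraticForm.sigPos_add_finrank_le_of_nonpos (Q := maslovForm L₁ M L₂)
      (V := Submodule.prod (L₂.1.comap L₁.1.subtype) (Submodule.prod (L₂.1.comap M.1.subtype) ⊤))
      (fun u hu => by
        have h1 : (u.1 : SympVec n) ∈ L₂.1 := hu.1
        have h2 : (u.2.1 : SympVec n) ∈ L₂.1 := hu.2.1
        rw [maslovForm_apply, key _ L₂ _ h2 h1, key _ L₂ _ u.2.2.2 h2,
          key _ L₂ _ h1 u.2.2.2]; simp)
    simp only [finrank_submodule_prod, finrank_comap_subtype, finrank_top, finrank_domain,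
      L₁.2.1, M.2.1, L₂.2.1] at b1 b2 b3
    rw [inf_comm M.1 L₁.1] at b1
    rw [inf_comm L₂.1 M.1] at b2
    rw [inf_comm L₁.1 L₂.1] at b3
    -- Let `I` be the sum of the dimensions of the intersections. The three isotropic subspaces give
    -- `3 sigPos ≤ 6n - 2I`, while index `n` gives `2 sigPos ≥ 4n - I`; hence `I = 0` and `sigPos =
    -- 2n`.
    have hd : finrank ℝ (L₂.1 ⊓ L₁.1 : Submodule ℝ (SympVec n)) = 0 := by omega
    have hp : sigPos (maslovForm L₁ M L₂) = 2 * n := by omega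
    refine ⟨(disjoint_iff.2 (Submodule.finrank_eq_zero.1 hd)).symm, fun v hv x hx hw hw0 => ?_⟩
    by_contra hle
    -- If `ω(v, x) ≤ 0`, the form is nonpositive on this subspace, where it equals `c² ω(v, x)`; its
    -- dimension `n + 1` is too large for `sigPos = 2n`.
    let φ : L₁.1 × ℝ →ₗ[ℝ] L₁.1 × M.1 × L₂.1 :=
      LinearMap.prod (LinearMap.fst ℝ _ _)
        (LinearMap.prod ((LinearMap.toSpanSingleton ℝ _ ⟨v + x, hw⟩) ∘ₗ LinearMap.snd ℝ _ _)
          ((LinearMap.toSpanSingleton ℝ _ ⟨x, hx⟩) ∘ₗ LinearMap.snd ℝ _ _))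
    have hφ : Function.Injective φ := by
      rw [injective_iff_map_eq_zero]
      rintro ⟨u, c⟩ hu
      have h1 : u = 0 := congrArg Prod.fst hu
      have h2 : c • (v + x) = 0 := congrArg (fun w => (w.2.1 : SympVec n)) hu
      rw [smul_eq_zero, or_iff_left hw0] at h2
      rw [h1, h2]; rfl
    have b4 := QuadraticForm.sigPos_add_finrank_le_of_nonpos (Q := maslovForm L₁ M L₂)
      (V := LinearMap.range φ) (by
        rintro _ ⟨⟨u, c⟩, rfl⟩
        rw [maslovForm_apply]
        change omega n u (c • (v + x)) + omega n (c • (v + x)) (c • x) + omega n (c • x) u ≤ 0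
        have e : omega n u (c • (v + x)) + omega n (c • (v + x)) (c • x) + omega n (c • x) u
            = c ^ 2 * omega n v x := by
          simp only [map_smul, map_add, LinearMap.smul_apply, LinearMap.add_apply, smul_eq_mul,
            omega_self, key _ L₁ _ hv u.2]
          rw [omega_neg_swap x u]
          ring
        rw [e]
        nlinarith [sq_nonneg c])
    rw [LinearMap.finrank_range_of_inj hφ, finrank_prod, finrank_self, L₁.2.1, finrank_domain,
      hp] at b4
    omega
  · intro h
    have d : ∀ {A B : Lag n}, Disjoint A.1 B.1 →
        finrank ℝ (A.1 ⊓ B.1 : Submodule ℝ (SympVec n)) = 0 := fun h => by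
      rw [h.eq_bot, finrank_bot]
    rw [d h.rotate.1.symm, d h.rotate.rotate.1.symm, d h.1.symm] at hrad
    have b1 := QuadraticForm.sigPos_add_finrank_le_of_nonpos (Q := maslovForm L₁ M L₂)
      (V := Submodule.prod ⊤ (Submodule.prod ⊥ ⊥))
      (fun u hu => by
        obtain ⟨u, w, x⟩ := u
        obtain ⟨-, hw, hx⟩ := hu
        replace hw : w = 0 := hw
        replace hx : x = 0 := hx
        subst hw hx
        simp [maslovForm_apply])
    simp only [finrank_submodule_prod, finrank_top, finrank_bot, finrank_domain, L₁.2.1] at b1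
    -- On the kernel of `ψ`, of dimension at least `2n`, the form is `ω(w - x, x)`, nonnegative by
    -- hypothesis; so `sigNeg ≤ n`, and the trivial radical settles the signature.
    let ψ : L₁.1 × M.1 × L₂.1 →ₗ[ℝ] SympVec n ⧸ L₁.1 :=
      L₁.1.mkQ ∘ₗ (M.1.subtype ∘ₗ LinearMap.fst ℝ _ _ ∘ₗ LinearMap.snd ℝ _ _ -
        L₂.1.subtype ∘ₗ LinearMap.snd ℝ _ _ ∘ₗ LinearMap.snd ℝ _ _)
    have b2 := QuadraticForm.sigPos_add_finrank_le_of_nonpos (Q := -maslovForm L₁ M L₂)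
      (V := LinearMap.ker ψ) (by
        rintro ⟨v, w, x⟩ hu
        have hy : (w - x : SympVec n) ∈ L₁.1 := by
          rw [LinearMap.mem_ker] at hu
          exact (Submodule.Quotient.mk_eq_zero _).1 hu
        rw [neg_apply, maslovForm_apply]
        dsimp only
        have e : omega n v w + omega n w x + omega n x v = omega n (w - x : SympVec n) x := by
          have := key _ L₁ _ hy v.2
          rw [map_sub] at this
          rw [map_sub, LinearMap.sub_apply, omega_self, omega_neg_swap (x : SympVec n) v]
          linarith
        rw [e]
        by_cases h0 : (w : SympVec n) = 0
        · rw [h0, zero_sub, map_neg, LinearMap.neg_apply, omega_self]; simp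
        · have := h.2 _ hy x x.2 (by simp) (by simpa using h0)
          linarith)
    have b3 := LinearMap.finrank_range_add_finrank_ker ψ
    have b4 := Submodule.finrank_le (LinearMap.range ψ)
    have b5 := Submodule.finrank_quotient_add_finrank L₁.1
    rw [sigPos_neg, finrank_domain] at b2
    rw [finrank_domain] at b3
    rw [L₁.2.1, finrank_sympVec] at b5
    omega

end Lag

end

/-! ### Symplectic bases adapted to a positive triple. -/

noncomputable section

open Module Matrix

section SymplecticFrames

variable {n : ℕ}

/-- The matrix of `omega n`. -/
def sympForm (n : ℕ) : Matrix (Fin n ⊕ Fin n) (Fin n ⊕ Fin n) ℝ := fromBlocks 0 1 (-1) 0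

theorem sympForm_eq_neg_J : sympForm n = -J (Fin n) ℝ := by
  simp [sympForm, J, fromBlocks_neg]

theorem sympForm_transpose : (sympForm n)ᵀ = -sympForm n := by
  simp [sympForm, fromBlocks_transpose, fromBlocks_neg]

theorem sympForm_mul_self : sympForm n * sympForm n = -1 := by
  rw [← fromBlocks_one, fromBlocks_neg]
  simp [sympForm, fromBlocks_multiply]

theorem mem_Sp_iff {g : Matrix (Fin n ⊕ Fin n) (Fin n ⊕ Fin n) ℝ} :
    g ∈ Sp n ↔ gᵀ * sympForm n * g = sympForm n := by
  rw [SymplecticGroup.mem_iff', sympForm_eq_neg_J]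
  simp

theorem omega_toLp (u v : Fin n ⊕ Fin n → ℝ) :
    omega n (WithLp.toLp 2 u) (WithLp.toLp 2 v) = u ⬝ᵥ (sympForm n *ᵥ v) := by
  simp [omega_apply, sympForm, dotProduct, fromBlocks_mulVec, sub_eq_add_neg,
    Finset.sum_add_distrib, neg_mulVec]

/-- The linear map with matrix `X`. -/
def colMap (X : Matrix (Fin n ⊕ Fin n) (Fin n) ℝ) : (Fin n → ℝ) →ₗ[ℝ] SympVec n :=
  (WithLp.linearEquiv 2 ℝ (Fin n ⊕ Fin n → ℝ)).symm.toLinearMap ∘ₗ X.mulVecLin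

/-- The span of the columns of `X`. -/
def colSpan (X : Matrix (Fin n ⊕ Fin n) (Fin n) ℝ) : Submodule ℝ (SympVec n) :=
  LinearMap.range (colMap X)

theorem colMap_apply (X : Matrix (Fin n ⊕ Fin n) (Fin n) ℝ) (c : Fin n → ℝ) :
    colMap X c = WithLp.toLp 2 (X *ᵥ c) := rfl

theorem omega_colMap (X Y : Matrix (Fin n ⊕ Fin n) (Fin n) ℝ) (c c' : Fin n → ℝ) :
    omega n (colMap X c) (colMap Y c') = c ⬝ᵥ ((Xᵀ * sympForm n * Y) *ᵥ c') := by
  rw [colMap_apply, colMap_apply, omega_toLp, ← mulVec_mulVec, ← mulVec_mulVec,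
    dotProduct_mulVec c, vecMul_transpose]

theorem matOp_toLp (g : Matrix (Fin n ⊕ Fin n) (Fin n ⊕ Fin n) ℝ) (v : Fin n ⊕ Fin n → ℝ) :
    matOp g (WithLp.toLp 2 v) = WithLp.toLp 2 (g *ᵥ v) := by
  simp [matOp]

theorem matOp_apply (g : Matrix (Fin n ⊕ Fin n) (Fin n ⊕ Fin n) ℝ) (v : SympVec n) :
    matOp g v = WithLp.toLp 2 (g *ᵥ v.ofLp) := matOp_toLp g v.ofLp

theorem matOp_colMap (g : Matrix (Fin n ⊕ Fin n) (Fin n ⊕ Fin n) ℝ)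
    (X : Matrix (Fin n ⊕ Fin n) (Fin n) ℝ) (c : Fin n → ℝ) :
    matOp g (colMap X c) = colMap (g * X) c := by
  rw [colMap_apply, matOp_toLp, mulVec_mulVec, colMap_apply]

theorem map_colSpan (g : Matrix (Fin n ⊕ Fin n) (Fin n ⊕ Fin n) ℝ)
    (X : Matrix (Fin n ⊕ Fin n) (Fin n) ℝ) :
    (colSpan X).map (matOp g : SympVec n →ₗ[ℝ] SympVec n) = colSpan (g * X) := by
  rw [colSpan, colSpan, ← LinearMap.range_comp]
  congr 1
  exact LinearMap.ext fun c => matOp_colMap g X c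

theorem colMap_mul (X : Matrix (Fin n ⊕ Fin n) (Fin n) ℝ) (T : Matrix (Fin n) (Fin n) ℝ)
    (c : Fin n → ℝ) : colMap (X * T) c = colMap X (T *ᵥ c) := by
  rw [colMap_apply, colMap_apply, mulVec_mulVec]

theorem colSpan_mul (X : Matrix (Fin n ⊕ Fin n) (Fin n) ℝ) {T : Matrix (Fin n) (Fin n) ℝ}
    (hT : IsUnit T.det) : colSpan (X * T) = colSpan X := by
  apply le_antisymm
  · rintro _ ⟨c, rfl⟩
    exact ⟨T *ᵥ c, (colMap_mul X T c).symm⟩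
  · rintro _ ⟨c, rfl⟩
    refine ⟨T⁻¹ *ᵥ c, ?_⟩
    rw [colMap_mul, mulVec_mulVec, mul_nonsing_inv _ hT, one_mulVec]

theorem omega_matOp {g : Matrix (Fin n ⊕ Fin n) (Fin n ⊕ Fin n) ℝ} (hg : g ∈ Sp n)
    (u v : SympVec n) : omega n (matOp g u) (matOp g v) = omega n u v := by
  rw [matOp_apply, matOp_apply, omega_toLp, mulVec_mulVec, dotProduct_mulVec, ← vecMul_transpose,
    vecMul_vecMul, ← dotProduct_mulVec, ← mul_assoc, mem_Sp_iff.1 hg]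
  exact (omega_toLp u.ofLp v.ofLp).symm

theorem colSpan_eq_of_injective {X : Matrix (Fin n ⊕ Fin n) (Fin n) ℝ} {L : Lag n}
    (h : ∀ c, colMap X c ∈ L.1) (hinj : Function.Injective (colMap X)) : colSpan X = L.1 := by
  refine Submodule.eq_of_le_of_finrank_eq ?_ ?_
  · rintro _ ⟨c, rfl⟩
    exact h c
  · rw [colSpan, LinearMap.finrank_range_of_inj hinj, L.2.1, finrank_fin_fun]

theorem injective_of_isUnit_left {X Y : Matrix (Fin n ⊕ Fin n) (Fin n) ℝ}
    (h : IsUnit (Xᵀ * sympForm n * Y).det) : Function.Injective (colMap Y) := by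
  rw [injective_iff_map_eq_zero]
  intro c hc
  have h1 : Y *ᵥ c = 0 := congrArg WithLp.ofLp hc
  have h2 : (Xᵀ * sympForm n * Y) *ᵥ c = 0 := by rw [← mulVec_mulVec, h1, mulVec_zero]
  rw [← one_mulVec c, ← nonsing_inv_mul _ h, ← mulVec_mulVec, h2, mulVec_zero]

theorem transpose_pairing (X Y : Matrix (Fin n ⊕ Fin n) (Fin n) ℝ) :
    (Xᵀ * sympForm n * Y)ᵀ = -(Yᵀ * sympForm n * X) := by
  rw [transpose_mul, transpose_mul, transpose_transpose, sympForm_transpose]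
  simp [Matrix.mul_assoc]

theorem injective_of_isUnit_right {X Y : Matrix (Fin n ⊕ Fin n) (Fin n) ℝ}
    (h : IsUnit (Xᵀ * sympForm n * Y).det) : Function.Injective (colMap X) := by
  refine injective_of_isUnit_left (X := Y) ?_
  rw [← det_transpose, transpose_pairing, det_neg] at h
  exact isUnit_of_mul_isUnit_right h

theorem pairing_self_eq_zero {X : Matrix (Fin n ⊕ Fin n) (Fin n) ℝ} {L : Lag n}
    (h : ∀ c, colMap X c ∈ L.1) : Xᵀ * sympForm n * X = 0 := by
  ext i j
  have := L.2.2 _ (h (Pi.single i 1)) _ (h (Pi.single j 1))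
  rw [omega_colMap] at this
  simpa using this

theorem isUnit_det_of_injective {A : Matrix (Fin n) (Fin n) ℝ} (h : ∀ c, A *ᵥ c = 0 → c = 0) :
    IsUnit A.det := by
  rw [← isUnit_iff_isUnit_det]
  refine mulVec_injective_iff_isUnit.1 fun c c' hc => ?_
  rw [← sub_eq_zero] at hc ⊢
  exact h _ (by rw [mulVec_sub, hc])

theorem fromCols_mem_Sp {X Y : Matrix (Fin n ⊕ Fin n) (Fin n) ℝ} (hX : Xᵀ * sympForm n * X = 0)
    (hY : Yᵀ * sympForm n * Y = 0) (hXY : Xᵀ * sympForm n * Y = 1) : fromCols X Y ∈ Sp n := by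
  have hYX : Yᵀ * sympForm n * X = -1 := by
    rw [← neg_eq_iff_eq_neg, ← transpose_pairing, hXY, transpose_one]
  rw [mem_Sp_iff, transpose_fromCols, fromRows_mul, fromRows_mul_fromCols, hX, hY, hXY, hYX]
  rfl

/-- Expansion in a symplectic basis: the coefficients come from the symplectic relation for the
transposed matrix. -/
theorem eq_combination {X Y : Matrix (Fin n ⊕ Fin n) (Fin n) ℝ} (h : fromCols X Y ∈ Sp n)
    (Z : Matrix (Fin n ⊕ Fin n) (Fin n) ℝ) :
    Z = Y * (Xᵀ * sympForm n * Z) - X * (Yᵀ * sympForm n * Z) := by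
  have h1 := mem_Sp_iff.1 (SymplecticGroup.transpose_mem h)
  rw [transpose_transpose] at h1
  have h2 : -(fromCols X Y * sympForm n * (fromCols X Y)ᵀ * (sympForm n * Z)) = Z := by
    rw [h1, ← Matrix.mul_assoc, sympForm_mul_self, Matrix.neg_mul, Matrix.one_mul, neg_neg]
  rw [transpose_fromCols, sympForm, fromCols_mul_fromBlocks, fromCols_mul_fromRows,
    ← sympForm] at h2
  simp only [Matrix.mul_zero, Matrix.mul_one, Matrix.mul_neg, zero_add, add_zero, Matrix.neg_mul,
    Matrix.add_mul, Matrix.mul_assoc, neg_add_rev, neg_neg] at h2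
  conv_lhs => rw [← h2]
  simp only [Matrix.mul_assoc]
  abel

/-- The columns spanning the `i`-th Lagrangian of the standard positive triple. -/
def stdMat (n : ℕ) (i : ZMod 3) : Matrix (Fin n ⊕ Fin n) (Fin n) ℝ :=
  if i = 0 then fromRows 1 0 else if i = 1 then fromRows 0 1 else fromRows (-1) 1

theorem stdMat_zero : stdMat n 0 = fromRows 1 0 := rfl

theorem stdMat_one : stdMat n 1 = fromRows 0 1 := rfl

theorem stdMat_two : stdMat n 2 = fromRows (-1) 1 := rfl

theorem ZMod.forall_three {P : ZMod 3 → Prop} (h0 : P 0) (h1 : P 1) (h2 : P 2) (i : ZMod 3) :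
    P i := by
  fin_cases i
  exacts [h0, h1, h2]

theorem colMap_stdMat_injective (i : ZMod 3) : Function.Injective (colMap (stdMat n i)) := by
  rw [injective_iff_map_eq_zero]
  intro c hc
  have h1 : stdMat n i *ᵥ c = 0 := congrArg WithLp.ofLp hc
  funext k
  induction i using ZMod.forall_three with
  | h0 =>
    have := congrFun h1 (Sum.inl k)
    simpa [stdMat_zero, fromRows_mulVec] using this
  | h1 =>
    have := congrFun h1 (Sum.inr k)
    simpa [stdMat_one, fromRows_mulVec] using this
  | h2 =>
    have := congrFun h1 (Sum.inr k)
    simpa [stdMat_two, fromRows_mulVec] using this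

/-- The standard positive triple of Lagrangians. -/
def stdLag (n : ℕ) (i : ZMod 3) : Lag n :=
  ⟨colSpan (stdMat n i), by
    rw [colSpan, LinearMap.finrank_range_of_inj (colMap_stdMat_injective i), finrank_fin_fun], by
    rintro _ ⟨c, rfl⟩ _ ⟨c', rfl⟩
    rw [omega_colMap]
    have : (stdMat n i)ᵀ * sympForm n * stdMat n i = 0 := by
      induction i using ZMod.forall_three with
      | h0 => simp [stdMat_zero, sympForm, transpose_fromRows, fromCols_mul_fromBlocks,
          fromCols_mul_fromRows]
      | h1 => simp [stdMat_one, sympForm, transpose_fromRows, fromCols_mul_fromBlocks,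
          fromCols_mul_fromRows]
      | h2 => simp [stdMat_two, sympForm, transpose_fromRows, fromCols_mul_fromBlocks,
          fromCols_mul_fromRows]
    rw [this, zero_mulVec, dotProduct_zero]⟩

theorem movesTo_stdLag_iff {g : Sp n} {i : ZMod 3} {L : Lag n} :
    MovesTo g (stdLag n i) L ↔ colSpan (g.1 * stdMat n i) = L.1 := by
  rw [← map_colSpan]
  rfl

/-- The symplectic rotation `e ↦ f`, `f ↦ f - e`, permuting cyclically the standard triple. -/
def rho (n : ℕ) : Sp n :=
  ⟨fromBlocks 0 (-1) 1 1, by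
    rw [mem_Sp_iff, sympForm]
    simp [fromBlocks_transpose, fromBlocks_multiply]⟩

theorem rho_movesTo (i : ZMod 3) : MovesTo (rho n) (stdLag n i) (stdLag n (i + 1)) := by
  rw [movesTo_stdLag_iff]
  change _ = colSpan _
  induction i using ZMod.forall_three with
  | h0 => simp [rho, stdMat_zero, stdMat_one, fromBlocks_mul_fromRows]
  | h1 =>
    rw [show (1 : ZMod 3) + 1 = 2 from rfl]
    simp [rho, stdMat_two, stdMat_one, fromBlocks_mul_fromRows]
  | h2 =>
    rw [show (2 : ZMod 3) + 1 = 0 from rfl]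
    have : (rho n).1 * stdMat n 2 = stdMat n 0 * (-1 : Matrix (Fin n) (Fin n) ℝ) := by
      simp [rho, stdMat_two, stdMat_zero, fromBlocks_mul_fromRows, fromRows_neg]
    rw [this, colSpan_mul]
    rw [det_neg, det_one, mul_one]
    exact (isUnit_one.neg).pow _

theorem rho_pow_movesTo (k : ℕ) (i : ZMod 3) :
    MovesTo (rho n ^ k) (stdLag n i) (stdLag n (i + k)) := by
  induction k with
  | zero => simpa using movesTo_one (stdLag n i)
  | succ k ih =>
    rw [pow_succ', Nat.cast_succ, ← add_assoc]
    exact movesTo_mul ih (rho_movesTo _)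

theorem rho_pow_val_movesTo (j i : ZMod 3) :
    MovesTo (rho n ^ j.val) (stdLag n i) (stdLag n (i + j)) := by
  have := rho_pow_movesTo (n := n) j.val i
  rwa [ZMod.natCast_zmod_val] at this

theorem isPositive_stdLag : Lag.IsPositive (stdLag n 0) (stdLag n 1) (stdLag n 2) := by
  have h0 : ∀ c, (colMap (stdMat n 0) c) = WithLp.toLp 2 (Sum.elim c 0) := fun c => by
    simp [colMap_apply, stdMat_zero, fromRows_mulVec]
  have h1 : ∀ c, (colMap (stdMat n 1) c) = WithLp.toLp 2 (Sum.elim (0 : Fin n → ℝ) c) := fun c => by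
    simp [colMap_apply, stdMat_one, fromRows_mulVec]
  have h2 : ∀ c, (colMap (stdMat n 2) c) = WithLp.toLp 2 (Sum.elim (-c) c) := fun c => by
    simp [colMap_apply, stdMat_two, fromRows_mulVec, neg_mulVec]
  constructor
  · rw [Submodule.disjoint_def]
    rintro _ ⟨c, rfl⟩ ⟨c', hc⟩
    rw [h0, h2] at hc
    have : c' = 0 := by
      funext i
      simpa using congrArg (fun w : SympVec n => w (Sum.inr i)) hc
    rw [h0, ← hc, this]
    ext k
    rcases k with k | k <;> simp
  · rintro _ ⟨c, rfl⟩ _ ⟨c', rfl⟩ ⟨c'', h⟩ hne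
    rw [h0, h2] at *
    rw [h1] at h
    have hc : c' = c := by
      funext i
      have := congrArg (fun w : SympVec n => w (Sum.inl i)) h
      simp only [PiLp.add_apply, Sum.elim_inl, Pi.zero_apply, Pi.neg_apply] at this
      linarith
    subst hc
    have hpos : omega n (WithLp.toLp 2 (Sum.elim c' 0)) (WithLp.toLp 2 (Sum.elim (-c') c'))
        = c' ⬝ᵥ c' := by
      simp [omega_apply, dotProduct]
    rw [hpos]
    have := (dotProduct_star_self_pos_iff (v := c')).2
    rw [star_trivial] at this
    apply this
    rintro rfl
    apply hne
    ext k
    rcases k with k | k <;> simp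

theorem Lag.IsPositive.map {g : Sp n} {L₁ M L₂ L₁' M' L₂' : Lag n} (h : Lag.IsPositive L₁ M L₂)
    (h1 : MovesTo g L₁ L₁') (h2 : MovesTo g M M') (h3 : MovesTo g L₂ L₂') :
    Lag.IsPositive L₁' M' L₂' := by
  have hinj : Function.Injective (matOp g.1 : SympVec n →ₗ[ℝ] SympVec n) := by
    rw [injective_iff_map_eq_zero]
    intro u hu
    refine eq_zero_of_omega fun v => ?_
    rw [← omega_matOp g.2]
    change omega n ((matOp g.1 : SympVec n →ₗ[ℝ] SympVec n) u) _ = 0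
    rw [hu, map_zero, LinearMap.zero_apply]
  unfold MovesTo at h1 h2 h3
  constructor
  · rw [← h1, ← h3]
    exact (Submodule.disjoint_map hinj h.1)
  · rw [← h1, ← h2, ← h3]
    rintro _ ⟨v, hv, rfl⟩ _ ⟨x, hx, rfl⟩ ⟨w, hw, hwe⟩ hne
    rw [← map_add] at hwe hne
    rw [hinj hwe] at hw
    change 0 < omega n (matOp g.1 v) (matOp g.1 x)
    rw [omega_matOp g.2]
    refine h.2 v hv x hx hw ?_
    rintro h0
    rw [h0, map_zero] at hne
    exact hne rfl

/-- For `X`, `Y`, `Z` spanning a positive triple, the matrix `S` such that `Z` spans the graph of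
`-S⁻¹` in the symplectic basis given by `X` and by the multiple of `Y` dual to it. -/
def frameShape (X Y Z : Matrix (Fin n ⊕ Fin n) (Fin n) ℝ) : Matrix (Fin n) (Fin n) ℝ :=
  ((Y * (Xᵀ * sympForm n * Y)⁻¹)ᵀ * sympForm n * Z) * (Xᵀ * sympForm n * Z)⁻¹

/-- The symplectic basis obtained from `X` and `Y` by the change of basis `T` on `X`. -/
def frameMat (X Y : Matrix (Fin n ⊕ Fin n) (Fin n) ℝ) (T : Matrix (Fin n) (Fin n) ℝ) :
    Matrix (Fin n ⊕ Fin n) (Fin n ⊕ Fin n) ℝ :=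
  fromCols (X * T) (Y * (Xᵀ * sympForm n * Y)⁻¹ * (T⁻¹)ᵀ)

section

variable {X Y Z : Matrix (Fin n ⊕ Fin n) (Fin n) ℝ} {L : ZMod 3 → Lag n}

theorem pairing_dual (hD : IsUnit (Xᵀ * sympForm n * Y).det) :
    Xᵀ * sympForm n * (Y * (Xᵀ * sympForm n * Y)⁻¹) = 1 := by
  rw [← Matrix.mul_assoc, mul_nonsing_inv _ hD]

theorem frameMat_mem {T : Matrix (Fin n) (Fin n) ℝ} (hX : Xᵀ * sympForm n * X = 0)
    (hY : Yᵀ * sympForm n * Y = 0) (hD : IsUnit (Xᵀ * sympForm n * Y).det)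
    (hT : IsUnit T.det) : frameMat X Y T ∈ Sp n := by
  refine fromCols_mem_Sp ?_ ?_ ?_
  · rw [transpose_mul, ← Matrix.mul_assoc, Matrix.mul_assoc Tᵀ, Matrix.mul_assoc Tᵀ, hX]
    simp
  · have : ∀ A : Matrix (Fin n) (Fin n) ℝ, (Y * A)ᵀ * sympForm n * (Y * A) = 0 := fun A => by
      rw [transpose_mul, ← Matrix.mul_assoc, Matrix.mul_assoc Aᵀ, Matrix.mul_assoc Aᵀ, hY]
      simp
    rw [Matrix.mul_assoc Y]
    exact this _
  · rw [transpose_mul, ← Matrix.mul_assoc, Matrix.mul_assoc Tᵀ, Matrix.mul_assoc Tᵀ,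
      pairing_dual hD, Matrix.mul_one, ← transpose_mul, nonsing_inv_mul _ hT, transpose_one]

/-- The first two Lagrangians are spanned by construction. With `Y'` the multiple of `Y` dual to
`X`, the third is spanned by `Y' - X S`, `S` being the shape; multiplying by `(T⁻¹)ᵀ` turns `X S`
into `X T` because `S = T Tᵀ`. -/
theorem frameMat_movesTo {T : Matrix (Fin n) (Fin n) ℝ} (hX : colSpan X = (L 0).1)
    (hY : colSpan Y = (L 1).1) (hZ : colSpan Z = (L 2).1)
    (hD : IsUnit (Xᵀ * sympForm n * Y).det) (hb : IsUnit (Xᵀ * sympForm n * Z).det)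
    (hT : IsUnit T.det) (hTS : T * Tᵀ = frameShape X Y Z) (hG : frameMat X Y T ∈ Sp n)
    (i : ZMod 3) : MovesTo ⟨frameMat X Y T, hG⟩ (stdLag n i) (L i) := by
  have hTt : IsUnit ((T⁻¹)ᵀ).det := by
    rw [det_transpose]
    exact isUnit_nonsing_inv_det _ hT
  rw [movesTo_stdLag_iff]
  induction i using ZMod.forall_three with
  | h0 =>
    rw [stdMat_zero]
    simp only [frameMat, fromCols_mul_fromRows, Matrix.mul_one, Matrix.mul_zero, add_zero]
    rw [colSpan_mul _ hT, hX]
  | h1 =>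
    rw [stdMat_one]
    simp only [frameMat, fromCols_mul_fromRows, Matrix.mul_one, Matrix.mul_zero, zero_add]
    rw [colSpan_mul _ hTt, colSpan_mul _ (isUnit_nonsing_inv_det _ hD), hY]
  | h2 =>
    have hXX := pairing_self_eq_zero (X := X) (L := L 0) fun c => by rw [← hX]; exact ⟨c, rfl⟩
    have hYY := pairing_self_eq_zero (X := Y) (L := L 1) fun c => by rw [← hY]; exact ⟨c, rfl⟩
    have hG' := frameMat_mem (T := 1) hXX hYY hD (by simp)
    rw [frameMat] at hG'
    simp only [Matrix.mul_one, inv_one, transpose_one] at hG'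
    have hcomb := congrArg (· * ((Xᵀ * sympForm n * Z)⁻¹ * (T⁻¹)ᵀ)) (eq_combination hG' Z)
    simp only [Matrix.sub_mul] at hcomb
    rw [← Matrix.mul_assoc, Matrix.mul_assoc _ _ ((Xᵀ * sympForm n * Z)⁻¹ * (T⁻¹)ᵀ),
      ← Matrix.mul_assoc (Xᵀ * sympForm n * Z), mul_nonsing_inv _ hb, Matrix.one_mul,
      Matrix.mul_assoc X, ← Matrix.mul_assoc _ _ (T⁻¹)ᵀ, ← frameShape, ← hTS,
      Matrix.mul_assoc T, ← transpose_mul, nonsing_inv_mul _ hT, transpose_one,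
      Matrix.mul_one] at hcomb
    rw [stdMat_two]
    simp only [frameMat, fromCols_mul_fromRows, Matrix.mul_one, Matrix.mul_neg]
    rw [neg_add_eq_sub, ← hcomb, colSpan_mul _ hTt, colSpan_mul _ (isUnit_nonsing_inv_det _ hb), hZ]

theorem isUnit_pairing_of_disjoint {L₁ L₂ : Lag n} (hX : colSpan X = L₁.1) (hY : colSpan Y = L₂.1)
    (hinj : Function.Injective (colMap Y)) (h : Disjoint L₁.1 L₂.1) :
    IsUnit (Xᵀ * sympForm n * Y).det := by
  refine isUnit_det_of_injective fun c hc => ?_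
  have h1 : colMap Y c ∈ L₁.1 := L₁.mem_of_omega fun v hv => by
    rw [← hX] at hv
    obtain ⟨c', rfl⟩ := hv
    rw [omega_colMap, hc, dotProduct_zero]
  have h2 : colMap Y c ∈ L₂.1 := by rw [← hY]; exact ⟨c, rfl⟩
  exact hinj ((Submodule.disjoint_def.1 h _ h1 h2).trans (map_zero _).symm)

/-- Isotropy of `Z`, expanded in the basis `X`, `Y'`, reads `aᵀ b = bᵀ a`, where `b` and `a` are the
pairings of `Z` with `X` and `Y'`. -/
theorem frameShape_transpose (hX : colSpan X = (L 0).1) (hY : colSpan Y = (L 1).1)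
    (hZ : colSpan Z = (L 2).1) (hD : IsUnit (Xᵀ * sympForm n * Y).det)
    (hb : IsUnit (Xᵀ * sympForm n * Z).det) : (frameShape X Y Z)ᵀ = frameShape X Y Z := by
  have hXX := pairing_self_eq_zero (X := X) (L := L 0) fun c => by rw [← hX]; exact ⟨c, rfl⟩
  have hYY := pairing_self_eq_zero (X := Y) (L := L 1) fun c => by rw [← hY]; exact ⟨c, rfl⟩
  have hZZ := pairing_self_eq_zero (X := Z) (L := L 2) fun c => by rw [← hZ]; exact ⟨c, rfl⟩
  have hG' := frameMat_mem (T := 1) hXX hYY hD (by simp)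
  rw [frameMat] at hG'
  simp only [Matrix.mul_one, inv_one, transpose_one] at hG'
  set Y' := Y * (Xᵀ * sympForm n * Y)⁻¹
  set b := Xᵀ * sympForm n * Z with hbdef
  set a := Y'ᵀ * sympForm n * Z with hadef
  have h1 := congrArg (fun W => Zᵀ * sympForm n * W) (eq_combination hG' Z)
  simp only [hZZ, Matrix.mul_sub, ← Matrix.mul_assoc] at h1
  rw [← neg_eq_iff_eq_neg.2 (transpose_pairing Y' Z), ← neg_eq_iff_eq_neg.2 (transpose_pairing X Z)] at h1
  have h2 : aᵀ * b = bᵀ * a := by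
    rw [hadef, hbdef]
    simp only [Matrix.neg_mul, ← Matrix.mul_assoc] at h1 ⊢
    have := sub_eq_zero.1 h1.symm
    exact neg_injective this
  have hbt : IsUnit (bᵀ).det := by rwa [det_transpose]
  change (a * b⁻¹)ᵀ = a * b⁻¹
  rw [transpose_mul, transpose_nonsing_inv]
  have h3 : (bᵀ)⁻¹ * (aᵀ * b) * b⁻¹ = (bᵀ)⁻¹ * (bᵀ * a) * b⁻¹ := by rw [h2]
  rw [← Matrix.mul_assoc, Matrix.mul_assoc _ b, mul_nonsing_inv _ hb, Matrix.mul_one,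
    ← Matrix.mul_assoc, nonsing_inv_mul _ hbt, Matrix.one_mul] at h3
  exact h3

/-- The vector `Y' c - X S c` lies in the third Lagrangian, so positivity of the rotated triple is
positivity of `S` at `c`. -/
theorem frameShape_pos (hX : colSpan X = (L 0).1) (hY : colSpan Y = (L 1).1)
    (hZ : colSpan Z = (L 2).1) (hD : IsUnit (Xᵀ * sympForm n * Y).det)
    (hb : IsUnit (Xᵀ * sympForm n * Z).det) (hL : Lag.IsPositive (L 0) (L 1) (L 2))
    {c : Fin n → ℝ} (hc : c ≠ 0) : 0 < c ⬝ᵥ (frameShape X Y Z *ᵥ c) := by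
  have hXX := pairing_self_eq_zero (X := X) (L := L 0) fun c => by rw [← hX]; exact ⟨c, rfl⟩
  have hYY := pairing_self_eq_zero (X := Y) (L := L 1) fun c => by rw [← hY]; exact ⟨c, rfl⟩
  have hG' := frameMat_mem (T := 1) hXX hYY hD (by simp)
  rw [frameMat] at hG'
  simp only [Matrix.mul_one, inv_one, transpose_one] at hG'
  have hcomb := eq_combination hG' Z
  have hdual := pairing_dual hD
  have hY' := colSpan_mul Y (isUnit_nonsing_inv_det _ hD)
  unfold frameShape
  set Y' := Y * (Xᵀ * sympForm n * Y)⁻¹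
  set b := Xᵀ * sympForm n * Z with hbdef
  set a := Y'ᵀ * sympForm n * Z with hadef
  have h1 : colMap Y' c + colMap X (-((a * b⁻¹) *ᵥ c)) = colMap Z (b⁻¹ *ᵥ c) := by
    rw [← colMap_mul]
    conv_rhs => rw [hcomb]
    rw [Matrix.sub_mul, Matrix.mul_assoc Y', mul_nonsing_inv _ hb, Matrix.mul_one,
      Matrix.mul_assoc X, map_neg, ← colMap_mul]
    simp only [colMap_apply, sub_mulVec, WithLp.toLp_sub, ← sub_eq_add_neg]
  have hne : colMap Z (b⁻¹ *ᵥ c) ≠ 0 := by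
    intro h0
    have h2 := injective_of_isUnit_left hb (h0.trans (map_zero _).symm)
    apply hc
    rw [← one_mulVec c, ← mul_nonsing_inv _ hb, ← mulVec_mulVec, h2, mulVec_zero]
  have h2 := hL.rotate.2 (colMap Y' c) (by rw [← hY, ← hY']; exact ⟨c, rfl⟩)
    (colMap X (-((a * b⁻¹) *ᵥ c))) (by rw [← hX]; exact ⟨_, rfl⟩)
    (by rw [h1, ← hZ]; exact ⟨_, rfl⟩) (by rwa [h1])
  rw [omega_neg_swap, omega_colMap, hdual, one_mulVec, neg_dotProduct, neg_neg,
    dotProduct_comm] at h2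
  exact h2

theorem exists_colSpan_eq (L : Lag n) :
    ∃ X : Matrix (Fin n ⊕ Fin n) (Fin n) ℝ, colSpan X = L.1 ∧ Function.Injective (colMap X) := by
  let β := finBasisOfFinrankEq ℝ L.1 L.2.1
  let X : Matrix (Fin n ⊕ Fin n) (Fin n) ℝ := Matrix.of fun k j => (β j : SympVec n) k
  have hX : ∀ c, colMap X c = ((∑ j, c j • β j : L.1) : SympVec n) := by
    intro c
    ext k
    simp [colMap_apply, X, mulVec, dotProduct, mul_comm]
  have hinj : Function.Injective (colMap X) := by
    rw [injective_iff_map_eq_zero]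
    intro c hc
    rw [hX] at hc
    funext j
    exact Fintype.linearIndependent_iff.1 β.linearIndependent c (Subtype.ext hc) j
  exact ⟨X, colSpan_eq_of_injective (fun c => by rw [hX]; exact Subtype.mem _) hinj, hinj⟩

/-- The factorization of positive definite matrices stays a hypothesis; it is met by a square root
for `n = 1` and by `cholesky` for `n = 2`. -/
theorem exists_frame_of_factor (hL : Lag.IsPositive (L 0) (L 1) (L 2))
    (hfac : ∀ S : Matrix (Fin n) (Fin n) ℝ, Sᵀ = S → (∀ c, c ≠ 0 → 0 < c ⬝ᵥ (S *ᵥ c)) →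
      ∃ T : Matrix (Fin n) (Fin n) ℝ, IsUnit T.det ∧ T * Tᵀ = S) :
    ∃ g : Sp n, ∀ i, MovesTo g (stdLag n i) (L i) := by
  obtain ⟨X, hX, -⟩ := exists_colSpan_eq (L 0)
  obtain ⟨Y, hY, hYi⟩ := exists_colSpan_eq (L 1)
  obtain ⟨Z, hZ, hZi⟩ := exists_colSpan_eq (L 2)
  have hD := isUnit_pairing_of_disjoint hX hY hYi hL.rotate.1.symm
  have hb := isUnit_pairing_of_disjoint hX hZ hZi hL.1
  obtain ⟨T, hT, hTS⟩ := hfac _ (frameShape_transpose hX hY hZ hD hb)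
    fun c hc => frameShape_pos hX hY hZ hD hb hL hc
  have hXX := pairing_self_eq_zero (X := X) (L := L 0) fun c => by rw [← hX]; exact ⟨c, rfl⟩
  have hYY := pairing_self_eq_zero (X := Y) (L := L 1) fun c => by rw [← hY]; exact ⟨c, rfl⟩
  exact ⟨⟨_, frameMat_mem hXX hYY hD hT⟩, frameMat_movesTo hX hY hZ hD hb hT hTS _⟩

end

theorem exists_frame_one {L : ZMod 3 → Lag 1} (hL : Lag.IsPositive (L 0) (L 1) (L 2)) :
    ∃ g : Sp 1, ∀ i, MovesTo g (stdLag 1 i) (L i) := by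
  refine exists_frame_of_factor hL fun S _ hS => ?_
  have h := hS 1 one_ne_zero
  simp only [dotProduct, Finset.univ_unique, Fin.default_eq_zero, Pi.one_apply, mulVec,
    Finset.sum_singleton, one_mul, mul_one] at h
  refine ⟨Matrix.of fun _ _ => √(S 0 0), ?_, ?_⟩
  · rw [det_unique]
    exact (Real.sqrt_pos.2 h).ne'.isUnit
  · ext i j
    rw [Subsingleton.elim i 0, Subsingleton.elim j 0, mul_apply]
    simp [Real.mul_self_sqrt h.le]

/-- The lower triangular square root of a positive definite matrix. -/
def cholesky (S : Matrix (Fin 2) (Fin 2) ℝ) : Matrix (Fin 2) (Fin 2) ℝ :=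
  !![√(S 0 0), 0; S 1 0 / √(S 0 0), √(S.det / S 0 0)]

/-- The triangular root has explicit entries, visibly smooth in `S`; the local frames built later
depend on this. -/
theorem cholesky_mul_transpose {S : Matrix (Fin 2) (Fin 2) ℝ} (hS : Sᵀ = S) (h0 : 0 < S 0 0)
    (hd : 0 < S.det) : cholesky S * (cholesky S)ᵀ = S := by
  have h1 := Real.mul_self_sqrt h0.le
  have h2 := Real.mul_self_sqrt (div_pos hd h0).le
  have h3 := (Real.sqrt_pos.2 h0).ne'
  have hs : S 0 1 = S 1 0 := congrFun (congrFun hS 1) 0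
  ext i j
  fin_cases i <;> fin_cases j
  · simpa [cholesky, mul_apply] using h1
  · simp [cholesky, mul_apply, mul_div_cancel₀ _ h3, hs]
  · simp [cholesky, mul_apply, div_mul_cancel₀ _ h3]
  · simp only [cholesky, mul_apply, Fin.sum_univ_two, transpose_apply, of_apply, cons_val', cons_val_zero,
      cons_val_one, cons_val_fin_one, Fin.mk_one]
    rw [h2, div_mul_div_comm, h1, det_fin_two, hs]
    field_simp
    ring

theorem isUnit_det_cholesky {S : Matrix (Fin 2) (Fin 2) ℝ} (h0 : 0 < S 0 0) (hd : 0 < S.det) :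
    IsUnit (cholesky S).det := by
  rw [cholesky, det_fin_two_of, zero_mul, sub_zero]
  exact (mul_pos (Real.sqrt_pos.2 h0) (Real.sqrt_pos.2 (div_pos hd h0))).ne'.isUnit

theorem pos_of_forall_dotProduct {S : Matrix (Fin 2) (Fin 2) ℝ} (hS : Sᵀ = S)
    (h : ∀ c, c ≠ 0 → 0 < c ⬝ᵥ (S *ᵥ c)) : 0 < S 0 0 ∧ 0 < S.det := by
  have hs : S 0 1 = S 1 0 := congrFun (congrFun hS 1) 0
  have h0 : 0 < S 0 0 := by
    have := h ![1, 0] (fun h => by simpa using congrFun h 0)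
    simpa [dotProduct, mulVec, Fin.sum_univ_two] using this
  refine ⟨h0, ?_⟩
  -- On this vector the form takes the value `S 0 0 * S.det`.
  have := h ![-S 1 0, S 0 0] (fun h => h0.ne' (by simpa using congrFun h 1))
  simp only [dotProduct, mulVec, Fin.sum_univ_two, cons_val_zero, cons_val_one,
    cons_val_fin_one, hs] at this
  rw [det_fin_two, hs]
  nlinarith

theorem exists_frame_two {L : ZMod 3 → Lag 2} (hL : Lag.IsPositive (L 0) (L 1) (L 2)) :
    ∃ g : Sp 2, ∀ i, MovesTo g (stdLag 2 i) (L i) :=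
  exists_frame_of_factor hL fun S hS h => ⟨cholesky S,
    isUnit_det_cholesky (pos_of_forall_dotProduct hS h).1 (pos_of_forall_dotProduct hS h).2,
    cholesky_mul_transpose hS (pos_of_forall_dotProduct hS h).1 (pos_of_forall_dotProduct hS h).2⟩

end SymplecticFrames

end

/-! ### Stabilizers of the standard triple, and maximality through flips. -/

noncomputable section

open Module Matrix

section StandardTriple

variable {n : ℕ}

theorem movesTo_of_forall {g : Sp n} {L L' : Lag n} (h : ∀ v ∈ L.1, matOp g.1 v ∈ L'.1) :
    MovesTo g L L' := by
  have hinj : Function.Injective (matOp g.1 : SympVec n →ₗ[ℝ] SympVec n) := by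
    rw [injective_iff_map_eq_zero]
    intro u hu
    refine eq_zero_of_omega fun v => ?_
    rw [← omega_matOp g.2]
    change omega n ((matOp g.1 : SympVec n →ₗ[ℝ] SympVec n) u) _ = 0
    rw [hu, map_zero, LinearMap.zero_apply]
  refine Submodule.eq_of_le_of_finrank_eq ?_ ?_
  · rintro _ ⟨v, hv, rfl⟩
    exact h v hv
  · rw [← (Submodule.equivMapOfInjective _ hinj L.1).finrank_eq, L.2.1, L'.2.1]

theorem MovesTo.mem {g : Sp n} {L L' : Lag n} (h : MovesTo g L L') {v : SympVec n} (hv : v ∈ L.1) :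
    matOp g.1 v ∈ L'.1 := by
  rw [← h]
  exact ⟨v, hv, rfl⟩

theorem mem_stdLag_zero {v : SympVec n} : v ∈ (stdLag n 0).1 ↔ ∀ i, v (Sum.inr i) = 0 := by
  constructor
  · rintro ⟨c, rfl⟩ i
    simp [colMap_apply, stdMat_zero, fromRows_mulVec]
  · intro h
    refine ⟨fun i => v (Sum.inl i), ?_⟩
    ext k
    rcases k with k | k
    · simp [colMap_apply, stdMat_zero, fromRows_mulVec]
    · simp [colMap_apply, stdMat_zero, fromRows_mulVec, h]

theorem mem_stdLag_one {v : SympVec n} : v ∈ (stdLag n 1).1 ↔ ∀ i, v (Sum.inl i) = 0 := by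
  constructor
  · rintro ⟨c, rfl⟩ i
    simp [colMap_apply, stdMat_one, fromRows_mulVec]
  · intro h
    refine ⟨fun i => v (Sum.inr i), ?_⟩
    ext k
    rcases k with k | k
    · simp [colMap_apply, stdMat_one, fromRows_mulVec, h]
    · simp [colMap_apply, stdMat_one, fromRows_mulVec]

theorem mem_stdLag_two {v : SympVec n} :
    v ∈ (stdLag n 2).1 ↔ ∀ i, v (Sum.inl i) = -v (Sum.inr i) := by
  constructor
  · rintro ⟨c, rfl⟩ i
    simp [colMap_apply, stdMat_two, fromRows_mulVec, neg_mulVec]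
  · intro h
    refine ⟨fun i => v (Sum.inr i), ?_⟩
    ext k
    rcases k with k | k
    · simp [colMap_apply, stdMat_two, fromRows_mulVec, neg_mulVec, h]
    · simp [colMap_apply, stdMat_two, fromRows_mulVec]

theorem matOp_single (g : Matrix (Fin n ⊕ Fin n) (Fin n ⊕ Fin n) ℝ) (k l : Fin n ⊕ Fin n) :
    matOp g (EuclideanSpace.single l 1) k = g k l := by
  rw [matOp_apply]
  simp [EuclideanSpace.single]

/-- The symplectic matrix exchanging the first two Lagrangians of the standard triple. -/
def swapMat (B : Matrix (Fin n) (Fin n) ℝ) : Matrix (Fin n ⊕ Fin n) (Fin n ⊕ Fin n) ℝ :=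
  fromBlocks 0 B (-(B⁻¹)ᵀ) 0

theorem swapMat_mem {B : Matrix (Fin n) (Fin n) ℝ} (hB : IsUnit B.det) : swapMat B ∈ Sp n := by
  rw [mem_Sp_iff, swapMat, sympForm]
  simp [fromBlocks_transpose, fromBlocks_multiply, nonsing_inv_mul _ hB, ← transpose_mul]

theorem swapMat_mul_swapMat {B : Matrix (Fin n) (Fin n) ℝ} (hB : IsUnit B.det) :
    swapMat (-Bᵀ) * swapMat B = 1 := by
  have h : IsUnit (Bᵀ).det := by rwa [det_transpose]
  have h1 : (-Bᵀ)⁻¹ = -(B⁻¹)ᵀ := by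
    apply inv_eq_left_inv
    rw [neg_mul_neg, ← transpose_mul, mul_nonsing_inv _ hB, transpose_one]
  rw [swapMat, swapMat, h1]
  simp [fromBlocks_multiply, nonsing_inv_mul _ hB, ← transpose_mul]

theorem swapMat_movesTo_zero {B : Matrix (Fin n) (Fin n) ℝ} (h : swapMat B ∈ Sp n) :
    MovesTo ⟨swapMat B, h⟩ (stdLag n 0) (stdLag n 1) := by
  refine movesTo_of_forall fun v hv => ?_
  rw [mem_stdLag_zero] at hv
  rw [mem_stdLag_one]
  intro i
  rw [matOp_apply]
  simp [swapMat, mulVec, dotProduct, hv]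

/-- The exchange kills the diagonal blocks, and the symplectic relation determines one off-diagonal
block from the other: a single invertible matrix remains. -/
theorem eq_swapMat {g : Sp n} (h0 : MovesTo g (stdLag n 0) (stdLag n 1))
    (h1 : MovesTo g (stdLag n 1) (stdLag n 0)) :
    IsUnit (g.1.toBlocks₁₂).det ∧ g.1 = swapMat g.1.toBlocks₁₂ := by
  have e1 : g.1.toBlocks₁₁ = 0 := by
    ext i j
    have := mem_stdLag_one.1 (h0.mem (v := EuclideanSpace.single (Sum.inl j) 1)
      (mem_stdLag_zero.2 fun i => by simp)) i
    rwa [matOp_single] at this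
  have e2 : g.1.toBlocks₂₂ = 0 := by
    ext i j
    have := mem_stdLag_zero.1 (h1.mem (v := EuclideanSpace.single (Sum.inr j) 1)
      (mem_stdLag_one.2 fun i => by simp)) i
    rwa [matOp_single] at this
  have hg := mem_Sp_iff.1 g.2
  have e := fromBlocks_toBlocks g.1
  rw [e1, e2] at e
  rw [← e, sympForm, fromBlocks_transpose, fromBlocks_multiply, fromBlocks_multiply] at hg
  simp only [transpose_zero, Matrix.zero_mul, Matrix.mul_zero, Matrix.mul_neg, Matrix.mul_one,
    zero_add, add_zero, Matrix.neg_mul, neg_zero] at hg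
  have hcb := congrArg toBlocks₁₂ hg
  simp only [toBlocks_fromBlocks₁₂] at hcb
  have hinv : -(g.1.toBlocks₂₁)ᵀ * g.1.toBlocks₁₂ = 1 := by rw [Matrix.neg_mul, hcb]
  have hu : IsUnit (g.1.toBlocks₁₂).det := by
    have := congrArg det hinv
    rw [det_mul, det_one] at this
    exact IsUnit.of_mul_eq_one_right _ this
  refine ⟨hu, ?_⟩
  rw [swapMat, inv_eq_left_inv hinv]
  simp only [transpose_neg, transpose_transpose, neg_neg]
  exact e.symm

/-- The diagonal action of a matrix on the two standard Lagrangians. -/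
def dblMat (o : Matrix (Fin n) (Fin n) ℝ) : Matrix (Fin n ⊕ Fin n) (Fin n ⊕ Fin n) ℝ :=
  fromBlocks o 0 0 o

theorem dblMat_mem {o : Matrix (Fin n) (Fin n) ℝ} (ho : oᵀ * o = 1) : dblMat o ∈ Sp n := by
  rw [mem_Sp_iff, dblMat, sympForm]
  simp [fromBlocks_transpose, fromBlocks_multiply, ho]

theorem dblMat_movesTo {o : Matrix (Fin n) (Fin n) ℝ} (h : dblMat o ∈ Sp n) (i : ZMod 3) :
    MovesTo ⟨dblMat o, h⟩ (stdLag n i) (stdLag n i) := by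
  refine movesTo_of_forall fun v hv => ?_
  rw [matOp_apply]
  induction i using ZMod.forall_three with
  | h0 =>
    rw [mem_stdLag_zero] at *
    intro i
    simp [dblMat, mulVec, dotProduct, hv]
  | h1 =>
    rw [mem_stdLag_one] at *
    intro i
    simp [dblMat, mulVec, dotProduct, hv]
  | h2 =>
    rw [mem_stdLag_two] at *
    intro i
    simp [dblMat, mulVec, dotProduct, hv]

/-- The first two Lagrangians make `g` block diagonal, the third makes the blocks equal, and the
symplectic relation makes them orthogonal. -/
theorem eq_dblMat {g : Sp n} (h : ∀ i, MovesTo g (stdLag n i) (stdLag n i)) :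
    ∃ o : Matrix (Fin n) (Fin n) ℝ, oᵀ * o = 1 ∧ g.1 = dblMat o := by
  have e1 : g.1.toBlocks₂₁ = 0 := by
    ext i j
    have := mem_stdLag_zero.1 ((h 0).mem (v := EuclideanSpace.single (Sum.inl j) 1)
      (mem_stdLag_zero.2 fun i => by simp)) i
    rwa [matOp_single] at this
  have e2 : g.1.toBlocks₁₂ = 0 := by
    ext i j
    have := mem_stdLag_one.1 ((h 1).mem (v := EuclideanSpace.single (Sum.inr j) 1)
      (mem_stdLag_one.2 fun i => by simp)) i
    rwa [matOp_single] at this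
  have e := fromBlocks_toBlocks g.1
  rw [e1, e2] at e
  have e3 : g.1.toBlocks₂₂ = g.1.toBlocks₁₁ := by
    ext i j
    have := mem_stdLag_two.1 ((h 2).mem
      (v := EuclideanSpace.single (Sum.inl j) 1 - EuclideanSpace.single (Sum.inr j) 1)
      (mem_stdLag_two.2 fun i => by simp)) i
    rw [map_sub, PiLp.sub_apply, PiLp.sub_apply, matOp_single, matOp_single, matOp_single,
      matOp_single, ← e] at this
    simp only [fromBlocks_apply₁₁, fromBlocks_apply₁₂, fromBlocks_apply₂₁, fromBlocks_apply₂₂,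
      Matrix.zero_apply, sub_zero, zero_sub, neg_neg] at this
    exact this.symm
  rw [e3] at e
  refine ⟨g.1.toBlocks₁₁, ?_, e.symm⟩
  have hg := mem_Sp_iff.1 g.2
  rw [← e, sympForm, fromBlocks_transpose, fromBlocks_multiply, fromBlocks_multiply] at hg
  simpa using congrArg toBlocks₁₂ hg

theorem isUnit_det_of_transpose_mul {o : Matrix (Fin n) (Fin n) ℝ} (ho : oᵀ * o = 1) :
    IsUnit o.det := by
  have := congrArg det ho
  rw [det_mul, det_one] at this
  exact IsUnit.of_mul_eq_one_right _ this

/-- Orthogonal changes of frame on the two sides of an edge act on its matrix by `B ↦ o' B oᵀ`. -/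
theorem dblMat_mul_swapMat {o o' : Matrix (Fin n) (Fin n) ℝ} (ho : oᵀ * o = 1) (ho' : o'ᵀ * o' = 1)
    (B : Matrix (Fin n) (Fin n) ℝ) :
    dblMat o' * swapMat B = swapMat (o' * B * oᵀ) * dblMat o := by
  have h1 : o⁻¹ = oᵀ := inv_eq_left_inv ho
  have h2 : o'⁻¹ = o'ᵀ := inv_eq_left_inv ho'
  have h3 : (oᵀ)⁻¹ = o := inv_eq_left_inv (mul_eq_one_comm.1 ho)
  rw [swapMat, swapMat, dblMat, dblMat, Matrix.mul_inv_rev, Matrix.mul_inv_rev, h2, h3]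
  simp [fromBlocks_multiply, Matrix.mul_assoc, ho]

theorem rho_mul_dblMat (o : Matrix (Fin n) (Fin n) ℝ) :
    (rho n).1 * dblMat o = dblMat o * (rho n).1 := by
  simp [rho, dblMat, fromBlocks_multiply]

theorem swapMat_injective : Function.Injective (swapMat (n := n)) := fun B B' h => by
  have := congrArg toBlocks₁₂ h
  simpa [swapMat] using this

/-- The inverse of a symplectic matrix is traded for a symplectic pairing, which makes the edge
matrix polynomial in the frames. -/
theorem toBlocks₁₂_inv_mul (A C : Sp n) :
    (A⁻¹ * C).1.toBlocks₁₂ =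
      -((A.1 * stdMat n 1)ᵀ * sympForm n * (C.1 * stdMat n 1)) := by
  have h1 : A.1ᵀ * sympForm n = sympForm n * (A⁻¹).1 := by
    have h2 := mem_Sp_iff.1 A.2
    have h3 : A.1 * (A⁻¹).1 = 1 := congrArg Subtype.val (mul_inv_cancel A)
    calc A.1ᵀ * sympForm n = A.1ᵀ * sympForm n * (A.1 * (A⁻¹).1) := by rw [h3, Matrix.mul_one]
      _ = _ := by rw [← Matrix.mul_assoc, h2]
  have h2 : (A⁻¹ * C).1 = (A⁻¹).1 * C.1 := rfl
  rw [transpose_mul, Matrix.mul_assoc _ A.1ᵀ, h1, ← Matrix.mul_assoc, ← Matrix.mul_assoc,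
    Matrix.mul_assoc _ (A⁻¹).1, ← h2]
  conv_rhs => rw [← fromBlocks_toBlocks (A⁻¹ * C).1]
  simp [stdMat_one, sympForm, transpose_fromRows, fromCols_mul_fromBlocks,
    fromCols_mul_fromRows]

end StandardTriple

theorem nextSide_nextSide_nextSide {F : Type*} (d : F × ZMod 3) : nextSide (nextSide (nextSide d)) = d := by
  obtain ⟨t, i⟩ := d
  have : i + 1 + 1 + 1 = i := by
    rw [add_assoc, add_assoc, show (1 : ZMod 3) + (1 + 1) = 0 from rfl, add_zero]
  simp [nextSide, this]

namespace IdealSurface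

variable {F : Type*} [Fintype F] {S : IdealSurface F} {n : ℕ}

section Maximality

theorem movesTo_one_iff {L L' : Lag n} : MovesTo 1 L L' ↔ L = L' := by
  constructor
  · intro h
    exact Subtype.ext ((movesTo_one L).symm.trans h)
  · rintro rfl
    exact movesTo_one L

/-- All triangles are positive. -/
def FramedLocalSystem.IsPositive (x : S.FramedLocalSystem n) : Prop :=
  ∀ d, Lag.IsPositive (x.lag d) (x.lag (nextSide d)) (x.lag (nextSide (nextSide d)))

theorem FramedLocalSystem.isPositive_next (x : S.FramedLocalSystem n) {d : F × ZMod 3}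
    (h : Lag.IsPositive (x.lag d) (x.lag (nextSide d)) (x.lag (nextSide (nextSide d)))) :
    Lag.IsPositive (x.lag (nextSide d)) (x.lag (nextSide (nextSide d)))
      (x.lag (nextSide (nextSide (nextSide d)))) := by
  rw [nextSide_nextSide_nextSide]
  exact h.rotate

theorem FramedLocalSystem.isPositive_of_fst (x : S.FramedLocalSystem n) {d e : F × ZMod 3}
    (h : Lag.IsPositive (x.lag d) (x.lag (nextSide d)) (x.lag (nextSide (nextSide d))))
    (he : e.1 = d.1) :
    Lag.IsPositive (x.lag e) (x.lag (nextSide e)) (x.lag (nextSide (nextSide e))) := by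
  obtain ⟨t, i⟩ := d
  obtain ⟨t', j⟩ := e
  obtain rfl : t' = t := he
  have h1 := x.isPositive_next h
  have h2 := x.isPositive_next h1
  have : j = i ∨ j = i + 1 ∨ j = i + 1 + 1 := by
    have key : ∀ i j : ZMod 3, j = i ∨ j = i + 1 ∨ j = i + 1 + 1 := by decide
    exact key i j
  rcases this with rfl | rfl | rfl
  exacts [h, h1, h2]

theorem FramedLocalSystem.maslov_eq_iff (x : S.FramedLocalSystem n) :
    (∀ t, x.maslov t = n) ↔ x.IsPositive := by
  constructor
  · intro h d
    exact x.isPositive_of_fst (d := (d.1, 0)) ((Lag.maslovIndex_eq_iff _ _ _).1 (h d.1)) rfl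
  · intro h t
    exact (Lag.maslovIndex_eq_iff _ _ _).2 (h (t, 0))

theorem isPositive_of_isIso {a b : Framed F n} (h : IsIso a b) (hb : b.2.IsPositive) :
    a.2.IsPositive := by
  obtain ⟨S, x, y, ⟨k, -, hk⟩, rfl, rfl⟩ := h
  intro d
  exact (hb d).map (movesTo_inv (hk d)) (movesTo_inv (hk (nextSide d)))
    (movesTo_inv (hk (nextSide (nextSide d))))

/-- Positivity propagates backwards along a flip: the two old triangles come from the two new ones
by `Lag.IsPositive.flip`, and the others are untouched. -/
theorem isPositive_of_isFlip {a b : Framed F n} (h : IsFlip a b) (hb : b.2.IsPositive) :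
    a.2.IsPositive := by
  obtain ⟨d, d', π, hd, hne, p1, p2, p3, p4, p5, p6, p7, hglue, ht, htr, hlag⟩ := h
  have hdd' : d ≠ d' := fun h => hne (congrArg Prod.fst h)
  have hne1 : ∀ e : F × ZMod 3, nextSide e ≠ e := fun e h => by
    have := congrArg Prod.snd h
    simp [nextSide] at this
  have hne2 : ∀ e : F × ZMod 3, nextSide (nextSide e) ≠ e := fun e h => by
    have h1 := congrArg nextSide h
    rw [nextSide_nextSide_nextSide] at h1
    exact hne1 e h1.symm
  have hfst : ∀ e : F × ZMod 3, (nextSide e).1 = e.1 := fun e => rfl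
  have hda : a.1.glue d ≠ d := by rw [hd]; exact hdd'.symm
  have hd' : a.1.glue d' = d := by rw [← hd, a.1.glue_glue]
  have hda' : a.1.glue d' ≠ d' := by rw [hd']; exact hdd'
  have ht' : a.2.trans d' = 1 := by
    have := (a.2.isLocalSystem d).1 hda
    rwa [ht, mul_one, hd] at this
  have fa : a.2.lag d = a.2.lag (nextSide d') := by
    have := a.2.flat d hda
    rwa [ht, hd, movesTo_one_iff] at this
  have fa' : a.2.lag d' = a.2.lag (nextSide d) := by
    have := a.2.flat d' hda'
    rwa [ht', hd', movesTo_one_iff] at this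
  have hbd : b.1.glue d = d' := by
    have := hglue d
    rwa [p1, hd, p2] at this
  have hbd' : b.1.glue d' = d := by rw [← hbd, b.1.glue_glue]
  have fb : b.2.lag d = b.2.lag (nextSide d') := by
    have h1 := b.2.flat d (by rw [hbd]; exact hdd'.symm)
    have h2 := htr d
    rw [p1, ht] at h2
    rwa [h2, hbd, movesTo_one_iff] at h1
  have fb' : b.2.lag d' = b.2.lag (nextSide d) := by
    have h1 := b.2.flat d' (by rw [hbd']; exact hdd')
    have h2 := htr d'
    rw [p2, ht'] at h2
    rwa [h2, hbd', movesTo_one_iff] at h1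
  have n1 : ∀ {e f : F × ZMod 3}, e.1 ≠ f.1 → e ≠ f := fun h h' => h (congrArg Prod.fst h')
  have l1 := hlag (nextSide d) (hne1 d) (n1 hne)
  have l2 := hlag (nextSide (nextSide d)) (hne2 d) (n1 hne)
  have l3 := hlag (nextSide d') (n1 hne.symm) (hne1 d')
  have l4 := hlag (nextSide (nextSide d')) (n1 hne.symm) (hne2 d')
  rw [p3] at l1
  rw [p4] at l2
  rw [p5] at l3
  rw [p6] at l4
  -- In terms of the old Lagrangians these are the triples `D C A` and `C D B`; flatness across the
  -- two diagonals identifies the repeated corners.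
  have t1 := hb d
  have t2 := hb d'
  rw [fb, l2, l3, l4, ← fa] at t1
  rw [fb', l1, l2, l4] at t2
  intro e
  by_cases h1 : e.1 = d.1
  · exact a.2.isPositive_of_fst (t1.flip t2) h1
  by_cases h2 : e.1 = d'.1
  · refine a.2.isPositive_of_fst (d := d') ?_ h2
    rw [fa', ← fa]
    exact t2.flip t1
  have hl : ∀ f : F × ZMod 3, f.1 = e.1 → b.2.lag f = a.2.lag f := fun f hf => by
    have := hlag f (n1 (by rwa [hf])) (n1 (by rwa [hf]))
    rwa [p7 f (by rwa [hf]) (by rwa [hf])] at this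
  have := hb e
  rwa [hl e rfl, hl (nextSide e) rfl, hl (nextSide (nextSide e)) rfl] at this

/-- Positivity on the final triangulation is pulled back step by step to the given one, so no choice
of flips is left in the condition. -/
theorem FramedLocalSystem.isMaximal_iff (x : S.FramedLocalSystem n) :
    x.IsMaximal ↔ x.IsPositive := by
  constructor
  · rintro ⟨b, hb, hpos⟩
    rw [FramedLocalSystem.maslov_eq_iff] at hpos
    have : ∀ a, Relation.ReflTransGen (fun a a' : Framed F n => IsIso a a' ∨ IsFlip a a') a b →
        a.2.IsPositive := fun a ha => by
      induction ha using Relation.ReflTransGen.head_induction_on with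
      | refl => exact hpos
      | head h _ ih =>
        rcases h with h | h
        · exact isPositive_of_isIso h ih
        · exact isPositive_of_isFlip h ih
    exact this ⟨S, x⟩ hb
  · intro h
    exact ⟨⟨S, x⟩, Relation.ReflTransGen.refl, x.maslov_eq_iff.2 h⟩

end Maximality

end IdealSurface

end

/-! ### Edge matrices of a framed local system. -/

noncomputable section

open Module Matrix

namespace IdealSurface

variable {F : Type*} [Fintype F] {S : IdealSurface F} {n : ℕ}

/-- An invertible matrix for each internal side, describing a framed local system whose
Lagrangians form the standard triple in every triangle. -/
structure EdgeData (S : IdealSurface F) (n : ℕ) where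
  mat : F × ZMod 3 → Matrix (Fin n) (Fin n) ℝ
  isUnit : ∀ d, S.glue d ≠ d → IsUnit (mat d).det
  glue : ∀ d, S.glue d ≠ d → mat (S.glue d) = -(mat d)ᵀ

/-- The symplectic rotation taking the first standard Lagrangian to the `i`-th one. -/
abbrev rot (n : ℕ) (i : ZMod 3) : Sp n := rho n ^ i.val

theorem rot_mul_dblMat (i : ZMod 3) (o : Matrix (Fin n) (Fin n) ℝ) :
    (rot n i).1 * dblMat o = dblMat o * (rot n i).1 := by
  have : ∀ k : ℕ, ((rho n) ^ k).1 * dblMat o = dblMat o * ((rho n) ^ k).1 := by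
    intro k
    induction k with
    | zero => simp
    | succ k ih =>
      have h : ((rho n) ^ (k + 1)).1 = ((rho n) ^ k).1 * (rho n).1 := by rw [pow_succ]; rfl
      rw [h, Matrix.mul_assoc, rho_mul_dblMat, ← Matrix.mul_assoc, ih, Matrix.mul_assoc]
  exact this _

theorem glue_ne_of_ne {d : F × ZMod 3} (h : S.glue d ≠ d) : S.glue (S.glue d) ≠ S.glue d := by
  rw [S.glue_glue]
  exact h.symm

namespace EdgeData

open Classical in
/-- The change of trivialization across the side `d`. -/
def trans (β : EdgeData S n) (d : F × ZMod 3) : Sp n :=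
  if h : S.glue d = d then 1
  else rot n (S.glue d).2 * ⟨swapMat (β.mat d), swapMat_mem (β.isUnit d h)⟩ * (rot n d.2)⁻¹

theorem trans_of_eq (β : EdgeData S n) {d : F × ZMod 3} (h : S.glue d = d) : β.trans d = 1 :=
  dif_pos h

theorem trans_of_ne (β : EdgeData S n) {d : F × ZMod 3} (h : S.glue d ≠ d) :
    β.trans d = rot n (S.glue d).2 * ⟨swapMat (β.mat d), swapMat_mem (β.isUnit d h)⟩ *
      (rot n d.2)⁻¹ :=
  dif_neg h

/-- The framed local system with the given edge matrices. -/
def system (β : EdgeData S n) : S.FramedLocalSystem n where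
  trans := β.trans
  isLocalSystem d := by
    refine ⟨fun h => ?_, fun h => β.trans_of_eq h⟩
    rw [β.trans_of_ne h, β.trans_of_ne (glue_ne_of_ne h)]
    have h1 : (⟨swapMat (β.mat (S.glue d)), swapMat_mem (β.isUnit _ (glue_ne_of_ne h))⟩ : Sp n) *
        ⟨swapMat (β.mat d), swapMat_mem (β.isUnit d h)⟩ = 1 := by
      refine Subtype.ext ?_
      change swapMat (β.mat (S.glue d)) * swapMat (β.mat d) = 1
      rw [β.glue d h, swapMat_mul_swapMat (β.isUnit d h)]
    rw [S.glue_glue, mul_assoc, mul_assoc, mul_assoc, inv_mul_cancel_left, ← mul_assoc _ _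
      (rot n d.2)⁻¹, h1, one_mul, mul_inv_cancel]
  lag c := stdLag n c.2
  flat d h := by
    rw [β.trans_of_ne h, mul_assoc]
    have h1 : MovesTo (rot n d.2)⁻¹ (stdLag n d.2) (stdLag n 0) := by
      have := rho_pow_val_movesTo (n := n) d.2 0
      rw [zero_add] at this
      exact movesTo_inv this
    have h3 := rho_pow_val_movesTo (n := n) (S.glue d).2 1
    rw [add_comm] at h3
    exact movesTo_mul (movesTo_mul h1 (swapMat_movesTo_zero _)) h3

theorem system_isMaximal (β : EdgeData S n) : β.system.IsMaximal := by
  rw [FramedLocalSystem.isMaximal_iff]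
  intro d
  exact β.system.isPositive_of_fst (d := (d.1, 0)) isPositive_stdLag rfl

/-- All corners carry the standard Lagrangians, so an isomorphism is an orthogonal matrix in each
triangle. These commute with the rotations `rot`, which cancel and leave the action on the edge
matrices. -/
theorem system_iso_iff (β β' : EdgeData S n) : β.system.Iso β'.system ↔
    ∃ o : F → Matrix (Fin n) (Fin n) ℝ, (∀ t, (o t)ᵀ * o t = 1) ∧
      ∀ d, S.glue d ≠ d → β'.mat d = o (S.glue d).1 * β.mat d * (o d.1)ᵀ := by
  have key : ∀ (i j : ZMod 3) (B B' o o' : Matrix (Fin n) (Fin n) ℝ) (hB : swapMat B ∈ Sp n)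
      (hB' : swapMat B' ∈ Sp n) (ho : dblMat o ∈ Sp n) (ho' : dblMat o' ∈ Sp n),
      (oᵀ * o = 1) → (o'ᵀ * o' = 1) →
      (rot n j * ⟨swapMat B', hB'⟩ * (rot n i)⁻¹ =
        (⟨dblMat o', ho'⟩ : Sp n) * (rot n j * ⟨swapMat B, hB⟩ * (rot n i)⁻¹) *
          (⟨dblMat o, ho⟩ : Sp n)⁻¹ ↔ B' = o' * B * oᵀ) := by
    intro i j B B' o o' hB hB' ho ho' h h'
    have c1 : (⟨dblMat o', ho'⟩ : Sp n) * rot n j = rot n j * ⟨dblMat o', ho'⟩ :=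
      Subtype.ext (rot_mul_dblMat j o').symm
    have c2 : (⟨dblMat o, ho⟩ : Sp n) * rot n i = rot n i * ⟨dblMat o, ho⟩ :=
      Subtype.ext (rot_mul_dblMat i o).symm
    have c3 : (rot n i)⁻¹ * (⟨dblMat o, ho⟩ : Sp n)⁻¹ =
        (⟨dblMat o, ho⟩ : Sp n)⁻¹ * (rot n i)⁻¹ := by
      rw [← _root_.mul_inv_rev, ← _root_.mul_inv_rev, c2]
    have e1 : (⟨dblMat o', ho'⟩ : Sp n) * (rot n j * ⟨swapMat B, hB⟩ * (rot n i)⁻¹) *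
          (⟨dblMat o, ho⟩ : Sp n)⁻¹ =
        rot n j * (⟨dblMat o', ho'⟩ * ⟨swapMat B, hB⟩ * (⟨dblMat o, ho⟩ : Sp n)⁻¹) *
          (rot n i)⁻¹ := by
      rw [mul_assoc, mul_assoc, mul_assoc, c3, ← mul_assoc, ← mul_assoc, c1]
      simp only [mul_assoc]
    rw [e1, mul_left_inj, mul_right_inj, eq_mul_inv_iff_mul_eq, ← Subtype.coe_inj]
    change swapMat B' * dblMat o = dblMat o' * swapMat B ↔ _
    rw [dblMat_mul_swapMat h h']
    constructor
    · intro e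
      have hinv : dblMat o * (dblMat o)⁻¹ = 1 :=
        mul_nonsing_inv _ (SymplecticGroup.symplectic_det ho)
      have := congrArg (· * (dblMat o)⁻¹) e
      simp only [Matrix.mul_assoc, hinv, Matrix.mul_one] at this
      rw [swapMat_injective this, Matrix.mul_assoc]
    · rintro rfl
      rfl
  constructor
  · rintro ⟨h, h1, h2⟩
    choose o ho hh using fun t => eq_dblMat (g := h t) fun i => h2 (t, i)
    refine ⟨o, ho, fun d hd => ?_⟩
    have := h1 d
    change β'.trans d = _ * β.trans d * _ at this
    rw [β.trans_of_ne hd, β'.trans_of_ne hd,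
      show h (S.glue d).1 = ⟨dblMat (o (S.glue d).1), dblMat_mem (ho _)⟩ from
        Subtype.ext (hh _),
      show h d.1 = ⟨dblMat (o d.1), dblMat_mem (ho _)⟩ from Subtype.ext (hh _)] at this
    exact (key _ _ _ _ _ _ _ _ _ _ (ho _) (ho _)).1 this
  · rintro ⟨o, ho, h⟩
    refine ⟨fun t => ⟨dblMat (o t), dblMat_mem (ho t)⟩, fun d => ?_,
      fun c => dblMat_movesTo _ _⟩
    change β'.trans d = _ * β.trans d * _
    by_cases hd : S.glue d = d
    · rw [β.trans_of_eq hd, β'.trans_of_eq hd, hd, mul_one, mul_inv_cancel]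
    · rw [β.trans_of_ne hd, β'.trans_of_ne hd]
      exact (key _ _ _ _ _ _ _ _ _ _ (ho _) (ho _)).2 (h d hd)

end EdgeData

namespace FramedLocalSystem

/-- `h` is a family of symplectic bases in which the Lagrangians form the standard triples. -/
def IsFrame (x : S.FramedLocalSystem n) (h : F → Sp n) : Prop :=
  ∀ t i, MovesTo (h t) (stdLag n i) (x.lag (t, i))

theorem IsMaximal.exists_isFrame_one {x : S.FramedLocalSystem 1} (hx : x.IsMaximal) :
    ∃ h, x.IsFrame h := by
  rw [isMaximal_iff] at hx
  choose h hh using fun t => exists_frame_one (L := fun i => x.lag (t, i)) (hx (t, 0))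
  exact ⟨h, hh⟩

theorem IsMaximal.exists_isFrame_two {x : S.FramedLocalSystem 2} (hx : x.IsMaximal) :
    ∃ h, x.IsFrame h := by
  rw [isMaximal_iff] at hx
  choose h hh using fun t => exists_frame_two (L := fun i => x.lag (t, i)) (hx (t, 0))
  exact ⟨h, hh⟩

/-- The change of trivialization across `d`, in the frames `h` and rotated such that it exchanges
the first two standard Lagrangians. -/
def rotatedTrans (x : S.FramedLocalSystem n) (h : F → Sp n) (d : F × ZMod 3) : Sp n :=
  (h (S.glue d).1 * rot n (S.glue d).2)⁻¹ * (x.trans d * (h d.1 * rot n d.2))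

theorem IsFrame.movesTo_rot {x : S.FramedLocalSystem n} {h : F → Sp n} (hh : x.IsFrame h)
    (c : F × ZMod 3) (i : ZMod 3) :
    MovesTo (h c.1 * rot n c.2) (stdLag n i) (x.lag (c.1, i + c.2)) :=
  movesTo_mul (rho_pow_val_movesTo _ _) (hh _ _)

theorem IsFrame.rotatedTrans_movesTo_zero {x : S.FramedLocalSystem n} {h : F → Sp n}
    (hh : x.IsFrame h) {d : F × ZMod 3} (hd : S.glue d ≠ d) :
    MovesTo (x.rotatedTrans h d) (stdLag n 0) (stdLag n 1) := by
  have h1 := hh.movesTo_rot d 0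
  rw [zero_add] at h1
  have h2 := hh.movesTo_rot (S.glue d) 1
  rw [add_comm] at h2
  exact movesTo_mul (movesTo_mul h1 (x.flat d hd)) (movesTo_inv h2)

theorem rotatedTrans_glue (x : S.FramedLocalSystem n) (h : F → Sp n) {d : F × ZMod 3}
    (hd : S.glue d ≠ d) : x.rotatedTrans h (S.glue d) = (x.rotatedTrans h d)⁻¹ := by
  have h1 := (x.isLocalSystem d).1 hd
  rw [rotatedTrans, rotatedTrans, S.glue_glue, eq_inv_of_mul_eq_one_left h1]
  simp only [_root_.mul_inv_rev, inv_inv, mul_assoc]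

theorem IsFrame.rotatedTrans_movesTo_one {x : S.FramedLocalSystem n} {h : F → Sp n}
    (hh : x.IsFrame h) {d : F × ZMod 3} (hd : S.glue d ≠ d) :
    MovesTo (x.rotatedTrans h d) (stdLag n 1) (stdLag n 0) := by
  have := movesTo_inv (hh.rotatedTrans_movesTo_zero (glue_ne_of_ne hd))
  rwa [rotatedTrans_glue x h hd, inv_inv] at this

/-- The edge matrix of the side `d` in the frames `h`. -/
def edgeMat (x : S.FramedLocalSystem n) (h : F → Sp n) (d : F × ZMod 3) :
    Matrix (Fin n) (Fin n) ℝ :=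
  (x.rotatedTrans h d).1.toBlocks₁₂

theorem IsFrame.rotatedTrans_eq {x : S.FramedLocalSystem n} {h : F → Sp n} (hh : x.IsFrame h)
    {d : F × ZMod 3} (hd : S.glue d ≠ d) : (x.rotatedTrans h d).1 = swapMat (x.edgeMat h d) :=
  (eq_swapMat (hh.rotatedTrans_movesTo_zero hd) (hh.rotatedTrans_movesTo_one hd)).2

theorem IsFrame.isUnit_edgeMat {x : S.FramedLocalSystem n} {h : F → Sp n} (hh : x.IsFrame h)
    {d : F × ZMod 3} (hd : S.glue d ≠ d) : IsUnit (x.edgeMat h d).det :=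
  (eq_swapMat (hh.rotatedTrans_movesTo_zero hd) (hh.rotatedTrans_movesTo_one hd)).1

/-- The edge matrices of a framed local system in the frames `h`. -/
def edgeData (x : S.FramedLocalSystem n) {h : F → Sp n} (hh : x.IsFrame h) : EdgeData S n where
  mat := x.edgeMat h
  isUnit d hd := hh.isUnit_edgeMat hd
  glue d hd := by
    have h1 : (x.rotatedTrans h (S.glue d)).1 * (x.rotatedTrans h d).1 = 1 := by
      rw [rotatedTrans_glue x h hd]
      exact congrArg Subtype.val (inv_mul_cancel (x.rotatedTrans h d))
    have h2 := swapMat_mul_swapMat (hh.isUnit_edgeMat hd)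
    rw [hh.rotatedTrans_eq hd, hh.rotatedTrans_eq (glue_ne_of_ne hd)] at h1
    refine swapMat_injective ?_
    rw [← inv_eq_left_inv h1, ← inv_eq_left_inv h2]

theorem iso_edgeData_system (x : S.FramedLocalSystem n) {h : F → Sp n} (hh : x.IsFrame h) :
    x.Iso (x.edgeData hh).system := by
  refine ⟨fun t => (h t)⁻¹, fun d => ?_, fun c => movesTo_inv (hh c.1 c.2)⟩
  change (x.edgeData hh).trans d = _
  by_cases hd : S.glue d = d
  · rw [EdgeData.trans_of_eq _ hd, hd, (x.isLocalSystem d).2 hd, mul_one, inv_inv, inv_mul_cancel]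
  · rw [EdgeData.trans_of_ne _ hd]
    have h1 : (⟨swapMat ((x.edgeData hh).mat d), swapMat_mem ((x.edgeData hh).isUnit d hd)⟩ : Sp n)
        = x.rotatedTrans h d := Subtype.ext (hh.rotatedTrans_eq hd).symm
    rw [h1, rotatedTrans]
    group

theorem edgeMat_eq (x : S.FramedLocalSystem n) (h : F → Sp n) (d : F × ZMod 3) :
    x.edgeMat h d = -(((h (S.glue d).1).1 * (rot n (S.glue d).2).1 * stdMat n 1)ᵀ * sympForm n *
      ((x.trans d).1 * ((h d.1).1 * (rot n d.2).1 * stdMat n 1))) := by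
  rw [edgeMat, rotatedTrans, toBlocks₁₂_inv_mul]
  change -(((h (S.glue d).1).1 * (rot n (S.glue d).2).1 * stdMat n 1)ᵀ * sympForm n *
      ((x.trans d).1 * ((h d.1).1 * (rot n d.2).1) * stdMat n 1)) = _
  simp only [Matrix.mul_assoc]

end FramedLocalSystem

end IdealSurface

end

/-! ### A spanning tree of the dual graph. -/

noncomputable section

namespace IdealSurface

variable {F : Type*} [Fintype F] {S : IdealSurface F}

/-- A spanning tree of the dual graph, directed away from a root, and an orientation of the
internal edges which extends the one of the tree. The edges `K.free j` are those outside the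
tree. -/
structure Skeleton (S : IdealSurface F) (m b : ℕ) where
  root : F
  dart : F → F × ZMod 3
  depth : F → ℕ
  glue_dart : ∀ t, t ≠ root → (S.glue (dart t)).1 = t
  depth_lt : ∀ t, t ≠ root → depth (dart t).1 < depth t
  edge : Fin m → F × ZMod 3
  edge_ne : ∀ e, S.glue (edge e) ≠ edge e
  edge_injective : Function.Injective edge
  glue_edge_ne : ∀ e e', S.glue (edge e) ≠ edge e'
  exists_edge : ∀ d, S.glue d ≠ d → (∃ e, edge e = d) ∨ ∃ e, S.glue (edge e) = d
  dart_edge : ∀ t, t ≠ root → ∃ e, edge e = dart t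
  free : Fin b → Fin m
  free_injective : Function.Injective free
  tree_iff : ∀ e, (∀ j, free j ≠ e) ↔ ∃ t, t ≠ root ∧ dart t = edge e

namespace Skeleton

variable {m b : ℕ} (K : Skeleton S m b)

/-- The edge `e` belongs to the tree. -/
def IsTree (e : Fin m) : Prop := ∀ j, K.free j ≠ e

theorem exists_free {e : Fin m} (he : ¬ K.IsTree e) : ∃ j, K.free j = e := by
  unfold IsTree at he
  push Not at he
  exact he

/-- Following `dart` towards the root strictly lowers the depth. -/
theorem tree_induction {P : F → Prop} (h0 : P K.root)
    (h1 : ∀ e, K.IsTree e → P (K.edge e).1 → P (S.glue (K.edge e)).1) (t : F) : P t := by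
  induction hn : K.depth t using Nat.strong_induction_on generalizing t with
  | _ n ih =>
    by_cases ht : t = K.root
    · rwa [ht]
    · obtain ⟨e, he⟩ := K.dart_edge t ht
      have h2 := h1 e ((K.tree_iff e).2 ⟨t, ht, he.symm⟩)
      rw [he, K.glue_dart t ht] at h2
      exact h2 (ih _ (hn ▸ K.depth_lt t ht) _ rfl)

open Classical in
/-- The product of the values of `φ` along the path from the root to `t`. -/
def gauge {M : Type*} [Monoid M] (φ : F × ZMod 3 → M) (t : F) : M :=
  if _h : t = K.root then 1 else gauge φ (K.dart t).1 * φ (K.dart t)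
termination_by K.depth t
decreasing_by exact K.depth_lt t _h

theorem gauge_root {M : Type*} [Monoid M] (φ : F × ZMod 3 → M) : K.gauge φ K.root = 1 := by
  rw [gauge, dif_pos rfl]

theorem gauge_glue {M : Type*} [Monoid M] (φ : F × ZMod 3 → M) {e : Fin m} (he : K.IsTree e) :
    K.gauge φ (S.glue (K.edge e)).1 = K.gauge φ (K.edge e).1 * φ (K.edge e) := by
  obtain ⟨t, ht, hte⟩ := (K.tree_iff e).1 he
  rw [← hte, K.glue_dart t ht]
  conv_lhs => rw [gauge, dif_neg ht]

end Skeleton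

/-- The triangle `t` can be reached from the root by crossing `k` sides. -/
def Reach (S : IdealSurface F) (root : F) : ℕ → F → Prop
  | 0, t => t = root
  | k + 1, t => ∃ d, Reach S root k d.1 ∧ (S.glue d).1 = t

theorem exists_reach (S : IdealSurface F) (root t : F) : ∃ k, S.Reach root k t := by
  induction S.connected root t with
  | refl => exact ⟨0, rfl⟩
  | tail _ h ih =>
    obtain ⟨k, hk⟩ := ih
    obtain ⟨i, j, h⟩ := h
    exact ⟨k + 1, (_, i), hk, congrArg Prod.fst h⟩

open Classical in
-- Breadth-first search: the depth is the distance to the root, and the last side crossed on a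
-- shortest path comes from a triangle of smaller depth.
theorem exists_tree (S : IdealSurface F) : ∃ (root : F) (dart : F → F × ZMod 3) (depth : F → ℕ),
    (∀ t, t ≠ root → (S.glue (dart t)).1 = t) ∧
    (∀ t, t ≠ root → depth (dart t).1 < depth t) := by
  obtain ⟨root⟩ := S.nonempty
  let depth : F → ℕ := fun t => Nat.find (S.exists_reach root t)
  have key : ∀ t, ∃ d, t ≠ root → (S.glue d).1 = t ∧ depth d.1 < depth t := by
    intro t
    have h := Nat.find_spec (S.exists_reach root t)
    rcases hk : Nat.find (S.exists_reach root t) with _ | k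
    · rw [hk] at h
      exact ⟨(t, 0), fun ht => absurd h ht⟩
    · rw [hk] at h
      obtain ⟨d, hd, hdt⟩ := h
      refine ⟨d, fun _ => ⟨hdt, ?_⟩⟩
      change Nat.find _ < Nat.find _
      rw [hk]
      exact Nat.lt_succ_of_le (Nat.find_min' _ hd)
  choose dart hdart using key
  exact ⟨root, dart, depth, fun t ht => (hdart t ht).1, fun t ht => (hdart t ht).2⟩

open Classical in
-- The tree has one edge for each triangle other than the root, which gives the first count. The
-- second counts the `3 |F|` sides: once for an external edge, twice for an internal one.
theorem exists_skeleton (S : IdealSurface F) : ∃ b : ℕ, Nonempty (Skeleton S S.numInternal b) ∧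
    b + Fintype.card F = S.numInternal + 1 ∧
    3 * Fintype.card F = S.numMarked + 2 * S.numInternal := by
  obtain ⟨root, dart, depth, h1, h2⟩ := S.exists_tree
  have hglue : Function.Injective S.glue := fun d d' h => by
    rw [← S.glue_glue d, h, S.glue_glue]
  let isT : F × ZMod 3 → Prop := fun d => ∃ t, t ≠ root ∧ dart t = d
  have hTne : ∀ d, isT d → S.glue d ≠ d := by
    rintro _ ⟨t, ht, rfl⟩ h
    have h3 := h1 t ht
    have h4 := h2 t ht
    rw [h] at h3
    rw [h3] at h4
    exact lt_irrefl _ h4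
  -- If both orientations were darts of the tree, each of the two triangles would have smaller depth
  -- than the other.
  have hTT : ∀ d, isT d → ¬ isT (S.glue d) := by
    rintro _ ⟨t, ht, rfl⟩ ⟨s, hs, hst⟩
    have h3 := h2 t ht
    have h4 := h2 s hs
    have h5 := h1 s hs
    rw [hst, S.glue_glue] at h5
    rw [hst, h1 t ht] at h4
    rw [h5] at h3
    exact lt_asymm h3 h4
  -- An arbitrary numbering orients the edges outside the tree.
  let key : F × ZMod 3 ≃ Fin (Fintype.card (F × ZMod 3)) := Fintype.equivFin _
  let pos : F × ZMod 3 → Prop := fun d => S.glue d ≠ d ∧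
    (isT d ∨ (¬ isT d ∧ ¬ isT (S.glue d) ∧ key d < key (S.glue d)))
  have hpos : ∀ d, S.glue d ≠ d → pos d ∨ pos (S.glue d) := by
    intro d hd
    have hd' : S.glue (S.glue d) ≠ S.glue d := glue_ne_of_ne hd
    by_cases t1 : isT d
    · exact Or.inl ⟨hd, Or.inl t1⟩
    by_cases t2 : isT (S.glue d)
    · exact Or.inr ⟨hd', Or.inl t2⟩
    rcases lt_or_gt_of_ne (fun h => hd (key.injective h).symm : key d ≠ key (S.glue d)) with h | h
    · exact Or.inl ⟨hd, Or.inr ⟨t1, t2, h⟩⟩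
    · exact Or.inr ⟨hd', Or.inr ⟨t2, by rwa [S.glue_glue], by rwa [S.glue_glue]⟩⟩
  have hnot : ∀ d, pos d → ¬ pos (S.glue d) := by
    rintro d ⟨hd, h⟩ ⟨-, h'⟩
    rw [S.glue_glue] at h'
    rcases h with h | ⟨h3, h4, h5⟩
    · rcases h' with h' | h'
      · exact hTT d h h'
      · exact h'.2.1 h
    · rcases h' with h' | h'
      · exact h4 h'
      · exact lt_asymm h5 h'.2.2
  let P : Finset (F × ZMod 3) := Finset.univ.filter pos
  have hP : ∀ d, d ∈ P ↔ pos d := fun d => by simp [P]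
  have hPcard : P.card = S.numInternal := by
    rw [numInternal, ← Set.ncard_coe_finset]
    have : {e : Set (F × ZMod 3) | ∃ d, S.glue d ≠ d ∧ e = {d, S.glue d}} =
        (fun d => ({d, S.glue d} : Set (F × ZMod 3))) '' (P : Set (F × ZMod 3)) := by
      ext e
      constructor
      · rintro ⟨d, hd, rfl⟩
        rcases hpos d hd with h | h
        · exact ⟨d, (hP d).2 h, rfl⟩
        · refine ⟨S.glue d, (hP _).2 h, ?_⟩
          simp only [S.glue_glue]
          exact Set.pair_comm _ _
      · rintro ⟨d, hd, rfl⟩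
        exact ⟨d, ((hP d).1 hd).1, rfl⟩
    rw [this, Set.InjOn.ncard_image]
    intro d hd d' hd' h
    have h3 : d ∈ ({d', S.glue d'} : Set (F × ZMod 3)) := by
      have : d ∈ ({d, S.glue d} : Set (F × ZMod 3)) := Set.mem_insert _ _
      rwa [show ({d, S.glue d} : Set (F × ZMod 3)) = {d', S.glue d'} from h] at this
    rcases h3 with h3 | h3
    · exact h3
    · rw [Set.mem_singleton_iff] at h3
      exact absurd ((hP d).1 hd) (h3 ▸ hnot d' ((hP d').1 hd'))
  let Tr : Finset (F × ZMod 3) := (Finset.univ.erase root).image dart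
  have hTr : ∀ d, d ∈ Tr ↔ isT d := fun d => by simp [Tr, isT]
  have hTrP : Tr ⊆ P := fun d hd =>
    (hP d).2 ⟨hTne d ((hTr d).1 hd), Or.inl ((hTr d).1 hd)⟩
  have hTrcard : Tr.card + 1 = Fintype.card F := by
    rw [Finset.card_image_of_injOn, Finset.card_erase_of_mem (Finset.mem_univ _), Finset.card_univ,
      Nat.sub_add_cancel (Fintype.card_pos_iff.2 ⟨root⟩)]
    intro t ht s hs h
    rw [← h1 t (by simpa using ht), h, h1 s (by simpa using hs)]
  have hTrle := Finset.card_le_card hTrP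
  have hfree : (P \ Tr).card + Tr.card = P.card := Finset.card_sdiff_add_card_eq_card hTrP
  have hcount : 3 * Fintype.card F = S.numMarked + 2 * S.numInternal := by
    have e1 : Fintype.card (F × ZMod 3) = 3 * Fintype.card F := by
      rw [Fintype.card_prod, ZMod.card, mul_comm]
    have e2 : S.numMarked = (Finset.univ.filter fun d => S.glue d = d).card := by
      rw [numMarked, Nat.card_eq_fintype_card, Fintype.card_subtype]
    have e3 : (Finset.univ.filter fun d => ¬ S.glue d = d) = P ∪ P.image S.glue := by
      ext d
      simp only [Finset.mem_filter, Finset.mem_univ, true_and, Finset.mem_union, Finset.mem_image,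
        hP]
      constructor
      · intro hd
        rcases hpos d hd with h | h
        · exact Or.inl h
        · exact Or.inr ⟨_, h, S.glue_glue d⟩
      · rintro (h | ⟨d, h, rfl⟩)
        · exact h.1
        · exact glue_ne_of_ne h.1
    have e4 : Disjoint P (P.image S.glue) := by
      rw [Finset.disjoint_left]
      intro d hd hd'
      obtain ⟨d', h', rfl⟩ := Finset.mem_image.1 hd'
      exact hnot d' ((hP _).1 h') ((hP _).1 hd)
    have e5 := Finset.card_filter_add_card_filter_not (s := Finset.univ) fun d => S.glue d = d
    rw [e3, Finset.card_union_of_disjoint e4, Finset.card_image_of_injective _ hglue, ← e2,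
      Finset.card_univ, e1, hPcard] at e5
    omega
  let eP : P ≃ Fin S.numInternal := P.equivFinOfCardEq hPcard
  let eF : ↥(P \ Tr) ≃ Fin (P \ Tr).card := (P \ Tr).equivFin
  have hedge : ∀ d (h : pos d), ((eP.symm (eP ⟨d, (hP d).2 h⟩)) : F × ZMod 3) = d := fun d h => by
    rw [Equiv.symm_apply_apply]
  refine ⟨(P \ Tr).card, ⟨{
    root := root
    dart := dart
    depth := depth
    glue_dart := h1
    depth_lt := h2
    edge := fun e => (eP.symm e).1
    edge_ne := fun e => ((hP _).1 (eP.symm e).2).1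
    edge_injective := Subtype.val_injective.comp eP.symm.injective
    glue_edge_ne := fun e e' h => hnot _ ((hP _).1 (eP.symm e).2) (h ▸ (hP _).1 (eP.symm e').2)
    exists_edge := fun d hd => by
      rcases hpos d hd with h | h
      · exact Or.inl ⟨_, hedge d h⟩
      · refine Or.inr ⟨_, (congrArg S.glue (hedge _ h)).trans (S.glue_glue d)⟩
    dart_edge := fun t ht => ⟨_, hedge _ ((hP _).1 (hTrP ((hTr _).2 ⟨t, ht, rfl⟩)))⟩
    free := fun j => eP ⟨(eF.symm j).1, Finset.sdiff_subset (eF.symm j).2⟩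
    free_injective := fun j j' h => by
      have := congrArg Subtype.val (eP.injective h)
      exact eF.symm.injective (Subtype.ext this)
    tree_iff := fun e => ?_ }⟩, ?_, hcount⟩
  · have : isT (eP.symm e).1 ↔ ∃ t, t ≠ root ∧ dart t = (eP.symm e).1 := Iff.rfl
    rw [← this]
    constructor
    · intro h
      by_contra hT
      have hmem : (eP.symm e).1 ∈ P \ Tr :=
        Finset.mem_sdiff.2 ⟨(eP.symm e).2, fun h' => hT ((hTr _).1 h')⟩
      refine h (eF ⟨_, hmem⟩) ?_
      simp
    · rintro hT j rfl
      rw [Equiv.symm_apply_apply] at hT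
      exact (Finset.mem_sdiff.1 (eF.symm j).2).2 ((hTr _).2 hT)
  · omega

end IdealSurface

end

/-! ### Real matrices of size two in complex notation, and the slice. -/

noncomputable section

open Matrix ComplexConjugate

/-- The matrix of the real linear map `z ↦ a z + b z̄` of `ℂ = ℝ²`. -/
def cmat (a b : ℂ) : Matrix (Fin 2) (Fin 2) ℝ :=
  !![a.re + b.re, -a.im + b.im; a.im + b.im, a.re - b.re]

/-- The coefficient of `z` in the linear map with matrix `B`. -/
def holPart (B : Matrix (Fin 2) (Fin 2) ℝ) : ℂ :=
  ⟨(B 0 0 + B 1 1) / 2, (B 1 0 - B 0 1) / 2⟩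

/-- The coefficient of `z̄` in the linear map with matrix `B`. -/
def antiPart (B : Matrix (Fin 2) (Fin 2) ℝ) : ℂ :=
  ⟨(B 0 0 - B 1 1) / 2, (B 1 0 + B 0 1) / 2⟩

theorem cmat_holPart_antiPart (B : Matrix (Fin 2) (Fin 2) ℝ) :
    cmat (holPart B) (antiPart B) = B := by
  ext i j
  fin_cases i <;> fin_cases j <;> simp [cmat, holPart, antiPart] <;> ring

theorem holPart_cmat (a b : ℂ) : holPart (cmat a b) = a := by
  apply Complex.ext <;> simp [cmat, holPart]

theorem antiPart_cmat (a b : ℂ) : antiPart (cmat a b) = b := by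
  apply Complex.ext <;> simp [cmat, antiPart]
  ring

theorem cmat_inj {a b a' b' : ℂ} : cmat a b = cmat a' b' ↔ a = a' ∧ b = b' := by
  constructor
  · intro h
    have h1 := congrArg holPart h
    have h2 := congrArg antiPart h
    rw [holPart_cmat, holPart_cmat] at h1
    rw [antiPart_cmat, antiPart_cmat] at h2
    exact ⟨h1, h2⟩
  · rintro ⟨rfl, rfl⟩
    rfl

theorem cmat_mul (a b a' b' : ℂ) :
    cmat a b * cmat a' b' = cmat (a * a' + b * conj b') (a * b' + b * conj a') := by
  ext i j
  fin_cases i <;> fin_cases j <;> simp [cmat, mul_apply, Fin.sum_univ_two] <;> ring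

theorem cmat_transpose (a b : ℂ) : (cmat a b)ᵀ = cmat (conj a) b := by
  ext i j
  fin_cases i <;> fin_cases j <;> simp [cmat]

theorem cmat_one_zero : cmat 1 0 = 1 := by
  ext i j
  fin_cases i <;> fin_cases j <;> simp [cmat]

theorem det_cmat (a b : ℂ) : (cmat a b).det = Complex.normSq a - Complex.normSq b := by
  rw [cmat, det_fin_two_of, Complex.normSq_apply, Complex.normSq_apply]
  ring

theorem isUnit_det_cmat {a b : ℂ} : IsUnit (cmat a b).det ↔ ‖a‖ ≠ ‖b‖ := by
  rw [det_cmat, isUnit_iff_ne_zero, sub_ne_zero, Complex.normSq_eq_norm_sq,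
    Complex.normSq_eq_norm_sq, not_iff_not, sq_eq_sq₀ (norm_nonneg _) (norm_nonneg _)]

theorem conj_mul_self {c : ℂ} (hc : ‖c‖ = 1) : conj c * c = 1 := by
  rw [mul_comm, Complex.mul_conj, Complex.normSq_eq_norm_sq, hc]
  simp

theorem transpose_mul_cmat_zero {c : ℂ} (hc : ‖c‖ = 1) : (cmat c 0)ᵀ * cmat c 0 = 1 := by
  rw [cmat_transpose, cmat_mul, conj_mul_self hc, ← cmat_one_zero]
  simp

theorem transpose_mul_cmat_zero_left {c : ℂ} (hc : ‖c‖ = 1) : (cmat 0 c)ᵀ * cmat 0 c = 1 := by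
  rw [cmat_transpose, cmat_mul, mul_comm c, conj_mul_self hc, ← cmat_one_zero]
  simp

/-- The antilinear part of `oᵀ * o` is twice the product of one part of `o` with the conjugate of
the other, so one of the two vanishes. -/
theorem eq_cmat_of_transpose_mul {o : Matrix (Fin 2) (Fin 2) ℝ} (ho : oᵀ * o = 1) :
    ∃ c : ℂ, ‖c‖ = 1 ∧ (o = cmat c 0 ∨ o = cmat 0 c) := by
  rw [← cmat_holPart_antiPart o, cmat_transpose, cmat_mul, ← cmat_one_zero, cmat_inj] at ho
  obtain ⟨h1, h2⟩ := ho
  rw [← cmat_holPart_antiPart o]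
  have h3 : conj (holPart o) * antiPart o = 0 := by
    have : (2 : ℂ) * (conj (holPart o) * antiPart o) = 0 := by rw [← h2]; ring
    simpa using this
  rw [mul_eq_zero, map_eq_zero] at h3
  have key : ∀ c : ℂ, c * conj c = 1 → ‖c‖ = 1 := fun c hc => by
    rw [Complex.mul_conj, Complex.normSq_eq_norm_sq, ← Complex.ofReal_one, Complex.ofReal_inj] at hc
    nlinarith [norm_nonneg c]
  rcases h3 with h3 | h3
  · rw [h3] at h1 ⊢
    exact ⟨_, key _ (by simpa using h1), Or.inr rfl⟩
  · rw [h3] at h1 ⊢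
    exact ⟨_, key _ (by simpa [mul_comm] using h1), Or.inl rfl⟩

/-- For a common rotation `c = c'` of modulus one, the linear part is fixed and the antilinear part
is multiplied by `c²`. -/
theorem conj_cmat_rot (c c' a b : ℂ) :
    cmat c' 0 * cmat a b * (cmat c 0)ᵀ = cmat (c' * a * conj c) (c' * b * c) := by
  rw [cmat_transpose, cmat_mul, cmat_mul]
  simp

theorem conj_cmat_refl (c c' a b : ℂ) :
    cmat 0 c' * cmat a b * (cmat 0 c)ᵀ = cmat (c' * conj a * conj c) (c' * conj b * c) := by
  rw [cmat_transpose, cmat_mul, cmat_mul]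
  simp

/-- Polar decomposition: the condition `‖z‖ < p` says that `cmat p z` is positive definite
symmetric. The orthogonal factor is a rotation or a reflection according to which part of `B` has
the larger modulus. -/
theorem exists_normalizer {B : Matrix (Fin 2) (Fin 2) ℝ} (hB : IsUnit B.det) :
    ∃ R : Matrix (Fin 2) (Fin 2) ℝ, Rᵀ * R = 1 ∧ ∃ (p : ℝ) (z : ℂ), ‖z‖ < p ∧ R * B = cmat p z := by
  obtain ⟨a, b, rfl⟩ : ∃ a b, B = cmat a b := ⟨_, _, (cmat_holPart_antiPart B).symm⟩
  rw [isUnit_det_cmat] at hB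
  have key : ∀ a : ℂ, a ≠ 0 → ‖a / ‖a‖‖ = 1 := fun a ha => by
    rw [norm_div, Complex.norm_real, norm_norm, div_self (norm_ne_zero_iff.2 ha)]
  have key2 : ∀ a : ℂ, a ≠ 0 → a / ‖a‖ * conj a = (‖a‖ : ℂ) := fun a ha => by
    rw [div_mul_eq_mul_div, Complex.mul_conj, Complex.normSq_eq_norm_sq, Complex.ofReal_pow, sq,
      mul_div_assoc, div_self, mul_one]
    simpa using ha
  rcases lt_or_gt_of_ne hB with h | h
  · have hb : b ≠ 0 := norm_pos_iff.1 ((norm_nonneg a).trans_lt h)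
    refine ⟨cmat 0 (b / ‖b‖), transpose_mul_cmat_zero_left (key b hb), ‖b‖, b / ‖b‖ * conj a, ?_, ?_⟩
    · rw [norm_mul, key b hb, one_mul, Complex.norm_conj]
      exact h
    · rw [cmat_mul, key2 b hb]
      simp
  · have ha : a ≠ 0 := norm_pos_iff.1 ((norm_nonneg b).trans_lt h)
    have hk := key a ha
    have hk' : ‖conj (a / ‖a‖)‖ = 1 := by rw [Complex.norm_conj]; exact hk
    refine ⟨cmat (conj (a / ‖a‖)) 0, transpose_mul_cmat_zero hk', ‖a‖, conj (a / ‖a‖) * b, ?_, ?_⟩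
    · rw [norm_mul, hk', one_mul]
      exact h
    · have := congrArg conj (key2 a ha)
      rw [map_mul, Complex.conj_conj, Complex.conj_ofReal] at this
      rw [cmat_mul, this]
      simp

/-- The normal form survives conjugation, which is what the gauge of the parent triangle does to a
normalized tree edge. -/
theorem exists_conj_cmat_ofReal {o : Matrix (Fin 2) (Fin 2) ℝ} (ho : oᵀ * o = 1) (p : ℝ) (z : ℂ) :
    ∃ z' : ℂ, ‖z'‖ = ‖z‖ ∧ o * cmat p z * oᵀ = cmat p z' := by
  obtain ⟨c, hc, rfl | rfl⟩ := eq_cmat_of_transpose_mul ho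
  · refine ⟨c * z * c, by simp [hc], ?_⟩
    rw [conj_cmat_rot, mul_comm c, mul_assoc, mul_comm c, conj_mul_self hc, mul_one]
  · refine ⟨c * conj z * c, by simp [hc], ?_⟩
    rw [conj_cmat_refl, Complex.conj_ofReal, mul_comm c, mul_assoc, mul_comm c, conj_mul_self hc,
      mul_one]

namespace IdealSurface

variable {F : Type*} [Fintype F] {S : IdealSurface F}

theorem EdgeData.system_iso_iff_edge {m b n : ℕ} (K : Skeleton S m b) (β β' : EdgeData S n) :
    β.system.Iso β'.system ↔ ∃ o : F → Matrix (Fin n) (Fin n) ℝ, (∀ t, (o t)ᵀ * o t = 1) ∧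
      ∀ e, β'.mat (K.edge e) =
        o (S.glue (K.edge e)).1 * β.mat (K.edge e) * (o (K.edge e).1)ᵀ := by
  rw [EdgeData.system_iso_iff]
  refine exists_congr fun o => and_congr_right fun ho => ?_
  constructor
  · intro h e
    exact h _ (K.edge_ne e)
  · intro h d hd
    rcases K.exists_edge d hd with ⟨e, rfl⟩ | ⟨e, rfl⟩
    · exact h e
    · rw [β.glue _ (K.edge_ne e), β'.glue _ (K.edge_ne e), h e, S.glue_glue]
      simp [Matrix.mul_assoc]

namespace Skeleton

variable {m b : ℕ} (K : Skeleton S m b)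

section Extend

variable {n : ℕ}

open Classical in
/-- Extension to all sides of matrices given for the oriented edges. -/
def extend (M : Fin m → Matrix (Fin n) (Fin n) ℝ) (d : F × ZMod 3) : Matrix (Fin n) (Fin n) ℝ :=
  (∑ e, if K.edge e = d then M e else 0) + ∑ e, if S.glue (K.edge e) = d then -(M e)ᵀ else 0

theorem extend_edge (M : Fin m → Matrix (Fin n) (Fin n) ℝ) (e : Fin m) :
    K.extend M (K.edge e) = M e := by
  rw [extend, Finset.sum_eq_single e, Finset.sum_eq_zero, if_pos rfl, add_zero]
  · intro e' _
    rw [if_neg (K.glue_edge_ne e' e)]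
  · intro e' _ he
    rw [if_neg fun h => he (K.edge_injective h)]
  · simp

theorem extend_glue_edge (M : Fin m → Matrix (Fin n) (Fin n) ℝ) (e : Fin m) :
    K.extend M (S.glue (K.edge e)) = -(M e)ᵀ := by
  rw [extend, Finset.sum_eq_zero, Finset.sum_eq_single e, if_pos rfl, zero_add]
  · intro e' _ he
    refine if_neg fun h => he (K.edge_injective ?_)
    rw [← S.glue_glue (K.edge e'), h, S.glue_glue]
  · simp
  · intro i _
    rw [if_neg (K.glue_edge_ne e i).symm]

/-- The edge data with given matrices on the oriented edges. -/
def edgeData (M : Fin m → Matrix (Fin n) (Fin n) ℝ) (hM : ∀ e, IsUnit (M e).det) :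
    EdgeData S n where
  mat := K.extend M
  isUnit d hd := by
    rcases K.exists_edge d hd with ⟨e, rfl⟩ | ⟨e, rfl⟩
    · rw [K.extend_edge]
      exact hM e
    · rw [K.extend_glue_edge, det_neg, det_transpose]
      exact ((isUnit_one.neg).pow _).mul (hM e)
  glue d hd := by
    rcases K.exists_edge d hd with ⟨e, rfl⟩ | ⟨e, rfl⟩
    · rw [K.extend_edge, K.extend_glue_edge]
    · rw [S.glue_glue, K.extend_edge, K.extend_glue_edge, transpose_neg, transpose_transpose,
        neg_neg]

theorem edgeData_mat_edge (M : Fin m → Matrix (Fin n) (Fin n) ℝ) (hM : ∀ e, IsUnit (M e).det)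
    (e : Fin m) : (K.edgeData M hM).mat (K.edge e) = M e :=
  K.extend_edge M e

theorem system_iso_edgeData (β : EdgeData S n) {M : Fin m → Matrix (Fin n) (Fin n) ℝ}
    (hM : ∀ e, IsUnit (M e).det) {o : F → Matrix (Fin n) (Fin n) ℝ} (ho : ∀ t, (o t)ᵀ * o t = 1)
    (h : ∀ e, M e = o (S.glue (K.edge e)).1 * β.mat (K.edge e) * (o (K.edge e).1)ᵀ) :
    β.system.Iso (K.edgeData M hM).system := by
  rw [EdgeData.system_iso_iff_edge K]
  exact ⟨o, ho, fun e => by rw [edgeData_mat_edge, h]⟩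

theorem gauge_orthogonal {φ : F × ZMod 3 → Matrix (Fin n) (Fin n) ℝ} (hφ : ∀ d, (φ d)ᵀ * φ d = 1)
    (t : F) : (K.gauge φ t)ᵀ * K.gauge φ t = 1 := by
  induction t using K.tree_induction with
  | h0 => rw [gauge_root, transpose_one, one_mul]
  | h1 e he ih =>
    rw [gauge_glue _ _ he, transpose_mul, Matrix.mul_assoc, ← Matrix.mul_assoc _ _ (φ _), ih,
      Matrix.one_mul, hφ]

end Extend

/-- The extension by zero to all edges of a function on the edges outside the tree. -/
def zeroExtend (q : Fin b → ℝ) (e : Fin m) : ℝ := ∑ j, if K.free j = e then q j else 0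

theorem zeroExtend_free (q : Fin b → ℝ) (j : Fin b) : K.zeroExtend q (K.free j) = q j := by
  rw [zeroExtend, Finset.sum_eq_single j, if_pos rfl]
  · intro j' _ h
    rw [if_neg fun h' => h (K.free_injective h')]
  · simp

theorem zeroExtend_tree (q : Fin b → ℝ) {e : Fin m} (he : K.IsTree e) : K.zeroExtend q e = 0 :=
  Finset.sum_eq_zero fun j _ => if_neg (he j)

/-- The space of the slice: real parts, imaginary parts outside the tree, antilinear parts. -/
abbrev SliceSpace (m b : ℕ) : Type := (Fin m → ℝ) × (Fin b → ℝ) × (Fin m → ℂ)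

/-- The linear part of the matrix of the edge `e`. -/
def hol (v : SliceSpace m b) (e : Fin m) : ℂ := ⟨v.1 e, K.zeroExtend v.2.1 e⟩

theorem hol_tree (v : SliceSpace m b) {e : Fin m} (he : K.IsTree e) : K.hol v e = (v.1 e : ℂ) := by
  apply Complex.ext
  · rfl
  · exact K.zeroExtend_tree _ he

/-- The slice: the parameters of the systems normalized along the tree. -/
def slice : Set (SliceSpace m b) :=
  {v | ∀ e, ‖K.hol v e‖ ≠ ‖v.2.2 e‖ ∧ (K.IsTree e → ‖v.2.2 e‖ < v.1 e)}

open Classical in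
/-- The edge matrices for the parameter `v`. -/
def sliceMat (v : SliceSpace m b) (e : Fin m) : Matrix (Fin 2) (Fin 2) ℝ :=
  -- Off the slice the matrix could be singular; the identity makes `point` total.
  if v ∈ K.slice then cmat (K.hol v e) (v.2.2 e) else 1

theorem sliceMat_eq {v : SliceSpace m b} (hv : v ∈ K.slice) (e : Fin m) :
    K.sliceMat v e = cmat (K.hol v e) (v.2.2 e) := if_pos hv

theorem isUnit_sliceMat (v : SliceSpace m b) (e : Fin m) : IsUnit (K.sliceMat v e).det := by
  unfold sliceMat
  split_ifs with hv
  · exact isUnit_det_cmat.2 (hv e).1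
  · simp

/-- The framed local system with parameter `v`. -/
def point (v : SliceSpace m b) : (S.Mf 2).E :=
  ⟨(K.edgeData (K.sliceMat v) (K.isUnit_sliceMat v)).system, EdgeData.system_isMaximal _⟩

/-- The linear parts are real along the tree, so recording imaginary parts only on the free edges
loses nothing. -/
theorem eq_sliceMat {M : Fin m → Matrix (Fin 2) (Fin 2) ℝ} (hM : ∀ e, IsUnit (M e).det)
    (htree : ∀ e, K.IsTree e → ∃ (p : ℝ) (z : ℂ), ‖z‖ < p ∧ M e = cmat p z) :
    ((fun e => (holPart (M e)).re, fun j => (holPart (M (K.free j))).im,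
        fun e => antiPart (M e)) : SliceSpace m b) ∈ K.slice ∧
      ∀ e, K.sliceMat (fun e => (holPart (M e)).re, fun j => (holPart (M (K.free j))).im,
        fun e => antiPart (M e)) e = M e := by
  set v : SliceSpace m b := (fun e => (holPart (M e)).re, fun j => (holPart (M (K.free j))).im,
        fun e => antiPart (M e)) with hv
  have hhol : ∀ e, K.hol v e = holPart (M e) := by
    intro e
    apply Complex.ext
    · rfl
    · change K.zeroExtend v.2.1 e = _
      by_cases he : K.IsTree e
      · obtain ⟨p, z, -, hpz⟩ := htree e he
        rw [K.zeroExtend_tree _ he, hpz, holPart_cmat, Complex.ofReal_im]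
      · obtain ⟨j, rfl⟩ := K.exists_free he
        rw [K.zeroExtend_free]
  have hmem : v ∈ K.slice := by
    intro e
    constructor
    · rw [hhol, ← isUnit_det_cmat, cmat_holPart_antiPart]
      exact hM e
    · intro he
      obtain ⟨p, z, hlt, hpz⟩ := htree e he
      change ‖antiPart (M e)‖ < (holPart (M e)).re
      rw [hpz, antiPart_cmat, holPart_cmat, Complex.ofReal_re]
      exact hlt
  refine ⟨hmem, fun e => ?_⟩
  rw [K.sliceMat_eq hmem, hhol, cmat_holPart_antiPart]

theorem exists_iso_point_of_edge (β : EdgeData S 2) {M : Fin m → Matrix (Fin 2) (Fin 2) ℝ}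
    (hM : ∀ e, IsUnit (M e).det)
    (htree : ∀ e, K.IsTree e → ∃ (p : ℝ) (z : ℂ), ‖z‖ < p ∧ M e = cmat p z)
    {o : F → Matrix (Fin 2) (Fin 2) ℝ} (ho : ∀ t, (o t)ᵀ * o t = 1)
    (h : ∀ e, M e = o (S.glue (K.edge e)).1 * β.mat (K.edge e) * (o (K.edge e).1)ᵀ) :
    β.system.Iso (K.point (fun e => (holPart (M e)).re, fun j => (holPart (M (K.free j))).im,
        fun e => antiPart (M e))).1 :=
  K.system_iso_edgeData β _ ho fun e => by rw [(K.eq_sliceMat hM htree).2, h]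

theorem exists_iso_point (x : (S.Mf 2).E) : ∃ v ∈ K.slice, x.1.Iso (K.point v).1 := by
  obtain ⟨h, hh⟩ := x.2.exists_isFrame_two
  have hR : ∀ d, ∃ R : Matrix (Fin 2) (Fin 2) ℝ, Rᵀ * R = 1 ∧ (S.glue d ≠ d →
      ∃ (p : ℝ) (z : ℂ), ‖z‖ < p ∧ R * (x.1.edgeData hh).mat d = cmat p z) := by
    intro d
    by_cases hd : S.glue d = d
    · exact ⟨1, by simp, fun h => absurd hd h⟩
    · obtain ⟨R, h1, h2⟩ := exists_normalizer ((x.1.edgeData hh).isUnit d hd)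
      exact ⟨R, h1, fun _ => h2⟩
  choose φ hφ hφ' using hR
  have ho := K.gauge_orthogonal hφ
  set β := x.1.edgeData hh
  let M : Fin m → Matrix (Fin 2) (Fin 2) ℝ := fun e =>
    K.gauge φ (S.glue (K.edge e)).1 * β.mat (K.edge e) * (K.gauge φ (K.edge e).1)ᵀ
  have hM : ∀ e, IsUnit (M e).det := fun e => by
    rw [det_mul, det_mul, det_transpose]
    exact ((isUnit_det_of_transpose_mul (ho _)).mul (β.isUnit _ (K.edge_ne e))).mul
      (isUnit_det_of_transpose_mul (ho _))
  have htree : ∀ e, K.IsTree e → ∃ (p : ℝ) (z : ℂ), ‖z‖ < p ∧ M e = cmat p z := fun e he => by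
    obtain ⟨p, z, hlt, hpz⟩ := hφ' _ (K.edge_ne e)
    obtain ⟨z', hz', he'⟩ := exists_conj_cmat_ofReal (ho (K.edge e).1) p z
    refine ⟨p, z', hz' ▸ hlt, ?_⟩
    change K.gauge φ (S.glue (K.edge e)).1 * β.mat (K.edge e) * (K.gauge φ (K.edge e).1)ᵀ = _
    -- With `g` the gauge at the parent, the new matrix is `g (φ B) gᵀ`, a conjugate of the polar
    -- part.
    rw [K.gauge_glue _ he, Matrix.mul_assoc _ (φ _), hpz, he']
  refine ⟨_, (K.eq_sliceMat hM htree).1, ?_⟩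
  exact (FramedLocalSystem.iso_equivalence S 2).trans (x.1.iso_edgeData_system hh)
    (K.exists_iso_point_of_edge β hM htree ho fun e => rfl)

end Skeleton

end IdealSurface

end

/-! ### Isomorphisms between points of the slice. -/

noncomputable section

open Matrix ComplexConjugate SmoothQuotient

namespace IdealSurface

variable {F : Type*} [Fintype F] {S : IdealSurface F}

namespace Skeleton

variable {m b : ℕ} (K : Skeleton S m b)

/-- The sign of the determinant is constant along tree edges, hence everywhere. -/
theorem orthogonal_type {o : F → Matrix (Fin 2) (Fin 2) ℝ} (ho : ∀ t, (o t)ᵀ * o t = 1)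
    (h : ∀ e, K.IsTree e → 0 < (o (S.glue (K.edge e)).1).det * (o (K.edge e).1).det) :
    (∃ c : F → ℂ, ∀ t, ‖c t‖ = 1 ∧ o t = cmat (c t) 0) ∨
      (∃ c : F → ℂ, ∀ t, ‖c t‖ = 1 ∧ o t = cmat 0 (c t)) := by
  choose c hc hoc using fun t => eq_cmat_of_transpose_mul (ho t)
  have d1 : ∀ t, (cmat (c t) 0).det = 1 := fun t => by
    rw [det_cmat, Complex.normSq_eq_norm_sq, hc]; simp
  have d2 : ∀ t, (cmat 0 (c t)).det = -1 := fun t => by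
    rw [det_cmat, Complex.normSq_eq_norm_sq (c t), hc]; simp
  rcases hoc K.root with h0 | h0
  · left
    refine ⟨c, fun t => ⟨hc t, ?_⟩⟩
    induction t using K.tree_induction with
    | h0 => exact h0
    | h1 e he ih =>
      refine (hoc _).resolve_right fun h' => ?_
      have := h e he
      rw [ih, h', d1, d2] at this
      norm_num at this
  · right
    refine ⟨c, fun t => ⟨hc t, ?_⟩⟩
    induction t using K.tree_induction with
    | h0 => exact h0
    | h1 e he ih =>
      refine (hoc _).resolve_left fun h' => ?_
      have := h e he
      rw [ih, h', d1, d2] at this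
      norm_num at this

theorem eq_root_of_tree {α : Type*} {c : F → α}
    (h : ∀ e, K.IsTree e → c (S.glue (K.edge e)).1 = c (K.edge e).1) (t : F) : c t = c K.root := by
  induction t using K.tree_induction with
  | h0 => rfl
  | h1 e he ih => rw [h e he, ih]

theorem hol_ext_iff {v v' : SliceSpace m b} :
    (∀ e, K.hol v' e = K.hol v e) ↔ v'.1 = v.1 ∧ v'.2.1 = v.2.1 := by
  constructor
  · intro h
    constructor
    · funext e
      exact congrArg Complex.re (h e)
    · funext j
      have := congrArg Complex.im (h (K.free j))
      change K.zeroExtend _ _ = K.zeroExtend _ _ at this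
      rwa [zeroExtend_free, zeroExtend_free] at this
  · rintro ⟨h1, h2⟩ e
    rw [hol, hol, h1, h2]

theorem zeroExtend_neg (q : Fin b → ℝ) (e : Fin m) : K.zeroExtend (-q) e = -K.zeroExtend q e := by
  rw [zeroExtend, zeroExtend, ← Finset.sum_neg_distrib]
  exact Finset.sum_congr rfl fun j _ => by split_ifs <;> simp

theorem conj_hol (v : SliceSpace m b) (e : Fin m) :
    conj (K.hol v e) = K.hol (v.1, -v.2.1, v.2.2) e := by
  apply Complex.ext
  · rfl
  · exact (K.zeroExtend_neg _ _).symm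

theorem hol_ext_conj_iff {v v' : SliceSpace m b} :
    (∀ e, K.hol v' e = conj (K.hol v e)) ↔ v'.1 = v.1 ∧ v'.2.1 = -v.2.1 := by
  simp only [conj_hol]
  exact K.hol_ext_iff

theorem det_pos_of_tree {v : SliceSpace m b} (hv : v ∈ K.slice) {e : Fin m} (he : K.IsTree e) :
    0 < (cmat (K.hol v e) (v.2.2 e)).det := by
  have h1 := (hv e).2 he
  rw [K.hol_tree v he, det_cmat, Complex.normSq_eq_norm_sq, Complex.normSq_eq_norm_sq,
    Complex.norm_real, Real.norm_eq_abs, sq_abs]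
  nlinarith [norm_nonneg (v.2.2 e)]

theorem pos_of_tree {v : SliceSpace m b} (hv : v ∈ K.slice) {e : Fin m} (he : K.IsTree e) :
    0 < v.1 e :=
  (norm_nonneg _).trans_lt ((hv e).2 he)

theorem point_iso_iff_exists {v v' : SliceSpace m b} (hv : v ∈ K.slice) (hv' : v' ∈ K.slice) :
    (K.point v).1.Iso (K.point v').1 ↔
      ∃ o : F → Matrix (Fin 2) (Fin 2) ℝ, (∀ t, (o t)ᵀ * o t = 1) ∧
      ∀ e, cmat (K.hol v' e) (v'.2.2 e) =
        o (S.glue (K.edge e)).1 * cmat (K.hol v e) (v.2.2 e) * (o (K.edge e).1)ᵀ := by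
  rw [point, point, EdgeData.system_iso_iff_edge K]
  simp only [edgeData_mat_edge, sliceMat_eq K hv, sliceMat_eq K hv']

theorem eq_of_mul_conj_eq {c c' : ℂ} {p p' : ℝ} (hc : ‖c‖ = 1) (hc' : ‖c'‖ = 1) (hp : 0 < p)
    (hp' : 0 < p') (h : (p' : ℂ) = c' * p * conj c) : c' = c := by
  have h1 := congrArg norm h
  rw [norm_mul, norm_mul, hc', Complex.norm_conj, hc, Complex.norm_real, Complex.norm_real,
    Real.norm_of_nonneg hp.le, Real.norm_of_nonneg hp'.le, one_mul, mul_one] at h1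
  rw [h1, mul_comm c', mul_assoc] at h
  have h2 : c' * conj c = 1 := by
    have : (p : ℂ) ≠ 0 := by exact_mod_cast hp.ne'
    exact mul_left_cancel₀ this (by rw [← h, mul_one])
  calc c' = c' * (conj c * c) := by rw [conj_mul_self hc, mul_one]
    _ = c := by rw [← mul_assoc, h2, one_mul]

theorem exists_circle_of_norm {c : ℂ} (hc : ‖c‖ = 1) : ∃ c' : Circle, (c' : ℂ) = c := by
  refine ⟨⟨c, ?_⟩, rfl⟩
  rw [Submonoid.unitSphere, Submonoid.mem_mk, Subsemigroup.mem_mk, mem_sphere_zero_iff_norm]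
  exact hc

theorem exists_sqrt_circle (c : Circle) : ∃ c' : ℂ, ‖c'‖ = 1 ∧ c' * c' = c := by
  obtain ⟨c', h⟩ := IsAlgClosed.exists_pow_nat_eq (c : ℂ) (n := 2) (by norm_num)
  refine ⟨c', ?_, by rw [← sq, h]⟩
  have := congrArg norm h
  rw [norm_pow, Circle.norm_coe] at this
  nlinarith [norm_nonneg c']

/-- Positive determinants along the tree make the changes of frame all rotations or all reflections,
and positive linear parts there make their phase constant. One element of O(2) remains, giving the
two branches of the relation. -/
theorem point_iso_iff {v v' : SliceSpace m b} (hv : v ∈ K.slice) (hv' : v' ∈ K.slice) :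
    (K.point v).1.Iso (K.point v').1 ↔ involutionRel m b m v v' := by
  rw [K.point_iso_iff_exists hv hv', involutionRel_iff]
  constructor
  · rintro ⟨o, ho, h⟩
    have htype : ∀ e, K.IsTree e →
        0 < (o (S.glue (K.edge e)).1).det * (o (K.edge e).1).det := fun e he => by
      have h1 := K.det_pos_of_tree hv he
      have h2 := K.det_pos_of_tree hv' he
      rw [h e, det_mul, det_mul, det_transpose] at h2
      by_contra h3
      nlinarith
    rcases K.orthogonal_type ho htype with ⟨c, hc⟩ | ⟨c, hc⟩
    · have h' : ∀ e, K.hol v' e = c (S.glue (K.edge e)).1 * K.hol v e * conj (c (K.edge e).1) ∧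
          v'.2.2 e = c (S.glue (K.edge e)).1 * v.2.2 e * c (K.edge e).1 := fun e => by
        have := h e
        rwa [(hc _).2, (hc _).2, conj_cmat_rot, cmat_inj] at this
      have hconst := K.eq_root_of_tree (c := c) fun e he => by
        have := (h' e).1
        rw [K.hol_tree v he, K.hol_tree v' he] at this
        exact eq_of_mul_conj_eq (hc _).1 (hc _).1 (K.pos_of_tree hv he) (K.pos_of_tree hv' he) this
      have h0 := (hc K.root).1
      have hhol := (K.hol_ext_iff (v := v) (v' := v')).1 fun e => by
        have := (h' e).1
        rwa [hconst (S.glue (K.edge e)).1, hconst (K.edge e).1, mul_comm (c _), mul_assoc, mul_comm (c _), conj_mul_self h0,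
          mul_one] at this
      -- The antilinear parts see the square of the common phase.
      obtain ⟨c', hc'⟩ := exists_circle_of_norm (c := c K.root * c K.root) (by simp [h0])
      refine ⟨hhol.1, Or.inl ⟨hhol.2, circleRel_iff.2 ⟨c', fun e => ?_⟩⟩⟩
      rw [(h' e).2, hconst (S.glue (K.edge e)).1, hconst (K.edge e).1, hc']
      ring
    · have h' : ∀ e, K.hol v' e =
            c (S.glue (K.edge e)).1 * conj (K.hol v e) * conj (c (K.edge e).1) ∧
          v'.2.2 e = c (S.glue (K.edge e)).1 * conj (v.2.2 e) * c (K.edge e).1 := fun e => by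
        have := h e
        rwa [(hc _).2, (hc _).2, conj_cmat_refl, cmat_inj] at this
      have hconst := K.eq_root_of_tree (c := c) fun e he => by
        have := (h' e).1
        rw [K.hol_tree v he, K.hol_tree v' he, Complex.conj_ofReal] at this
        exact eq_of_mul_conj_eq (hc _).1 (hc _).1 (K.pos_of_tree hv he) (K.pos_of_tree hv' he) this
      have h0 := (hc K.root).1
      have hhol := (K.hol_ext_conj_iff (v := v) (v' := v')).1 fun e => by
        have := (h' e).1
        rwa [hconst (S.glue (K.edge e)).1, hconst (K.edge e).1, mul_comm (c _), mul_assoc, mul_comm (c _), conj_mul_self h0,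
          mul_one] at this
      obtain ⟨c', hc'⟩ := exists_circle_of_norm (c := c K.root * c K.root) (by simp [h0])
      refine ⟨hhol.1, Or.inr ⟨hhol.2, circleRel_iff.2 ⟨c', fun e => ?_⟩⟩⟩
      rw [(h' e).2, hconst (S.glue (K.edge e)).1, hconst (K.edge e).1, hc', conjVec]
      ring
  · rintro ⟨h1, ⟨h2, h3⟩ | ⟨h2, h3⟩⟩
    · obtain ⟨c, hc⟩ := circleRel_iff.1 h3
      -- Conversely a circle element is realized by a rotation through half its angle.
      obtain ⟨c', hc', hcc⟩ := exists_sqrt_circle c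
      refine ⟨fun _ => cmat c' 0, fun _ => transpose_mul_cmat_zero hc', fun e => ?_⟩
      rw [conj_cmat_rot, K.hol_ext_iff.2 ⟨h1, h2⟩, hc, mul_comm c', mul_assoc, mul_comm c',
        conj_mul_self hc', mul_one, ← hcc]
      congr 1
      ring
    · obtain ⟨c, hc⟩ := circleRel_iff.1 h3
      obtain ⟨c', hc', hcc⟩ := exists_sqrt_circle c
      refine ⟨fun _ => cmat 0 c', fun _ => transpose_mul_cmat_zero_left hc', fun e => ?_⟩
      rw [conj_cmat_refl, K.hol_ext_conj_iff.2 ⟨h1, h2⟩, hc, mul_comm c', mul_assoc, mul_comm c',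
        conj_mul_self hc', mul_one, ← hcc, conjVec]
      congr 1
      ring

theorem slice_saturated {v v' : SliceSpace m b} (h : involutionRel m b m v v')
    (hv : v ∈ K.slice) : v' ∈ K.slice := by
  have key : (∀ e, ‖K.hol v' e‖ = ‖K.hol v e‖) ∧ ∀ e, ‖v'.2.2 e‖ = ‖v.2.2 e‖ := by
    obtain ⟨h1, ⟨h2, h3⟩ | ⟨h2, h3⟩⟩ := involutionRel_iff.1 h
    · obtain ⟨c, hc⟩ := circleRel_iff.1 h3
      exact ⟨fun e => by rw [K.hol_ext_iff.2 ⟨h1, h2⟩], fun e => by rw [hc, norm_mul, Circle.norm_coe, one_mul]⟩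
    · obtain ⟨c, hc⟩ := circleRel_iff.1 h3
      exact ⟨fun e => by rw [K.hol_ext_conj_iff.2 ⟨h1, h2⟩, Complex.norm_conj],
        fun e => by
          rw [hc, conjVec, norm_mul, Circle.norm_coe, one_mul, Complex.norm_conj]⟩
  intro e
  rw [key.1, key.2, (involutionRel_iff.1 h).1]
  exact hv e

theorem contDiff_hol (e : Fin m) : ContDiff ℝ ∞ fun v : SliceSpace m b => K.hol v e := by
  have : (fun v : SliceSpace m b => K.hol v e) =
      fun v => (v.1 e : ℂ) + (K.zeroExtend v.2.1 e : ℂ) * Complex.I := by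
    funext v
    apply Complex.ext <;> simp [hol]
  rw [this]
  have h2 : ContDiff ℝ ∞ fun v : SliceSpace m b => K.zeroExtend v.2.1 e := by
    unfold zeroExtend
    refine ContDiff.sum fun j _ => ?_
    split_ifs <;> fun_prop
  exact (contDiff_ofReal.comp (by fun_prop)).add ((contDiff_ofReal.comp h2).mul contDiff_const)

theorem isOpen_slice : IsOpen K.slice := by
  have : K.slice = ⋂ e, {v | ‖K.hol v e‖ ≠ ‖v.2.2 e‖ ∧ (K.IsTree e → ‖v.2.2 e‖ < v.1 e)} := by
    ext v
    simp [slice]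
  rw [this]
  refine isOpen_iInter_of_finite fun e => ?_
  have h1 : IsOpen {v : SliceSpace m b | ‖K.hol v e‖ ≠ ‖v.2.2 e‖} :=
    isOpen_ne_fun (K.contDiff_hol e).continuous.norm (by fun_prop)
  refine h1.inter ?_
  by_cases he : K.IsTree e
  · simp only [he, true_imp_iff]
    exact isOpen_lt (by fun_prop) (by fun_prop)
  · simp only [he, false_imp_iff]
    exact isOpen_univ

end Skeleton

end IdealSurface

end

/-! ### Smooth matrix-valued functions and smoothness of the slice map. -/

noncomputable section

open Matrix ComplexConjugate SmoothQuotient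

section SmoothMat

variable {W : Type*} [NormedAddCommGroup W] [NormedSpace ℝ W] {p q r : Type*} {w : W}

/-- The matrix-valued function `M` has smooth entries at `w`. -/
def SmoothMatAt (M : W → Matrix p q ℝ) (w : W) : Prop :=
  ∀ i j, ContDiffAt ℝ ∞ (fun w => M w i j) w

theorem smoothMatAt_const (M : Matrix p q ℝ) : SmoothMatAt (fun _ : W => M) w :=
  fun _ _ => contDiffAt_const

theorem SmoothMatAt.mul [Fintype q] {M : W → Matrix p q ℝ} {M' : W → Matrix q r ℝ}
    (h : SmoothMatAt M w) (h' : SmoothMatAt M' w) : SmoothMatAt (fun w => M w * M' w) w :=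
  fun i j => by
    simp only [mul_apply]
    exact ContDiffAt.sum fun k _ => (h i k).mul (h' k j)

theorem SmoothMatAt.add {M M' : W → Matrix p q ℝ} (h : SmoothMatAt M w) (h' : SmoothMatAt M' w) :
    SmoothMatAt (fun w => M w + M' w) w :=
  fun i j => (h i j).add (h' i j)

theorem SmoothMatAt.sum {ι : Type*} {s : Finset ι} {M : ι → W → Matrix p q ℝ}
    (h : ∀ e ∈ s, SmoothMatAt (M e) w) : SmoothMatAt (fun w => ∑ e ∈ s, M e w) w :=
  fun i j => by
    simp only [Matrix.sum_apply]
    exact ContDiffAt.sum fun e he => h e he i j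

theorem SmoothMatAt.neg {M : W → Matrix p q ℝ} (h : SmoothMatAt M w) :
    SmoothMatAt (fun w => -M w) w :=
  fun i j => (h i j).neg

theorem SmoothMatAt.transpose {M : W → Matrix p q ℝ} (h : SmoothMatAt M w) :
    SmoothMatAt (fun w => (M w)ᵀ) w :=
  fun i j => h j i

theorem SmoothMatAt.fromCols {M : W → Matrix p q ℝ} {M' : W → Matrix p r ℝ}
    (h : SmoothMatAt M w) (h' : SmoothMatAt M' w) :
    SmoothMatAt (fun w => Matrix.fromCols (M w) (M' w)) w := by
  rintro i (j | j)
  · exact h i j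
  · exact h' i j

theorem SmoothMatAt.det {M : W → Matrix (Fin 2) (Fin 2) ℝ} (h : SmoothMatAt M w) :
    ContDiffAt ℝ ∞ (fun w => (M w).det) w := by
  simp only [det_fin_two]
  exact ((h 0 0).mul (h 1 1)).sub ((h 0 1).mul (h 1 0))

theorem SmoothMatAt.inv {M : W → Matrix (Fin 2) (Fin 2) ℝ} (h : SmoothMatAt M w)
    (hw : IsUnit (M w).det) : SmoothMatAt (fun w => (M w)⁻¹) w := by
  intro i j
  simp only [inv_def, Ring.inverse_eq_inv', Matrix.smul_apply, smul_eq_mul, adjugate_fin_two]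
  refine (h.det.inv hw.ne_zero).mul ?_
  fin_cases i <;> fin_cases j
  exacts [h 1 1, (h 0 1).neg, (h 1 0).neg, h 0 0]

theorem SmoothMatAt.swapMat {M : W → Matrix (Fin 2) (Fin 2) ℝ} (h : SmoothMatAt M w)
    (hw : IsUnit (M w).det) : SmoothMatAt (fun w => swapMat (M w)) w := by
  have h' := (h.inv hw).transpose.neg
  rintro (i | i) (j | j)
  · exact contDiffAt_const
  · exact h i j
  · exact h' i j
  · exact contDiffAt_const

theorem smoothMatAt_cmat {f g : W → ℂ} (hf : ContDiffAt ℝ ∞ f w) (hg : ContDiffAt ℝ ∞ g w) :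
    SmoothMatAt (fun w => cmat (f w) (g w)) w := by
  have f1 := contDiff_re.contDiffAt.comp w hf
  have f2 := contDiff_im.contDiffAt.comp w hf
  have g1 := contDiff_re.contDiffAt.comp w hg
  have g2 := contDiff_im.contDiffAt.comp w hg
  intro i j
  fin_cases i <;> fin_cases j
  exacts [f1.add g1, f2.neg.add g2, f2.add g2, f1.sub g1]

theorem contDiffAt_complex_mk {f g : W → ℝ} (hf : ContDiffAt ℝ ∞ f w) (hg : ContDiffAt ℝ ∞ g w) :
    ContDiffAt ℝ ∞ (fun w => (⟨f w, g w⟩ : ℂ)) w := by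
  have : (fun w => (⟨f w, g w⟩ : ℂ)) = fun w => (f w : ℂ) + (g w : ℂ) * Complex.I := by
    funext w
    apply Complex.ext <;> simp
  rw [this]
  exact (contDiff_ofReal.contDiffAt.comp w hf).add
    ((contDiff_ofReal.contDiffAt.comp w hg).mul contDiffAt_const)

theorem SmoothMatAt.holPart {M : W → Matrix (Fin 2) (Fin 2) ℝ} (h : SmoothMatAt M w) :
    ContDiffAt ℝ ∞ (fun w => holPart (M w)) w :=
  contDiffAt_complex_mk (((h 0 0).add (h 1 1)).div_const 2) (((h 1 0).sub (h 0 1)).div_const 2)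

theorem SmoothMatAt.antiPart {M : W → Matrix (Fin 2) (Fin 2) ℝ} (h : SmoothMatAt M w) :
    ContDiffAt ℝ ∞ (fun w => antiPart (M w)) w :=
  contDiffAt_complex_mk (((h 0 0).sub (h 1 1)).div_const 2) (((h 1 0).add (h 0 1)).div_const 2)

theorem SmoothMatAt.cholesky {M : W → Matrix (Fin 2) (Fin 2) ℝ} (h : SmoothMatAt M w)
    (h0 : 0 < M w 0 0) (hd : 0 < (M w).det) : SmoothMatAt (fun w => cholesky (M w)) w := by
  have h1 := (h 0 0).sqrt h0.ne'
  have h2 := (h.det.div (h 0 0) h0.ne').sqrt (div_pos hd h0).ne'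
  intro i j
  fin_cases i <;> fin_cases j
  exacts [h1, contDiffAt_const, (h 1 0).div h1 (Real.sqrt_pos.2 h0).ne', h2]

variable {n : ℕ}

theorem SmoothMatAt.matOp {M : W → Matrix (Fin n ⊕ Fin n) (Fin n ⊕ Fin n) ℝ}
    (h : SmoothMatAt M w) : ContDiffAt ℝ ∞ (fun w => matOp (M w)) w := by
  let L : (Fin n ⊕ Fin n → Fin n ⊕ Fin n → ℝ) →ₗ[ℝ] (SympVec n →L[ℝ] SympVec n) :=
    (Matrix.toEuclideanCLM (𝕜 := ℝ) (n := Fin n ⊕ Fin n)).toAlgEquiv.toLinearMap ∘ₗ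
      (Matrix.ofLinearEquiv ℝ).toLinearMap
  let f : W → Fin n ⊕ Fin n → Fin n ⊕ Fin n → ℝ := fun w i j => M w i j
  have h1 : ContDiffAt ℝ ∞ f w := contDiffAt_pi.2 fun i => contDiffAt_pi.2 fun j => h i j
  exact (L.toContinuousLinearMap.contDiff (n := ∞)).contDiffAt.comp w h1

/-- The matrix of an operator of `ℝ^{2n}`. -/
def opMat (T : SympVec n →L[ℝ] SympVec n) : Matrix (Fin n ⊕ Fin n) (Fin n ⊕ Fin n) ℝ :=
  (Matrix.toEuclideanCLM (𝕜 := ℝ)).symm T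

theorem matOp_opMat (T : SympVec n →L[ℝ] SympVec n) : matOp (opMat T) = T :=
  (Matrix.toEuclideanCLM (𝕜 := ℝ)).apply_symm_apply T

theorem opMat_matOp (g : Matrix (Fin n ⊕ Fin n) (Fin n ⊕ Fin n) ℝ) : opMat (matOp g) = g :=
  (Matrix.toEuclideanCLM (𝕜 := ℝ)).symm_apply_apply g

theorem opMat_apply (T : SympVec n →L[ℝ] SympVec n) (k l : Fin n ⊕ Fin n) :
    opMat T k l = T (EuclideanSpace.single l 1) k := by
  rw [← matOp_single (opMat T), matOp_opMat]

theorem smoothMatAt_opMat {T : W → SympVec n →L[ℝ] SympVec n} (hT : ContDiffAt ℝ ∞ T w) :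
    SmoothMatAt (fun w => opMat (T w)) w := by
  intro i j
  simp only [opMat_apply]
  exact contDiffAt_euclidean.1 (hT.clm_apply contDiffAt_const) i

theorem colMap_opMat_mul (T : SympVec n →L[ℝ] SympVec n) (X : Matrix (Fin n ⊕ Fin n) (Fin n) ℝ)
    (c : Fin n → ℝ) : colMap (opMat T * X) c = T (colMap X c) := by
  rw [← matOp_colMap, matOp_opMat]

theorem colMap_injective_mat : Function.Injective (colMap (n := n)) := by
  intro X Y h
  refine Matrix.ext_of_mulVec_single fun i => ?_
  exact congrArg WithLp.ofLp (LinearMap.congr_fun h (Pi.single i 1))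

end SmoothMat

namespace IdealSurface

variable {F : Type*} [Fintype F] {S : IdealSurface F}

/-- An isomorphism onto a system in standard position is, inverted, a frame in which the edge
matrices are the given ones. -/
theorem FramedLocalSystem.edgeMat_of_trans_eq {n : ℕ} {x : S.FramedLocalSystem n}
    {β : EdgeData S n} {k : F → Sp n}
    (hk : ∀ d, β.system.trans d = k (S.glue d).1 * x.trans d * (k d.1)⁻¹) {d : F × ZMod 3}
    (hd : S.glue d ≠ d) : x.edgeMat (fun t => (k t)⁻¹) d = β.mat d := by
  have h1 : x.rotatedTrans (fun t => (k t)⁻¹) d =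
      (rot n (S.glue d).2)⁻¹ * β.system.trans d * rot n d.2 := by
    rw [hk, rotatedTrans]
    group
  have h2 : x.rotatedTrans (fun t => (k t)⁻¹) d =
      ⟨swapMat (β.mat d), swapMat_mem (β.isUnit d hd)⟩ := by
    rw [h1]
    change _ * β.trans d * _ = _
    rw [β.trans_of_ne hd]
    group
  rw [edgeMat, h2]
  exact toBlocks_fromBlocks₁₂ _ _ _ _

instance finiteDimensional_Mf_W (S : IdealSurface F) (n : ℕ) : FiniteDimensional ℝ (S.Mf n).W :=
  inferInstanceAs (FiniteDimensional ℝ ((F × ZMod 3 → SympVec n →L[ℝ] SympVec n) ×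
    (F × ZMod 3 → SympVec n →L[ℝ] SympVec n)))

namespace Skeleton

variable {m b : ℕ} (K : Skeleton S m b)

theorem smoothMatAt_extend {W : Type*} [NormedAddCommGroup W] [NormedSpace ℝ W] {n : ℕ} {w : W}
    {M : W → Fin m → Matrix (Fin n) (Fin n) ℝ} (h : ∀ e, SmoothMatAt (fun w => M w e) w)
    (d : F × ZMod 3) : SmoothMatAt (fun w => K.extend (M w) d) w := by
  unfold extend
  refine SmoothMatAt.add (SmoothMatAt.sum fun e _ => ?_) (SmoothMatAt.sum fun e _ => ?_)
  · split_ifs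
    · exact h e
    · exact smoothMatAt_const _
  · split_ifs
    · exact (h e).transpose.neg
    · exact smoothMatAt_const _

/-- The Lagrangians are the standard ones at every parameter, so only the changes of trivialization
vary. -/
theorem contDiffOn_point : ContDiffOn ℝ ∞ (fun v => (S.Mf 2).ι (K.point v)) K.slice := by
  change ContDiffOn ℝ ∞ (fun v => (fun d => matOp ((K.point v).1.trans d).1,
    fun c => ((K.point v).1.lag c).1.starProjection)) K.slice
  refine ContDiffOn.prodMk (contDiffOn_pi.2 fun d => ?_)
    (contDiffOn_const (c := fun c : F × ZMod 3 => (stdLag 2 c.2).1.starProjection))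
  by_cases hd : S.glue d = d
  · refine contDiffOn_const (c := matOp 1) |>.congr fun v _ => ?_
    change matOp (EdgeData.trans _ d).1 = _
    rw [EdgeData.trans_of_eq _ hd]
    rfl
  · have h1 : ∀ v ∈ K.slice, matOp ((K.point v).1.trans d).1 = matOp ((rot 2 (S.glue d).2).1 *
        swapMat (K.extend (fun e => cmat (K.hol v e) (v.2.2 e)) d) * ((rot 2 d.2)⁻¹).1) := by
      intro v hv
      change matOp (EdgeData.trans _ d).1 = _
      rw [EdgeData.trans_of_ne _ hd]
      have : (fun e => cmat (K.hol v e) (v.2.2 e)) = K.sliceMat v :=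
        funext fun e => (K.sliceMat_eq hv e).symm
      rw [this]
      rfl
    refine ContDiffOn.congr (fun v hv => ContDiffAt.contDiffWithinAt ?_) h1
    have h2 : SmoothMatAt (fun v => K.extend (fun e => cmat (K.hol v e) (v.2.2 e)) d) v :=
      K.smoothMatAt_extend (fun e => smoothMatAt_cmat (K.contDiff_hol e).contDiffAt
        (ContDiff.contDiffAt (by fun_prop))) d
    have h3 : IsUnit (K.extend (fun e => cmat (K.hol v e) (v.2.2 e)) d).det :=
      (K.edgeData _ fun e => isUnit_det_cmat.2 (hv e).1).isUnit d hd
    exact (((smoothMatAt_const _).mul (h2.swapMat h3)).mul (smoothMatAt_const _)).matOp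

end Skeleton

end IdealSurface

end

/-! ### Smooth local sections onto the slice. -/

noncomputable section

open Matrix ComplexConjugate SmoothQuotient

namespace IdealSurface

variable {F : Type*} [Fintype F] {S : IdealSurface F}

/-- The space in which framed local systems are recorded. -/
abbrev Ambient (F : Type*) (n : ℕ) : Type _ :=
  (F × ZMod 3 → SympVec n →L[ℝ] SympVec n) × (F × ZMod 3 → SympVec n →L[ℝ] SympVec n)

section LocalFrame

variable (G : F → Matrix (Fin 2 ⊕ Fin 2) (Fin 2 ⊕ Fin 2) ℝ) (w : Ambient F 2)

/-- The projections to the `i`-th Lagrangian of the corresponding columns of the reference frame. -/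
def projCols (t : F) (i : ZMod 3) : Matrix (Fin 2 ⊕ Fin 2) (Fin 2) ℝ :=
  opMat (w.2 (t, i)) * (G t * stdMat 2 i)

/-- The shape of the triple spanned by the projected columns. -/
def localShape (t : F) : Matrix (Fin 2) (Fin 2) ℝ :=
  frameShape (projCols G w t 0) (projCols G w t 1) (projCols G w t 2)

/-- The frame obtained from the projected columns. -/
def localFrame (t : F) : Matrix (Fin 2 ⊕ Fin 2) (Fin 2 ⊕ Fin 2) ℝ :=
  frameMat (projCols G w t 0) (projCols G w t 1) (cholesky (localShape G w t))

/-- The edge matrix in the frames `localFrame`. -/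
def localEdge (S : IdealSurface F) (d : F × ZMod 3) : Matrix (Fin 2) (Fin 2) ℝ :=
  -((localFrame G w (S.glue d).1 * (rot 2 (S.glue d).2).1 * stdMat 2 1)ᵀ * sympForm 2 *
    (opMat (w.1 d) * (localFrame G w d.1 * (rot 2 d.2).1 * stdMat 2 1)))

/-- The conditions under which `localFrame` is a smooth frame. -/
structure IsRegularFrame : Prop where
  isUnit₁ : ∀ t, IsUnit ((projCols G w t 0)ᵀ * sympForm 2 * projCols G w t 1).det
  isUnit₂ : ∀ t, IsUnit ((projCols G w t 0)ᵀ * sympForm 2 * projCols G w t 2).det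
  pos : ∀ t, 0 < localShape G w t 0 0
  det_pos : ∀ t, 0 < (localShape G w t).det

variable {G w}

theorem smoothMatAt_projCols (t : F) (i : ZMod 3) : SmoothMatAt (fun w => projCols G w t i) w :=
  (smoothMatAt_opMat (ContDiff.contDiffAt (by fun_prop))).mul (smoothMatAt_const _)

theorem smoothMatAt_localShape {t : F}
    (h1 : IsUnit ((projCols G w t 0)ᵀ * sympForm 2 * projCols G w t 1).det)
    (h2 : IsUnit ((projCols G w t 0)ᵀ * sympForm 2 * projCols G w t 2).det) :
    SmoothMatAt (fun w => localShape G w t) w := by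
  have X := fun i => smoothMatAt_projCols (G := G) (w := w) t i
  have D := ((X 0).transpose.mul (smoothMatAt_const (sympForm 2))).mul (X 1)
  have B := ((X 0).transpose.mul (smoothMatAt_const (sympForm 2))).mul (X 2)
  exact ((((X 1).mul (D.inv h1)).transpose.mul (smoothMatAt_const (sympForm 2))).mul (X 2)).mul
    (B.inv h2)

theorem IsRegularFrame.smoothMatAt_localFrame (h : IsRegularFrame G w) (t : F) :
    SmoothMatAt (fun w => localFrame G w t) w := by
  have X := fun i => smoothMatAt_projCols (G := G) (w := w) t i
  have D := ((X 0).transpose.mul (smoothMatAt_const (sympForm 2))).mul (X 1)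
  have T := (smoothMatAt_localShape (h.isUnit₁ t) (h.isUnit₂ t)).cholesky (h.pos t) (h.det_pos t)
  exact ((X 0).mul T).fromCols (((X 1).mul (D.inv (h.isUnit₁ t))).mul
    (T.inv (isUnit_det_cholesky (h.pos t) (h.det_pos t))).transpose)

theorem IsRegularFrame.smoothMatAt_localEdge (h : IsRegularFrame G w) (d : F × ZMod 3) :
    SmoothMatAt (fun w => localEdge G w S d) w := by
  have V := fun c : F × ZMod 3 => ((h.smoothMatAt_localFrame c.1).mul
    (smoothMatAt_const (rot 2 c.2).1)).mul (smoothMatAt_const (stdMat 2 1))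
  exact (((V (S.glue d)).transpose.mul (smoothMatAt_const (sympForm 2))).mul
    ((smoothMatAt_opMat (ContDiff.contDiffAt (by fun_prop))).mul (V d))).neg

theorem eventually_isRegularFrame (h : IsRegularFrame G w) :
    ∀ᶠ w' in 𝓝 w, IsRegularFrame G w' := by
  have e1 : ∀ t, ∀ᶠ w' in 𝓝 w,
      IsUnit ((projCols G w' t 0)ᵀ * sympForm 2 * projCols G w' t 1).det := fun t => by
    have := (((smoothMatAt_projCols (G := G) (w := w) t 0).transpose.mul
      (smoothMatAt_const (sympForm 2))).mul (smoothMatAt_projCols (G := G) (w := w) t 1)).det.continuousAt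
    filter_upwards [this.eventually_ne (h.isUnit₁ t).ne_zero] with w' hw'
    exact hw'.isUnit
  have e2 : ∀ t, ∀ᶠ w' in 𝓝 w,
      IsUnit ((projCols G w' t 0)ᵀ * sympForm 2 * projCols G w' t 2).det := fun t => by
    have := (((smoothMatAt_projCols (G := G) (w := w) t 0).transpose.mul
      (smoothMatAt_const (sympForm 2))).mul (smoothMatAt_projCols (G := G) (w := w) t 2)).det.continuousAt
    filter_upwards [this.eventually_ne (h.isUnit₂ t).ne_zero] with w' hw'
    exact hw'.isUnit
  have e3 : ∀ t, ∀ᶠ w' in 𝓝 w, 0 < localShape G w' t 0 0 := fun t =>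
    ((smoothMatAt_localShape (h.isUnit₁ t) (h.isUnit₂ t)) 0 0).continuousAt.eventually_const_lt
      (h.pos t)
  have e4 : ∀ t, ∀ᶠ w' in 𝓝 w, 0 < (localShape G w' t).det := fun t =>
    ((smoothMatAt_localShape (h.isUnit₁ t) (h.isUnit₂ t))).det.continuousAt.eventually_const_lt
      (h.det_pos t)
  filter_upwards [Filter.eventually_all.2 e1, Filter.eventually_all.2 e2,
    Filter.eventually_all.2 e3, Filter.eventually_all.2 e4] with w' h1 h2 h3 h4
  exact ⟨h1, h2, h3, h4⟩

/-- The point of the ambient space recording `x`. -/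
def FramedLocalSystem.record {n : ℕ} (x : S.FramedLocalSystem n) : Ambient F n :=
  (fun d => matOp (x.trans d).1, fun c => (x.lag c).1.starProjection)

theorem FramedLocalSystem.opMat_record (x : S.FramedLocalSystem 2) (d : F × ZMod 3) :
    opMat (x.record.1 d) = (x.trans d).1 :=
  opMat_matOp _

theorem colMap_projCols_mem (x : S.FramedLocalSystem 2) (t : F) (i : ZMod 3) (c : Fin 2 → ℝ) :
    colMap (projCols G x.record t i) c ∈ (x.lag (t, i)).1 := by
  rw [projCols, colMap_opMat_mul]
  exact Submodule.starProjection_apply_mem _ _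

/-- The projected columns lie in the Lagrangians of `x`, and the invertible pairings make them
bases; the explicit frame of a positive triple then applies. -/
theorem IsRegularFrame.localFrame_spec {x : S.FramedLocalSystem 2}
    (h : IsRegularFrame G x.record) (t : F) : ∃ hG : localFrame G x.record t ∈ Sp 2,
      ∀ i, MovesTo ⟨localFrame G x.record t, hG⟩ (stdLag 2 i) (x.lag (t, i)) := by
  have h0 := colSpan_eq_of_injective (colMap_projCols_mem (G := G) x t 0)
    (injective_of_isUnit_right (h.isUnit₁ t))
  have h1 := colSpan_eq_of_injective (colMap_projCols_mem (G := G) x t 1)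
    (injective_of_isUnit_left (h.isUnit₁ t))
  have h2 := colSpan_eq_of_injective (colMap_projCols_mem (G := G) x t 2)
    (injective_of_isUnit_left (h.isUnit₂ t))
  have hS := frameShape_transpose (L := fun i => x.lag (t, i)) h0 h1 h2 (h.isUnit₁ t) (h.isUnit₂ t)
  have hT := isUnit_det_cholesky (h.pos t) (h.det_pos t)
  have hG : localFrame G x.record t ∈ Sp 2 :=
    frameMat_mem (pairing_self_eq_zero (colMap_projCols_mem x t 0))
      (pairing_self_eq_zero (colMap_projCols_mem x t 1)) (h.isUnit₁ t) hT
  exact ⟨hG, frameMat_movesTo (L := fun i => x.lag (t, i)) h0 h1 h2 (h.isUnit₁ t) (h.isUnit₂ t) hT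
    (cholesky_mul_transpose hS (h.pos t) (h.det_pos t)) hG⟩

theorem IsRegularFrame.exists_isFrame {x : S.FramedLocalSystem 2}
    (h : IsRegularFrame G x.record) : ∃ k, x.IsFrame k ∧
      ∀ d, x.edgeMat k d = localEdge G x.record S d := by
  have hex : ∀ t, ∃ g : Sp 2, g.1 = localFrame G x.record t ∧
      ∀ i, MovesTo g (stdLag 2 i) (x.lag (t, i)) := fun t => by
    obtain ⟨hG, hL⟩ := h.localFrame_spec t
    exact ⟨⟨_, hG⟩, rfl, hL⟩
  choose k hk hL using hex
  refine ⟨k, hL, fun d => ?_⟩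
  rw [FramedLocalSystem.edgeMat_eq, localEdge, hk, hk, x.opMat_record]

/-- At the reference system the columns already lie in the Lagrangians, so the projections do
nothing. The construction thus returns the reference frame, and regularity holds there. -/
theorem projCols_record {x : S.FramedLocalSystem 2} {k : F → Sp 2} (hk : x.IsFrame k) (t : F)
    (i : ZMod 3) : projCols (fun t => (k t).1) x.record t i = (k t).1 * stdMat 2 i := by
  refine colMap_injective_mat (LinearMap.ext fun c => ?_)
  rw [projCols, colMap_opMat_mul]
  refine Submodule.starProjection_eq_self_iff.2 ?_
  rw [← movesTo_stdLag_iff.1 (hk t i)]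
  exact ⟨c, rfl⟩

theorem pairing_mul_Sp (g : Sp 2) (X Y : Matrix (Fin 2 ⊕ Fin 2) (Fin 2) ℝ) :
    (g.1 * X)ᵀ * sympForm 2 * (g.1 * Y) = Xᵀ * sympForm 2 * Y := by
  rw [transpose_mul, ← Matrix.mul_assoc, Matrix.mul_assoc Xᵀ, Matrix.mul_assoc Xᵀ,
    mem_Sp_iff.1 g.2]

theorem pairing_std_zero_one : (stdMat 2 0)ᵀ * sympForm 2 * stdMat 2 1 = 1 := by
  simp [stdMat_zero, stdMat_one, sympForm, transpose_fromRows, fromCols_mul_fromBlocks,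
    fromCols_mul_fromRows]

theorem pairing_std_zero_two : (stdMat 2 0)ᵀ * sympForm 2 * stdMat 2 2 = 1 := by
  simp [stdMat_zero, stdMat_two, sympForm, transpose_fromRows, fromCols_mul_fromBlocks,
    fromCols_mul_fromRows]

theorem pairing_std_one_two : (stdMat 2 1)ᵀ * sympForm 2 * stdMat 2 2 = 1 := by
  simp [stdMat_one, stdMat_two, sympForm, transpose_fromRows, fromCols_mul_fromBlocks,
    fromCols_mul_fromRows]

theorem localShape_record {x : S.FramedLocalSystem 2} {k : F → Sp 2} (hk : x.IsFrame k) (t : F) :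
    localShape (fun t => (k t).1) x.record t = 1 := by
  rw [localShape, frameShape, projCols_record hk, projCols_record hk, projCols_record hk,
    pairing_mul_Sp, pairing_mul_Sp, pairing_std_zero_one, pairing_std_zero_two, inv_one,
    Matrix.mul_one, Matrix.mul_one, pairing_mul_Sp, pairing_std_one_two]

theorem isRegularFrame_record {x : S.FramedLocalSystem 2} {k : F → Sp 2} (hk : x.IsFrame k) :
    IsRegularFrame (fun t => (k t).1) x.record where
  isUnit₁ t := by
    rw [projCols_record hk, projCols_record hk, pairing_mul_Sp, pairing_std_zero_one]
    simp
  isUnit₂ t := by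
    rw [projCols_record hk, projCols_record hk, pairing_mul_Sp, pairing_std_zero_two]
    simp
  pos t := by
    rw [localShape_record hk]
    simp
  det_pos t := by
    rw [localShape_record hk]
    simp

theorem cholesky_one : cholesky 1 = 1 := by
  ext i j
  fin_cases i <;> fin_cases j <;> simp [cholesky]

theorem localFrame_record {x : S.FramedLocalSystem 2} {k : F → Sp 2} (hk : x.IsFrame k) (t : F) :
    localFrame (fun t => (k t).1) x.record t = (k t).1 := by
  rw [localFrame, frameMat, localShape_record hk, cholesky_one, projCols_record hk,
    projCols_record hk, pairing_mul_Sp, pairing_std_zero_one, inv_one, transpose_one,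
    Matrix.mul_one, Matrix.mul_one, Matrix.mul_one, ← Matrix.mul_fromCols]
  have : fromCols (stdMat 2 0) (stdMat 2 1) = 1 := by
    rw [stdMat_zero, stdMat_one, fromCols_fromRows_eq_fromBlocks, fromBlocks_one]
  rw [this, Matrix.mul_one]

theorem localEdge_record {x : S.FramedLocalSystem 2} {k : F → Sp 2} (hk : x.IsFrame k)
    (d : F × ZMod 3) : localEdge (fun t => (k t).1) x.record S d = x.edgeMat k d := by
  rw [FramedLocalSystem.edgeMat_eq, localEdge, localFrame_record hk, localFrame_record hk,
    x.opMat_record]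

end LocalFrame

namespace Skeleton

variable {m b : ℕ} (K : Skeleton S m b) (G : F → Matrix (Fin 2 ⊕ Fin 2) (Fin 2 ⊕ Fin 2) ℝ)

/-- The phase by which the linear part of the matrix of `d` is made positive. -/
def phase (w : Ambient F 2) (d : F × ZMod 3) : ℂ :=
  conj (holPart (localEdge G w S d)) * ((‖holPart (localEdge G w S d)‖⁻¹ : ℝ) : ℂ)

/-- The edge matrices made positive along the tree by rotations. -/
def localMat (w : Ambient F 2) (e : Fin m) : Matrix (Fin 2) (Fin 2) ℝ :=
  cmat (K.gauge (phase (S := S) G w) (S.glue (K.edge e)).1) 0 * localEdge G w S (K.edge e) *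
    (cmat (K.gauge (phase (S := S) G w) (K.edge e).1) 0)ᵀ

/-- The local section of the slice. -/
def localSection (w : Ambient F 2) : SliceSpace m b :=
  (fun e => (holPart (K.localMat G w e)).re, fun j => (holPart (K.localMat G w (K.free j))).im,
    fun e => antiPart (K.localMat G w e))

/-- The conditions under which `localSection` is smooth. -/
structure IsRegular (w : Ambient F 2) : Prop extends IsRegularFrame G w where
  tree : ∀ e, K.IsTree e →
    ‖antiPart (localEdge G w S (K.edge e))‖ < ‖holPart (localEdge G w S (K.edge e))‖

variable {K G} {w : Ambient F 2}

theorem IsRegular.hol_ne_zero (h : K.IsRegular G w) {e : Fin m} (he : K.IsTree e) :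
    holPart (localEdge G w S (K.edge e)) ≠ 0 :=
  norm_pos_iff.1 ((norm_nonneg _).trans_lt (h.tree e he))

theorem IsRegular.norm_phase (h : K.IsRegular G w) {e : Fin m} (he : K.IsTree e) :
    ‖phase (S := S) G w (K.edge e)‖ = 1 := by
  rw [phase, norm_mul, Complex.norm_conj, Complex.norm_real, norm_inv, norm_norm,
    mul_inv_cancel₀ (norm_ne_zero_iff.2 (h.hol_ne_zero he))]

theorem IsRegular.norm_gauge (h : K.IsRegular G w) (t : F) :
    ‖K.gauge (phase (S := S) G w) t‖ = 1 := by
  induction t using K.tree_induction with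
  | h0 => rw [gauge_root, norm_one]
  | h1 e he ih => rw [gauge_glue _ _ he, norm_mul, ih, h.norm_phase he, one_mul]

theorem IsRegular.contDiffAt_gauge (h : K.IsRegular G w) (t : F) :
    ContDiffAt ℝ ∞ (fun w => K.gauge (phase (S := S) G w) t) w := by
  induction t using K.tree_induction with
  | h0 =>
    simp only [gauge_root]
    exact contDiffAt_const
  | h1 e he ih =>
    simp only [gauge_glue _ _ he]
    have h1 := (h.smoothMatAt_localEdge (S := S) (K.edge e)).holPart
    exact ih.mul ((contDiff_conj.contDiffAt.comp w h1).mul (contDiff_ofReal.contDiffAt.comp w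
      ((h1.norm ℝ (h.hol_ne_zero he)).inv (norm_ne_zero_iff.2 (h.hol_ne_zero he)))))

theorem IsRegular.smoothMatAt_localMat (h : K.IsRegular G w) (e : Fin m) :
    SmoothMatAt (fun w => K.localMat G w e) w :=
  ((smoothMatAt_cmat (h.contDiffAt_gauge _) contDiffAt_const).mul
    (h.smoothMatAt_localEdge _)).mul
    (smoothMatAt_cmat (h.contDiffAt_gauge _) contDiffAt_const).transpose

theorem IsRegular.contDiffAt_localSection (h : K.IsRegular G w) :
    ContDiffAt ℝ ∞ (K.localSection G) w := by
  refine ContDiffAt.prodMk (contDiffAt_pi.2 fun e => ?_)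
    (ContDiffAt.prodMk (contDiffAt_pi.2 fun j => ?_) (contDiffAt_pi.2 fun e => ?_))
  · exact contDiff_re.contDiffAt.comp w (h.smoothMatAt_localMat e).holPart
  · exact contDiff_im.contDiffAt.comp w (h.smoothMatAt_localMat _).holPart
  · exact (h.smoothMatAt_localMat e).antiPart

theorem eventually_isRegular (h : K.IsRegular G w) : ∀ᶠ w' in 𝓝 w, K.IsRegular G w' := by
  have e1 : ∀ e, ∀ᶠ w' in 𝓝 w, K.IsTree e →
      ‖antiPart (localEdge G w' S (K.edge e))‖ < ‖holPart (localEdge G w' S (K.edge e))‖ := by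
    intro e
    by_cases he : K.IsTree e
    · have h1 := h.smoothMatAt_localEdge (S := S) (K.edge e)
      filter_upwards [h1.antiPart.continuousAt.norm.eventually_lt h1.holPart.continuousAt.norm
        (h.tree e he)] with w' hw' _
      exact hw'
    · exact Filter.Eventually.of_forall fun _ h => absurd h he
  filter_upwards [eventually_isRegularFrame h.toIsRegularFrame, Filter.eventually_all.2 e1] with
    w' h1 h2
  exact ⟨h1, h2⟩

/-- Passing from a triangle to its child adds one phase to the gauge, and that phase turns the
linear part of the edge into its modulus. Rotations suffice here, as the linear part dominates on
the tree. -/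
theorem IsRegular.localMat_tree (h : K.IsRegular G w) {e : Fin m} (he : K.IsTree e) :
    ∃ (p : ℝ) (z : ℂ), ‖z‖ < p ∧ K.localMat G w e = cmat p z := by
  set B := localEdge G w S (K.edge e) with hB
  set c := K.gauge (phase (S := S) G w) (K.edge e).1 with hcdef
  have hc : ‖c‖ = 1 := h.norm_gauge _
  have hne := norm_ne_zero_iff.2 (h.hol_ne_zero he)
  refine ⟨‖holPart B‖, c * phase (S := S) G w (K.edge e) * antiPart B * c, ?_, ?_⟩
  · rw [norm_mul, norm_mul, norm_mul, hc, h.norm_phase he]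
    simpa using h.tree e he
  · rw [localMat, gauge_glue _ _ he, ← hcdef, ← hB]
    conv_lhs => rw [← cmat_holPart_antiPart B]
    rw [conj_cmat_rot]
    congr 1
    have h1 : phase (S := S) G w (K.edge e) * holPart B = (‖holPart B‖ : ℂ) := by
      rw [phase, ← hB, mul_right_comm, mul_comm (conj _), Complex.mul_conj,
        Complex.normSq_eq_norm_sq, ← Complex.ofReal_mul, sq, mul_assoc, mul_inv_cancel₀ hne,
        mul_one]
    rw [mul_assoc c, h1, mul_right_comm, mul_comm c, conj_mul_self hc, one_mul]

theorem IsRegular.iso_localSection {x : S.FramedLocalSystem 2} (h : K.IsRegular G x.record) :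
    K.localSection G x.record ∈ K.slice ∧ x.Iso (K.point (K.localSection G x.record)).1 := by
  obtain ⟨k, hk, hedge⟩ := h.exists_isFrame
  have ho : ∀ t, (cmat (K.gauge (phase (S := S) G x.record) t) 0)ᵀ *
      cmat (K.gauge (phase (S := S) G x.record) t) 0 = 1 := fun t =>
    transpose_mul_cmat_zero (h.norm_gauge t)
  have hM : ∀ e, IsUnit (K.localMat G x.record e).det := fun e => by
    rw [localMat, det_mul, det_mul, det_transpose, ← hedge]
    exact ((isUnit_det_of_transpose_mul (ho _)).mul (hk.isUnit_edgeMat (K.edge_ne e))).mul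
      (isUnit_det_of_transpose_mul (ho _))
  refine ⟨(K.eq_sliceMat hM fun e he => h.localMat_tree he).1, ?_⟩
  refine (FramedLocalSystem.iso_equivalence S 2).trans (x.iso_edgeData_system hk) ?_
  exact K.exists_iso_point_of_edge (x.edgeData hk) hM (fun e he => h.localMat_tree he) ho
    fun e => by
      change _ = _ * x.edgeMat k (K.edge e) * _
      rw [hedge, localMat]

variable (K)

/-- The reference frame is one in which `x` already has the edge matrices of a point of the slice;
the required strict inequalities hold there, and they are open conditions. -/
theorem exists_isRegular (x : (S.Mf 2).E) : ∃ G, K.IsRegular G x.1.record := by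
  obtain ⟨v, hv, k, hk, hkL⟩ := K.exists_iso_point x
  have hfr : x.1.IsFrame fun t => (k t)⁻¹ := fun t i => movesTo_inv (hkL (t, i))
  refine ⟨fun t => ((k t)⁻¹).1, isRegularFrame_record hfr, fun e he => ?_⟩
  rw [localEdge_record hfr, FramedLocalSystem.edgeMat_of_trans_eq hk (K.edge_ne e),
    edgeData_mat_edge, sliceMat_eq K hv, antiPart_cmat, holPart_cmat, K.hol_tree v he,
    Complex.norm_real]
  exact ((hv e).2 he).trans_le (le_abs_self _)

/-- The slice criterion needs a smooth return near every representative `x`, not only near `point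
v`; the reference frame is therefore chosen depending on `x`. -/
theorem locallyIso_point {v : SliceSpace m b} (hv : v ∈ K.slice) :
    LocallyIso (S.Mf 2) (modelCircleInvolution m b m) ((S.Mf 2).cls (K.point v)) (cls _ v) := by
  refine locallyIso_of_slice (involutionRel m b m) K.isOpen_slice
    (fun v v' h hv => K.slice_saturated h hv) K.point
    (fun v hv v' hv' => (K.point_iso_iff hv hv').symm) K.contDiffOn_point ?_ hv
  intro v hv x hx
  obtain ⟨G, hG⟩ := K.exists_isRegular x
  obtain ⟨O, hO, hOo, hxO⟩ := mem_nhds_iff.1 (eventually_isRegular hG)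
  refine ⟨O, hOo, hxO, K.localSection G,
    fun w hw => (hO hw).contDiffAt_localSection.contDiffWithinAt, fun x' hx' => ?_⟩
  have h : K.IsRegular G x'.1.record := hO hx'
  exact ⟨h.iso_localSection.1, (FramedLocalSystem.iso_equivalence S 2).symm h.iso_localSection.2⟩

end Skeleton

end IdealSurface

end

/-! ### Direct sums and tensor products in terms of edge matrices. -/

noncomputable section

open Matrix ComplexConjugate SmoothQuotient

namespace IdealSurface

theorem blockSum_mul (g₁ g₂ h₁ h₂ : Matrix (Fin 1 ⊕ Fin 1) (Fin 1 ⊕ Fin 1) ℝ) :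
    blockSum g₁ g₂ * blockSum h₁ h₂ = blockSum (g₁ * h₁) (g₂ * h₂) := by
  simp only [blockSum, fromBlocks_multiply, diagonal_mul_diagonal, diagonal_add]
  congr 1 <;> congr 1 <;> funext i <;> fin_cases i <;> simp [mul_apply]

theorem blockSum_transpose (g₁ g₂ : Matrix (Fin 1 ⊕ Fin 1) (Fin 1 ⊕ Fin 1) ℝ) :
    (blockSum g₁ g₂)ᵀ = blockSum g₁ᵀ g₂ᵀ := by
  simp [blockSum, fromBlocks_transpose]

theorem blockSum_sympForm : blockSum (sympForm 1) (sympForm 1) = sympForm 2 := by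
  rw [blockSum, sympForm]
  congr 1 <;> ext i j <;> fin_cases i <;> fin_cases j <;> simp

theorem tensor_mul (g h : Matrix (Fin 1 ⊕ Fin 1) (Fin 1 ⊕ Fin 1) ℝ)
    (u w : Matrix (Fin 2) (Fin 2) ℝ) : tensor g u * tensor h w = tensor (g * h) (u * w) := by
  simp only [tensor, fromBlocks_multiply, Matrix.smul_mul, Matrix.mul_smul, smul_smul, ← add_smul]
  simp [mul_apply, mul_comm]

theorem tensor_one_right (g : Matrix (Fin 1 ⊕ Fin 1) (Fin 1 ⊕ Fin 1) ℝ) :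
    tensor g 1 = blockSum g g := by
  rw [tensor, blockSum]
  congr 1 <;> ext i j <;> fin_cases i <;> fin_cases j <;> simp

theorem blockSum_one : blockSum 1 1 = 1 := by
  rw [← tensor_one_right]
  simp [tensor]

theorem tensor_transpose (g : Matrix (Fin 1 ⊕ Fin 1) (Fin 1 ⊕ Fin 1) ℝ)
    (u : Matrix (Fin 2) (Fin 2) ℝ) : (tensor g u)ᵀ = tensor gᵀ uᵀ := by
  simp [tensor, fromBlocks_transpose]

theorem transpose_mul_of_mem {u : Matrix (Fin 2) (Fin 2) ℝ}
    (hu : u ∈ specialOrthogonalGroup (Fin 2) ℝ) : uᵀ * u = 1 :=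
  (mem_orthogonalGroup_iff' _ _).1 (mem_specialOrthogonalGroup_iff.1 hu).1

/-- The embedding of `SL(2, ℝ) × SL(2, ℝ)`. -/
def blockHom : Sp 1 × Sp 1 →* Sp 2 where
  toFun g := ⟨blockSum g.1.1 g.2.1, by
    rw [mem_Sp_iff, blockSum_transpose, ← blockSum_sympForm, blockSum_mul, blockSum_mul,
      mem_Sp_iff.1 g.1.2, mem_Sp_iff.1 g.2.2]⟩
  map_one' := Subtype.ext blockSum_one
  map_mul' _ _ := Subtype.ext (blockSum_mul _ _ _ _).symm

/-- The homomorphism of `SL(2, ℝ) × SO(2)` to `Sp(4, ℝ)`. -/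
def tensorHom : Sp 1 × specialOrthogonalGroup (Fin 2) ℝ →* Sp 2 where
  toFun g := ⟨tensor g.1.1 g.2.1, by
    rw [mem_Sp_iff, tensor_transpose, ← blockSum_sympForm, ← tensor_one_right, tensor_mul,
      tensor_mul, mem_Sp_iff.1 g.1.2, Matrix.mul_one, transpose_mul_of_mem g.2.2]⟩
  map_one' := Subtype.ext (by
    change tensor 1 1 = 1
    rw [tensor_one_right, blockSum_one])
  map_mul' _ _ := Subtype.ext (tensor_mul _ _ _ _).symm

theorem tensorHom_one_right (g : Sp 1) : tensorHom (g, 1) = blockHom (g, g) :=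
  Subtype.ext (tensor_one_right g.1)

theorem blockHom_rho : blockHom (rho 1, rho 1) = rho 2 := by
  refine Subtype.ext ?_
  change blockSum (rho 1).1 (rho 1).1 = (rho 2).1
  rw [blockSum, rho, rho]
  congr 1 <;> ext i j <;> fin_cases i <;> fin_cases j <;> simp

theorem blockHom_rot (i : ZMod 3) : blockHom (rot 1 i, rot 1 i) = rot 2 i := by
  rw [rot, rot, ← blockHom_rho, ← map_pow, Prod.pow_mk]

theorem swapMat_diagonal (A B : Matrix (Fin 1) (Fin 1) ℝ) (hA : IsUnit A.det)
    (hB : IsUnit B.det) :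
    swapMat (diagonal ![A 0 0, B 0 0]) = blockSum (swapMat A) (swapMat B) := by
  rw [det_unique, isUnit_iff_ne_zero] at hA hB
  have h : (diagonal ![A 0 0, B 0 0])⁻¹ = diagonal ![(A 0 0)⁻¹, (B 0 0)⁻¹] := by
    refine inv_eq_right_inv ?_
    rw [diagonal_mul_diagonal, ← diagonal_one]
    congr 1
    funext i
    fin_cases i
    · exact mul_inv_cancel₀ hA
    · exact mul_inv_cancel₀ hB
  rw [swapMat, blockSum, h]
  congr 1 <;> ext i j <;> fin_cases i <;> fin_cases j <;> simp [swapMat]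

theorem swapMat_smul (A : Matrix (Fin 1) (Fin 1) ℝ) (hA : IsUnit A.det)
    {u : Matrix (Fin 2) (Fin 2) ℝ} (hu : uᵀ * u = 1) :
    swapMat (A 0 0 • u) = tensor (swapMat A) u := by
  rw [det_unique, isUnit_iff_ne_zero] at hA
  have hA : A 0 0 ≠ 0 := hA
  have h : (A 0 0 • u)⁻¹ = (A 0 0)⁻¹ • uᵀ := by
    refine inv_eq_left_inv ?_
    rw [Matrix.smul_mul, Matrix.mul_smul, smul_smul, inv_mul_cancel₀ hA, hu, one_smul]
  rw [swapMat, tensor, h]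
  congr 1 <;> ext i j <;> simp [swapMat]

theorem isDirectSum_stdLag (i : ZMod 3) : IsDirectSum (stdLag 1 i) (stdLag 1 i) (stdLag 2 i) := by
  refine ZMod.forall_three (P := fun i => IsDirectSum (stdLag 1 i) (stdLag 1 i) (stdLag 2 i))
    ?_ ?_ ?_ i <;> intro v
  · simp [mem_stdLag_zero, planePart]
  · simp [mem_stdLag_one, planePart]
  · simp [mem_stdLag_two, planePart]

theorem planePart_blockSum (g₁ g₂ : Matrix (Fin 1 ⊕ Fin 1) (Fin 1 ⊕ Fin 1) ℝ) (v : SympVec 2) :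
    planePart 0 (matOp (blockSum g₁ g₂) v) = matOp g₁ (planePart 0 v) ∧
      planePart 1 (matOp (blockSum g₁ g₂) v) = matOp g₂ (planePart 1 v) := by
  constructor <;> ext i <;> rcases i with i | i <;>
    rw [Subsingleton.elim i 0] <;> simp [planePart, matOp_apply, blockSum, mulVec, dotProduct]

theorem blockHom_movesTo {g₁ g₂ : Sp 1} {ℓ₁ ℓ₂ ℓ₁' ℓ₂' : Lag 1} {L L' : Lag 2}
    (h₁ : MovesTo g₁ ℓ₁ ℓ₁') (h₂ : MovesTo g₂ ℓ₂ ℓ₂') (hL : IsDirectSum ℓ₁ ℓ₂ L)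
    (hL' : IsDirectSum ℓ₁' ℓ₂' L') : MovesTo (blockHom (g₁, g₂)) L L' := by
  refine movesTo_of_forall fun v hv => (hL' _).2 ?_
  obtain ⟨hv₁, hv₂⟩ := (hL v).1 hv
  obtain ⟨e₁, e₂⟩ := planePart_blockSum g₁.1 g₂.1 v
  change planePart 0 (matOp (blockSum g₁.1 g₂.1) v) ∈ _ ∧
    planePart 1 (matOp (blockSum g₁.1 g₂.1) v) ∈ _
  rw [e₁, e₂]
  exact ⟨h₁.mem hv₁, h₂.mem hv₂⟩

variable {F : Type*} [Fintype F] {S : IdealSurface F}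

/-- Frames of the two summands combine into a frame of the sum, where the edge matrices are
diagonal. -/
theorem exists_edgeData_of_blockSum {x : S.FramedLocalSystem 2} {y₁ y₂ : S.FramedLocalSystem 1}
    (hy₁ : y₁.IsMaximal) (hy₂ : y₂.IsMaximal)
    (h : ∀ d, (x.trans d).1 = blockSum (y₁.trans d).1 (y₂.trans d).1)
    (hlag : ∀ c, IsDirectSum (y₁.lag c) (y₂.lag c) (x.lag c)) :
    ∃ β : EdgeData S 2, x.Iso β.system ∧
      ∃ f₁ f₂ : F × ZMod 3 → ℝ, ∀ d, β.mat d = diagonal ![f₁ d, f₂ d] := by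
  obtain ⟨k₁, hk₁⟩ := hy₁.exists_isFrame_one
  obtain ⟨k₂, hk₂⟩ := hy₂.exists_isFrame_one
  have hfr : x.IsFrame fun t => blockHom (k₁ t, k₂ t) := fun t i =>
    blockHom_movesTo (hk₁ t i) (hk₂ t i) (isDirectSum_stdLag i) (hlag _)
  refine ⟨x.edgeData hfr, x.iso_edgeData_system hfr, fun d => y₁.edgeMat k₁ d 0 0,
    fun d => y₂.edgeMat k₂ d 0 0, fun d => ?_⟩
  have h1 : x.trans d = blockHom (y₁.trans d, y₂.trans d) := Subtype.ext (h d)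
  have h2 : x.rotatedTrans (fun t => blockHom (k₁ t, k₂ t)) d =
      blockHom (y₁.rotatedTrans k₁ d, y₂.rotatedTrans k₂ d) := by
    simp only [FramedLocalSystem.rotatedTrans, h1, ← blockHom_rot, ← map_mul, ← map_inv,
      Prod.mk_mul_mk, Prod.inv_mk]
  change (x.rotatedTrans _ d).1.toBlocks₁₂ = _
  rw [h2]
  exact toBlocks_fromBlocks₁₂ _ _ _ _

/-- A frame of the factor in SL(2, ℝ), doubled, commutes with the rotations `u`, which survive as
the orthogonal factors of the edge matrices. -/
theorem exists_edgeData_of_tensor {x : S.FramedLocalSystem 2} {y : S.FramedLocalSystem 1}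
    (hy : y.IsMaximal) {u : F × ZMod 3 → specialOrthogonalGroup (Fin 2) ℝ}
    (h : ∀ d, (x.trans d).1 = tensor (y.trans d).1 (u d).1)
    (hlag : ∀ c, IsDirectSum (y.lag c) (y.lag c) (x.lag c)) :
    ∃ β : EdgeData S 2, x.Iso β.system ∧
      ∃ f : F × ZMod 3 → ℝ, ∀ d, β.mat d = f d • (u d).1 := by
  obtain ⟨k, hk⟩ := hy.exists_isFrame_one
  have hfr : x.IsFrame fun t => tensorHom (k t, 1) := fun t i => by
    change MovesTo (tensorHom (k t, 1)) _ _
    rw [tensorHom_one_right]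
    exact blockHom_movesTo (hk t i) (hk t i) (isDirectSum_stdLag i) (hlag _)
  refine ⟨x.edgeData hfr, x.iso_edgeData_system hfr, fun d => y.edgeMat k d 0 0, fun d => ?_⟩
  have h1 : x.trans d = tensorHom (y.trans d, u d) := Subtype.ext (h d)
  have h2 : x.rotatedTrans (fun t => tensorHom (k t, 1)) d =
      tensorHom (y.rotatedTrans k d, u d) := by
    simp only [FramedLocalSystem.rotatedTrans, h1, ← blockHom_rot, ← tensorHom_one_right,
      ← map_mul, ← map_inv, Prod.mk_mul_mk, Prod.inv_mk, mul_one, inv_one, one_mul]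
  change (x.rotatedTrans _ d).1.toBlocks₁₂ = _
  rw [h2]
  exact toBlocks_fromBlocks₁₂ _ _ _ _

namespace EdgeData

theorem trans_eq_blockHom {β : EdgeData S 2} {γ₁ γ₂ : EdgeData S 1}
    (h : ∀ d, S.glue d ≠ d → β.mat d = diagonal ![γ₁.mat d 0 0, γ₂.mat d 0 0]) (d : F × ZMod 3) :
    β.trans d = blockHom (γ₁.trans d, γ₂.trans d) := by
  by_cases hd : S.glue d = d
  · rw [trans_of_eq _ hd, trans_of_eq _ hd, trans_of_eq _ hd, ← Prod.one_eq_mk, map_one]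
  · have h1 : (⟨swapMat (β.mat d), swapMat_mem (β.isUnit d hd)⟩ : Sp 2) =
        blockHom (⟨_, swapMat_mem (γ₁.isUnit d hd)⟩, ⟨_, swapMat_mem (γ₂.isUnit d hd)⟩) :=
      Subtype.ext (by
        change swapMat (β.mat d) = _
        rw [h d hd, swapMat_diagonal _ _ (γ₁.isUnit d hd) (γ₂.isUnit d hd)]
        rfl)
    rw [trans_of_ne _ hd, trans_of_ne _ hd, trans_of_ne _ hd, h1, ← blockHom_rot, ← blockHom_rot,
      ← map_mul, ← map_inv, ← map_mul]
    rfl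

theorem trans_eq_tensorHom {β : EdgeData S 2} {γ : EdgeData S 1}
    {u : F × ZMod 3 → specialOrthogonalGroup (Fin 2) ℝ} (hu : S.IsLocalSystem u)
    (h : ∀ d, S.glue d ≠ d → β.mat d = γ.mat d 0 0 • (u d).1) (d : F × ZMod 3) :
    β.trans d = tensorHom (γ.trans d, u d) := by
  by_cases hd : S.glue d = d
  · rw [trans_of_eq _ hd, trans_of_eq _ hd, (hu d).2 hd, ← Prod.one_eq_mk, map_one]
  · have h1 : (⟨swapMat (β.mat d), swapMat_mem (β.isUnit d hd)⟩ : Sp 2) =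
        tensorHom (⟨_, swapMat_mem (γ.isUnit d hd)⟩, u d) :=
      Subtype.ext (by
        change swapMat (β.mat d) = _
        rw [h d hd, swapMat_smul _ (γ.isUnit d hd) (transpose_mul_of_mem (u d).2)]
        rfl)
    rw [trans_of_ne _ hd, trans_of_ne _ hd, h1, ← blockHom_rot, ← blockHom_rot,
      ← tensorHom_one_right, ← tensorHom_one_right, ← map_mul, ← map_inv, ← map_mul]
    simp

/-- The maximal framed local system with the given edge matrices. -/
def toMf {n : ℕ} (β : EdgeData S n) : (S.Mf n).E := ⟨β.system, β.system_isMaximal⟩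

theorem toMf_mem_product {β : EdgeData S 2} {γ₁ γ₂ : EdgeData S 1}
    (h : ∀ d, S.glue d ≠ d → β.mat d = diagonal ![γ₁.mat d 0 0, γ₂.mat d 0 0]) :
    (S.Mf 2).cls β.toMf ∈ S.MfProduct :=
  ⟨β.toMf, γ₁.toMf, γ₂.toMf, rfl, fun d => congrArg Subtype.val (trans_eq_blockHom h d),
    fun c => isDirectSum_stdLag c.2⟩

theorem toMf_mem_tensor {β : EdgeData S 2} {γ : EdgeData S 1}
    {u : F × ZMod 3 → specialOrthogonalGroup (Fin 2) ℝ} (hu : S.IsLocalSystem u)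
    (h : ∀ d, S.glue d ≠ d → β.mat d = γ.mat d 0 0 • (u d).1) :
    (S.Mf 2).cls β.toMf ∈ S.MfTensorSO :=
  ⟨β.toMf, γ.toMf, u, rfl, hu, fun d => congrArg Subtype.val (trans_eq_tensorHom hu h d),
    fun c => isDirectSum_stdLag c.2⟩

theorem toMf_mem_diagonal {β : EdgeData S 2} {γ : EdgeData S 1}
    (h : ∀ d, S.glue d ≠ d → β.mat d = γ.mat d 0 0 • 1) :
    (S.Mf 2).cls β.toMf ∈ S.MfDiagonal := by
  have hu : S.IsLocalSystem fun _ => (1 : specialOrthogonalGroup (Fin 2) ℝ) :=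
    fun d => ⟨fun _ => one_mul _, fun _ => rfl⟩
  exact ⟨β.toMf, γ.toMf, rfl, fun d => congrArg Subtype.val (trans_eq_tensorHom hu h d),
    fun c => isDirectSum_stdLag c.2⟩

end EdgeData

end IdealSurface

end

/-! ### The product, tensor and diagonal loci in the slice. -/

noncomputable section

open Matrix ComplexConjugate SmoothQuotient

namespace IdealSurface

theorem diagonal_eq_cmat (x y : ℝ) :
    diagonal ![x, y] = cmat (((x + y) / 2 : ℝ) : ℂ) (((x - y) / 2 : ℝ) : ℂ) := by
  ext i j
  fin_cases i <;> fin_cases j <;> simp [cmat] <;> ring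

theorem cmat_ofReal_zero (x : ℝ) : cmat x 0 = x • 1 := by
  ext i j
  fin_cases i <;> fin_cases j <;> simp [cmat]

theorem smul_cmat_zero (x : ℝ) (a : ℂ) : x • cmat a 0 = cmat (x * a) 0 := by
  ext i j
  fin_cases i <;> fin_cases j <;> simp [cmat]

theorem cmat_mem_specialOrthogonalGroup {c : ℂ} (hc : ‖c‖ = 1) :
    cmat c 0 ∈ specialOrthogonalGroup (Fin 2) ℝ := by
  refine mem_specialOrthogonalGroup_iff.2
    ⟨(mem_orthogonalGroup_iff' _ _).2 (transpose_mul_cmat_zero hc), ?_⟩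
  rw [det_cmat, Complex.normSq_eq_norm_sq, hc]
  simp

theorem eq_cmat_of_mem_specialOrthogonalGroup {u : Matrix (Fin 2) (Fin 2) ℝ}
    (hu : u ∈ specialOrthogonalGroup (Fin 2) ℝ) : ∃ c : ℂ, u = cmat c 0 := by
  obtain ⟨c, hc, h | h⟩ := eq_cmat_of_transpose_mul (transpose_mul_of_mem hu)
  · exact ⟨c, h⟩
  · have h1 := (mem_specialOrthogonalGroup_iff.1 hu).2
    rw [h, det_cmat, Complex.normSq_eq_norm_sq c, hc] at h1
    norm_num at h1

variable {F : Type*} [Fintype F] {S : IdealSurface F}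

theorem cls_eq_cls_iff {n : ℕ} {x y : (S.Mf n).E} :
    (S.Mf n).cls x = (S.Mf n).cls y ↔ x.1.Iso y.1 :=
  Quotient.eq

namespace Skeleton

variable {m b : ℕ} (K : Skeleton S m b)

theorem cls_point_eq_iff {v v' : SliceSpace m b} (hv : v ∈ K.slice) (hv' : v' ∈ K.slice) :
    (S.Mf 2).cls (K.point v) = (S.Mf 2).cls (K.point v') ↔ involutionRel m b m v v' :=
  cls_eq_cls_iff.trans (K.point_iso_iff hv hv')

theorem exists_cls_point_eq (x : (S.Mf 2).Pt) : ∃ v ∈ K.slice, (S.Mf 2).cls (K.point v) = x := by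
  obtain ⟨y, rfl⟩ : ∃ y, (S.Mf 2).cls y = x := Quotient.exists_rep x
  obtain ⟨v, hv, h⟩ := K.exists_iso_point y
  exact ⟨v, hv, (cls_eq_cls_iff.2 h).symm⟩

theorem iso_point_iff {v : SliceSpace m b} (hv : v ∈ K.slice) (β : EdgeData S 2) :
    β.system.Iso (K.point v).1 ↔
      ∃ o : F → Matrix (Fin 2) (Fin 2) ℝ, (∀ t, (o t)ᵀ * o t = 1) ∧
      ∀ e, cmat (K.hol v e) (v.2.2 e) =
        o (S.glue (K.edge e)).1 * β.mat (K.edge e) * (o (K.edge e).1)ᵀ := by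
  rw [point, EdgeData.system_iso_iff_edge K]
  simp only [edgeData_mat_edge, sliceMat_eq K hv]

theorem hol_ne_zero {v : SliceSpace m b} (hv : v ∈ K.slice) (hz : v.2.2 = 0) (e : Fin m) :
    K.hol v e ≠ 0 := by
  have := (hv e).1
  rw [hz] at this
  simpa using this

/-- The one-dimensional edge data with the given numbers on the edges. -/
def scalarData (f : Fin m → ℝ) (hf : ∀ e, f e ≠ 0) : EdgeData S 1 :=
  K.edgeData (fun e => of fun _ _ => f e) fun e => by
    rw [det_unique]
    exact (hf e).isUnit

theorem scalarData_edge (f : Fin m → ℝ) (hf : ∀ e, f e ≠ 0) (e : Fin m) :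
    (K.scalarData f hf).mat (K.edge e) 0 0 = f e := by
  rw [scalarData, edgeData_mat_edge]
  rfl

theorem scalarData_glue (f : Fin m → ℝ) (hf : ∀ e, f e ≠ 0) {d : F × ZMod 3} (hd : S.glue d ≠ d) :
    (K.scalarData f hf).mat (S.glue d) 0 0 = -(K.scalarData f hf).mat d 0 0 := by
  rw [(K.scalarData f hf).glue d hd]
  rfl

theorem forall_internal {P : F × ZMod 3 → Prop} (h : ∀ e, P (K.edge e))
    (h' : ∀ d, S.glue d ≠ d → P d → P (S.glue d)) {d : F × ZMod 3} (hd : S.glue d ≠ d) : P d := by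
  rcases K.exists_edge d hd with ⟨e, rfl⟩ | ⟨e, rfl⟩
  · exact h e
  · exact h' _ (K.edge_ne e) (h e)

theorem mem_diagonal_of {v : SliceSpace m b} (hv : v ∈ K.slice) (hq : v.2.1 = 0)
    (hz : v.2.2 = 0) : (S.Mf 2).cls (K.point v) ∈ S.MfDiagonal := by
  have hhol : ∀ e, K.hol v e = (v.1 e : ℂ) := fun e => by
    rw [hol, hq]
    simp [zeroExtend, Complex.ext_iff]
  have hne : ∀ e, v.1 e ≠ 0 := fun e h => K.hol_ne_zero hv hz e (by rw [hhol, h, Complex.ofReal_zero])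
  refine EdgeData.toMf_mem_diagonal (β := K.edgeData _ (K.isUnit_sliceMat v))
    (γ := K.scalarData v.1 hne) fun d hd => ?_
  refine K.forall_internal (P := fun d => (K.edgeData _ (K.isUnit_sliceMat v)).mat d =
    (K.scalarData v.1 hne).mat d 0 0 • 1) (fun e => ?_) (fun d hd h => ?_) hd
  · rw [edgeData_mat_edge, scalarData_edge, K.sliceMat_eq hv, hhol, hz, ← cmat_ofReal_zero]
    rfl
  · rw [EdgeData.glue _ _ hd, h, K.scalarData_glue _ _ hd]
    simp

theorem mem_product_of {v : SliceSpace m b} (hv : v ∈ K.slice) (hq : v.2.1 = 0)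
    (hz : ∀ e, (v.2.2 e).im = 0) : (S.Mf 2).cls (K.point v) ∈ S.MfProduct := by
  have hhol : ∀ e, K.hol v e = (v.1 e : ℂ) := fun e => by
    rw [hol, hq]
    simp [zeroExtend, Complex.ext_iff]
  have hzr : ∀ e, v.2.2 e = ((v.2.2 e).re : ℂ) := fun e => by
    rw [Complex.ext_iff]
    simp [hz]
  -- With both parts real the edge matrix is diagonal, and the sum and the difference of the parts
  -- are the edge numbers of the two summands.
  have hmat : ∀ e, K.sliceMat v e = diagonal ![v.1 e + (v.2.2 e).re, v.1 e - (v.2.2 e).re] :=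
    fun e => by
    rw [K.sliceMat_eq hv, hhol, hzr, diagonal_eq_cmat]
    congr 2 <;> simp
  have hne : ∀ e, v.1 e + (v.2.2 e).re ≠ 0 ∧ v.1 e - (v.2.2 e).re ≠ 0 := fun e => by
    have := (K.isUnit_sliceMat v e).ne_zero
    rw [hmat, det_diagonal, Fin.prod_univ_two] at this
    exact mul_ne_zero_iff.1 this
  refine EdgeData.toMf_mem_product (β := K.edgeData _ (K.isUnit_sliceMat v))
    (γ₁ := K.scalarData _ fun e => (hne e).1) (γ₂ := K.scalarData _ fun e => (hne e).2)
    fun d hd => ?_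
  refine K.forall_internal (P := fun d => (K.edgeData _ (K.isUnit_sliceMat v)).mat d =
    diagonal ![(K.scalarData _ fun e => (hne e).1).mat d 0 0,
      (K.scalarData _ fun e => (hne e).2).mat d 0 0]) (fun e => ?_) (fun d hd h => ?_) hd
  · rw [edgeData_mat_edge, scalarData_edge, scalarData_edge, hmat]
  · rw [EdgeData.glue _ _ hd, h, K.scalarData_glue _ _ hd, K.scalarData_glue _ _ hd]
    ext i j
    fin_cases i <;> fin_cases j <;> simp

/-- A nonzero complex number is its modulus times a rotation: the moduli give the SL(2, ℝ)-system
and the rotations the SO(2)-system. -/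
theorem mem_tensor_of {v : SliceSpace m b} (hv : v ∈ K.slice) (hz : v.2.2 = 0) :
    (S.Mf 2).cls (K.point v) ∈ S.MfTensorSO := by
  have hne : ∀ e, ‖K.hol v e‖ ≠ 0 := fun e => norm_ne_zero_iff.2 (K.hol_ne_zero hv hz e)
  set β := K.edgeData _ (K.isUnit_sliceMat v) with hβ
  set γ := K.scalarData _ hne with hγ
  have hγne : ∀ d, S.glue d ≠ d → γ.mat d 0 0 ≠ 0 := fun d hd => by
    have := (γ.isUnit d hd).ne_zero
    rwa [det_unique] at this
  have hex : ∀ d, S.glue d ≠ d → ∃ u : specialOrthogonalGroup (Fin 2) ℝ,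
      β.mat d = γ.mat d 0 0 • u.1 := fun d hd => by
    refine K.forall_internal (P := fun d => ∃ u : specialOrthogonalGroup (Fin 2) ℝ,
      β.mat d = γ.mat d 0 0 • u.1) (fun e => ?_) (fun d hd h => ?_) hd
    · refine ⟨⟨cmat ((‖K.hol v e‖⁻¹ : ℝ) * K.hol v e) 0, cmat_mem_specialOrthogonalGroup ?_⟩, ?_⟩
      · rw [norm_mul, Complex.norm_real, norm_inv, norm_norm, inv_mul_cancel₀ (hne e)]
      · rw [hβ, hγ, edgeData_mat_edge, scalarData_edge, K.sliceMat_eq hv, hz, smul_cmat_zero,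
          ← mul_assoc, ← Complex.ofReal_mul, mul_inv_cancel₀ (hne e), Complex.ofReal_one, one_mul]
        rfl
    · obtain ⟨u, hu⟩ := h
      refine ⟨u⁻¹, ?_⟩
      rw [β.glue d hd, hu, K.scalarData_glue _ _ hd, transpose_smul, neg_smul]
      rfl
  have hex' : ∀ d, ∃ u : specialOrthogonalGroup (Fin 2) ℝ,
      (S.glue d ≠ d → β.mat d = γ.mat d 0 0 • u.1) ∧ (S.glue d = d → u = 1) := fun d => by
    by_cases hd : S.glue d = d
    · exact ⟨1, fun h => absurd hd h, fun _ => rfl⟩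
    · obtain ⟨u, hu⟩ := hex d hd
      exact ⟨u, fun _ => hu, fun h => absurd h hd⟩
  choose u hu hu' using hex'
  refine EdgeData.toMf_mem_tensor (β := β) (γ := γ) (u := u)
    (fun d => ⟨fun hd => ?_, hu' d⟩) hu
  refine Subtype.ext ?_
  change (u (S.glue d)).1 * (u d).1 = 1
  have h1 := hu _ (glue_ne_of_ne hd)
  rw [β.glue d hd, hu d hd, K.scalarData_glue _ _ hd, transpose_smul, neg_smul, neg_inj] at h1
  rw [← smul_right_injective _ (hγne d hd) h1]
  exact transpose_mul_of_mem (u d).2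

theorem orthogonal_type_of_pos {o : F → Matrix (Fin 2) (Fin 2) ℝ} (ho : ∀ t, (o t)ᵀ * o t = 1)
    {v : SliceSpace m b} (hv : v ∈ K.slice) {a : Fin m → ℂ}
    (h : ∀ e, cmat (K.hol v e) (v.2.2 e) =
        o (S.glue (K.edge e)).1 * cmat (a e) 0 * (o (K.edge e).1)ᵀ) :
    (∃ c : F → ℂ, ∀ t, ‖c t‖ = 1 ∧ o t = cmat (c t) 0) ∨
      (∃ c : F → ℂ, ∀ t, ‖c t‖ = 1 ∧ o t = cmat 0 (c t)) := by
  refine K.orthogonal_type ho fun e he => ?_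
  have h1 := K.det_pos_of_tree hv he
  rw [h e, det_mul, det_mul, det_transpose, det_cmat, map_zero, sub_zero] at h1
  have h2 := Complex.normSq_nonneg (a e)
  by_contra h3
  nlinarith

/-- The edge matrices of a tensor product are complex linear, and changes of frame that are all
rotations or all reflections keep them so. -/
theorem eq_zero_of_mem_tensor {v : SliceSpace m b} (hv : v ∈ K.slice)
    (h : (S.Mf 2).cls (K.point v) ∈ S.MfTensorSO) : v.2.2 = 0 := by
  obtain ⟨x, y, u, hx, -, htr, hlag⟩ := h
  obtain ⟨β, hβ, f, hf⟩ := exists_edgeData_of_tensor y.2 htr hlag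
  have hiso := (FramedLocalSystem.iso_equivalence S 2).trans
    ((FramedLocalSystem.iso_equivalence S 2).symm hβ) (cls_eq_cls_iff.1 hx)
  obtain ⟨o, ho, heq⟩ := (K.iso_point_iff hv β).1 hiso
  choose c hc using fun d => eq_cmat_of_mem_specialOrthogonalGroup (u d).2
  simp only [hf, hc, smul_cmat_zero] at heq
  funext e
  rcases K.orthogonal_type_of_pos ho hv heq with ⟨g, hg⟩ | ⟨g, hg⟩
  · have := heq e
    rw [(hg _).2, (hg _).2, conj_cmat_rot, cmat_inj] at this
    simpa using this.2
  · have := heq e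
    rw [(hg _).2, (hg _).2, conj_cmat_refl, cmat_inj] at this
    simpa using this.2

/-- The edge matrices of the given system are real scalars. Real linear parts on the tree make all
the phases real multiples of the one at the root, so the linear parts on the free edges are real as
well. -/
theorem eq_zero_of_mem_diagonal {v : SliceSpace m b} (hv : v ∈ K.slice)
    (h : (S.Mf 2).cls (K.point v) ∈ S.MfDiagonal) : v.2.1 = 0 := by
  obtain ⟨x, y, hx, htr, hlag⟩ := h
  obtain ⟨β, hβ, f, hf⟩ := exists_edgeData_of_tensor (u := fun _ => 1) y.2 htr hlag
  have hiso := (FramedLocalSystem.iso_equivalence S 2).trans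
    ((FramedLocalSystem.iso_equivalence S 2).symm hβ) (cls_eq_cls_iff.1 hx)
  obtain ⟨o, ho, heq⟩ := (K.iso_point_iff hv β).1 hiso
  have hone : ∀ d, β.mat d = cmat (f d : ℂ) 0 := fun d => by
    rw [hf, cmat_ofReal_zero]
    rfl
  simp only [hone] at heq
  obtain ⟨c, hc, hhol⟩ : ∃ c : F → ℂ, (∀ t, ‖c t‖ = 1) ∧ ∀ e, K.hol v e =
      c (S.glue (K.edge e)).1 * f (K.edge e) * conj (c (K.edge e).1) := by
    rcases K.orthogonal_type_of_pos ho hv heq with ⟨g, hg⟩ | ⟨g, hg⟩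
    · refine ⟨g, fun t => (hg t).1, fun e => ?_⟩
      have := heq e
      rw [(hg _).2, (hg _).2, conj_cmat_rot, cmat_inj] at this
      exact this.1
    · refine ⟨g, fun t => (hg t).1, fun e => ?_⟩
      have := heq e
      rw [(hg _).2, (hg _).2, conj_cmat_refl, cmat_inj, Complex.conj_ofReal] at this
      exact this.1
  have hreal : ∀ t, ∃ s : ℝ, c t = s * c K.root := fun t => by
    induction t using K.tree_induction with
    | h0 => exact ⟨1, by simp⟩
    | h1 e he ih =>
      obtain ⟨s, hs⟩ := ih
      have h1 := hhol e
      rw [K.hol_tree v he] at h1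
      have hfe : (f (K.edge e) : ℂ) ≠ 0 := fun h0 => by
        rw [h0, mul_zero, zero_mul, Complex.ofReal_eq_zero] at h1
        exact (K.pos_of_tree hv he).ne' h1
      refine ⟨v.1 e / f (K.edge e) * s, ?_⟩
      have h2 : c (S.glue (K.edge e)).1 * f (K.edge e) = v.1 e * c (K.edge e).1 := by
        rw [h1, mul_assoc _ (conj _), conj_mul_self (hc _), mul_one]
      rw [eq_div_of_mul_eq hfe h2, hs]
      push_cast
      ring
  funext j
  obtain ⟨s, hs⟩ := hreal (K.edge (K.free j)).1
  obtain ⟨s', hs'⟩ := hreal (S.glue (K.edge (K.free j))).1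
  have h1 := hhol (K.free j)
  have h2 : K.hol v (K.free j) = ((s' * f (K.edge (K.free j)) * s : ℝ) : ℂ) := by
    rw [h1, hs, hs', map_mul, Complex.conj_ofReal]
    push_cast
    linear_combination (s' * f (K.edge (K.free j)) * s : ℂ) * conj_mul_self (hc K.root)
  have h3 := congrArg Complex.im h2
  rw [Complex.ofReal_im] at h3
  change K.zeroExtend v.2.1 (K.free j) = 0 at h3
  rwa [zeroExtend_free] at h3

theorem mem_tensor_iff {v : SliceSpace m b} (hv : v ∈ K.slice) :
    (S.Mf 2).cls (K.point v) ∈ S.MfTensorSO ↔ v.2.2 = 0 :=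
  ⟨K.eq_zero_of_mem_tensor hv, K.mem_tensor_of hv⟩

theorem diagonal_subset_tensor : S.MfDiagonal ⊆ S.MfTensorSO := by
  rintro _ ⟨x, y, hx, htr, hlag⟩
  exact ⟨x, y, fun _ => 1, hx, fun d => ⟨fun _ => one_mul _, fun _ => rfl⟩, htr, hlag⟩

theorem mem_diagonal_iff {v : SliceSpace m b} (hv : v ∈ K.slice) :
    (S.Mf 2).cls (K.point v) ∈ S.MfDiagonal ↔ v.2.1 = 0 ∧ v.2.2 = 0 :=
  ⟨fun h => ⟨K.eq_zero_of_mem_diagonal hv h,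
    K.eq_zero_of_mem_tensor hv (diagonal_subset_tensor h)⟩, fun h => K.mem_diagonal_of hv h.1 h.2⟩

/-- Diagonal edge matrices can be made positive along the tree by diagonal sign matrices, which keep
the other edges diagonal; the normalized system is then a slice point with real parts only. -/
theorem exists_of_mem_product {v : SliceSpace m b} (hv : v ∈ K.slice)
    (h : (S.Mf 2).cls (K.point v) ∈ S.MfProduct) :
    ∃ v', involutionRel m b m v v' ∧ v'.2.1 = 0 ∧ ∀ e, (v'.2.2 e).im = 0 := by
  obtain ⟨x, y₁, y₂, hx, htr, hlag⟩ := h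
  obtain ⟨β, hβ, f₁, f₂, hf⟩ := exists_edgeData_of_blockSum y₁.2 y₂.2 htr hlag
  -- The value at `0` must also be a sign, for orthogonality on sides where the edge number is
  -- unconstrained.
  let sg : ℝ → ℝ := fun r => if 0 < r then 1 else -1
  have hsg : ∀ r, r ≠ 0 → 0 < sg r * r := fun r hr => by
    rcases lt_or_gt_of_ne hr with h | h
    · simp only [sg, if_neg h.not_gt]
      linarith
    · simp only [sg, if_pos h]
      linarith
  have hsg2 : ∀ r, sg r * sg r = 1 := fun r => by
    simp only [sg]
    split_ifs <;> norm_num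
  let φ : F × ZMod 3 → Matrix (Fin 2) (Fin 2) ℝ := fun d => diagonal ![sg (f₁ d), sg (f₂ d)]
  have hmul : ∀ a b c d : ℝ, (diagonal ![a, b] * diagonal ![c, d] : Matrix (Fin 2) (Fin 2) ℝ) =
      diagonal ![a * c, b * d] := fun a b c d => by
    rw [diagonal_mul_diagonal]
    congr 1
    funext i
    fin_cases i <;> rfl
  have hg : ∀ t, ∃ s₁ s₂ : ℝ, s₁ * s₁ = 1 ∧ s₂ * s₂ = 1 ∧ K.gauge φ t = diagonal ![s₁, s₂] :=
    fun t => by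
    induction t using K.tree_induction with
    | h0 =>
      refine ⟨1, 1, by norm_num, by norm_num, ?_⟩
      rw [gauge_root, ← diagonal_one]
      congr 1
      funext i
      fin_cases i <;> rfl
    | h1 e he ih =>
      obtain ⟨s₁, s₂, h1, h2, h3⟩ := ih
      refine ⟨s₁ * sg (f₁ (K.edge e)), s₂ * sg (f₂ (K.edge e)), ?_, ?_, ?_⟩
      · rw [mul_mul_mul_comm, h1, hsg2, one_mul]
      · rw [mul_mul_mul_comm, h2, hsg2, one_mul]
      · rw [gauge_glue _ _ he, h3, hmul]
  have hone : (diagonal ![1, 1] : Matrix (Fin 2) (Fin 2) ℝ) = 1 := by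
    rw [← diagonal_one]
    congr 1
    funext i
    fin_cases i <;> rfl
  have ho := K.gauge_orthogonal (φ := φ) fun d => by
    rw [diagonal_transpose, hmul, hsg2, hsg2, hone]
  let M : Fin m → Matrix (Fin 2) (Fin 2) ℝ := fun e =>
    K.gauge φ (S.glue (K.edge e)).1 * β.mat (K.edge e) * (K.gauge φ (K.edge e).1)ᵀ
  have hM : ∀ e, IsUnit (M e).det := fun e => by
    rw [det_mul, det_mul, det_transpose]
    exact ((isUnit_det_of_transpose_mul (ho _)).mul (β.isUnit _ (K.edge_ne e))).mul
      (isUnit_det_of_transpose_mul (ho _))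
  have hMd : ∀ e, ∃ r₁ r₂ : ℝ, M e = diagonal ![r₁, r₂] := fun e => by
    obtain ⟨s₁, s₂, -, -, h3⟩ := hg (K.edge e).1
    obtain ⟨s₁', s₂', -, -, h3'⟩ := hg (S.glue (K.edge e)).1
    exact ⟨_, _, by simp only [M]; rw [h3, h3', hf, diagonal_transpose, hmul, hmul]⟩
  have htree : ∀ e, K.IsTree e → ∃ (p : ℝ) (z : ℂ), ‖z‖ < p ∧ M e = cmat p z := fun e he => by
    obtain ⟨s₁, s₂, h1, h2, h3⟩ := hg (K.edge e).1
    have hne := (β.isUnit _ (K.edge_ne e)).ne_zero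
    rw [hf, det_diagonal, Fin.prod_univ_two] at hne
    have hne := mul_ne_zero_iff.1 hne
    have p1 := hsg _ hne.1
    have p2 := hsg _ hne.2
    have hMe : M e = diagonal ![sg (f₁ (K.edge e)) * f₁ (K.edge e),
        sg (f₂ (K.edge e)) * f₂ (K.edge e)] := by
      simp only [M]
      rw [gauge_glue _ _ he, h3, hf, diagonal_transpose, hmul, hmul, hmul]
      rw [show s₁ * sg (f₁ (K.edge e)) * f₁ (K.edge e) * s₁ = sg (f₁ (K.edge e)) * f₁ (K.edge e) by
          linear_combination (sg (f₁ (K.edge e)) * f₁ (K.edge e)) * h1,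
        show s₂ * sg (f₂ (K.edge e)) * f₂ (K.edge e) * s₂ = sg (f₂ (K.edge e)) * f₂ (K.edge e) by
          linear_combination (sg (f₂ (K.edge e)) * f₂ (K.edge e)) * h2]
    refine ⟨_, _, ?_, hMe.trans (diagonal_eq_cmat _ _)⟩
    rw [Complex.norm_real, Real.norm_eq_abs, abs_lt]
    change 0 < sg (f₁ (K.edge e)) * f₁ (K.edge e) at p1
    change 0 < sg (f₂ (K.edge e)) * f₂ (K.edge e) at p2
    constructor <;> linarith
  obtain ⟨hmem, -⟩ := K.eq_sliceMat hM htree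
  refine ⟨_, (K.point_iso_iff hv hmem).1 ?_, ?_, fun e => ?_⟩
  · exact (FramedLocalSystem.iso_equivalence S 2).trans
      ((FramedLocalSystem.iso_equivalence S 2).symm (cls_eq_cls_iff.1 hx))
      ((FramedLocalSystem.iso_equivalence S 2).trans hβ
        (K.exists_iso_point_of_edge β hM htree ho fun e => rfl))
  · funext j
    obtain ⟨r₁, r₂, hr⟩ := hMd (K.free j)
    change (holPart (M (K.free j))).im = 0
    rw [hr, diagonal_eq_cmat, holPart_cmat, Complex.ofReal_im]
  · obtain ⟨r₁, r₂, hr⟩ := hMd e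
    change (antiPart (M e)).im = 0
    rw [hr, diagonal_eq_cmat, antiPart_cmat, Complex.ofReal_im]

theorem mem_product_iff {v : SliceSpace m b} (hv : v ∈ K.slice) :
    (S.Mf 2).cls (K.point v) ∈ S.MfProduct ↔
      ∃ v', involutionRel m b m v v' ∧ v'.2.1 = 0 ∧ ∀ e, (v'.2.2 e).im = 0 := by
  refine ⟨K.exists_of_mem_product hv, ?_⟩
  rintro ⟨v', h, hq, hz⟩
  rw [(K.cls_point_eq_iff hv (K.slice_saturated h hv)).2 h]
  exact K.mem_product_of (K.slice_saturated h hv) hq hz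

/-- A parametrization of the linear parts by logarithms. -/
def expPoint (s : (Fin m → ℝ) × (Fin b → ℝ)) : SliceSpace m b :=
  (fun e => Real.exp (s.1 e) * Real.cos (K.zeroExtend s.2 e),
    fun j => Real.exp (s.1 (K.free j)) * Real.sin (s.2 j), 0)

theorem hol_expPoint (s : (Fin m → ℝ) × (Fin b → ℝ)) (e : Fin m) :
    K.hol (K.expPoint s) e = Complex.exp (s.1 e + K.zeroExtend s.2 e * Complex.I) := by
  apply Complex.ext
  · simp [Complex.exp_re, hol, expPoint]
  · by_cases he : K.IsTree e
    · simp [Complex.exp_im, hol, expPoint, K.zeroExtend_tree _ he]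
    · obtain ⟨j, rfl⟩ := K.exists_free he
      simp [Complex.exp_im, hol, expPoint, K.zeroExtend_free]

theorem expPoint_mem (s : (Fin m → ℝ) × (Fin b → ℝ)) : K.expPoint s ∈ K.slice := by
  intro e
  constructor
  · rw [hol_expPoint]
    simp [expPoint]
  · intro he
    simp [expPoint, K.zeroExtend_tree _ he, Real.exp_pos]

/-- With no antilinear part all linear parts are nonzero and have logarithms; on the tree they are
positive, so the argument vanishes as the parametrization demands. -/
theorem exists_expPoint_eq {v : SliceSpace m b} (hv : v ∈ K.slice) (hz : v.2.2 = 0) :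
    ∃ s, K.expPoint s = v := by
  let s : (Fin m → ℝ) × (Fin b → ℝ) :=
    (fun e => Real.log ‖K.hol v e‖, fun j => (K.hol v (K.free j)).arg)
  have harg : ∀ e, K.zeroExtend s.2 e = (K.hol v e).arg := fun e => by
    by_cases he : K.IsTree e
    · rw [K.zeroExtend_tree _ he, K.hol_tree v he, Complex.arg_ofReal_of_nonneg
        (K.pos_of_tree hv he).le]
    · obtain ⟨j, rfl⟩ := K.exists_free he
      rw [K.zeroExtend_free]
  have h := (K.hol_ext_iff (v := v) (v' := K.expPoint s)).1 fun e => by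
    rw [hol_expPoint, harg]
    exact Complex.exp_log (K.hol_ne_zero hv hz e)
  exact ⟨s, Prod.ext h.1 (Prod.ext h.2 hz.symm)⟩

theorem continuous_expPoint : Continuous K.expPoint := by
  unfold expPoint zeroExtend
  refine Continuous.prodMk (continuous_pi fun e => ?_) (by fun_prop)
  refine Continuous.mul (by fun_prop) (Real.continuous_cos.comp ?_)
  refine continuous_finsetSum _ fun j _ => ?_
  split_ifs <;> fun_prop

theorem continuous_cls_expPoint :
    Continuous fun s => (S.Mf 2).cls (K.point (K.expPoint s)) := by
  have h1 : Continuous fun s => (S.Mf 2).ι (K.point (K.expPoint s)) :=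
    K.contDiffOn_point.continuousOn.comp_continuous K.continuous_expPoint K.expPoint_mem
  let _ : TopologicalSpace (S.Mf 2).E := TopologicalSpace.induced (S.Mf 2).ι inferInstance
  have h2 : Continuous fun s => K.point (K.expPoint s) := continuous_induced_rng.2 h1
  exact continuous_coinduced_rng.comp h2

theorem isConnected_tensor (K : Skeleton S m b) : IsConnected S.MfTensorSO := by
  have : S.MfTensorSO = Set.range fun s => (S.Mf 2).cls (K.point (K.expPoint s)) := by
    ext x
    constructor
    · intro hx
      obtain ⟨v, hv, rfl⟩ := K.exists_cls_point_eq x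
      have hz := (K.mem_tensor_iff hv).1 hx
      obtain ⟨s, rfl⟩ := K.exists_expPoint_eq hv hz
      exact ⟨s, rfl⟩
    · rintro ⟨s, rfl⟩
      exact K.mem_tensor_of (K.expPoint_mem s) rfl
  rw [this]
  exact isConnected_range K.continuous_cls_expPoint

end Skeleton

end IdealSurface

end

/-! ### The local models at the points of the moduli space. -/

noncomputable section

open SmoothQuotient

theorem SmoothQuotient.IsSmoothPoint.of_locallyIso {X Y : SmoothQuotient} {x : X.Pt} {y : Y.Pt}
    (h : LocallyIso X Y x y) (hy : Y.IsSmoothPoint y) : X.IsSmoothPoint x := by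
  obtain ⟨d, hd⟩ := hy
  exact ⟨d, h.trans hd⟩

theorem SmoothQuotient.LocallyIso.isOrbifoldPointWithGroup_of_sign {X : SmoothQuotient} {x : X.Pt}
    {a l : ℕ} (h : LocallyIso X (modelSign a l) x (cls _ (0, 0))) (hl : 0 < l) :
    IsOrbifoldPointWithGroup (Multiplicative (ZMod 2)) X x := by
  obtain ⟨d, Γ, hfin, e, hd⟩ := isOrbifoldPointWithGroup_sign a hl
  exact ⟨d, Γ, hfin, e, h.trans hd⟩

namespace IdealSurface.Skeleton

variable {F : Type*} [Fintype F] {S : IdealSurface F} {m b : ℕ} (K : Skeleton S m b)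

theorem isSmoothPoint_of_notMem {v : SliceSpace m b} (hv : v ∈ K.slice)
    (h : (S.Mf 2).cls (K.point v) ∉ S.MfProduct ∪ S.MfTensorSO) :
    IsSmoothPoint (S.Mf 2) ((S.Mf 2).cls (K.point v)) := by
  rw [Set.mem_union, K.mem_product_iff hv, K.mem_tensor_iff hv, not_or] at h
  exact (isSmoothPoint_involution h.2 fun v' hr hq => h.1 ⟨v', hr, hq⟩).of_locallyIso
    (K.locallyIso_point hv)

theorem locallyIso_sign_of_mem {v : SliceSpace m b} (hv : v ∈ K.slice)
    (h : (S.Mf 2).cls (K.point v) ∈ S.MfProduct \ S.MfTensorSO) :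
    LocallyIso (S.Mf 2) (modelSign (m + m) (m + b - 1)) ((S.Mf 2).cls (K.point v))
      (cls _ (0, 0)) := by
  obtain ⟨hp, ht⟩ := h
  obtain ⟨v', hr, hq, him⟩ := (K.mem_product_iff hv).1 hp
  have hv' := K.slice_saturated hr hv
  rw [(K.cls_point_eq_iff hv hv').2 hr] at ht ⊢
  rw [K.mem_tensor_iff hv'] at ht
  -- A nonzero `z` has a coordinate; without one, `m + b - 1` could be a truncated subtraction.
  have hm : 0 < m := by
    obtain ⟨i, -⟩ := Function.ne_iff.1 ht
    exact i.pos
  obtain ⟨p, q, z⟩ := v'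
  obtain rfl : q = 0 := hq
  exact (K.locallyIso_point hv').trans
    (locallyIso_involution_of_real rfl (by omega) p ht him)

theorem locallyIso_circle_of_mem {v : SliceSpace m b} (hv : v ∈ K.slice)
    (h : (S.Mf 2).cls (K.point v) ∈ S.MfTensorSO \ S.MfDiagonal) :
    LocallyIso (S.Mf 2) (modelCircle (m + b) m) ((S.Mf 2).cls (K.point v)) (cls _ (0, 0)) := by
  rw [Set.mem_sdiff, K.mem_tensor_iff hv, K.mem_diagonal_iff hv] at h
  obtain ⟨hz, hd⟩ := h
  obtain ⟨p, q, z⟩ := v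
  obtain rfl : z = 0 := hz
  exact (K.locallyIso_point hv).trans
    (locallyIso_involution_circle rfl p fun hq => hd ⟨hq, rfl⟩)

theorem locallyIso_involution_of_mem {v : SliceSpace m b} (hv : v ∈ K.slice)
    (h : (S.Mf 2).cls (K.point v) ∈ S.MfDiagonal) :
    LocallyIso (S.Mf 2) (modelCircleInvolution m b m) ((S.Mf 2).cls (K.point v))
      (cls _ (0, 0, 0)) := by
  obtain ⟨hq, hz⟩ := (K.mem_diagonal_iff hv).1 h
  obtain ⟨p, q, z⟩ := v
  obtain rfl : q = 0 := hq
  obtain rfl : z = 0 := hz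
  exact (K.locallyIso_point hv).trans (locallyIso_involution_translate p)

end IdealSurface.Skeleton

end

open SmoothQuotient in
theorem mainTheorem7 {F : Type*} [Fintype F] (S : IdealSurface F) :
    IsConnected S.MfTensorSO ∧
    (∀ x : (S.Mf 2).Pt,
      (x ∉ S.MfProduct ∪ S.MfTensorSO → IsSmoothPoint (S.Mf 2) x) ∧
      (x ∈ S.MfProduct \ S.MfTensorSO →
        LocallyIso (S.Mf 2)
          (modelSign (6 * S.absEulerChar + 2 * S.numMarked).toNat
            (4 * S.absEulerChar + S.numMarked).toNat)
          x (cls _ (0, 0))) ∧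
      (x ∈ S.MfTensorSO \ S.MfDiagonal →
        LocallyIso (S.Mf 2)
          (modelCircle (4 * S.absEulerChar + S.numMarked + 1).toNat
            (3 * S.absEulerChar + S.numMarked).toNat)
          x (cls _ (0, 0))) ∧
      (x ∈ S.MfDiagonal →
        LocallyIso (S.Mf 2)
          (modelCircleInvolution (3 * S.absEulerChar + S.numMarked).toNat
            (S.absEulerChar + 1).toNat (3 * S.absEulerChar + S.numMarked).toNat)
          x (cls _ (0, 0, 0))) ∧
      (2 ≤ 3 * S.absEulerChar + S.numMarked →
        (IsSmoothPoint (S.Mf 2) x ↔ x ∉ S.MfProduct ∪ S.MfTensorSO) ∧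
        (IsOrbifoldPointWithGroup (Multiplicative (ZMod 2)) (S.Mf 2) x ↔
          x ∈ S.MfProduct \ S.MfTensorSO) ∧
        (IsNonOrbifoldSingularPoint (S.Mf 2) x ↔ x ∈ S.MfTensorSO))) := by
  obtain ⟨b, ⟨K⟩, hb, hF⟩ := S.exists_skeleton
  set m := S.numInternal with hm
  -- The dimensions of the statement are now expressed by the numbers `m` of internal edges and `b`
  -- of free edges.
  have hc : S.absEulerChar + 1 = b := by
    rw [IdealSurface.absEulerChar, IdealSurface.eulerChar, ← hm]
    omega
  have hr : 3 * S.absEulerChar + S.numMarked = m := by omega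
  rw [show 6 * S.absEulerChar + 2 * (S.numMarked : ℤ) = ((m + m : ℕ) : ℤ) by push_cast; omega,
    show 4 * S.absEulerChar + (S.numMarked : ℤ) + 1 = ((m + b : ℕ) : ℤ) by push_cast; omega,
    show 4 * S.absEulerChar + (S.numMarked : ℤ) = (m + b : ℤ) - 1 by omega, hr, hc]
  simp only [Int.toNat_natCast]
  refine ⟨K.isConnected_tensor, fun x => ?_⟩
  obtain ⟨v, hv, rfl⟩ := K.exists_cls_point_eq x
  have c1 := K.isSmoothPoint_of_notMem hv
  have c2 := K.locallyIso_sign_of_mem hv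
  have c3 := K.locallyIso_circle_of_mem hv
  have c4 := K.locallyIso_involution_of_mem hv
  -- For a single triangle `m = b = 0` and the integer is `-1`; both sides truncate it to `0`.
  have hl : ((m + b : ℤ) - 1).toNat = m + b - 1 := by omega
  rw [hl]
  refine ⟨c1, c2, c3, c4, fun h2 => ?_⟩
  have hm2 : 2 ≤ m := by exact_mod_cast h2
  have o2 := fun h => (c2 h).isOrbifoldPointWithGroup_of_sign (by omega)
  -- Excluding orbifold points on the tensor locus excludes smooth points too, the trivial group
  -- being allowed; the three equivalences then follow by elimination.
  have o3 : (S.Mf 2).cls (K.point v) ∈ S.MfTensorSO →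
      ¬ (S.Mf 2).IsOrbifoldPoint ((S.Mf 2).cls (K.point v)) := fun h => by
    by_cases hd : (S.Mf 2).cls (K.point v) ∈ S.MfDiagonal
    · exact not_isOrbifoldPoint_of_involution hm2 (c4 hd)
    · exact not_isOrbifoldPoint_of_circle hm2 (c3 ⟨h, hd⟩)
  refine ⟨⟨fun hs => ?_, c1⟩, ⟨fun ho => ⟨?_, fun ht => o3 ht ho.isOrbifoldPoint⟩, o2⟩,
    ⟨fun hs => ?_, fun ht => ⟨fun hs => o3 ht hs.isOrbifoldPoint, o3 ht⟩⟩⟩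
  · rintro (hp | ht)
    · by_cases ht : (S.Mf 2).cls (K.point v) ∈ S.MfTensorSO
      · exact o3 ht hs.isOrbifoldPoint
      · exact not_isSmoothPoint_of_two (o2 ⟨hp, ht⟩) hs
    · exact o3 ht hs.isOrbifoldPoint
  · by_contra hp
    refine not_isSmoothPoint_of_two ho (c1 ?_)
    rintro (h | ht)
    · exact hp h
    · exact o3 ht ho.isOrbifoldPoint
  · by_contra ht
    by_cases hp : (S.Mf 2).cls (K.point v) ∈ S.MfProduct
    · exact hs.2 (o2 ⟨hp, ht⟩).isOrbifoldPoint
    · exact hs.1 (c1 fun h => h.elim hp ht)
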